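/- **Proposition 2.1.** Work on $\mathbb R^2$. Fix smooth radial functions $\chi,\varphi$ with values in $[0,1]$, $\chi$ supported in $\{|\xi|\le 4/3\}$ and $\varphi$ supported in $\{3/4\le|\xi|\le 8/3\}$, such that $\sum_{j\in\mathbb Z}\varphi(2^{-j}\xi)=1$ for $\xi\ne0$ and $\chi(\xi)+\sum_{j\ge0}\varphi(2^{-j}\xi)=1$ for all $\xi$. Put $\dot\Delta_j=\varphi(2^{-j}D)$ and $\dot S_j=\chi(2^{-j}D)$. For $s\in\mathbb R$ and $1\le p\le\infty$, let $\dot B^s_{p,1}$ be the set of tempered distributions $v$ with $\dot S_jv\to0$ in $\mathcal S'$ as $j\to-\infty$ and $$\|v\|_{\dot B^s_{p,1}}=\sum_{j\in\mathbb Z}2^{js}\|\dot\Delta_jv\|_{L^p}<\infty ,$$ and for time dependent $v$ put $$\|v\|_{\widetilde L^\infty_t(\dot B^s_{p,1})}=\sum_{j\in\mathbb Z}2^{js}\|\dot\Delta_jv\|_{L^\infty(0,t;L^p)},\qquad \|v\|_{L^1_t(\dot B^s_{p,1})}=\int_0^t\|v(\tau)\|_{\dot B^s_{p,1}}\,d\tau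 .$$ Let $(p,q)\in[1,\infty]^2$ with $\frac1q-\frac1p\le\frac12$. There is a constant $C>0$, depending only on $p$, $q$, $\chi$ and $\varphi$, such that the following holds. Let $T>0$, let $a_0\in\dot B^{2/q}_{q,1}$, let $u\in L^1(0,T;\dot B^{2/p+1}_{p,1})$ be a real vector field with $\operatorname{div}u=0$, and let $a\in C([0,T];\dot B^{2/q}_{q,1})$ be real valued with $a(0)=a_0$ and $$\partial_ta+u\cdot\nabla a=0$$ in the sense of distributions on $(0,T)\times\mathbb R^2$, where $u\cdot\nabla a=\operatorname{div}(ua)$ and $ua$ is locally integrable on $(0,T)\times\mathbb R^2$. Put $U(t)=\|u\|_{L^1_t(\dot B^{2/p+1}_{p,1})}$. Then, for all $t\in[0,T]$, $$\|a\|_{\widetilde L^\infty_t(\dot B^{2/q}_{q,1})}\le\|a_0\|_{\dot B^{2/q}_{q,1}}\,e^{CU(t)},$$ and, for all $t\in[0,T]$ and all $m\in\mathbb Z$, $$\sum_{j\ge m}2^{2j/q}\|\dot\Delta_ja\|_{L^\infty(0,t;L^q)}\le\sum_{j\ge m}2^{2j/q}\|\dot\Delta_ja_0\|_{L^q}+\|a_0\|_{\dot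 B^{2/q}_{q,1}}\bigl(e^{CU(t)}-1\bigr)$$ and $$\|a-\dot S_ma\|_{\widetilde L^\infty_t(\dot B^{2/q}_{q,1})}\le C\sum_{j\ge m}2^{2j/q}\|\dot\Delta_ja_0\|_{L^q}+\|a_0\|_{\dot B^{2/q}_{q,1}}\bigl(e^{CU(t)}-1\bigr).$$ -/

import Mathlib

open MeasureTheory Set Filter Topology
open scoped ENNReal ContDiff SchwartzMap FourierTransform LineDeriv

noncomputable section

/-- The space domain `ℝ²` with its Euclidean norm. -/
abbrev Plane : Type := EuclideanSpace ℝ (Fin 2)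

/-- The values of (complexified) planar vector fields. -/
abbrev CPlane : Type := EuclideanSpace ℂ (Fin 2)

/-- A pair of cut-off functions of Littlewood--Paley theory: smooth radial functions with values in
`[0, 1]`, `χ` supported in the ball of radius `4/3`, `φ` supported in the annulus of radii `3/4` and
`8/3`, which generate the homogeneous and the inhomogeneous dyadic partition of unity. -/
structure LittlewoodPaley where
  χ : Plane → ℝ
  φ : Plane → ℝ
  χ_smooth : ContDiff ℝ ∞ χ
  φ_smooth : ContDiff ℝ ∞ φ
  χ_radial : ∀ ξ η : Plane, ‖ξ‖ = ‖η‖ → χ ξ = χ η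
  φ_radial : ∀ ξ η : Plane, ‖ξ‖ = ‖η‖ → φ ξ = φ η
  χ_mem : ∀ ξ, χ ξ ∈ Icc (0 : ℝ) 1
  φ_mem : ∀ ξ, φ ξ ∈ Icc (0 : ℝ) 1
  χ_support : tsupport χ ⊆ {ξ | ‖ξ‖ ≤ 4 / 3}
  φ_support : tsupport φ ⊆ {ξ | 3 / 4 ≤ ‖ξ‖ ∧ ‖ξ‖ ≤ 8 / 3}
  sum_φ : ∀ ξ : Plane, ξ ≠ 0 → HasSum (fun j : ℤ => φ ((2 : ℝ) ^ (-j) • ξ)) 1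
  χ_add_sum_φ : ∀ ξ : Plane,
    HasSum (fun j : ℕ => φ ((2 : ℝ) ^ (-(j : ℤ)) • ξ)) (1 - χ ξ)

/-- Such pairs of cut-off functions exist. -/
theorem LittlewoodPaley.nonempty : Nonempty LittlewoodPaley := by
  let c : Plane → ℝ := fun ξ => Real.smoothTransition ((16 / 9 - ‖ξ‖ ^ 2) / (175 / 144))
  have hc : ContDiff ℝ ∞ c := by
    refine Real.smoothTransition.contDiff.comp ?_
    exact (contDiff_const.sub (contDiff_norm_sq ℝ)).div_const _
  have c1 : ∀ ξ, ‖ξ‖ ≤ 3 / 4 → c ξ = 1 := fun ξ h => by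
    refine Real.smoothTransition.one_of_one_le ?_
    rw [le_div_iff₀ (by norm_num)]
    nlinarith [norm_nonneg ξ]
  have c0 : ∀ ξ, 4 / 3 ≤ ‖ξ‖ → c ξ = 0 := fun ξ h => by
    refine Real.smoothTransition.zero_of_nonpos ?_
    refine div_nonpos_of_nonpos_of_nonneg ?_ (by norm_num)
    nlinarith [norm_nonneg ξ]
  have cr : ∀ ξ η, ‖ξ‖ = ‖η‖ → c ξ = c η := fun ξ η h => by simp only [c, h]
  have cm : ∀ ξ η, ‖ξ‖ ≤ ‖η‖ → c η ≤ c ξ := fun ξ η h => by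
    refine Real.smoothTransition.monotone ?_
    gcongr
  have cn : ∀ ξ, 0 ≤ c ξ := fun ξ => Real.smoothTransition.nonneg _
  have cl : ∀ ξ, c ξ ≤ 1 := fun ξ => Real.smoothTransition.le_one _
  let f : Plane → ℝ := fun ξ => c ((1 / 2 : ℝ) • ξ) - c ξ
  have hn : ∀ ξ : Plane, ‖(1 / 2 : ℝ) • ξ‖ = ‖ξ‖ / 2 := fun ξ => by
    rw [norm_smul]; norm_num; ring
  have fn : ∀ ξ, 0 ≤ f ξ := fun ξ => by
    have := cm ((1 / 2 : ℝ) • ξ) ξ (by rw [hn]; linarith [norm_nonneg ξ])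
    simp only [f]; linarith
  have tel : ∀ (j : ℤ) (ξ : Plane), f ((2 : ℝ) ^ (-j) • ξ)
      = c ((2 : ℝ) ^ (-(j + 1)) • ξ) - c ((2 : ℝ) ^ (-j) • ξ) := fun j ξ => by
    simp only [f, smul_smul]
    congr 3
    rw [neg_add, zpow_add₀ two_ne_zero]; norm_num; ring
  have hpos : ∀ ξ : Plane, HasSum (fun j : ℕ => f ((2 : ℝ) ^ (-(j : ℤ)) • ξ)) (1 - c ξ) := by
    intro ξ
    rw [hasSum_iff_tendsto_nat_of_nonneg (fun _ => fn _)]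
    have hs : ∀ n : ℕ, ∑ j ∈ Finset.range n, f ((2 : ℝ) ^ (-(j : ℤ)) • ξ)
        = c ((2 : ℝ) ^ (-(n : ℤ)) • ξ) - c ξ := by
      intro n
      induction n with
      | zero => simp
      | succ n ih => rw [Finset.sum_range_succ, ih, tel]; push_cast; ring
    simp only [hs]
    refine Tendsto.sub_const ?_ _
    have ht : Tendsto (fun n : ℕ => (2 : ℝ) ^ (-(n : ℤ)) • ξ) atTop (𝓝 0) := by
      have := (tendsto_pow_atTop_nhds_zero_of_lt_one (r := (1 / 2 : ℝ)) (by norm_num)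
        (by norm_num)).smul_const ξ
      simpa using this
    have := (hc.continuous.tendsto 0).comp ht
    rwa [c1 0 (by rw [norm_zero]; norm_num)] at this
  have hneg : ∀ ξ : Plane, ξ ≠ 0 →
      HasSum (fun j : ℕ => f ((2 : ℝ) ^ (-(-((j : ℤ) + 1))) • ξ)) (c ξ) := by
    intro ξ hξ
    rw [hasSum_iff_tendsto_nat_of_nonneg (fun _ => fn _)]
    have hs : ∀ n : ℕ, ∑ j ∈ Finset.range n, f ((2 : ℝ) ^ (-(-((j : ℤ) + 1))) • ξ)
        = c ξ - c ((2 : ℝ) ^ (n : ℤ) • ξ) := by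
      intro n
      induction n with
      | zero => simp
      | succ n ih =>
        rw [Finset.sum_range_succ, ih, tel]
        have e1 : -(-((n : ℤ) + 1) + 1) = n := by ring
        rw [e1, neg_neg]; push_cast; ring
    simp only [hs]
    have ht : Tendsto (fun n : ℕ => (2 : ℝ) ^ n * ‖ξ‖) atTop atTop :=
      (tendsto_pow_atTop_atTop_of_one_lt one_lt_two).atTop_mul_const (norm_pos_iff.mpr hξ)
    refine tendsto_const_nhds.congr' ?_
    filter_upwards [ht.eventually_ge_atTop (4 / 3)] with n h
    rw [c0 ((2 : ℝ) ^ (n : ℤ) • ξ) (by rw [norm_smul]; simpa using h), sub_zero]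
  refine ⟨⟨c, f, hc, (hc.comp (contDiff_const_smul _)).sub hc, cr, ?_, fun ξ => ⟨cn ξ, cl ξ⟩,
    fun ξ => ⟨fn ξ, ?_⟩, ?_, ?_, ?_, hpos⟩⟩
  · intro ξ η h
    simp only [f, cr ξ η h, cr ((1 / 2 : ℝ) • ξ) ((1 / 2 : ℝ) • η) (by rw [hn, hn, h])]
  · have := cn ξ
    have := cl ((1 / 2 : ℝ) • ξ)
    simp only [f]; linarith
  · refine closure_minimal (fun ξ hξ => ?_) (isClosed_le continuous_norm continuous_const)
    by_contra h
    exact hξ (c0 ξ (not_le.mp h).le)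
  · refine closure_minimal (fun ξ hξ => ?_) ((isClosed_le continuous_const continuous_norm).inter
      (isClosed_le continuous_norm continuous_const))
    refine ⟨?_, ?_⟩
    · by_contra! h
      refine hξ ?_
      simp only [f, c1 ξ h.le, c1 ((1 / 2 : ℝ) • ξ) (by rw [hn]; linarith [norm_nonneg ξ]), sub_self]
    · by_contra! h
      refine hξ ?_
      simp only [f, c0 ξ (by linarith), c0 ((1 / 2 : ℝ) • ξ) (by rw [hn]; linarith), sub_self]
  · intro ξ hξ
    have := HasSum.of_nat_of_neg_add_one (f := fun j : ℤ => f ((2 : ℝ) ^ (-j) • ξ)) (hpos ξ) (hneg ξ hξ)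
    simpa using this

namespace LittlewoodPaley

theorem φ_hasCompactSupport (L : LittlewoodPaley) : HasCompactSupport L.φ := by
  refine HasCompactSupport.of_support_subset_isCompact (isCompact_closedBall (0 : Plane) (8 / 3)) ?_
  intro ξ hξ
  have := (L.φ_support (subset_tsupport _ hξ)).2
  simpa using this

/-- The function `φ` as a complex valued Schwartz function. -/
def φSchwartz (L : LittlewoodPaley) : 𝓢(Plane, ℂ) :=
  HasCompactSupport.toSchwartzMap (f := fun ξ => (L.φ ξ : ℂ))
    (L.φ_hasCompactSupport.comp_left (g := fun x : ℝ => (x : ℂ)) Complex.ofReal_zero)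
    (Complex.ofRealCLM.contDiff.comp L.φ_smooth)

/-- The Schwartz function `h = 𝓕⁻¹ φ`. -/
def h (L : LittlewoodPaley) : 𝓢(Plane, ℂ) := 𝓕⁻ L.φSchwartz

/-- The linear automorphism `y ↦ -2 ^ j y` of the plane. -/
def negDilation (j : ℤ) : Plane ≃L[ℝ] Plane :=
  ContinuousLinearEquiv.smulLeft
    (Units.mk0 (-(2 : ℝ) ^ j) (neg_ne_zero.mpr (zpow_ne_zero j two_ne_zero)))

/-- The Schwartz function `y ↦ 2 ^ (2 j) h (2 ^ j (x - y))`. -/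
def kernel (L : LittlewoodPaley) (j : ℤ) (x : Plane) : 𝓢(Plane, ℂ) :=
  ((2 : ℂ) ^ (2 * j)) • SchwartzMap.compSubConstCLM ℂ x
    (SchwartzMap.compCLMOfContinuousLinearEquiv ℂ (negDilation j) L.h)

theorem kernel_apply (L : LittlewoodPaley) (j : ℤ) (x y : Plane) :
    L.kernel j x y = (2 : ℂ) ^ (2 * j) * L.h ((2 : ℝ) ^ j • (x - y)) := by
  have : negDilation j (y - x) = (2 : ℝ) ^ j • (x - y) := by
    change (-(2 : ℝ) ^ j) • (y - x) = _
    rw [neg_smul, ← smul_neg, neg_sub]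
  simp [kernel, this]

/-- The homogeneous dyadic block `Δ̇ⱼ T = 2 ^ (2 j) ∫ h (2 ^ j y) T (· - y) dy` of a tempered
distribution `T`, which is a smooth function: its value at `x` is the pairing of `T` with
`y ↦ 2 ^ (2 j) h (2 ^ j (x - y))`. -/
def block {F : Type*} [NormedAddCommGroup F] [NormedSpace ℂ F] (L : LittlewoodPaley)
    (j : ℤ) (T : 𝓢'(Plane, F)) (x : Plane) : F :=
  T (L.kernel j x)

/-- The low-frequency cut-off operator `Ṡⱼ = χ (2 ^ (-j) D)` on tempered distributions. -/
def lowFreq {F : Type*} [NormedAddCommGroup F] [NormedSpace ℂ F] (L : LittlewoodPaley)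
    (j : ℤ) (T : 𝓢'(Plane, F)) : 𝓢'(Plane, F) :=
  TemperedDistribution.fourierMultiplierCLM F (fun ξ => (L.χ ((2 : ℝ) ^ (-j) • ξ) : ℂ)) T

theorem χ_hasTemperateGrowth (L : LittlewoodPaley) (j : ℤ) :
    (fun ξ : Plane => (L.χ ((2 : ℝ) ^ (-j) • ξ) : ℂ)).HasTemperateGrowth := by
  have hc : HasCompactSupport L.χ := by
    refine HasCompactSupport.of_support_subset_isCompact
      (isCompact_closedBall (0 : Plane) (4 / 3)) ?_
    intro ξ hξ
    simpa using L.χ_support (subset_tsupport _ hξ)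
  have hd : HasCompactSupport (fun ξ : Plane => L.χ ((2 : ℝ) ^ (-j) • ξ)) :=
    hc.comp_smul (zpow_ne_zero _ two_ne_zero)
  have he : HasCompactSupport (fun ξ : Plane => (L.χ ((2 : ℝ) ^ (-j) • ξ) : ℂ)) :=
    hd.comp_left (g := fun x : ℝ => (x : ℂ)) Complex.ofReal_zero
  exact (HasCompactSupport.toSchwartzMap he (Complex.ofRealCLM.contDiff.comp
    (L.χ_smooth.comp (contDiff_const_smul _)))).hasTemperateGrowth

end LittlewoodPaley

section Besov

variable {F : Type*} [NormedAddCommGroup F] [NormedSpace ℂ F]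

/-- The space `𝓢'ₕ`: the low-frequency parts tend to `0` in `𝓢'` (pointwise on Schwartz functions). -/
def MemSh (L : LittlewoodPaley) (T : 𝓢'(Plane, F)) : Prop :=
  Tendsto (fun j : ℤ => L.lowFreq j T) atBot (𝓝 0)

/-- The weight `2 ^ (j s)`. -/
def dyadicWeight (s : ℝ) (j : ℤ) : ℝ≥0∞ := ENNReal.ofReal ((2 : ℝ) ^ ((j : ℝ) * s))

/-- The norm of the homogeneous Besov space `Ḃ^s_{p,r}`: the `ℓ^r(ℤ)` norm of
`j ↦ 2 ^ (j s) ‖Δ̇ⱼ T‖_{L^p}`. -/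
def besovNorm (L : LittlewoodPaley) (s : ℝ) (p r : ℝ≥0∞) (T : 𝓢'(Plane, F)) : ℝ≥0∞ :=
  eLpNorm (fun j : ℤ => dyadicWeight s j * eLpNorm (L.block j T) p volume) r Measure.count

/-- Membership in the homogeneous Besov space `Ḃ^s_{p,r}`. -/
def MemBesov (L : LittlewoodPaley) (s : ℝ) (p r : ℝ≥0∞) (T : 𝓢'(Plane, F)) : Prop :=
  MemSh L T ∧ besovNorm L s p r T < (⊤ : ℝ≥0∞)

/-- The norm `‖Δ̇ⱼ v‖_{L^σ(0,t; L^p)}` of a time dependent distribution. -/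
def blockTimeNorm (L : LittlewoodPaley) (σ p : ℝ≥0∞) (t : ℝ) (j : ℤ)
    (v : ℝ → 𝓢'(Plane, F)) : ℝ≥0∞ :=
  eLpNorm (fun τ => eLpNorm (L.block j (v τ)) p volume) σ (volume.restrict (Ioo 0 t))

/-- The Chemin--Lerner norm of `L̃^σ_t(Ḃ^s_{p,r})`. -/
def cheminLernerNorm (L : LittlewoodPaley) (σ : ℝ≥0∞) (s : ℝ) (p r : ℝ≥0∞) (t : ℝ)
    (v : ℝ → 𝓢'(Plane, F)) : ℝ≥0∞ :=
  eLpNorm (fun j : ℤ => dyadicWeight s j * blockTimeNorm L σ p t j v) r Measure.count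

/-- The norm of `L¹(0,t; Ḃ^s_{p,r})`. -/
def l1BesovNorm (L : LittlewoodPaley) (s : ℝ) (p r : ℝ≥0∞) (t : ℝ)
    (v : ℝ → 𝓢'(Plane, F)) : ℝ≥0∞ :=
  ∫⁻ τ in Ioo 0 t, besovNorm L s p r (v τ)

/-- The real number `2 / p` for `p ∈ [1,∞]`, with `2 / ∞ = 0`. -/
def twoOver (p : ℝ≥0∞) : ℝ := 2 * (p⁻¹).toReal

/-- Membership in `L¹(0,T; Ḃ^s_{p,r})`. Measurability in time is only required in the weak sense,
against each Schwartz function. -/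
def MemL1Besov (L : LittlewoodPaley) (s : ℝ) (p r : ℝ≥0∞) (T : ℝ)
    (v : ℝ → 𝓢'(Plane, F)) : Prop :=
  (∀ ψ : 𝓢(Plane, ℂ), AEStronglyMeasurable (fun τ => v τ ψ) (volume.restrict (Ioo 0 T))) ∧
  (∀ᵐ τ ∂(volume.restrict (Ioo 0 T)), MemBesov L s p r (v τ)) ∧
  l1BesovNorm L s p r T v < (⊤ : ℝ≥0∞)

/-- Membership in `C([0,T]; Ḃ^s_{p,r})`. -/
def MemCBesov (L : LittlewoodPaley) (s : ℝ) (p r : ℝ≥0∞) (T : ℝ)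
    (v : ℝ → 𝓢'(Plane, F)) : Prop :=
  (∀ t ∈ Icc 0 T, MemBesov L s p r (v t)) ∧
  ∀ t ∈ Icc 0 T, Tendsto (fun τ => besovNorm L s p r (v τ - v t)) (𝓝[Icc 0 T] t) (𝓝 0)

/-- The tempered distribution `T` is given by integration against the function `f`. -/
def IsRepresentedBy (T : 𝓢'(Plane, F)) (f : Plane → F) : Prop :=
  ∀ ψ : 𝓢(Plane, ℂ), Integrable (fun x => ψ x • f x) ∧ T ψ = ∫ x, ψ x • f x

end Besov

/-- A real vector regarded as a complex one. -/
def complexify (v : Plane) : CPlane := WithLp.toLp 2 (fun i => (v i : ℂ))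

/-- `div V = 0` in the sense of distributions. -/
def IsDivFree (V : 𝓢'(Plane, CPlane)) : Prop :=
  ∀ ψ : 𝓢(Plane, ℂ),
    ∑ i : Fin 2, (∂_{(EuclideanSpace.single i (1 : ℝ) : Plane)} V : 𝓢'(Plane, CPlane)) ψ i = 0

/-- `a` solves `∂ₜ a + u · ∇a = 0` in the sense of distributions on `(0,T) × ℝ²`, for a real valued
`a` and a real divergence free field `u`, so that `u · ∇a = div (u a)`: the distributions `a t` and
`u t` are given by functions `α (t, ·)` and `υ (t, ·)`, the functions `α` and `α υ` are locally
integrable on `(0,T) × ℝ²`, and `∫∫ α (∂ₜ ψ + υ · ∇ψ) = 0` for all test functions `ψ` on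
`(0,T) × ℝ²`. -/
def IsTransportSolution (T : ℝ) (u : ℝ → 𝓢'(Plane, CPlane)) (a : ℝ → 𝓢'(Plane, ℂ)) : Prop :=
  ∃ (α : ℝ × Plane → ℝ) (υ : ℝ × Plane → Plane),
    (∀ᵐ t ∂(volume.restrict (Ioo 0 T)),
      IsRepresentedBy (a t) (fun x => (α (t, x) : ℂ)) ∧
      IsRepresentedBy (u t) (fun x => complexify (υ (t, x)))) ∧
    LocallyIntegrableOn α (Ioo 0 T ×ˢ univ) ∧
    LocallyIntegrableOn (fun z => α z • υ z) (Ioo 0 T ×ˢ univ) ∧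
    ∀ ψ : ℝ × Plane → ℝ, ContDiff ℝ ∞ ψ → HasCompactSupport ψ →
      tsupport ψ ⊆ Ioo 0 T ×ˢ univ →
      ∫ z, α z * fderiv ℝ ψ z (1, υ z) = 0

end

/-! Applying `Δ̇ⱼ` to the equation in divergence form gives `∂ₜ b + u · ∇b = Rⱼ` for `b = Δ̇ⱼ a`,
with the commutator `Rⱼ(x) = ∫ ∇κⱼ(x - y) · (u(x) - u(y)) a(y) dy` (`transportComm`), where `κⱼ` is
the real kernel of `Δ̇ⱼ`. A divergence free flow preserves `L^q` norms, so `‖Δ̇ⱼ a(t)‖_q ≤ ‖Δ̇ⱼ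
a₀‖_q + C ∫₀ᵗ ‖Rⱼ‖_q`, with coefficient one on the datum. Once `∑ⱼ 2^(2j/q) ‖Rⱼ‖_q ≤ C ‖u‖ ‖a‖` is
known in the critical norms, summation over `j` and Gronwall's inequality bound the total of the
integral terms by `‖a₀‖ (e^(CU) - 1)`. The outcome is `BesovTransport.exists_blockTimeNorm_le`: each
weighted block is at most its initial value plus `ρⱼ`, with `∑ ρⱼ` bounded in this way. Summing over
all `j` or over `j ≥ m` gives the first two inequalities. The third follows because `Δ̇ⱼ (1 - Ṡₘ)`
involves only the blocks `k ≥ m` with `|j - k| ≤ 1`.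

The commutator estimate (`dyadicWeight_mul_eLpNorm_transportComm_le`, summed in
`BlockPair.dyadicWeight_mul_eLpNorm_le`) decomposes `u` into blocks `uₖ` and `a` into blocks `aₗ`.
If `j` and `l` are close, the Lipschitz bound of `uₖ` is balanced by the first moment of `∇κⱼ`. If
they are far apart, the term with `u(x)` vanishes, and the other one vanishes unless the two largest
of `j`, `k`, `l` are comparable. For small `l` the derivative is moved onto `aₗ`, and the
inequalities of Hölder and Bernstein apply when `q ≤ p`; the condition `1/q - 1/p ≤ 1/2` enters
here. For small `j` the derivative stays on `κⱼ` and produces the decay `2^(j - l)`. When `q > p`,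
the embedding of `Ḃ^(2/p+1)_{p,1}` into `Ḃ^(2/q+1)_{q,1}` reduces matters to equal exponents.

The Besov norm of `u` controls only its Lipschitz constant: the field is the sum of its blocks up to
a function of time, about which only the local integrability of `u a` says anything. On a compact
time interval where `a(t) ≠ 0` throughout, this integrability forces `u` to grow at most linearly in
space with an integrable constant (`WeakTransport.exists_norm_le`), which is what the cut-off
arguments of the energy estimates require. Near a time where `a` vanishes this control is lost, but
such a time is itself a good initial time, since all blocks are zero there
(`BesovTransport.exists_start`). -/

set_option linter.unusedSectionVars false

noncomputable section

/-! ### Continuity and growth of translations in the Schwartz space -/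

section SchwartzTranslation

variable {E F : Type*} [NormedAddCommGroup E] [NormedSpace ℝ E] [NormedAddCommGroup F]
  [NormedSpace ℝ F] [NormedSpace ℂ F] [SMulCommClass ℝ ℂ F]

theorem SchwartzMap.iteratedFDeriv_translate (f : 𝓢(E, F)) (a : E) (n : ℕ) (y : E) :
    iteratedFDeriv ℝ n (SchwartzMap.compSubConstCLM ℂ a f) y = iteratedFDeriv ℝ n f (y - a) := by
  have : (SchwartzMap.compSubConstCLM ℂ a f : E → F) = fun z => f (z - a) := by
    ext z; simp
  rw [this, iteratedFDeriv_comp_sub]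

theorem SchwartzMap.exists_one_add_pow_mul_le (f : 𝓢(E, F)) (k n : ℕ) :
    ∃ C, 0 ≤ C ∧ ∀ x, (1 + ‖x‖) ^ k * ‖iteratedFDeriv ℝ n f x‖ ≤ C := by
  refine ⟨_, ?_, fun x => SchwartzMap.one_add_le_sup_seminorm_apply (𝕜 := ℂ) (m := (k, n))
    le_rfl le_rfl f x⟩
  positivity

/-- The weights satisfy `‖y‖ ≤ (1 + ‖a‖) (1 + ‖y - a‖)`. Hence `x ↦ T (g (· - x))` grows at most
polynomially for a tempered distribution `T`, and can be integrated against a Schwartz function. -/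
theorem SchwartzMap.seminorm_translate_le (f : 𝓢(E, F)) (k n : ℕ) :
    ∃ C, 0 ≤ C ∧ ∀ a, SchwartzMap.seminorm ℂ k n (SchwartzMap.compSubConstCLM ℂ a f)
      ≤ C * (1 + ‖a‖) ^ k := by
  obtain ⟨C, hC, h⟩ := f.exists_one_add_pow_mul_le k n
  refine ⟨C, hC, fun a => SchwartzMap.seminorm_le_bound ℂ k n _ (by positivity) fun y => ?_⟩
  rw [SchwartzMap.iteratedFDeriv_translate]
  have h1 : ‖y‖ ≤ (1 + ‖a‖) * (1 + ‖y - a‖) := by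
    have : ‖y‖ ≤ ‖y - a‖ + ‖a‖ := by simpa using norm_add_le (y - a) a
    nlinarith [norm_nonneg a, norm_nonneg (y - a), mul_nonneg (norm_nonneg a) (norm_nonneg (y - a))]
  calc ‖y‖ ^ k * ‖iteratedFDeriv ℝ n f (y - a)‖
      ≤ ((1 + ‖a‖) * (1 + ‖y - a‖)) ^ k * ‖iteratedFDeriv ℝ n f (y - a)‖ := by gcongr
    _ = (1 + ‖a‖) ^ k * ((1 + ‖y - a‖) ^ k * ‖iteratedFDeriv ℝ n f (y - a)‖) := by
      rw [mul_pow]; ring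
    _ ≤ (1 + ‖a‖) ^ k * C := by gcongr; exact h _
    _ = C * (1 + ‖a‖) ^ k := mul_comm _ _

/-- Mean value inequality on the unit ball around `y - a`, at the price of one more derivative. The
weight `‖y‖ ^ k` is constant there and is compared with `(1 + ‖z‖) ^ k` at each point `z` of the
ball. -/
theorem SchwartzMap.seminorm_translate_sub_le (f : 𝓢(E, F)) (k n : ℕ) (a : E) :
    ∃ C, 0 ≤ C ∧ ∀ b, ‖b - a‖ ≤ 1 → SchwartzMap.seminorm ℂ k n
      (SchwartzMap.compSubConstCLM ℂ b f - SchwartzMap.compSubConstCLM ℂ a f) ≤ C * ‖b - a‖ := by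
  obtain ⟨C, hC, h⟩ := f.exists_one_add_pow_mul_le k (n + 1)
  refine ⟨C * (2 + ‖a‖) ^ k, by positivity, fun b hb =>
    SchwartzMap.seminorm_le_bound ℂ k n _ (by positivity) fun y => ?_⟩
  have hsub : iteratedFDeriv ℝ n
      (SchwartzMap.compSubConstCLM ℂ b f - SchwartzMap.compSubConstCLM ℂ a f : 𝓢(E, F)) y
      = iteratedFDeriv ℝ n f (y - b) - iteratedFDeriv ℝ n f (y - a) := by
    rw [← SchwartzMap.iteratedFDeriv_translate, ← SchwartzMap.iteratedFDeriv_translate]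
    exact iteratedFDeriv_sub_apply ((SchwartzMap.smooth _ n).contDiffAt)
      ((SchwartzMap.smooth _ n).contDiffAt)
  rw [hsub]
  have hd : Differentiable ℝ (iteratedFDeriv ℝ n f) :=
    (f.smooth (n + 1)).differentiable_iteratedFDeriv (by exact_mod_cast Nat.lt_succ_self n)
  have hk : ∀ z ∈ Metric.closedBall (y - a) 1, ‖y‖ ≤ (2 + ‖a‖) * (1 + ‖z‖) := by
    intro z hz
    rw [mem_closedBall_iff_norm] at hz
    have h1 : ‖y‖ ≤ ‖y - a - z‖ + ‖z‖ + ‖a‖ := by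
      have := norm_add₃_le (a := y - a - z) (b := z) (c := a)
      simpa using this
    rw [norm_sub_rev] at hz
    nlinarith [norm_nonneg a, norm_nonneg z, mul_nonneg (norm_nonneg a) (norm_nonneg z)]
  have key : ‖y‖ ^ k * ‖iteratedFDeriv ℝ n f (y - b) - iteratedFDeriv ℝ n f (y - a)‖
      ≤ C * (2 + ‖a‖) ^ k * ‖(y - b) - (y - a)‖ := by
    rw [← abs_of_nonneg (by positivity : (0 : ℝ) ≤ ‖y‖ ^ k), ← Real.norm_eq_abs, ← norm_smul,
      smul_sub]
    refine (convex_closedBall (y - a) 1).norm_image_sub_le_of_norm_fderiv_le (𝕜 := ℝ)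
      (f := fun z => ‖y‖ ^ k • iteratedFDeriv ℝ n f z)
      (fun z _ => (hd z).fun_const_smul _) (fun z hz => ?_) (by simp) ?_
    · rw [fderiv_fun_const_smul (hd z), norm_smul, norm_fderiv_iteratedFDeriv, norm_pow, norm_norm]
      calc ‖y‖ ^ k * ‖iteratedFDeriv ℝ (n + 1) f z‖
          ≤ ((2 + ‖a‖) * (1 + ‖z‖)) ^ k * ‖iteratedFDeriv ℝ (n + 1) f z‖ := by
            gcongr; exact hk z hz
        _ = (2 + ‖a‖) ^ k * ((1 + ‖z‖) ^ k * ‖iteratedFDeriv ℝ (n + 1) f z‖) := by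
            rw [mul_pow]; ring
        _ ≤ (2 + ‖a‖) ^ k * C := by gcongr; exact h _
        _ = _ := mul_comm _ _
    · rw [mem_closedBall_iff_norm]
      have : y - b - (y - a) = -(b - a) := by abel
      rw [this, norm_neg]; exact hb
  have e : y - b - (y - a) = -(b - a) := by abel
  rwa [e, norm_neg] at key

theorem SchwartzMap.continuous_translate (f : 𝓢(E, F)) :
    Continuous fun a : E => SchwartzMap.compSubConstCLM ℂ a f := by
  refine continuous_iff_continuousAt.mpr fun a => ?_
  refine ((schwartz_withSeminorms ℂ E F).tendsto_nhds _ _).mpr fun i ε hε => ?_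
  obtain ⟨C, hC, h⟩ := f.seminorm_translate_sub_le i.1 i.2 a
  have ht : Tendsto (fun b => C * ‖b - a‖) (𝓝 a) (𝓝 0) := by
    have : Continuous fun b => C * ‖b - a‖ := by fun_prop
    simpa using this.tendsto a
  filter_upwards [Metric.closedBall_mem_nhds a one_pos, ht.eventually (gt_mem_nhds hε)] with b hb hb'
  rw [mem_closedBall_iff_norm] at hb
  exact (h b hb).trans_lt hb'

end SchwartzTranslation

/-! ### Pairing a tempered distribution with a convolution -/

section TemperedConvolution

open BoundedContinuousFunction

variable {E : Type*} [NormedAddCommGroup E] [InnerProductSpace ℝ E] [FiniteDimensional ℝ E]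
  [MeasurableSpace E] [BorelSpace E]

/-- The convolution of two complex valued Schwartz functions. -/
abbrev SchwartzMap.conv (ψ g : 𝓢(E, ℂ)) : 𝓢(E, ℂ) :=
  SchwartzMap.convolution (ContinuousLinearMap.mul ℂ ℂ) ψ g

theorem SchwartzMap.conv_apply (ψ g : 𝓢(E, ℂ)) (y : E) :
    SchwartzMap.conv ψ g y = ∫ x, ψ x * g (y - x) := by
  rw [SchwartzMap.conv, SchwartzMap.convolution_apply]
  rfl

theorem SchwartzMap.fourier_conv_apply (ψ g : 𝓢(E, ℂ)) (ξ : E) :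
    𝓕 (SchwartzMap.conv ψ g) ξ = 𝓕 ψ ξ * 𝓕 g ξ := by
  rw [SchwartzMap.conv, SchwartzMap.fourier_convolution]
  rfl

theorem SchwartzMap.ext_fourier {f g : 𝓢(E, ℂ)} (h : ∀ ξ, 𝓕 f ξ = 𝓕 g ξ) : f = g := by
  have : 𝓕 f = 𝓕 g := SchwartzMap.ext h
  rw [← FourierTransform.fourierInv_fourier_eq (F := 𝓢(E, ℂ)) f, this,
    FourierTransform.fourierInv_fourier_eq]

theorem SchwartzMap.lineDerivOp_conv (ψ g : 𝓢(E, ℂ)) (m : E) :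
    (∂_{m} (SchwartzMap.conv ψ g) : 𝓢(E, ℂ)) = SchwartzMap.conv ψ (∂_{m} g) := by
  refine SchwartzMap.ext_fourier fun ξ => ?_
  have hg : (fun x : E => inner ℝ x m).HasTemperateGrowth := by fun_prop
  rw [SchwartzMap.fourier_conv_apply, SchwartzMap.fourier_lineDerivOp_eq,
    SchwartzMap.fourier_lineDerivOp_eq]
  simp only [_root_.smul_apply, SchwartzMap.smulLeftCLM_apply_apply hg,
    SchwartzMap.fourier_conv_apply, smul_eq_mul, Complex.real_smul]
  ring

theorem SchwartzMap.iteratedLineDerivOp_conv (ψ g : 𝓢(E, ℂ)) {n : ℕ} (m : Fin n → E) :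
    (∂^{m} (SchwartzMap.conv ψ g) : 𝓢(E, ℂ)) = SchwartzMap.conv ψ (∂^{m} g) := by
  induction n with
  | zero => rfl
  | succ n ih =>
    rw [LineDeriv.iteratedLineDerivOp_succ_left, LineDeriv.iteratedLineDerivOp_succ_left, ih,
      SchwartzMap.lineDerivOp_conv]

/-- The discrete space of triples `((k, n), x, m)` with `(k, n) ∈ s`, `x` a point and `m` a family of
`n` vectors. -/
structure SchwartzIndex (E : Type*) (s : Finset (ℕ × ℕ)) where
  idx : s
  point : E
  vec : Fin idx.1.2 → E

instance (s : Finset (ℕ × ℕ)) : TopologicalSpace (SchwartzIndex E s) := ⊥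

instance (s : Finset (ℕ × ℕ)) : DiscreteTopology (SchwartzIndex E s) := ⟨rfl⟩

theorem SchwartzMap.norm_index_le (f : 𝓢(E, ℂ)) (k n : ℕ) (x : E) (m : Fin n → E) :
    ‖((‖x‖ ^ k / ∏ i, ‖m i‖ : ℝ) : ℂ) * iteratedFDeriv ℝ n f x m‖
      ≤ ‖x‖ ^ k * ‖iteratedFDeriv ℝ n f x‖ := by
  have h0 : 0 ≤ ∏ i, ‖m i‖ := Finset.prod_nonneg fun _ _ => norm_nonneg _
  rw [norm_mul, Complex.norm_real, Real.norm_of_nonneg (by positivity), div_mul_eq_mul_div,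
    mul_div_assoc]
  gcongr
  exact ContinuousMultilinearMap.ratio_le_opNorm _ _

/-- The map sending a Schwartz function to the bounded function with values
`‖x‖ ^ k / ∏ ‖m i‖ * D ^ n f x m`. -/
def SchwartzMap.toBoundedFamily (s : Finset (ℕ × ℕ)) : 𝓢(E, ℂ) →ₗ[ℂ] (SchwartzIndex E s →ᵇ ℂ) where
  toFun f := BoundedContinuousFunction.ofNormedAddCommGroup
    (fun w => ((‖w.point‖ ^ w.idx.1.1 / ∏ i, ‖w.vec i‖ : ℝ) : ℂ)
      * iteratedFDeriv ℝ w.idx.1.2 f w.point w.vec)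
    continuous_of_discreteTopology
    (s.sup (schwartzSeminormFamily ℂ E ℂ) f) (fun w =>
      ((f.norm_index_le _ _ _ _).trans (SchwartzMap.le_seminorm ℂ w.idx.1.1 w.idx.1.2 f w.point)).trans
      (Seminorm.le_finset_sup_apply (p := schwartzSeminormFamily ℂ E ℂ) w.idx.2))
  map_add' f g := by
    ext w
    have : iteratedFDeriv ℝ w.idx.1.2 (f + g : 𝓢(E, ℂ)) w.point
      = iteratedFDeriv ℝ w.idx.1.2 f w.point + iteratedFDeriv ℝ w.idx.1.2 g w.point :=
      iteratedFDeriv_add_apply ((f.smooth _).contDiffAt) ((g.smooth _).contDiffAt)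
    simp only [BoundedContinuousFunction.coe_ofNormedAddCommGroup,
      BoundedContinuousFunction.coe_add, Pi.add_apply, this, _root_.add_apply]
    ring
  map_smul' c f := by
    ext w
    have : iteratedFDeriv ℝ w.idx.1.2 (c • f : 𝓢(E, ℂ)) w.point
      = c • iteratedFDeriv ℝ w.idx.1.2 f w.point :=
      iteratedFDeriv_const_smul_apply ((f.smooth _).contDiffAt)
    simp only [BoundedContinuousFunction.coe_ofNormedAddCommGroup,
      BoundedContinuousFunction.coe_smul, this, _root_.smul_apply, smul_eq_mul,
      RingHom.id_apply]
    ring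

theorem SchwartzMap.toBoundedFamily_apply (s : Finset (ℕ × ℕ)) (f : 𝓢(E, ℂ))
    (w : SchwartzIndex E s) : SchwartzMap.toBoundedFamily s f w
      = ((‖w.point‖ ^ w.idx.1.1 / ∏ i, ‖w.vec i‖ : ℝ) : ℂ)
        * iteratedFDeriv ℝ w.idx.1.2 f w.point w.vec := rfl

theorem SchwartzMap.norm_toBoundedFamily_le (s : Finset (ℕ × ℕ)) (f : 𝓢(E, ℂ)) :
    ‖SchwartzMap.toBoundedFamily s f‖ ≤ s.sup (schwartzSeminormFamily ℂ E ℂ) f :=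
  (BoundedContinuousFunction.norm_le (apply_nonneg _ _)).mpr fun w =>
    ((f.norm_index_le _ _ _ _).trans (SchwartzMap.le_seminorm ℂ w.idx.1.1 w.idx.1.2 f w.point)).trans
      (Seminorm.le_finset_sup_apply (p := schwartzSeminormFamily ℂ E ℂ) w.idx.2)

/-- Division by `∏ ‖m i‖` recovers the operator norm of the derivative from its values. With the
reverse bound, the map is an isometry for the finite supremum of seminorms. -/
theorem SchwartzMap.seminorm_le_norm_toBoundedFamily (s : Finset (ℕ × ℕ)) (f : 𝓢(E, ℂ)) :
    s.sup (schwartzSeminormFamily ℂ E ℂ) f ≤ ‖SchwartzMap.toBoundedFamily s f‖ := by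
  refine Seminorm.finset_sup_apply_le (norm_nonneg _) fun i hi => ?_
  refine SchwartzMap.seminorm_le_bound ℂ i.1 i.2 f (norm_nonneg _) fun x => ?_
  rw [← Real.norm_of_nonneg (by positivity : (0 : ℝ) ≤ ‖x‖ ^ i.1), ← norm_smul]
  refine ContinuousMultilinearMap.opNorm_le_bound (norm_nonneg _) fun m => ?_
  rcases eq_or_ne (∏ j, ‖m j‖) 0 with h0 | h0
  · obtain ⟨j, -, hj⟩ := Finset.prod_eq_zero_iff.mp h0
    rw [ContinuousMultilinearMap.map_coord_zero _ j (norm_eq_zero.mp hj), h0]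
    simp
  · have h1 := (SchwartzMap.toBoundedFamily s f).norm_coe_le_norm ⟨⟨i, hi⟩, x, m⟩
    have hp : 0 < ∏ j, ‖m j‖ := lt_of_le_of_ne (Finset.prod_nonneg fun _ _ => norm_nonneg _)
      (Ne.symm h0)
    rw [SchwartzMap.toBoundedFamily_apply] at h1
    simp only [norm_mul, Complex.norm_real, norm_div, norm_pow, norm_norm,
      Real.norm_of_nonneg hp.le] at h1
    rw [_root_.smul_apply, norm_smul, norm_pow, norm_norm]
    rw [div_mul_eq_mul_div, div_le_iff₀ hp] at h1
    exact h1

/-- Finitely many seminorms control `T`, so `T` factors through a normed space of bounded functions,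
and Hahn--Banach extends it to the whole Banach space. Bochner integrals, which commute with
continuous functionals, become available in place of integrals in the Schwartz space. -/
theorem SchwartzMap.exists_extension_toBoundedFamily (T : 𝓢(E, ℂ) →L[ℂ] ℂ) :
    ∃ (s : Finset (ℕ × ℕ)) (g : StrongDual ℂ (SchwartzIndex E s →ᵇ ℂ)),
      ∀ f, g (SchwartzMap.toBoundedFamily s f) = T f := by
  let q : Seminorm ℂ 𝓢(E, ℂ) := (normSeminorm ℂ ℂ).comp T.toLinearMap
  have hq : Continuous q := continuous_norm.comp T.continuous
  obtain ⟨s, C, -, hC⟩ := Seminorm.bound_of_continuous (schwartz_withSeminorms ℂ E ℂ) q hq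
  -- The pair `(0, 0)` adds the values of the function itself to the family, which makes the map
  -- injective.
  refine ⟨insert (0, 0) s, ?_⟩
  set s' := insert (0, 0) s
  have hT : ∀ f, ‖T f‖ ≤ C * ‖SchwartzMap.toBoundedFamily s' f‖ := fun f => by
    have h1 : ‖T f‖ ≤ C * s.sup (schwartzSeminormFamily ℂ E ℂ) f := hC f
    refine h1.trans ?_
    gcongr
    refine le_trans ?_ (SchwartzMap.seminorm_le_norm_toBoundedFamily s' f)
    exact Finset.sup_mono (f := schwartzSeminormFamily ℂ E ℂ) (Finset.subset_insert _ _) f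
  have hinj : Function.Injective (SchwartzMap.toBoundedFamily (E := E) s') := by
    refine (injective_iff_map_eq_zero _).mpr fun f hf => ?_
    ext x
    have h0 : SchwartzMap.toBoundedFamily s' f
      ⟨⟨(0, 0), Finset.mem_insert_self _ _⟩, x, fun _ => 0⟩ = 0 := by rw [hf]; rfl
    rw [SchwartzMap.toBoundedFamily_apply] at h0
    simpa using h0
  let e := LinearEquiv.ofInjective _ hinj
  let φ : StrongDual ℂ (LinearMap.range (SchwartzMap.toBoundedFamily (E := E) s')) :=
    LinearMap.mkContinuous (T.toLinearMap ∘ₗ e.symm.toLinearMap) C (fun w => by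
      have := hT (e.symm w)
      have h2 : SchwartzMap.toBoundedFamily s' (e.symm w) = w :=
        congrArg Subtype.val (e.apply_symm_apply w)
      rw [h2] at this
      exact this)
  obtain ⟨g, hg, -⟩ := exists_extension_norm_eq _ φ
  refine ⟨g, fun f => ?_⟩
  have := hg (e f)
  have h2 : φ (e f) = T f := by
    change T (e.symm (e f)) = T f
    rw [e.symm_apply_apply]
  rw [h2] at this
  exact this

theorem SchwartzMap.integrable_of_growth (ψ : 𝓢(E, ℂ)) {G : Type*} [NormedAddCommGroup G]
    {u : E → G} (hu : Continuous u) {C : ℝ} {k : ℕ} (hC : ∀ x, ‖u x‖ ≤ C * (1 + ‖x‖) ^ k)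
    [NormedSpace ℂ G] : Integrable (fun x => ψ x • u x) := by
  have hs : SecondCountableTopology E := inferInstance
  have h1 : Integrable (fun x => (1 + ‖x‖) ^ k * ‖ψ x‖) := by
    have : (fun x : E => (1 + ‖x‖) ^ k * ‖ψ x‖)
        = fun x => ∑ i ∈ Finset.range (k + 1), (‖x‖ ^ i * ‖ψ x‖) * (k.choose i : ℝ) := by
      ext x
      rw [add_comm, add_pow, Finset.sum_mul]
      refine Finset.sum_congr rfl fun i _ => ?_
      simp; ring
    rw [this]
    exact integrable_finsetSum _ fun i _ => (ψ.integrable_pow_mul volume i).mul_const _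
  refine (h1.const_mul C).mono' (ψ.continuous.smul hu).aestronglyMeasurable ?_
  refine Eventually.of_forall fun x => ?_
  rw [norm_smul]
  calc ‖ψ x‖ * ‖u x‖ ≤ ‖ψ x‖ * (C * (1 + ‖x‖) ^ k) := by gcongr; exact hC x
    _ = _ := by ring

theorem SchwartzMap.sup_seminorm_translate_le (g : 𝓢(E, ℂ)) (s : Finset (ℕ × ℕ)) :
    ∃ C, ∃ k : ℕ, 0 ≤ C ∧ ∀ a, s.sup (schwartzSeminormFamily ℂ E ℂ)
      (SchwartzMap.compSubConstCLM ℂ a g) ≤ C * (1 + ‖a‖) ^ k := by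
  choose C hC h using fun i : ℕ × ℕ => g.seminorm_translate_le i.1 i.2
  refine ⟨∑ i ∈ s, C i, s.sup Prod.fst, Finset.sum_nonneg fun i _ => hC i, fun a => ?_⟩
  have hs : (0 : ℝ) ≤ ∑ i ∈ s, C i := Finset.sum_nonneg fun i _ => hC i
  refine Seminorm.finset_sup_apply_le (by positivity) fun i hi => (h i a).trans ?_
  have h1 : (1 : ℝ) ≤ 1 + ‖a‖ := by linarith [norm_nonneg a]
  refine mul_le_mul ?_ (pow_le_pow_right₀ h1 ?_) (by positivity) hs
  · exact Finset.single_le_sum (fun i _ => hC i) hi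
  · exact Finset.le_sup (f := Prod.fst) hi

/-- The convolution is the integral of the translates of `g` weighted by `ψ`. This identity is
established for Banach space valued integrals, after which the extended functional is applied to
both sides. -/
theorem SchwartzMap.integral_mul_apply_translate (T : 𝓢(E, ℂ) →L[ℂ] ℂ) (ψ g : 𝓢(E, ℂ)) :
    ∫ x, ψ x * T (SchwartzMap.compSubConstCLM ℂ x g) = T (SchwartzMap.conv ψ g) := by
  obtain ⟨s, τ, hτ⟩ := SchwartzMap.exists_extension_toBoundedFamily T
  set Φ := SchwartzMap.toBoundedFamily (E := E) s
  have hcont : Continuous fun x => Φ (SchwartzMap.compSubConstCLM ℂ x g) := by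
    refine continuous_iff_continuousAt.mpr fun a => ?_
    rw [ContinuousAt, tendsto_iff_norm_sub_tendsto_zero]
    have h1 := ((schwartz_withSeminorms ℂ E ℂ).tendsto_nhds' _ _).mp
      (g.continuous_translate.tendsto a) s
    refine squeeze_zero' (Eventually.of_forall fun _ => norm_nonneg _)
      (Eventually.of_forall fun b => ?_) (f := fun b => ‖Φ (SchwartzMap.compSubConstCLM ℂ b g)
        - Φ (SchwartzMap.compSubConstCLM ℂ a g)‖)
      (g := fun b => s.sup (schwartzSeminormFamily ℂ E ℂ) (SchwartzMap.compSubConstCLM ℂ b g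
        - SchwartzMap.compSubConstCLM ℂ a g)) ?_
    · rw [← map_sub]; exact SchwartzMap.norm_toBoundedFamily_le s _
    · refine Metric.tendsto_nhds.mpr fun ε hε => ?_
      filter_upwards [h1 ε hε] with b hb
      rwa [Real.dist_0_eq_abs, abs_of_nonneg (apply_nonneg _ _)]
  obtain ⟨C, k, hC, hk⟩ := g.sup_seminorm_translate_le s
  have hint : Integrable fun x => ψ x • Φ (SchwartzMap.compSubConstCLM ℂ x g) :=
    ψ.integrable_of_growth hcont fun x => (SchwartzMap.norm_toBoundedFamily_le s _).trans (hk x)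
  -- Point evaluations separate bounded functions, and at each index the claim is the formula for a
  -- derivative of the convolution, with all derivatives on `g`.
  have key : ∫ x, ψ x • Φ (SchwartzMap.compSubConstCLM ℂ x g) = Φ (SchwartzMap.conv ψ g) := by
    ext w
    have h1 := (BoundedContinuousFunction.evalCLM ℂ w).integral_comp_comm hint
    simp only [BoundedContinuousFunction.evalCLM_apply] at h1
    rw [← h1]
    simp only [Φ, BoundedContinuousFunction.coe_smul, SchwartzMap.toBoundedFamily_apply,
      SchwartzMap.iteratedFDeriv_translate, smul_eq_mul]
    rw [← SchwartzMap.iteratedLineDerivOp_eq_iteratedFDeriv, SchwartzMap.iteratedLineDerivOp_conv,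
      SchwartzMap.conv_apply, ← integral_const_mul]
    simp only [← SchwartzMap.iteratedLineDerivOp_eq_iteratedFDeriv]
    refine integral_congr_ae (Eventually.of_forall fun x => ?_)
    simp only
    ring
  have h3 := τ.integral_comp_comm hint
  rw [key, hτ] at h3
  rw [← h3]
  refine integral_congr_ae (Eventually.of_forall fun x => ?_)
  simp only [map_smul, smul_eq_mul, hτ, Φ]

/-- Pairing a tempered distribution with a convolution. -/
theorem TemperedDistribution.integral_smul_apply_translate {F : Type*} [NormedAddCommGroup F]
    [NormedSpace ℂ F] [CompleteSpace F] (T : 𝓢'(E, F)) (ψ g : 𝓢(E, ℂ)) :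
    Integrable (fun x => ψ x • T (SchwartzMap.compSubConstCLM ℂ x g)) ∧
    ∫ x, ψ x • T (SchwartzMap.compSubConstCLM ℂ x g) = T (SchwartzMap.conv ψ g) := by
  have hT : Continuous T := map_continuous T
  have hint : Integrable (fun x => ψ x • T (SchwartzMap.compSubConstCLM ℂ x g)) := by
    let q : Seminorm ℂ 𝓢(E, ℂ) := (normSeminorm ℂ F).comp (T : 𝓢(E, ℂ) →ₗ[ℂ] F)
    have hq : Continuous q := continuous_norm.comp hT
    obtain ⟨s, C, -, hC⟩ := Seminorm.bound_of_continuous (schwartz_withSeminorms ℂ E ℂ) q hq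
    obtain ⟨C', k, hC', hk⟩ := g.sup_seminorm_translate_le s
    refine ψ.integrable_of_growth (hT.comp g.continuous_translate) (C := C * C') (k := k)
      fun x => ?_
    have h1 : ‖T (SchwartzMap.compSubConstCLM ℂ x g)‖ ≤ C * s.sup (schwartzSeminormFamily ℂ E ℂ)
      (SchwartzMap.compSubConstCLM ℂ x g) := hC _
    refine h1.trans ?_
    rw [mul_assoc]
    gcongr
    exact hk x
  refine ⟨hint, ?_⟩
  refine (SeparatingDual.eq_iff_forall_dual_eq (R := ℂ)).mpr fun ℓ => ?_
  rw [← ℓ.integral_comp_comm hint]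
  let T' : 𝓢(E, ℂ) →L[ℂ] ℂ := ⟨ℓ.toLinearMap ∘ₗ (T : 𝓢(E, ℂ) →ₗ[ℂ] F), ℓ.continuous.comp hT⟩
  have := SchwartzMap.integral_mul_apply_translate T' ψ g
  simp only [map_smul, smul_eq_mul]
  exact this

end TemperedConvolution

/-! ### Frequency localization of the dyadic kernels and the Littlewood--Paley decomposition -/

section DyadicKernels

theorem SchwartzMap.fourierInv_apply_eq_fourier_neg (f : 𝓢(Plane, ℂ)) (ξ : Plane) :
    (𝓕⁻ f : 𝓢(Plane, ℂ)) ξ = (𝓕 f : 𝓢(Plane, ℂ)) (-ξ) := by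
  rw [SchwartzMap.fourierInv_apply_eq]
  rfl

theorem SchwartzMap.fourierInv_conv_apply (ψ g : 𝓢(Plane, ℂ)) (ξ : Plane) :
    (𝓕⁻ (SchwartzMap.conv ψ g) : 𝓢(Plane, ℂ)) ξ
      = (𝓕⁻ ψ : 𝓢(Plane, ℂ)) ξ * (𝓕⁻ g : 𝓢(Plane, ℂ)) ξ := by
  simp only [SchwartzMap.fourierInv_apply_eq_fourier_neg, SchwartzMap.fourier_conv_apply]

theorem SchwartzMap.ext_fourierInv {f g : 𝓢(Plane, ℂ)}
    (h : ∀ ξ, (𝓕⁻ f : 𝓢(Plane, ℂ)) ξ = (𝓕⁻ g : 𝓢(Plane, ℂ)) ξ) : f = g := by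
  refine SchwartzMap.ext_fourier fun ξ => ?_
  have := h (-ξ)
  simpa only [SchwartzMap.fourierInv_apply_eq_fourier_neg, neg_neg] using this

theorem SchwartzMap.conv_translate (f g : 𝓢(Plane, ℂ)) (a : Plane) :
    SchwartzMap.conv (SchwartzMap.compSubConstCLM ℂ a f) g
      = SchwartzMap.compSubConstCLM ℂ a (SchwartzMap.conv f g) := by
  ext y
  rw [SchwartzMap.compSubConstCLM_apply, SchwartzMap.conv_apply, SchwartzMap.conv_apply]
  rw [← integral_sub_right_eq_self (fun x => f x * g (y - a - x)) a]
  refine integral_congr_ae (Eventually.of_forall fun x => ?_)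
  simp only [SchwartzMap.compSubConstCLM_apply, sub_sub_sub_cancel_right]

theorem SchwartzMap.fourierInv_translate (f : 𝓢(Plane, ℂ)) (a ξ : Plane) :
    (𝓕⁻ (SchwartzMap.compSubConstCLM ℂ a f) : 𝓢(Plane, ℂ)) ξ
      = Real.fourierChar (inner ℝ a ξ) • (𝓕⁻ f : 𝓢(Plane, ℂ)) ξ := by
  rw [SchwartzMap.fourierInv_coe, SchwartzMap.fourierInv_coe, Real.fourierInv_eq,
    Real.fourierInv_eq]
  simp only [Circle.smul_def]
  rw [← integral_smul]
  rw [← integral_sub_right_eq_self (fun v => (Real.fourierChar (inner ℝ a ξ) : ℂ) •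
    (Real.fourierChar (inner ℝ v ξ) : ℂ) • f v) a]
  refine integral_congr_ae (Eventually.of_forall fun v => ?_)
  simp only [SchwartzMap.compSubConstCLM_apply, smul_smul]
  rw [← Circle.coe_mul, ← AddChar.map_add_eq_mul, ← inner_add_left, add_sub_cancel]

namespace LittlewoodPaley

variable (L : LittlewoodPaley)

theorem φ_neg (ξ : Plane) : L.φ (-ξ) = L.φ ξ := L.φ_radial _ _ (norm_neg ξ)

theorem φ_eq_zero_of_norm {ξ : Plane} (h : ‖ξ‖ < 3 / 4 ∨ 8 / 3 < ‖ξ‖) : L.φ ξ = 0 := by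
  by_contra h0
  have := L.φ_support (subset_tsupport _ h0)
  simp only [mem_ofPred_eq] at this
  rcases h with h | h <;> linarith [this.1, this.2]

theorem norm_zpow_smul (j : ℤ) (ξ : Plane) : ‖(2 : ℝ) ^ j • ξ‖ = (2 : ℝ) ^ j * ‖ξ‖ := by
  rw [norm_smul, Real.norm_of_nonneg (by positivity)]

theorem φ_dilate_ne_zero {j : ℤ} {ξ : Plane} (h : L.φ ((2 : ℝ) ^ (-j) • ξ) ≠ 0) :
    3 / 4 * (2 : ℝ) ^ j ≤ ‖ξ‖ ∧ ‖ξ‖ ≤ 8 / 3 * (2 : ℝ) ^ j := by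
  have h1 := L.φ_support (subset_tsupport _ h)
  simp only [mem_ofPred_eq, norm_zpow_smul] at h1
  rw [zpow_neg] at h1
  have h2 : (0 : ℝ) < 2 ^ j := by positivity
  rw [inv_mul_eq_div, le_div_iff₀ h2, div_le_iff₀ h2] at h1
  exact h1

/-- With a gap of two indices the annuli are disjoint, because `4 * (3 / 4) = 3 > 8 / 3`. -/
theorem φ_dilate_eq_zero {i k : ℤ} {ξ : Plane} (hk : L.φ ((2 : ℝ) ^ (-k) • ξ) ≠ 0)
    (hik : i + 2 ≤ k ∨ k + 2 ≤ i) : L.φ ((2 : ℝ) ^ (-i) • ξ) = 0 := by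
  by_contra hi
  obtain ⟨h1, h2⟩ := L.φ_dilate_ne_zero hk
  obtain ⟨h3, h4⟩ := L.φ_dilate_ne_zero hi
  have h5 : ∀ m n : ℤ, m + 2 ≤ n → 4 * (2 : ℝ) ^ m ≤ 2 ^ n := fun m n h => by
    have : (2 : ℝ) ^ (m + 2) ≤ 2 ^ n := zpow_le_zpow_right₀ one_le_two h
    rw [zpow_add₀ two_ne_zero] at this
    norm_num at this
    linarith
  have hi0 : (0 : ℝ) < 2 ^ i := by positivity
  have hk0 : (0 : ℝ) < 2 ^ k := by positivity
  rcases hik with h | h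
  · linarith [h5 _ _ h]
  · linarith [h5 _ _ h]

theorem sum_φ_neighbours {k : ℤ} {ξ : Plane} (hk : L.φ ((2 : ℝ) ^ (-k) • ξ) ≠ 0) :
    ∑ i ∈ Finset.Icc (k - 1) (k + 1), L.φ ((2 : ℝ) ^ (-i) • ξ) = 1 := by
  have hξ : ξ ≠ 0 := by
    rintro rfl
    apply hk
    rw [smul_zero]
    exact L.φ_eq_zero_of_norm (Or.inl (by rw [norm_zero]; norm_num))
  refine (hasSum_sum_of_ne_finset_zero fun i hi => ?_).unique (L.sum_φ ξ hξ)
  refine L.φ_dilate_eq_zero hk ?_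
  rw [Finset.mem_Icc] at hi
  omega

/-- The inhomogeneous partitions of unity at the scales `n` and `n + 1` differ by a single term. -/
theorem χ_telescope (n : ℤ) (ξ : Plane) :
    L.χ ((2 : ℝ) ^ (-(n + 1)) • ξ) - L.χ ((2 : ℝ) ^ (-n) • ξ) = L.φ ((2 : ℝ) ^ (-n) • ξ) := by
  have h1 := L.χ_add_sum_φ ((2 : ℝ) ^ (-n) • ξ)
  have h2 := L.χ_add_sum_φ ((2 : ℝ) ^ (-(n + 1)) • ξ)
  have h3 := (hasSum_nat_add_iff' 1).mpr h1
  have e : (fun j : ℕ => L.φ ((2 : ℝ) ^ (-((j + 1 : ℕ) : ℤ)) • (2 : ℝ) ^ (-n) • ξ))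
      = fun j : ℕ => L.φ ((2 : ℝ) ^ (-(j : ℤ)) • (2 : ℝ) ^ (-(n + 1)) • ξ) := by
    ext j
    rw [smul_smul, smul_smul, ← zpow_add₀ two_ne_zero, ← zpow_add₀ two_ne_zero]
    congr 3
    push_cast
    ring
  rw [e] at h3
  have := h3.unique h2
  rw [Finset.sum_range_one, Nat.cast_zero, neg_zero, zpow_zero, one_smul] at this
  linarith

/-- The partition of unity at scale `m` sums over all `k ≥ m`, and at a frequency seen by the block
`j` only the neighbours of `j` contribute. -/
theorem one_sub_χ_eq_sum {j : ℤ} {ξ : Plane} (hj : L.φ ((2 : ℝ) ^ (-j) • ξ) ≠ 0) (m : ℤ) :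
    1 - L.χ ((2 : ℝ) ^ (-m) • ξ)
      = ∑ k ∈ (Finset.Icc (j - 1) (j + 1)).filter (m ≤ ·), L.φ ((2 : ℝ) ^ (-k) • ξ) := by
  have h1 := L.χ_add_sum_φ ((2 : ℝ) ^ (-m) • ξ)
  have e : ∀ n : ℕ, (2 : ℝ) ^ (-(n : ℤ)) • (2 : ℝ) ^ (-m) • ξ = (2 : ℝ) ^ (-(m + n)) • ξ := by
    intro n
    rw [smul_smul, ← zpow_add₀ two_ne_zero]
    congr 2
    ring
  simp only [e] at h1
  have h2 : HasSum (fun n : ℕ => L.φ ((2 : ℝ) ^ (-(m + n)) • ξ))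
      (∑ n ∈ ((Finset.Icc (j - 1) (j + 1)).filter (m ≤ ·)).image (fun k => (k - m).toNat),
        L.φ ((2 : ℝ) ^ (-(m + n)) • ξ)) := by
    refine hasSum_sum_of_ne_finset_zero fun n hn => L.φ_dilate_eq_zero hj ?_
    by_contra hcon
    refine hn (Finset.mem_image.mpr ⟨m + n, ?_, by simp⟩)
    rw [Finset.mem_filter, Finset.mem_Icc]
    omega
  rw [h1.unique h2, Finset.sum_image]
  · refine Finset.sum_congr rfl fun k hk => ?_
    rw [Finset.mem_filter] at hk
    congr 4
    omega
  · intro a ha b hb hab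
    simp only [Finset.coe_filter, mem_ofPred_eq] at ha hb
    simp only at hab
    omega

theorem χ_eq_one {ξ : Plane} (h : ‖ξ‖ < 3 / 4) : L.χ ξ = 1 := by
  have h1 := L.χ_add_sum_φ ξ
  have e : (fun j : ℕ => L.φ ((2 : ℝ) ^ (-(j : ℤ)) • ξ)) = fun _ => 0 := by
    ext j
    refine L.φ_eq_zero_of_norm (Or.inl ?_)
    rw [norm_zpow_smul]
    have : (2 : ℝ) ^ (-(j : ℤ)) ≤ 1 := zpow_le_one_of_nonpos₀ one_le_two (by simp)
    nlinarith [norm_nonneg ξ]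
  rw [e] at h1
  have := h1.unique hasSum_zero
  linarith

/-- The Schwartz function `y ↦ 2 ^ (2 j) h (-2 ^ j y)`. -/
def g (j : ℤ) : 𝓢(Plane, ℂ) :=
  ((2 : ℂ) ^ (2 * j)) • SchwartzMap.compCLMOfContinuousLinearEquiv ℂ (negDilation j) L.h

theorem kernel_eq_translate (j : ℤ) (x : Plane) :
    L.kernel j x = SchwartzMap.compSubConstCLM ℂ x (L.g j) := by
  rw [kernel, g, map_smul]

theorem fourier_h : (𝓕 L.h : 𝓢(Plane, ℂ)) = L.φSchwartz := by
  rw [h, FourierTransform.fourier_fourierInv_eq]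

theorem φSchwartz_apply (ξ : Plane) : L.φSchwartz ξ = (L.φ ξ : ℂ) := rfl

theorem h_neg (x : Plane) : L.h (-x) = L.h x := by
  have h1 : L.h x = (𝓕 L.φSchwartz : 𝓢(Plane, ℂ)) (-x) := by
    rw [← SchwartzMap.fourierInv_apply_eq_fourier_neg]; rfl
  have h2 : L.h (-x) = (𝓕 L.φSchwartz : 𝓢(Plane, ℂ)) x := by
    rw [h, SchwartzMap.fourierInv_apply_eq_fourier_neg, neg_neg]
  rw [h1, h2, SchwartzMap.fourier_coe, Real.fourier_eq, Real.fourier_eq, ← integral_neg_eq_self]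
  refine integral_congr_ae (Eventually.of_forall fun v => ?_)
  simp only [inner_neg_left, inner_neg_right, φSchwartz_apply, φ_neg]

/-- The symbol `φ` is real and even, so its inverse Fourier transform is real. All kernels are
therefore real, and real distributions have real blocks. -/
theorem conj_h (x : Plane) : (starRingEnd ℂ) (L.h x) = L.h x := by
  have h1 : L.h x = (𝓕 L.φSchwartz : 𝓢(Plane, ℂ)) (-x) := by
    rw [← SchwartzMap.fourierInv_apply_eq_fourier_neg]; rfl
  have h2 : L.h x = (𝓕 L.φSchwartz : 𝓢(Plane, ℂ)) x := by
    rw [← h_neg, h, SchwartzMap.fourierInv_apply_eq_fourier_neg, neg_neg]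
  conv_lhs => rw [h1]
  rw [h2, SchwartzMap.fourier_coe, Real.fourier_eq, Real.fourier_eq, ← integral_conj]
  refine integral_congr_ae (Eventually.of_forall fun v => ?_)
  simp only [inner_neg_right, φSchwartz_apply, Circle.smul_def, smul_eq_mul, map_mul,
    Complex.conj_ofReal, neg_neg]
  congr 1
  rw [← Circle.coe_inv_eq_conj, ← AddChar.map_neg_eq_inv]

theorem g_apply (j : ℤ) (y : Plane) : L.g j y = (2 : ℂ) ^ (2 * j) * L.h ((2 : ℝ) ^ j • y) := by
  have : negDilation j y = -((2 : ℝ) ^ j • y) := by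
    change (-(2 : ℝ) ^ j) • y = _
    rw [neg_smul]
  rw [← h_neg, ← this]
  rfl

theorem g_neg (j : ℤ) (y : Plane) : L.g j (-y) = L.g j y := by
  rw [g_apply, g_apply, smul_neg, h_neg]

/-- Frequencies are read off with `𝓕⁻` rather than `𝓕`, because Fourier multipliers act on
distributions by duality through `𝓕⁻` of the test function. As `φ` is even, the choice does not
affect the symbol. -/
theorem fourierInv_g (j : ℤ) (ξ : Plane) :
    (𝓕⁻ (L.g j) : 𝓢(Plane, ℂ)) ξ = (L.φ ((2 : ℝ) ^ (-j) • ξ) : ℂ) := by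
  rw [← φSchwartz_apply, ← fourier_h, SchwartzMap.fourierInv_apply_eq_fourier_neg,
    SchwartzMap.fourier_coe, SchwartzMap.fourier_coe, Real.fourier_eq, Real.fourier_eq]
  have h2 : (2 : ℝ) ^ j ≠ 0 := by positivity
  have key := Measure.integral_comp_smul (volume : Measure Plane)
    (fun v => Real.fourierChar (-inner ℝ v ((2 : ℝ) ^ (-j) • (-ξ))) • L.h v) ((2 : ℝ) ^ j)
  have e1 : ∫ v, Real.fourierChar (-inner ℝ v ((2 : ℝ) ^ (-j) • ξ)) • L.h v
      = ∫ v, Real.fourierChar (-inner ℝ v ((2 : ℝ) ^ (-j) • (-ξ))) • L.h v := by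
    rw [← integral_neg_eq_self]
    refine integral_congr_ae (Eventually.of_forall fun v => ?_)
    simp only [inner_neg_left, inner_neg_right, smul_neg, h_neg]
  rw [e1]
  have e2 : |(((2 : ℝ) ^ j) ^ Module.finrank ℝ Plane)⁻¹| = ((2 : ℝ) ^ (2 * j))⁻¹ := by
    rw [finrank_euclideanSpace_fin, abs_of_nonneg (by positivity), ← zpow_natCast, ← zpow_mul]
    congr 2
    push_cast
    ring
  rw [e2, eq_inv_smul_iff₀ (by positivity), ← integral_smul] at key
  rw [← key]
  refine integral_congr_ae (Eventually.of_forall fun v => ?_)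
  have e3 : inner ℝ ((2 : ℝ) ^ j • v) ((2 : ℝ) ^ (-j) • -ξ) = inner ℝ v (-ξ) := by
    rw [inner_smul_left, inner_smul_right, ← mul_assoc, zpow_neg]
    simp [h2]
  simp only [g_apply, e3, Complex.real_smul, Circle.smul_def, smul_eq_mul]
  push_cast
  ring

/-- The sum of the kernels of three consecutive dyadic blocks. -/
def gFat (k : ℤ) : 𝓢(Plane, ℂ) := ∑ i ∈ Finset.Icc (k - 1) (k + 1), L.g i

theorem fourierInv_gFat (k : ℤ) (ξ : Plane) : (𝓕⁻ (L.gFat k) : 𝓢(Plane, ℂ)) ξ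
    = ∑ i ∈ Finset.Icc (k - 1) (k + 1), (L.φ ((2 : ℝ) ^ (-i) • ξ) : ℂ) := by
  have : (𝓕⁻ (L.gFat k) : 𝓢(Plane, ℂ))
      = ∑ i ∈ Finset.Icc (k - 1) (k + 1), (𝓕⁻ (L.g i) : 𝓢(Plane, ℂ)) := by
    exact map_sum (FourierTransform.fourierInvCLM ℂ 𝓢(Plane, ℂ)) _ _
  rw [this, _root_.sum_apply]
  simp only [fourierInv_g]

theorem gFat_neg (k : ℤ) (y : Plane) : L.gFat k (-y) = L.gFat k y := by
  simp only [gFat, _root_.sum_apply, g_neg]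

/-- The symbols of three consecutive blocks add up to one on the support of the middle one, so the
fattened kernel reproduces the block. -/
theorem conv_gFat_g (k : ℤ) : SchwartzMap.conv (L.gFat k) (L.g k) = L.g k := by
  refine SchwartzMap.ext_fourierInv fun ξ => ?_
  rw [SchwartzMap.fourierInv_conv_apply, fourierInv_gFat, fourierInv_g]
  by_cases h0 : L.φ ((2 : ℝ) ^ (-k) • ξ) = 0
  · rw [h0, Complex.ofReal_zero, mul_zero]
  · have := L.sum_φ_neighbours h0
    rw [← Complex.ofReal_sum, this]
    simp

/-- The real kernel of the dyadic block `Δ̇ⱼ`. -/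
def κ (j : ℤ) (x : Plane) : ℝ := (L.g j x).re

/-- The real kernel of the sum of three consecutive dyadic blocks. -/
def κFat (k : ℤ) (x : Plane) : ℝ := (L.gFat k x).re

theorem g_eq_κ (j : ℤ) (x : Plane) : L.g j x = (L.κ j x : ℂ) := by
  rw [κ]
  refine (Complex.conj_eq_iff_re.mp ?_).symm
  rw [g_apply, map_mul, conj_h, map_zpow₀, Complex.conj_ofNat]

theorem gFat_eq_κFat (j : ℤ) (x : Plane) : L.gFat j x = (L.κFat j x : ℂ) := by
  rw [κFat]
  simp only [gFat, _root_.sum_apply, g_eq_κ, ← Complex.ofReal_sum, Complex.ofReal_re]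

theorem κ_neg (j : ℤ) (x : Plane) : L.κ j (-x) = L.κ j x := by rw [κ, g_neg]; rfl

theorem κFat_neg (j : ℤ) (x : Plane) : L.κFat j (-x) = L.κFat j x := by rw [κFat, gFat_neg]; rfl

variable {F : Type*} [NormedAddCommGroup F] [NormedSpace ℂ F] [CompleteSpace F]

theorem block_eq (j : ℤ) (T : 𝓢'(Plane, F)) (x : Plane) :
    L.block j T x = T (SchwartzMap.compSubConstCLM ℂ x (L.g j)) := by
  rw [block, kernel_eq_translate]

theorem continuous_block (j : ℤ) (T : 𝓢'(Plane, F)) : Continuous (L.block j T) := by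
  have : L.block j T = fun x => T (SchwartzMap.compSubConstCLM ℂ x (L.g j)) :=
    funext fun x => L.block_eq j T x
  rw [this]
  exact (map_continuous T).comp (L.g j).continuous_translate

theorem integral_smul_block (j : ℤ) (T : 𝓢'(Plane, F)) (ψ : 𝓢(Plane, ℂ)) :
    Integrable (fun x => ψ x • L.block j T x) ∧
      ∫ x, ψ x • L.block j T x = T (SchwartzMap.conv ψ (L.g j)) := by
  simp only [block_eq]
  exact TemperedDistribution.integral_smul_apply_translate T ψ (L.g j)

/-- This formula is the source of all Bernstein inequalities below: it presents a block as its own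
convolution with a fixed dilated Schwartz kernel. -/
theorem block_reproducing (k : ℤ) (T : 𝓢'(Plane, F)) (x : Plane) :
    L.block k T x = ∫ z, (L.κFat k (x - z) : ℂ) • L.block k T z := by
  have := (L.integral_smul_block k T (SchwartzMap.compSubConstCLM ℂ x (L.gFat k))).2
  rw [SchwartzMap.conv_translate, conv_gFat_g, ← block_eq] at this
  rw [← this]
  refine integral_congr_ae (Eventually.of_forall fun z => ?_)
  simp only [SchwartzMap.compSubConstCLM_apply, ← gFat_eq_κFat]
  rw [← gFat_neg, neg_sub]

/-- On the Fourier side, `1 - χ(2^(-m) ξ)` is the sum of the symbols with `k ≥ m`, and the test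
function, being a translate of the kernel of `Δ̇ⱼ`, sees only `|k - j| ≤ 1`. -/
theorem block_sub_lowFreq (j m : ℤ) (T : 𝓢'(Plane, F)) (x : Plane) :
    L.block j (T - L.lowFreq m T) x
      = ∑ k ∈ (Finset.Icc (j - 1) (j + 1)).filter (m ≤ ·),
        ∫ z, (L.κ j (x - z) : ℂ) • L.block k T z := by
  have h1 : ∀ k, ∫ z, (L.κ j (x - z) : ℂ) • L.block k T z
      = T (SchwartzMap.conv (SchwartzMap.compSubConstCLM ℂ x (L.g j)) (L.g k)) := fun k => by
    rw [← (L.integral_smul_block k T _).2]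
    refine integral_congr_ae (Eventually.of_forall fun z => ?_)
    simp only [SchwartzMap.compSubConstCLM_apply, ← g_eq_κ]
    rw [← g_neg, neg_sub]
  simp only [h1]
  rw [← map_sum, block_eq]
  change T _ - L.lowFreq m T _ = _
  rw [lowFreq, TemperedDistribution.fourierMultiplierCLM_apply_apply, ← map_sub]
  congr 1
  refine SchwartzMap.ext_fourierInv fun ξ => ?_
  set ψ := SchwartzMap.compSubConstCLM ℂ x (L.g j) with hψ
  have e1 : (𝓕⁻ (∑ k ∈ (Finset.Icc (j - 1) (j + 1)).filter (m ≤ ·),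
      SchwartzMap.conv ψ (L.g k)) : 𝓢(Plane, ℂ))
      = ∑ k ∈ (Finset.Icc (j - 1) (j + 1)).filter (m ≤ ·),
        (𝓕⁻ (SchwartzMap.conv ψ (L.g k)) : 𝓢(Plane, ℂ)) :=
    map_sum (FourierTransform.fourierInvCLM ℂ 𝓢(Plane, ℂ)) _ _
  have e2 : (𝓕⁻ (ψ - 𝓕 (SchwartzMap.smulLeftCLM ℂ
      (fun ξ => (L.χ ((2 : ℝ) ^ (-m) • ξ) : ℂ)) (𝓕⁻ ψ : 𝓢(Plane, ℂ)))) : 𝓢(Plane, ℂ))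
      = 𝓕⁻ ψ - SchwartzMap.smulLeftCLM ℂ
      (fun ξ => (L.χ ((2 : ℝ) ^ (-m) • ξ) : ℂ)) (𝓕⁻ ψ : 𝓢(Plane, ℂ)) := by
    refine (map_sub (FourierTransform.fourierInvCLM ℂ 𝓢(Plane, ℂ)) _ _).trans ?_
    congr 1
    exact FourierTransform.fourierInv_fourier_eq (F := 𝓢(Plane, ℂ)) _
  rw [e1, e2, _root_.sum_apply, _root_.sub_apply,
    SchwartzMap.smulLeftCLM_apply_apply (L.χ_hasTemperateGrowth m)]
  simp only [SchwartzMap.fourierInv_conv_apply, fourierInv_g, smul_eq_mul]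
  rw [← Finset.mul_sum]
  have hψ0 : (𝓕⁻ ψ : 𝓢(Plane, ℂ)) ξ ≠ 0 → L.φ ((2 : ℝ) ^ (-j) • ξ) ≠ 0 := by
    rw [hψ, SchwartzMap.fourierInv_translate, fourierInv_g]
    intro h h'
    rw [h', Complex.ofReal_zero, smul_zero] at h
    exact h rfl
  by_cases h0 : (𝓕⁻ ψ : 𝓢(Plane, ℂ)) ξ = 0
  · simp [h0]
  · have h2 := hψ0 h0
    have h3 : 1 - L.χ ((2 : ℝ) ^ (-m) • ξ)
        = ∑ k ∈ (Finset.Icc (j - 1) (j + 1)).filter (m ≤ ·), L.φ ((2 : ℝ) ^ (-k) • ξ) :=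
      L.one_sub_χ_eq_sum h2 m
    rw [← Complex.ofReal_sum, ← h3]
    push_cast
    ring

theorem χ_hasCompactSupport : HasCompactSupport L.χ := by
  refine HasCompactSupport.of_support_subset_isCompact (isCompact_closedBall (0 : Plane) (4 / 3)) ?_
  intro ξ hξ
  simpa using L.χ_support (subset_tsupport _ hξ)

theorem exists_iteratedFDeriv_χ_sub_one_le (n : ℕ) :
    ∃ C, 0 ≤ C ∧ ∀ ξ, ‖iteratedFDeriv ℝ n (fun ξ => (L.χ ξ : ℂ) - 1) ξ‖ ≤ C := by
  let X : 𝓢(Plane, ℂ) := HasCompactSupport.toSchwartzMap (f := fun ξ => (L.χ ξ : ℂ))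
    (L.χ_hasCompactSupport.comp_left (g := fun x : ℝ => (x : ℂ)) Complex.ofReal_zero)
    (Complex.ofRealCLM.contDiff.comp L.χ_smooth)
  refine ⟨SchwartzMap.seminorm ℂ 0 n X + 1, by positivity, fun ξ => ?_⟩
  have e : iteratedFDeriv ℝ n (fun ξ => (L.χ ξ : ℂ) - 1) ξ
      = iteratedFDeriv ℝ n X ξ - iteratedFDeriv ℝ n (fun _ : Plane => (1 : ℂ)) ξ :=
    iteratedFDeriv_sub_apply (f := X) ((X.smooth n).contDiffAt) contDiffAt_const
  rw [e]
  refine (norm_sub_le _ _).trans (add_le_add (X.norm_iteratedFDeriv_le_seminorm ℂ n ξ) ?_)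
  rcases eq_or_ne n 0 with rfl | hn
  · simp
  · rw [iteratedFDeriv_const_of_ne hn]
    simp

/-- The factor `χ(r ξ) - 1` vanishes for `r ‖ξ‖ < 3/4`, and elsewhere one more power of `‖ξ‖` gains
a factor of order `r`. Leibniz' rule then gives the rate `r = 2^(-N)` in every seminorm. -/
theorem tendsto_smulLeftCLM_χ (f : 𝓢(Plane, ℂ)) :
    Tendsto (fun N : ℕ => SchwartzMap.smulLeftCLM ℂ
      (fun ξ => (L.χ ((2 : ℝ) ^ (-(N : ℤ)) • ξ) : ℂ)) f) atTop (𝓝 f) := by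
  refine ((schwartz_withSeminorms ℂ Plane ℂ).tendsto_nhds _ _).mpr fun ⟨k, n⟩ ε hε => ?_
  choose C hC hCb using L.exists_iteratedFDeriv_χ_sub_one_le
  set K := ∑ i ∈ Finset.range (n + 1),
    (n.choose i : ℝ) * C i * (4 / 3 * SchwartzMap.seminorm ℂ (k + 1) (n - i) f) with hK
  have hK0 : 0 ≤ K := Finset.sum_nonneg fun i _ => by have := hC i; positivity
  have hω : ContDiff ℝ ∞ fun ξ => (L.χ ξ : ℂ) - 1 :=
    (Complex.ofRealCLM.contDiff.comp L.χ_smooth).sub contDiff_const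
  have main : ∀ N : ℕ, SchwartzMap.seminorm ℂ k n (SchwartzMap.smulLeftCLM ℂ
      (fun ξ => (L.χ ((2 : ℝ) ^ (-(N : ℤ)) • ξ) : ℂ)) f - f) ≤ K * (2 : ℝ) ^ (-(N : ℤ)) := by
    intro N
    set r : ℝ := (2 : ℝ) ^ (-(N : ℤ)) with hr
    have hr0 : 0 < r := by positivity
    have hr1 : r ≤ 1 := zpow_le_one_of_nonpos₀ one_le_two (by simp)
    refine SchwartzMap.seminorm_le_bound ℂ k n _ (by positivity) fun ξ => ?_
    have e : ((SchwartzMap.smulLeftCLM ℂ (fun ξ => (L.χ (r • ξ) : ℂ)) f - f : 𝓢(Plane, ℂ)) :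
        Plane → ℂ) = fun ξ => ((L.χ (r • ξ) : ℂ) - 1) * f ξ := by
      ext ξ
      rw [_root_.sub_apply, SchwartzMap.smulLeftCLM_apply_apply (L.χ_hasTemperateGrowth N)]
      simp only [smul_eq_mul]
      ring
    rw [e]
    rcases lt_or_ge (r * ‖ξ‖) (3 / 4) with hlt | hge
    · have : (fun ξ => ((L.χ (r • ξ) : ℂ) - 1) * f ξ) =ᶠ[𝓝 ξ] fun _ => 0 := by
        have ho : IsOpen {ξ : Plane | r * ‖ξ‖ < 3 / 4} :=
          isOpen_lt (by fun_prop) continuous_const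
        filter_upwards [ho.mem_nhds hlt] with η hη
        rw [L.χ_eq_one (by rw [norm_smul, Real.norm_of_nonneg hr0.le]; exact hη)]
        simp
      have h0 : iteratedFDeriv ℝ n (fun ξ => ((L.χ (r • ξ) : ℂ) - 1) * f ξ) ξ = 0 := by
        rw [(this.iteratedFDeriv ℝ n).eq_of_nhds]
        rw [iteratedFDeriv_fun_zero]
        rfl
      rw [h0, norm_zero, mul_zero]
      positivity
    · have h1 := norm_iteratedFDeriv_mul_le (𝕜 := ℝ) (N := ∞) (n := n)
        (f := fun ξ : Plane => (L.χ (r • ξ) : ℂ) - 1) (g := f)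
        (hω.comp (contDiff_const_smul r)) (f.smooth ⊤) ξ (by exact_mod_cast le_top)
      refine (mul_le_mul_of_nonneg_left h1 (by positivity)).trans ?_
      rw [Finset.mul_sum, hK, Finset.sum_mul]
      refine Finset.sum_le_sum fun i hi => ?_
      have h2 : ‖iteratedFDeriv ℝ i (fun ξ : Plane => (L.χ (r • ξ) : ℂ) - 1) ξ‖ ≤ C i := by
        rw [iteratedFDeriv_comp_const_smul (f := fun ξ => (L.χ ξ : ℂ) - 1) r
          (hω.of_le (by exact_mod_cast le_top))]
        rw [norm_smul, norm_pow, Real.norm_of_nonneg hr0.le]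
        calc r ^ i * _ ≤ 1 * C i := by
              gcongr
              · exact pow_le_one₀ hr0.le hr1
              · exact hCb i _
          _ = C i := one_mul _
      -- In this region `1 ≤ (4 / 3) r ‖ξ‖`, which exchanges the factor `r` for one more power of
      -- the weight.
      have h3 : ‖ξ‖ ^ k * ‖iteratedFDeriv ℝ (n - i) f ξ‖
          ≤ r * (4 / 3 * SchwartzMap.seminorm ℂ (k + 1) (n - i) f) := by
        have h4 := f.le_seminorm ℂ (k + 1) (n - i) ξ
        rw [pow_succ, mul_assoc, mul_comm ‖ξ‖, ← mul_assoc] at h4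
        set w := ‖ξ‖ ^ k * ‖iteratedFDeriv ℝ (n - i) f ξ‖
        have hw : 0 ≤ w := by positivity
        nlinarith [mul_nonneg hw (norm_nonneg ξ), mul_le_mul_of_nonneg_left h4 hr0.le,
          mul_le_mul_of_nonneg_left hge hw]
      calc ‖ξ‖ ^ k * ((n.choose i : ℝ) * ‖iteratedFDeriv ℝ i _ ξ‖
            * ‖iteratedFDeriv ℝ (n - i) f ξ‖)
          = (n.choose i : ℝ) * ‖iteratedFDeriv ℝ i
            (fun ξ : Plane => (L.χ (r • ξ) : ℂ) - 1) ξ‖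
            * (‖ξ‖ ^ k * ‖iteratedFDeriv ℝ (n - i) f ξ‖) := by ring
        _ ≤ (n.choose i : ℝ) * C i *
            (r * (4 / 3 * SchwartzMap.seminorm ℂ (k + 1) (n - i) f)) := by
          have := hC i
          gcongr
        _ = _ := by ring
  have ht : Tendsto (fun N : ℕ => K * (2 : ℝ) ^ (-(N : ℤ))) atTop (𝓝 0) := by
    have := (tendsto_pow_atTop_nhds_zero_of_lt_one (r := (1 / 2 : ℝ)) (by norm_num)
      (by norm_num)).const_mul K
    simpa using this
  filter_upwards [ht.eventually (gt_mem_nhds hε)] with N hN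
  exact (main N).trans_lt hN

theorem sum_integral_smul_block (T : 𝓢'(Plane, F)) (ψ : 𝓢(Plane, ℂ)) (N : ℕ) :
    ∑ k ∈ Finset.Ico (-(N : ℤ)) N, ∫ x, ψ x • L.block k T x
      = L.lowFreq N T ψ - L.lowFreq (-N) T ψ := by
  have h1 : ∀ k : ℤ, ∫ x, ψ x • L.block k T x = L.lowFreq (k + 1) T ψ - L.lowFreq k T ψ := by
    intro k
    rw [(L.integral_smul_block k T ψ).2, lowFreq, lowFreq,
      TemperedDistribution.fourierMultiplierCLM_apply_apply,
      TemperedDistribution.fourierMultiplierCLM_apply_apply, ← map_sub]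
    congr 1
    refine SchwartzMap.ext_fourierInv fun ξ => ?_
    have e2 : ∀ f g : 𝓢(Plane, ℂ), (𝓕⁻ (𝓕 f - 𝓕 g : 𝓢(Plane, ℂ)) : 𝓢(Plane, ℂ)) = f - g := by
      intro f g
      refine (map_sub (FourierTransform.fourierInvCLM ℂ 𝓢(Plane, ℂ)) _ _).trans ?_
      congr 1
      · exact FourierTransform.fourierInv_fourier_eq (F := 𝓢(Plane, ℂ)) _
      · exact FourierTransform.fourierInv_fourier_eq (F := 𝓢(Plane, ℂ)) _
    rw [e2, _root_.sub_apply, SchwartzMap.smulLeftCLM_apply_apply (L.χ_hasTemperateGrowth _),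
      SchwartzMap.smulLeftCLM_apply_apply (L.χ_hasTemperateGrowth _),
      SchwartzMap.fourierInv_conv_apply, fourierInv_g, ← χ_telescope]
    simp only [smul_eq_mul]
    push_cast
    ring
  simp only [h1]
  induction N with
  | zero => simp
  | succ N ih =>
    have e : Finset.Ico (-((N + 1 : ℕ) : ℤ)) ((N + 1 : ℕ) : ℤ)
        = insert (-((N : ℤ) + 1)) (insert (N : ℤ) (Finset.Ico (-(N : ℤ)) N)) := by
      ext i
      simp only [Finset.mem_Ico, Finset.mem_insert]
      push_cast
      omega
    rw [e, Finset.sum_insert, Finset.sum_insert, ih]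
    · have : -((N : ℤ) + 1) + 1 = -N := by ring
      rw [this]
      push_cast
      abel
    · simp
    · simp only [Finset.mem_Ico, Finset.mem_insert]
      omega

/-- The partial sums telescope to `Ṡ_N T - Ṡ_{-N} T`. The first term tends to `T` for every tempered
distribution, and the second tends to zero exactly by membership in `𝓢'ₕ`. -/
theorem tendsto_sum_integral_smul_block {T : 𝓢'(Plane, F)} (hT : MemSh L T) (ψ : 𝓢(Plane, ℂ)) :
    Tendsto (fun N : ℕ => ∑ k ∈ Finset.Ico (-(N : ℤ)) N, ∫ x, ψ x • L.block k T x) atTop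
      (𝓝 (T ψ)) := by
  simp only [sum_integral_smul_block]
  have h1 : Tendsto (fun N : ℕ => L.lowFreq N T ψ) atTop (𝓝 (T ψ)) := by
    have hc : Continuous T := map_continuous T
    have hF : Continuous (FourierTransform.fourierCLM ℂ 𝓢(Plane, ℂ)) := map_continuous _
    have := ((hc.comp hF).tendsto _).comp (L.tendsto_smulLeftCLM_χ (𝓕⁻ ψ))
    have e : (T ∘ FourierTransform.fourierCLM ℂ 𝓢(Plane, ℂ)) (𝓕⁻ ψ) = T ψ := by
      change T (𝓕 (𝓕⁻ ψ : 𝓢(Plane, ℂ))) = _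
      rw [FourierTransform.fourier_fourierInv_eq]
    rw [e] at this
    exact this
  have h2 : Tendsto (fun N : ℕ => L.lowFreq (-(N : ℤ)) T ψ) atTop (𝓝 0) := by
    have hcast : Tendsto (fun N : ℕ => -(N : ℤ)) atTop atBot :=
      tendsto_neg_atTop_atBot.comp tendsto_natCast_atTop_atTop
    have h3 : Tendsto (fun N : ℕ => L.lowFreq (-(N : ℤ)) T) atTop (𝓝 0) := hT.comp hcast
    exact (PointwiseConvergenceCLM.tendsto_iff_forall_tendsto.mp h3) ψ
  simpa using h1.sub h2

end LittlewoodPaley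

end DyadicKernels

/-! ### Dyadic weights -/

section DyadicWeight

theorem dyadicWeight_pos (s : ℝ) (j : ℤ) : 0 < dyadicWeight s j :=
  ENNReal.ofReal_pos.mpr (by positivity)

theorem dyadicWeight_ne_zero (s : ℝ) (j : ℤ) : dyadicWeight s j ≠ 0 := (dyadicWeight_pos s j).ne'

theorem dyadicWeight_ne_top (s : ℝ) (j : ℤ) : dyadicWeight s j ≠ ⊤ := ENNReal.ofReal_ne_top

theorem dyadicWeight_add (s t : ℝ) (j : ℤ) :
    dyadicWeight (s + t) j = dyadicWeight s j * dyadicWeight t j := by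
  rw [dyadicWeight, dyadicWeight, dyadicWeight, ← ENNReal.ofReal_mul (by positivity), mul_add,
    Real.rpow_add two_pos]

theorem dyadicWeight_int_add (s : ℝ) (i j : ℤ) :
    dyadicWeight s (i + j) = dyadicWeight s i * dyadicWeight s j := by
  rw [dyadicWeight, dyadicWeight, dyadicWeight, ← ENNReal.ofReal_mul (by positivity), Int.cast_add,
    add_mul, Real.rpow_add two_pos]

theorem dyadicWeight_zero (j : ℤ) : dyadicWeight 0 j = 1 := by simp [dyadicWeight]

theorem dyadicWeight_int_zero (s : ℝ) : dyadicWeight s 0 = 1 := by simp [dyadicWeight]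

theorem dyadicWeight_rpow (s t : ℝ) (j : ℤ) : dyadicWeight s j ^ t = dyadicWeight (s * t) j := by
  rw [dyadicWeight, dyadicWeight, ENNReal.ofReal_rpow_of_pos (by positivity),
    ← Real.rpow_mul two_pos.le, mul_assoc]

theorem dyadicWeight_natCast (n : ℕ) (j : ℤ) :
    dyadicWeight n j = ENNReal.ofReal (((2 : ℝ) ^ j) ^ n) := by
  rw [dyadicWeight, Real.rpow_mul two_pos.le, Real.rpow_intCast, Real.rpow_natCast]

theorem dyadicWeight_two (j : ℤ) : dyadicWeight 2 j = ENNReal.ofReal (((2 : ℝ) ^ j) ^ 2) := by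
  exact_mod_cast dyadicWeight_natCast 2 j

theorem dyadicWeight_one (j : ℤ) : dyadicWeight 1 j = ENNReal.ofReal ((2 : ℝ) ^ j) := by
  have := dyadicWeight_natCast 1 j
  rw [pow_one] at this
  exact_mod_cast this

theorem dyadicWeight_mono_int {s : ℝ} (hs : 0 ≤ s) {i j : ℤ} (hij : i ≤ j) :
    dyadicWeight s i ≤ dyadicWeight s j := by
  rw [dyadicWeight, dyadicWeight]
  refine ENNReal.ofReal_le_ofReal (Real.rpow_le_rpow_of_exponent_le one_le_two ?_)
  have : (i : ℝ) ≤ j := by exact_mod_cast hij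
  gcongr

end DyadicWeight

/-! ### Convolution and interpolation inequalities for nonnegative functions -/

section Convolution

/-- The convolution of two nonnegative functions on the plane. -/
def lconv (N f : Plane → ℝ≥0∞) (x : Plane) : ℝ≥0∞ := ∫⁻ y, N (x - y) * f y

theorem measurable_lconv {N f : Plane → ℝ≥0∞} (hN : Measurable N) (hf : Measurable f) :
    Measurable (lconv N f) := by
  refine Measurable.lintegral_prod_right' (f := fun z : Plane × Plane => N (z.1 - z.2) * f z.2) ?_
  fun_prop

theorem lintegral_lconv {N f : Plane → ℝ≥0∞} (hN : Measurable N) (hf : Measurable f) :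
    ∫⁻ x, lconv N f x = (∫⁻ x, N x) * ∫⁻ x, f x := by
  unfold lconv
  rw [lintegral_lintegral_swap (by fun_prop)]
  have : ∀ y, ∫⁻ x, N (x - y) * f y = (∫⁻ x, N x) * f y := fun y => by
    rw [lintegral_mul_const _ (by fun_prop), lintegral_sub_right_eq_self N y]
  simp only [this]
  rw [lintegral_const_mul _ hf]

/-- Hölder's inequality for the measure `N(x - y) dy`, whose total mass is `∫ N`. Both Young's
inequality and the pointwise bound follow from it. -/
theorem lconv_rpow_le {N f : Plane → ℝ≥0∞} (hN : Measurable N) (hf : Measurable f) {p : ℝ}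
    (hp : 1 ≤ p) (x : Plane) :
    lconv N f x ≤ (∫⁻ y, N y) ^ (1 - p⁻¹) * lconv N (fun y => f y ^ p) x ^ p⁻¹ := by
  have hp0 : 0 < p := by linarith
  have hpi : p⁻¹ ≤ 1 := inv_le_one_of_one_le₀ hp
  have h := ENNReal.lintegral_mul_norm_pow_le (μ := (volume : Measure Plane))
    (f := fun y => N (x - y)) (g := fun y => N (x - y) * f y ^ p) (by fun_prop) (by fun_prop)
    (sub_nonneg.mpr hpi) (inv_nonneg.mpr hp0.le) (by ring)
  rw [lintegral_sub_left_eq_self N x] at h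
  refine le_trans (le_of_eq ?_) h
  refine lintegral_congr fun y => ?_
  rw [ENNReal.mul_rpow_of_nonneg _ _ (inv_nonneg.mpr hp0.le), ← ENNReal.rpow_mul,
    mul_inv_cancel₀ hp0.ne', ENNReal.rpow_one, ← mul_assoc,
    ← ENNReal.rpow_add_of_nonneg _ _ (sub_nonneg.mpr hpi) (inv_nonneg.mpr hp0.le)]
  simp

theorem lconv_le_top {N f : Plane → ℝ≥0∞} (hN : Measurable N) (x : Plane) :
    lconv N f x ≤ (∫⁻ y, N y) * eLpNorm f ∞ volume := by
  have h : ∀ᵐ y, f y ≤ eLpNorm f ∞ volume := by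
    rw [eLpNorm_exponent_top]
    exact enorm_ae_le_eLpNormEssSup f volume
  calc lconv N f x ≤ ∫⁻ y, N (x - y) * eLpNorm f ∞ volume := by
        refine lintegral_mono_ae ?_
        filter_upwards [h] with y hy
        gcongr
    _ = _ := by rw [lintegral_mul_const _ (by fun_prop), lintegral_sub_left_eq_self N x]

/-- Young's inequality `‖N * f‖_p ≤ ‖N‖_1 ‖f‖_p`. -/
theorem eLpNorm_lconv_le {N f : Plane → ℝ≥0∞} (hN : Measurable N) (hf : Measurable f) {p : ℝ≥0∞}
    (hp : 1 ≤ p) : eLpNorm (lconv N f) p volume ≤ (∫⁻ y, N y) * eLpNorm f p volume := by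
  rcases eq_or_ne p ∞ with rfl | hpt
  · rw [eLpNorm_exponent_top (f := lconv N f)]
    exact eLpNormEssSup_le_of_ae_enorm_bound (Eventually.of_forall fun x => lconv_le_top hN x)
  · have hp0 : p ≠ 0 := (zero_lt_one.trans_le hp).ne'
    have hp1 : 1 ≤ p.toReal := by
      rw [← ENNReal.toReal_one]; exact ENNReal.toReal_mono hpt hp
    have hpos : 0 < p.toReal := by linarith
    rw [eLpNorm_eq_lintegral_rpow_enorm_toReal hp0 hpt,
      eLpNorm_eq_lintegral_rpow_enorm_toReal hp0 hpt]
    simp only [enorm_eq_self]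
    set r := p.toReal with hr
    set I := ∫⁻ y, N y with hI
    have hri : r⁻¹ ≤ 1 := inv_le_one_of_one_le₀ hp1
    calc (∫⁻ x, lconv N f x ^ r) ^ (1 / r)
        ≤ (∫⁻ x, I ^ (r - 1) * lconv N (fun y => f y ^ r) x) ^ (1 / r) := by
          gcongr with x
          refine (ENNReal.rpow_le_rpow (lconv_rpow_le hN hf hp1 x) hpos.le).trans (le_of_eq ?_)
          rw [ENNReal.mul_rpow_of_nonneg _ _ hpos.le, ← ENNReal.rpow_mul, ← ENNReal.rpow_mul,
            inv_mul_cancel₀ hpos.ne', ENNReal.rpow_one, sub_mul, inv_mul_cancel₀ hpos.ne', one_mul]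
      _ = (I ^ (r - 1) * (I * ∫⁻ x, f x ^ r)) ^ (1 / r) := by
          rw [lintegral_const_mul _ (measurable_lconv hN (by fun_prop)),
            lintegral_lconv hN (by fun_prop)]
      _ = (I ^ r * ∫⁻ x, f x ^ r) ^ (1 / r) := by
          rw [← mul_assoc]
          congr 2
          nth_rewrite 2 [← ENNReal.rpow_one I]
          rw [← ENNReal.rpow_add_of_nonneg _ _ (by linarith) zero_le_one, sub_add_cancel]
      _ = I * (∫⁻ x, f x ^ r) ^ (1 / r) := by
          rw [ENNReal.mul_rpow_of_nonneg _ _ (by positivity), ← ENNReal.rpow_mul,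
            mul_one_div_cancel hpos.ne', ENNReal.rpow_one]

/-- A pointwise bound for a convolution with a bounded integrable kernel. -/
theorem lconv_le_eLpNorm {N f : Plane → ℝ≥0∞} (hN : Measurable N) (hf : Measurable f) {p : ℝ≥0∞}
    (hp : 1 ≤ p) {M : ℝ≥0∞} (hM : ∀ y, N y ≤ M) (x : Plane) :
    lconv N f x ≤ (∫⁻ y, N y) ^ (1 - (p⁻¹).toReal) * M ^ (p⁻¹).toReal * eLpNorm f p volume := by
  rcases eq_or_ne p ∞ with rfl | hpt
  · simpa using lconv_le_top hN x
  · have hp0 : p ≠ 0 := (zero_lt_one.trans_le hp).ne'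
    have hp1 : 1 ≤ p.toReal := by
      rw [← ENNReal.toReal_one]; exact ENNReal.toReal_mono hpt hp
    have hpos : 0 < p.toReal := by linarith
    rw [eLpNorm_eq_lintegral_rpow_enorm_toReal hp0 hpt, ENNReal.toReal_inv]
    simp only [enorm_eq_self]
    refine (lconv_rpow_le hN hf hp1 x).trans ?_
    rw [mul_assoc]
    gcongr
    rw [one_div, ← ENNReal.mul_rpow_of_nonneg _ _ (by positivity)]
    gcongr
    refine (lintegral_mono fun y => ?_).trans (lintegral_const_mul M (by fun_prop)).le
    gcongr
    exact hM _

/-- Interpolation between `L^q` and `L^∞`. -/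
theorem eLpNorm_le_of_enorm_le {E : Type*} [NormedAddCommGroup E] {g : Plane → E} {q r : ℝ≥0∞}
    (hq : 1 ≤ q) (hqr : q ≤ r) {M : ℝ≥0∞} (hM : ∀ x, ‖g x‖ₑ ≤ M) (hMt : M ≠ ⊤) :
    eLpNorm g r volume ≤ M ^ (1 - (r⁻¹).toReal / (q⁻¹).toReal)
      * eLpNorm g q volume ^ ((r⁻¹).toReal / (q⁻¹).toReal) := by
  rcases eq_or_ne r (⊤ : ℝ≥0∞) with rfl | hrt
  · simp only [ENNReal.inv_top, ENNReal.toReal_zero, zero_div, sub_zero, ENNReal.rpow_one,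
      ENNReal.rpow_zero, mul_one, eLpNorm_exponent_top]
    exact eLpNormEssSup_le_of_ae_enorm_bound (Eventually.of_forall hM)
  · have hqt : q ≠ (⊤ : ℝ≥0∞) := ne_top_of_le_ne_top hrt hqr
    have hq0 : q ≠ 0 := (zero_lt_one.trans_le hq).ne'
    have hr0 : r ≠ 0 := (zero_lt_one.trans_le (hq.trans hqr)).ne'
    have hqpos : 0 < q.toReal := ENNReal.toReal_pos hq0 hqt
    have hrpos : 0 < r.toReal := ENNReal.toReal_pos hr0 hrt
    have hle : q.toReal ≤ r.toReal := ENNReal.toReal_mono hrt hqr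
    rw [eLpNorm_eq_lintegral_rpow_enorm_toReal hq0 hqt,
      eLpNorm_eq_lintegral_rpow_enorm_toReal hr0 hrt, ENNReal.toReal_inv, ENNReal.toReal_inv]
    set a := q.toReal
    set b := r.toReal
    have h1 : ∫⁻ x, ‖g x‖ₑ ^ b ≤ M ^ (b - a) * ∫⁻ x, ‖g x‖ₑ ^ a := by
      rw [← lintegral_const_mul' _ _ (by
        exact ENNReal.rpow_ne_top_of_nonneg (by linarith) hMt)]
      refine lintegral_mono fun x => ?_
      rw [show b = (b - a) + a by ring, ENNReal.rpow_add_of_nonneg _ _ (by linarith) hqpos.le,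
        sub_add_cancel]
      gcongr
      exact hM x
    have e1 : b⁻¹ / a⁻¹ = a / b := by field_simp
    refine (ENNReal.rpow_le_rpow h1 (by positivity)).trans (le_of_eq ?_)
    rw [ENNReal.mul_rpow_of_nonneg _ _ (by positivity), ← ENNReal.rpow_mul, ← ENNReal.rpow_mul, e1]
    congr 2
    · field_simp
    · field_simp

end Convolution

/-! ### Decay of Schwartz kernels and differentiation of convolutions -/

section Kernels

/-- The real part of a Schwartz function. -/
def SchwartzMap.rePart (f : 𝓢(Plane, ℂ)) : 𝓢(Plane, ℝ) := f.postcompCLM Complex.reCLM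

/-- The exponent `3` is an integer above the dimension `2`, so the majorant is integrable on the
plane. -/
theorem SchwartzMap.exists_decay (K : 𝓢(Plane, ℝ)) (n : ℕ) :
    ∃ C, 0 ≤ C ∧ ∀ x, ‖iteratedFDeriv ℝ n K x‖ ≤ C * (1 + ‖x‖) ^ (-3 : ℝ) := by
  refine ⟨2 ^ 3 * (Finset.Iic (3, n)).sup (fun m => SchwartzMap.seminorm ℝ m.1 m.2) K, ?_,
    fun x => ?_⟩
  rotate_left
  · have := SchwartzMap.one_add_le_sup_seminorm_apply (𝕜 := ℝ) (m := (3, n)) le_rfl le_rfl K x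
    have h0 : (0 : ℝ) < 1 + ‖x‖ := by positivity
    rw [Real.rpow_neg h0.le, ← div_eq_mul_inv, le_div_iff₀ (by positivity), mul_comm]
    rw [show (3 : ℝ) = ((3 : ℕ) : ℝ) by norm_num, Real.rpow_natCast]
    exact this
  · positivity

theorem SchwartzMap.exists_decay_zero (K : 𝓢(Plane, ℝ)) :
    ∃ C, 0 ≤ C ∧ ∀ x, ‖K x‖ ≤ C * (1 + ‖x‖) ^ (-3 : ℝ) := by
  obtain ⟨C, hC, h⟩ := K.exists_decay 0
  exact ⟨C, hC, fun x => by simpa using h x⟩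

theorem SchwartzMap.exists_decay_fderiv (K : 𝓢(Plane, ℝ)) :
    ∃ C, 0 ≤ C ∧ ∀ x, ‖fderiv ℝ K x‖ ≤ C * (1 + ‖x‖) ^ (-3 : ℝ) := by
  obtain ⟨C, hC, h⟩ := K.exists_decay 1
  refine ⟨C, hC, fun x => ?_⟩
  have := h x
  rwa [norm_iteratedFDeriv_one] at this

theorem integrable_japanese : Integrable fun x : Plane => (1 + ‖x‖) ^ (-3 : ℝ) :=
  integrable_one_add_norm (by rw [finrank_euclideanSpace_fin]; norm_num)

theorem SchwartzMap.continuous_fderiv (K : 𝓢(Plane, ℝ)) : Continuous (fderiv ℝ K) :=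
  (K.smooth 1).continuous_fderiv one_ne_zero

variable {E : Type*} [NormedAddCommGroup E] [NormedSpace ℝ E] [CompleteSpace E]

theorem integrable_kernel_smul {K : Plane → ℝ} (hK : Continuous K) {C : ℝ}
    (hC : ∀ x, ‖K x‖ ≤ C * (1 + ‖x‖) ^ (-3 : ℝ)) {f : Plane → E}
    (hf : AEStronglyMeasurable f) {M : ℝ} (hM : ∀ y, ‖f y‖ ≤ M) (x : Plane) :
    Integrable fun y => K (x - y) • f y := by
  have h0 : 0 ≤ M := (norm_nonneg _).trans (hM 0)
  refine ((integrable_japanese.comp_sub_left x).const_mul (C * M)).mono'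
    ((hK.comp (by fun_prop)).aestronglyMeasurable.smul hf) (Eventually.of_forall fun y => ?_)
  rw [norm_smul]
  calc ‖K (x - y)‖ * ‖f y‖ ≤ (C * (1 + ‖x - y‖) ^ (-3 : ℝ)) * M :=
        mul_le_mul (hC _) (hM _) (norm_nonneg _) ((norm_nonneg _).trans (hC _))
    _ = _ := by ring

theorem SchwartzMap.integrable_smul_sub (K : 𝓢(Plane, ℝ)) {f : Plane → E}
    (hf : AEStronglyMeasurable f) {M : ℝ} (hM : ∀ y, ‖f y‖ ≤ M) (x : Plane) :
    Integrable fun y => K (x - y) • f y := by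
  obtain ⟨C, hC, hCK⟩ := K.exists_decay_zero
  exact integrable_kernel_smul K.continuous hCK hf hM x

theorem SchwartzMap.integrable_fderiv_smulRight_sub (K : 𝓢(Plane, ℝ)) {f : Plane → E}
    (hf : AEStronglyMeasurable f) {M : ℝ} (hM : ∀ y, ‖f y‖ ≤ M) (x : Plane) :
    Integrable fun y => (fderiv ℝ K (x - y)).smulRight (f y) := by
  obtain ⟨C, hC, hCK⟩ := K.exists_decay_fderiv
  have h0 : 0 ≤ M := (norm_nonneg _).trans (hM 0)
  refine ((integrable_japanese.comp_sub_left x).const_mul (C * M)).mono' ?_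
    (Eventually.of_forall fun y => ?_)
  · have h1 : AEStronglyMeasurable (fun y => fderiv ℝ K (x - y)) (volume : Measure Plane) :=
      (K.continuous_fderiv.comp (by fun_prop)).aestronglyMeasurable
    exact (ContinuousLinearMap.smulRightL ℝ Plane E).aestronglyMeasurable_comp₂ h1 hf
  · rw [ContinuousLinearMap.norm_smulRight_apply]
    calc ‖fderiv ℝ K (x - y)‖ * ‖f y‖ ≤ (C * (1 + ‖x - y‖) ^ (-3 : ℝ)) * M := by
          gcongr
          · exact hCK _
          · exact hM y
      _ = _ := by ring

/-- Differentiation of a convolution of a Schwartz function with a bounded function. -/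
theorem SchwartzMap.hasFDerivAt_integral_smul (K : 𝓢(Plane, ℝ)) {f : Plane → E}
    (hf : AEStronglyMeasurable f) {M : ℝ} (hM : ∀ y, ‖f y‖ ≤ M) (x : Plane) :
    HasFDerivAt (fun x => ∫ y, K (x - y) • f y)
      (∫ y, (fderiv ℝ K (x - y)).smulRight (f y)) x := by
  obtain ⟨C, hC, hCK⟩ := K.exists_decay_fderiv
  have h0 : 0 ≤ M := (norm_nonneg _).trans (hM 0)
  refine hasFDerivAt_integral_of_dominated_of_fderiv_le
    (F' := fun x y => (fderiv ℝ K (x - y)).smulRight (f y))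
    (bound := fun y => C * 8 * M * (1 + ‖x - y‖) ^ (-3 : ℝ))
    (Metric.ball_mem_nhds x one_pos)
    (Eventually.of_forall fun z => (K.integrable_smul_sub hf hM z).aestronglyMeasurable)
    (K.integrable_smul_sub hf hM x) (K.integrable_fderiv_smulRight_sub hf hM x).aestronglyMeasurable
    (Eventually.of_forall fun y z hz => ?_)
    ((integrable_japanese.comp_sub_left x).const_mul _)
    (Eventually.of_forall fun y z hz => ?_)
  · rw [ContinuousLinearMap.norm_smulRight_apply]
    -- For `z` in the unit ball around `x`, `1 + ‖z - y‖` is at least half of `1 + ‖x - y‖`; the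
    -- constant is `8 = 2 ^ 3`.
    have h1 : (1 + ‖z - y‖) ^ (-3 : ℝ) ≤ 8 * (1 + ‖x - y‖) ^ (-3 : ℝ) := by
      rw [mem_ball_iff_norm] at hz
      have h2 : ‖x - y‖ ≤ ‖z - y‖ + 1 := by
        have := norm_sub_le (z - y) (z - x)
        rw [sub_sub_sub_cancel_left] at this
        linarith
      have h3 : (1 + ‖x - y‖) / 2 ≤ 1 + ‖z - y‖ := by linarith [norm_nonneg (z - y)]
      have h4 : (0 : ℝ) < (1 + ‖x - y‖) / 2 := by positivity
      refine (Real.rpow_le_rpow_of_nonpos h4 h3 (by norm_num)).trans (le_of_eq ?_)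
      rw [Real.div_rpow (by positivity) two_pos.le]
      norm_num
      ring
    calc ‖fderiv ℝ K (z - y)‖ * ‖f y‖ ≤ (C * (8 * (1 + ‖x - y‖) ^ (-3 : ℝ))) * M := by
          gcongr
          · exact (hCK _).trans (by gcongr)
          · exact hM y
      _ = _ := by ring
  · have h1 : HasFDerivAt (fun z => K (z - y)) (fderiv ℝ K (z - y)) z := by
      exact (hasFDerivAt_comp_sub y).mpr (K.hasFDerivAt (z - y))
    exact h1.smul_const (f y)

theorem lintegral_comp_zpow_smul {f : Plane → ℝ≥0∞} (hf : Measurable f) (j : ℤ) :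
    dyadicWeight 2 j * ∫⁻ x, f ((2 : ℝ) ^ j • x) = ∫⁻ x, f x := by
  have h2 : (2 : ℝ) ^ j ≠ 0 := by positivity
  have h := Measure.map_addHaar_smul (volume : Measure Plane) h2
  rw [finrank_euclideanSpace_fin, abs_of_nonneg (by positivity)] at h
  have h3 : ∫⁻ x, f ((2 : ℝ) ^ j • x) = ∫⁻ x, f x ∂(Measure.map ((2 : ℝ) ^ j • ·) volume) :=
    (lintegral_map hf (by fun_prop)).symm
  rw [h3, h, lintegral_smul_measure, smul_eq_mul, dyadicWeight_two, ← mul_assoc,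
    ← ENNReal.ofReal_mul (by positivity), mul_inv_cancel₀ (by positivity), ENNReal.ofReal_one,
    one_mul]

end Kernels

/-! ### Kernel bounds uniform in the dyadic scale -/

section Kernels

variable {E : Type*} [NormedAddCommGroup E] [NormedSpace ℝ E] [CompleteSpace E]

theorem SchwartzMap.fderiv_integral_smul (K : 𝓢(Plane, ℝ)) {f : Plane → E}
    (hf : AEStronglyMeasurable f) {M : ℝ} (hM : ∀ y, ‖f y‖ ≤ M) (x : Plane) :
    fderiv ℝ (fun x => ∫ y, K (x - y) • f y) x = ∫ y, (fderiv ℝ K (x - y)).smulRight (f y) :=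
  (K.hasFDerivAt_integral_smul hf hM x).fderiv

theorem SchwartzMap.contDiff_integral_smul (K : 𝓢(Plane, ℝ)) {f : Plane → E}
    (hf : Continuous f) {M : ℝ} (hM : ∀ y, ‖f y‖ ≤ M) :
    ContDiff ℝ 1 (fun x => ∫ y, K (x - y) • f y) := by
  refine contDiff_one_iff_fderiv.mpr
    ⟨fun x => (K.hasFDerivAt_integral_smul hf.aestronglyMeasurable hM x).differentiableAt, ?_⟩
  -- The change of variables leaves `x` only in the bounded continuous `f`, so dominated convergence
  -- gives continuity of the derivative without moving the kernel.
  have h1 : fderiv ℝ (fun x => ∫ y, K (x - y) • f y)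
      = fun x => ∫ y, (fderiv ℝ K y).smulRight (f (x - y)) := by
    ext1 x
    rw [K.fderiv_integral_smul hf.aestronglyMeasurable hM,
      ← integral_sub_left_eq_self (fun y => (fderiv ℝ K y).smulRight (f (x - y))) volume x]
    simp only [sub_sub_cancel]
  rw [h1]
  obtain ⟨C, hC, hCK⟩ := K.exists_decay_fderiv
  refine continuous_of_dominated (bound := fun y => C * M * (1 + ‖y‖) ^ (-3 : ℝ))
    (fun x => ?_) (fun x => Eventually.of_forall fun y => ?_) (integrable_japanese.const_mul _)
    (Eventually.of_forall fun y => ?_)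
  · exact (((ContinuousLinearMap.smulRightL ℝ Plane E).continuous₂).comp
      (K.continuous_fderiv.prodMk (hf.comp (by fun_prop : Continuous fun y => x - y)))
      ).aestronglyMeasurable
  · rw [ContinuousLinearMap.norm_smulRight_apply]
    calc ‖fderiv ℝ K y‖ * ‖f (x - y)‖ ≤ (C * (1 + ‖y‖) ^ (-3 : ℝ)) * M := by
          gcongr
          · exact hCK _
          · exact hM _
      _ = _ := by ring
  · exact ((ContinuousLinearMap.smulRightL ℝ Plane E) (fderiv ℝ K y)).continuous.comp
      (hf.comp (by fun_prop))

/-- Bounds of an integrable kernel at frequency `2 ^ j`. -/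
structure KernelBound (B : ℝ≥0∞) (j : ℤ) (K : 𝓢(Plane, ℝ)) : Prop where
  lintegral_le : ∫⁻ x, ‖K x‖ₑ ≤ B
  enorm_le : ∀ x, ‖K x‖ₑ ≤ B * dyadicWeight 2 j
  lintegral_fderiv_le : ∫⁻ x, ‖fderiv ℝ K x‖ₑ ≤ B * dyadicWeight 1 j
  enorm_fderiv_le : ∀ x, ‖fderiv ℝ K x‖ₑ ≤ B * dyadicWeight 3 j
  lintegral_moment_le : ∫⁻ x, ‖x‖ₑ * ‖fderiv ℝ K x‖ₑ ≤ B

theorem KernelBound.mono {B B' : ℝ≥0∞} {j : ℤ} {K : 𝓢(Plane, ℝ)} (h : KernelBound B j K)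
    (hB : B ≤ B') : KernelBound B' j K where
  lintegral_le := h.lintegral_le.trans hB
  enorm_le x := (h.enorm_le x).trans (by gcongr)
  lintegral_fderiv_le := h.lintegral_fderiv_le.trans (by gcongr)
  enorm_fderiv_le x := (h.enorm_fderiv_le x).trans (by gcongr)
  lintegral_moment_le := h.lintegral_moment_le.trans hB

theorem SchwartzMap.exists_kernelBound_zero (K : 𝓢(Plane, ℝ)) :
    ∃ B : ℝ≥0∞, B ≠ ⊤ ∧ KernelBound B 0 K := by
  obtain ⟨C₀, hC₀, h0⟩ := K.exists_decay_zero
  obtain ⟨C₁, hC₁, h1⟩ := K.exists_decay_fderiv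
  have hle : ∀ x : Plane, (1 + ‖x‖) ^ (-3 : ℝ) ≤ 1 := fun x =>
    Real.rpow_le_one_of_one_le_of_nonpos (by linarith [norm_nonneg x]) (by norm_num)
  have i0 : Integrable (fun x => K x) := (integrable_japanese.const_mul C₀).mono'
    K.continuous.aestronglyMeasurable (Eventually.of_forall h0)
  have i1 : Integrable (fun x => fderiv ℝ K x) := (integrable_japanese.const_mul C₁).mono'
    K.continuous_fderiv.aestronglyMeasurable (Eventually.of_forall h1)
  have i2 : Integrable (fun x => ‖x‖ * ‖fderiv ℝ K x‖) := by
    refine (integrable_japanese.const_mul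
      (2 ^ 4 * (Finset.Iic (4, 1)).sup (fun m => SchwartzMap.seminorm ℝ m.1 m.2) K)).mono'
      (continuous_norm.mul K.continuous_fderiv.norm).aestronglyMeasurable
      (Eventually.of_forall fun x => ?_)
    have := SchwartzMap.one_add_le_sup_seminorm_apply (𝕜 := ℝ) (m := (4, 1)) le_rfl le_rfl K x
    rw [norm_iteratedFDeriv_one] at this
    have hx : (0 : ℝ) < 1 + ‖x‖ := by positivity
    rw [Real.rpow_neg hx.le, ← div_eq_mul_inv, le_div_iff₀ (by positivity),
      show (3 : ℝ) = ((3 : ℕ) : ℝ) by norm_num, Real.rpow_natCast, norm_mul, norm_norm, norm_norm]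
    refine le_trans ?_ this
    calc ‖x‖ * ‖fderiv ℝ K x‖ * (1 + ‖x‖) ^ 3
        ≤ (1 + ‖x‖) * ‖fderiv ℝ K x‖ * (1 + ‖x‖) ^ 3 := by gcongr; linarith
      _ = _ := by ring
  have e2 : ∫⁻ x, ‖x‖ₑ * ‖fderiv ℝ K x‖ₑ = ∫⁻ x, ‖‖x‖ * ‖fderiv ℝ K x‖‖ₑ := by
    refine lintegral_congr fun x => ?_
    rw [enorm_mul, enorm_norm, enorm_norm]
  refine ⟨(∫⁻ x, ‖K x‖ₑ) + ENNReal.ofReal C₀ + (∫⁻ x, ‖fderiv ℝ K x‖ₑ) + ENNReal.ofReal C₁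
    + ∫⁻ x, ‖x‖ₑ * ‖fderiv ℝ K x‖ₑ, ?_, ⟨?_, fun x => ?_, ?_, fun x => ?_, ?_⟩⟩
  · rw [e2]
    exact ENNReal.add_ne_top.mpr ⟨ENNReal.add_ne_top.mpr ⟨ENNReal.add_ne_top.mpr
      ⟨ENNReal.add_ne_top.mpr ⟨i0.2.ne, ENNReal.ofReal_ne_top⟩, i1.2.ne⟩, ENNReal.ofReal_ne_top⟩,
      i2.2.ne⟩
  · rw [add_assoc, add_assoc, add_assoc]; exact le_self_add
  · rw [dyadicWeight_int_zero, mul_one]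
    have : ‖K x‖ₑ ≤ ENNReal.ofReal C₀ := by
      rw [← ofReal_norm]
      exact ENNReal.ofReal_le_ofReal ((h0 x).trans (mul_le_of_le_one_right hC₀ (hle x)))
    refine this.trans ?_
    rw [add_assoc, add_assoc, add_comm (∫⁻ x, ‖K x‖ₑ), add_assoc]; exact le_self_add
  · rw [dyadicWeight_int_zero, mul_one, add_assoc, add_right_comm,
      add_comm _ (∫⁻ x, ‖fderiv ℝ K x‖ₑ)]
    rw [add_assoc]; exact le_self_add
  · rw [dyadicWeight_int_zero, mul_one]
    have : ‖fderiv ℝ K x‖ₑ ≤ ENNReal.ofReal C₁ := by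
      rw [← ofReal_norm]
      exact ENNReal.ofReal_le_ofReal ((h1 x).trans (mul_le_of_le_one_right hC₁ (hle x)))
    refine this.trans ?_
    rw [add_right_comm]; exact le_add_self
  · exact le_add_self

theorem fderiv_eq_of_dilate {K K₀ : 𝓢(Plane, ℝ)} {c : ℝ}
    (h : ∀ x, K x = c ^ 2 * K₀ (c • x)) (x : Plane) :
    fderiv ℝ K x = c ^ 3 • fderiv ℝ K₀ (c • x) := by
  have h1 : HasFDerivAt (fun x => c ^ 2 * K₀ (c • x))
      (c ^ 2 • (fderiv ℝ K₀ (c • x)).comp (c • ContinuousLinearMap.id ℝ Plane)) x :=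
    ((K₀.hasFDerivAt (c • x)).comp x ((hasFDerivAt_id x).const_smul c)).const_mul _
  have h2 : (K : Plane → ℝ) = fun x => c ^ 2 * K₀ (c • x) := funext h
  rw [h2, h1.fderiv, ContinuousLinearMap.comp_smul, ContinuousLinearMap.comp_id, smul_smul]
  ring_nf

theorem dyadicWeight_three (j : ℤ) : dyadicWeight 3 j = ENNReal.ofReal (((2 : ℝ) ^ j) ^ 3) := by
  exact_mod_cast dyadicWeight_natCast 3 j

/-- Each exponent in `KernelBound` is the scaling exponent of the corresponding quantity under `K₀ ↦
c² K₀(c ·)`. The first moment of the gradient is scale invariant, and this is what lets the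
commutator absorb one derivative. -/
theorem KernelBound.of_dilate {B : ℝ≥0∞} {K K₀ : 𝓢(Plane, ℝ)} (hB : KernelBound B 0 K₀) {j : ℤ}
    (h : ∀ x, K x = ((2 : ℝ) ^ j) ^ 2 * K₀ ((2 : ℝ) ^ j • x)) : KernelBound B j K := by
  have hd := fderiv_eq_of_dilate h
  have e0 : ∀ x, ‖K x‖ₑ = dyadicWeight 2 j * ‖K₀ ((2 : ℝ) ^ j • x)‖ₑ := fun x => by
    rw [h, enorm_mul, dyadicWeight_two, Real.enorm_of_nonneg (by positivity)]
  have e1 : ∀ x, ‖fderiv ℝ K x‖ₑ = dyadicWeight 3 j * ‖fderiv ℝ K₀ ((2 : ℝ) ^ j • x)‖ₑ :=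
    fun x => by
      rw [hd, enorm_smul, dyadicWeight_three, Real.enorm_of_nonneg (by positivity)]
  have e3 : dyadicWeight 3 j = dyadicWeight 2 j * dyadicWeight 1 j := by
    rw [← dyadicWeight_add]; norm_num
  have m0 : Measurable fun x => ‖K₀ x‖ₑ := K₀.continuous.enorm.measurable
  have m1 : Measurable fun x => ‖fderiv ℝ K₀ x‖ₑ := K₀.continuous_fderiv.enorm.measurable
  have b0 := hB.enorm_le
  have b1 := hB.enorm_fderiv_le
  have b2 := hB.lintegral_fderiv_le
  simp only [dyadicWeight_int_zero, mul_one] at b0 b1 b2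
  refine ⟨?_, fun x => ?_, ?_, fun x => ?_, ?_⟩
  · simp only [e0]
    rw [lintegral_const_mul' _ _ (dyadicWeight_ne_top _ _), lintegral_comp_zpow_smul m0]
    exact hB.lintegral_le
  · rw [e0, mul_comm]
    gcongr
    exact b0 _
  · simp only [e1, e3]
    rw [lintegral_const_mul' _ _ (by finiteness [dyadicWeight_ne_top 2 j, dyadicWeight_ne_top 1 j]),
      mul_right_comm, lintegral_comp_zpow_smul m1]
    gcongr
  · rw [e1, mul_comm]
    gcongr
    exact b1 _
  · have : ∀ x, ‖x‖ₑ * ‖fderiv ℝ K x‖ₑ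
        = dyadicWeight 2 j * (‖(2 : ℝ) ^ j • x‖ₑ * ‖fderiv ℝ K₀ ((2 : ℝ) ^ j • x)‖ₑ) := fun x => by
      rw [e1, e3, enorm_smul, Real.enorm_of_nonneg (by positivity), ← dyadicWeight_one]
      ring
    simp only [this]
    rw [lintegral_const_mul' _ _ (dyadicWeight_ne_top _ _),
      lintegral_comp_zpow_smul (f := fun x => ‖x‖ₑ * ‖fderiv ℝ K₀ x‖ₑ)
        (continuous_enorm.measurable.mul m1)]
    exact hB.lintegral_moment_le

end Kernels

namespace LittlewoodPaley

variable (L : LittlewoodPaley)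

/-- The real convolution kernel of the dyadic block, as a Schwartz function. -/
def κS (j : ℤ) : 𝓢(Plane, ℝ) := (L.g j).rePart

/-- The real convolution kernel of three consecutive dyadic blocks, as a Schwartz function. -/
def κFatS (k : ℤ) : 𝓢(Plane, ℝ) := (L.gFat k).rePart

theorem κS_apply (j : ℤ) (x : Plane) : L.κS j x = L.κ j x := rfl

theorem κFatS_apply (j : ℤ) (x : Plane) : L.κFatS j x = L.κFat j x := rfl

theorem g_dilate (i j : ℤ) (x : Plane) :
    L.g (i + j) x = (2 : ℂ) ^ (2 * j) * L.g i ((2 : ℝ) ^ j • x) := by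
  rw [g_apply, g_apply, smul_smul, ← zpow_add₀ two_ne_zero, ← mul_assoc,
    ← zpow_add₀ two_ne_zero, mul_add, add_comm (2 * i)]

theorem re_zpow_mul (j : ℤ) (z : ℂ) : ((2 : ℂ) ^ (2 * j) * z).re = ((2 : ℝ) ^ j) ^ 2 * z.re := by
  have : (2 : ℂ) ^ (2 * j) = ((((2 : ℝ) ^ j) ^ 2 : ℝ) : ℂ) := by
    push_cast
    rw [mul_comm, zpow_mul]
    norm_cast
  rw [this, Complex.re_ofReal_mul]

theorem κS_dilate (j : ℤ) (x : Plane) :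
    L.κS j x = ((2 : ℝ) ^ j) ^ 2 * L.κS 0 ((2 : ℝ) ^ j • x) := by
  change (L.g j x).re = _ * (L.g 0 _).re
  rw [← re_zpow_mul, ← g_dilate, zero_add]

theorem κFatS_dilate (j : ℤ) (x : Plane) :
    L.κFatS j x = ((2 : ℝ) ^ j) ^ 2 * L.κFatS 0 ((2 : ℝ) ^ j • x) := by
  change (L.gFat j x).re = _ * (L.gFat 0 _).re
  rw [← re_zpow_mul]
  congr 1
  simp only [gFat, _root_.sum_apply, Finset.mul_sum, ← g_dilate]
  rw [show Finset.Icc (j - 1) (j + 1)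
    = (Finset.Icc (0 - 1 : ℤ) (0 + 1)).map (addRightEmbedding j) by
      rw [Finset.map_add_right_Icc]; congr 1 <;> ring]
  rw [Finset.sum_map]
  simp [addRightEmbedding]

/-- A common bound of all the kernels attached to `L`. -/
theorem exists_kernelBound : ∃ B : ℝ≥0∞, B ≠ ⊤ ∧ 1 ≤ B ∧
    (∀ j, KernelBound B j (L.κS j)) ∧ ∀ j, KernelBound B j (L.κFatS j) := by
  obtain ⟨B₁, h1, hB₁⟩ := (L.κS 0).exists_kernelBound_zero
  obtain ⟨B₂, h2, hB₂⟩ := (L.κFatS 0).exists_kernelBound_zero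
  refine ⟨1 + B₁ + B₂, by finiteness, by rw [add_assoc]; exact le_self_add, fun j => ?_,
    fun j => ?_⟩
  · exact (hB₁.of_dilate (L.κS_dilate j)).mono
      (by rw [add_comm 1, add_assoc]; exact le_self_add)
  · exact (hB₂.of_dilate (L.κFatS_dilate j)).mono le_add_self

end LittlewoodPaley

/-! ### Bernstein inequalities -/

section Spectral

variable {E : Type*} [NormedAddCommGroup E] [NormedSpace ℝ E] [CompleteSpace E]

/-- A bounded continuous function which is localized at frequencies of size `2 ^ k`. -/
structure Spectral (L : LittlewoodPaley) (k : ℤ) (f : Plane → E) : Prop where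
  continuous : Continuous f
  bounded : ∃ M : ℝ, ∀ x, ‖f x‖ ≤ M
  reproducing : ∀ x, f x = ∫ y, L.κFatS k (x - y) • f y

theorem dyadicWeight_interp {B : ℝ≥0∞} (s t θ : ℝ) (hθ : 0 ≤ θ) (hθ' : θ ≤ 1) (k : ℤ) :
    (B * dyadicWeight s k) ^ (1 - θ) * (B * dyadicWeight t k) ^ θ
      = B * dyadicWeight (s * (1 - θ) + t * θ) k := by
  rw [ENNReal.mul_rpow_of_nonneg _ _ (sub_nonneg.mpr hθ'), ENNReal.mul_rpow_of_nonneg _ _ hθ,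
    mul_mul_mul_comm, ← ENNReal.rpow_add_of_nonneg _ _ (sub_nonneg.mpr hθ') hθ, sub_add_cancel,
    ENNReal.rpow_one, dyadicWeight_rpow, dyadicWeight_rpow, ← dyadicWeight_add]

theorem toReal_inv_mem {q : ℝ≥0∞} (hq : 1 ≤ q) : 0 ≤ (q⁻¹).toReal ∧ (q⁻¹).toReal ≤ 1 := by
  refine ⟨ENNReal.toReal_nonneg, ?_⟩
  rw [← ENNReal.toReal_one]
  exact ENNReal.toReal_mono ENNReal.one_ne_top (ENNReal.inv_le_one.mpr hq)

namespace Spectral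

variable {L : LittlewoodPaley} {k : ℤ} {f : Plane → E} {B : ℝ≥0∞}

theorem contDiff (h : Spectral L k f) : ContDiff ℝ 1 f := by
  obtain ⟨M, hM⟩ := h.bounded
  rw [show f = fun x => ∫ y, L.κFatS k (x - y) • f y from funext h.reproducing]
  exact (L.κFatS k).contDiff_integral_smul h.continuous hM

theorem differentiable (h : Spectral L k f) : Differentiable ℝ f :=
  h.contDiff.differentiable one_ne_zero

theorem continuous_fderiv (h : Spectral L k f) : Continuous (fderiv ℝ f) :=
  h.contDiff.continuous_fderiv one_ne_zero

theorem fderiv_eq (h : Spectral L k f) (x : Plane) :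
    fderiv ℝ f x = ∫ y, (fderiv ℝ (L.κFatS k) (x - y)).smulRight (f y) := by
  obtain ⟨M, hM⟩ := h.bounded
  rw [← (L.κFatS k).fderiv_integral_smul h.continuous.aestronglyMeasurable hM,
    show (fun x => ∫ y, L.κFatS k (x - y) • f y) = f from (funext h.reproducing).symm]

theorem enorm_le_lconv (h : Spectral L k f) (x : Plane) :
    ‖f x‖ₑ ≤ lconv (fun x => ‖L.κFatS k x‖ₑ) (fun x => ‖f x‖ₑ) x := by
  conv_lhs => rw [h.reproducing x]
  refine (enorm_integral_le_lintegral_enorm _).trans (le_of_eq ?_)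
  simp only [enorm_smul, lconv]

theorem enorm_fderiv_le_lconv (h : Spectral L k f) (x : Plane) :
    ‖fderiv ℝ f x‖ₑ ≤ lconv (fun x => ‖fderiv ℝ (L.κFatS k) x‖ₑ) (fun x => ‖f x‖ₑ) x := by
  rw [h.fderiv_eq]
  refine (enorm_integral_le_lintegral_enorm _).trans (le_of_eq ?_)
  refine lintegral_congr fun y => ?_
  rw [← ofReal_norm, ContinuousLinearMap.norm_smulRight_apply,
    ENNReal.ofReal_mul (norm_nonneg _), ofReal_norm, ofReal_norm]

theorem measurable_enorm (h : Spectral L k f) : Measurable fun x => ‖f x‖ₑ :=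
  h.continuous.enorm.measurable

theorem measurable_kernel (L : LittlewoodPaley) (k : ℤ) : Measurable fun x => ‖L.κFatS k x‖ₑ :=
  (L.κFatS k).continuous.enorm.measurable

theorem measurable_kernel_fderiv (L : LittlewoodPaley) (k : ℤ) :
    Measurable fun x => ‖fderiv ℝ (L.κFatS k) x‖ₑ :=
  (L.κFatS k).continuous_fderiv.enorm.measurable

/-- The kernel is bounded in `L¹` uniformly and in `L^∞` by `2^(2k)`. Interpolation with parameter
`1/q` between the exponents `0` and `2` produces the weight `2^(2k/q)`. -/
theorem enorm_le (h : Spectral L k f) (hB : KernelBound B k (L.κFatS k)) {q : ℝ≥0∞} (hq : 1 ≤ q)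
    (x : Plane) : ‖f x‖ₑ ≤ B * dyadicWeight (twoOver q) k * eLpNorm f q volume := by
  obtain ⟨h0, h1⟩ := toReal_inv_mem hq
  have := lconv_le_eLpNorm (measurable_kernel L k) h.measurable_enorm hq hB.enorm_le x
  rw [eLpNorm_enorm] at this
  refine (h.enorm_le_lconv x).trans (this.trans ?_)
  refine mul_le_mul_left ?_ _
  refine (mul_le_mul_left (ENNReal.rpow_le_rpow hB.lintegral_le (sub_nonneg.mpr h1)) _).trans ?_
  have := dyadicWeight_interp (B := B) 0 2 (q⁻¹).toReal h0 h1 k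
  rw [dyadicWeight_zero, mul_one, zero_mul, zero_add] at this
  exact this.le

theorem enorm_fderiv_le (h : Spectral L k f) (hB : KernelBound B k (L.κFatS k)) {q : ℝ≥0∞}
    (hq : 1 ≤ q) (x : Plane) :
    ‖fderiv ℝ f x‖ₑ ≤ B * dyadicWeight (1 + twoOver q) k * eLpNorm f q volume := by
  obtain ⟨h0, h1⟩ := toReal_inv_mem hq
  have := lconv_le_eLpNorm (measurable_kernel_fderiv L k) h.measurable_enorm hq
    hB.enorm_fderiv_le x
  rw [eLpNorm_enorm] at this
  refine (h.enorm_fderiv_le_lconv x).trans (this.trans ?_)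
  refine mul_le_mul_left ?_ _
  refine (mul_le_mul_left (ENNReal.rpow_le_rpow hB.lintegral_fderiv_le
    (sub_nonneg.mpr h1)) _).trans ?_
  have := dyadicWeight_interp (B := B) 1 3 (q⁻¹).toReal h0 h1 k
  rw [show 1 * (1 - (q⁻¹).toReal) + 3 * (q⁻¹).toReal = 1 + twoOver q by rw [twoOver]; ring] at this
  exact this.le

theorem eLpNorm_fderiv_le (h : Spectral L k f) (hB : KernelBound B k (L.κFatS k)) {q : ℝ≥0∞}
    (hq : 1 ≤ q) :
    eLpNorm (fderiv ℝ f) q volume ≤ B * dyadicWeight 1 k * eLpNorm f q volume := by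
  have h1 := eLpNorm_lconv_le (measurable_kernel_fderiv L k) h.measurable_enorm hq
  rw [eLpNorm_enorm] at h1
  refine (eLpNorm_mono_enorm (g := lconv (fun x => ‖fderiv ℝ (L.κFatS k) x‖ₑ)
    (fun x => ‖f x‖ₑ)) fun x => ?_).trans (h1.trans ?_)
  · rw [enorm_eq_self]
    exact h.enorm_fderiv_le_lconv x
  · gcongr
    exact hB.lintegral_fderiv_le

/-- Bernstein's inequality for a function bounded in `L^∞` and `L^q`. -/
theorem eLpNorm_le_interp {G : Type*} [NormedAddCommGroup G] {g : Plane → G} (hB1 : 1 ≤ B)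
    (hBt : B ≠ ⊤) {q r n : ℝ≥0∞} (hq : 1 ≤ q) (hqr : q ≤ r) (s : ℝ)
    (h1 : ∀ x, ‖g x‖ₑ ≤ B * dyadicWeight (s + twoOver q) k * n)
    (h2 : eLpNorm g q volume ≤ B * dyadicWeight s k * n) :
    eLpNorm g r volume ≤ B * dyadicWeight (s + twoOver q - twoOver r) k * n := by
  have hB0 : B ≠ 0 := (zero_lt_one.trans_le hB1).ne'
  rcases eq_or_ne n ⊤ with rfl | hn
  · rw [ENNReal.mul_top (mul_ne_zero hB0 (dyadicWeight_ne_zero _ _))]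
    exact le_top
  · set θ := (r⁻¹).toReal / (q⁻¹).toReal with hθ
    obtain ⟨q0, q1⟩ := toReal_inv_mem hq
    obtain ⟨r0, r1⟩ := toReal_inv_mem (hq.trans hqr)
    have hrq : (r⁻¹).toReal ≤ (q⁻¹).toReal := by
      refine ENNReal.toReal_mono ?_ (ENNReal.inv_le_inv.mpr hqr)
      exact ENNReal.inv_ne_top.mpr (zero_lt_one.trans_le hq).ne'
    have hθ0 : 0 ≤ θ := div_nonneg r0 q0
    have hθ1 : θ ≤ 1 := div_le_one_of_le₀ hrq q0
    have hθq : (q⁻¹).toReal * θ = (r⁻¹).toReal := by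
      -- For `q = ∞` also `r = ∞`, and `θ = 0 / 0 = 0` still satisfies the relation.
      rcases eq_or_lt_of_le q0 with h | h
      · rw [← h] at hrq ⊢
        rw [zero_mul]
        exact le_antisymm r0 hrq
      · rw [hθ]; field_simp
    have hMt : B * dyadicWeight (s + twoOver q) k * n ≠ ⊤ := by
      finiteness [dyadicWeight_ne_top (s + twoOver q) k]
    refine (eLpNorm_le_of_enorm_le hq hqr h1 hMt).trans ?_
    refine (mul_le_mul_right (ENNReal.rpow_le_rpow h2 hθ0) _).trans (le_of_eq ?_)
    rw [← hθ, ENNReal.mul_rpow_of_nonneg _ _ (sub_nonneg.mpr hθ1), ENNReal.mul_rpow_of_nonneg _ _ hθ0,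
      mul_mul_mul_comm, ← ENNReal.rpow_add_of_nonneg _ _ (sub_nonneg.mpr hθ1) hθ0, sub_add_cancel,
      ENNReal.rpow_one, dyadicWeight_interp _ _ _ hθ0 hθ1]
    congr 3
    rw [twoOver, twoOver, ← hθq]
    ring

theorem eLpNorm_le (h : Spectral L k f) (hB : KernelBound B k (L.κFatS k)) (hB1 : 1 ≤ B)
    (hBt : B ≠ ⊤) {q r : ℝ≥0∞} (hq : 1 ≤ q) (hqr : q ≤ r) :
    eLpNorm f r volume ≤ B * dyadicWeight (twoOver q - twoOver r) k * eLpNorm f q volume := by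
  have := eLpNorm_le_interp (k := k) (g := f) hB1 hBt hq hqr 0 (n := eLpNorm f q volume)
    (by rw [zero_add]; exact h.enorm_le hB hq) (by
      rw [dyadicWeight_zero, mul_one]
      exact le_mul_of_one_le_left zero_le hB1)
  rwa [zero_add] at this

theorem eLpNorm_fderiv_le_of_le (h : Spectral L k f) (hB : KernelBound B k (L.κFatS k))
    (hB1 : 1 ≤ B) (hBt : B ≠ ⊤) {q r : ℝ≥0∞} (hq : 1 ≤ q) (hqr : q ≤ r) :
    eLpNorm (fderiv ℝ f) r volume
      ≤ B * dyadicWeight (1 + twoOver q - twoOver r) k * eLpNorm f q volume :=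
  eLpNorm_le_interp hB1 hBt hq hqr 1 (h.enorm_fderiv_le hB hq) (h.eLpNorm_fderiv_le hB hq)

theorem enorm_sub_le (h : Spectral L k f) {M : ℝ≥0∞} (hM : ∀ x, ‖fderiv ℝ f x‖ₑ ≤ M)
    (x y : Plane) : ‖f x - f y‖ₑ ≤ M * ‖x - y‖ₑ := by
  rcases eq_or_ne M ⊤ with rfl | hMt
  · rcases eq_or_ne x y with rfl | hxy
    · simp
    · rw [ENNReal.top_mul (by simpa [sub_eq_zero] using hxy)]
      exact le_top
  · have h1 : LipschitzWith M.toNNReal f := by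
      refine lipschitzWith_of_nnnorm_fderiv_le h.differentiable fun x => ?_
      have := hM x
      rw [← ENNReal.coe_toNNReal hMt] at this
      exact_mod_cast this
    have := h1 x y
    rwa [edist_eq_enorm_sub, edist_eq_enorm_sub, ENNReal.coe_toNNReal hMt] at this

end Spectral

end Spectral

/-! ### Vanishing interactions between separated frequencies -/

section Vanishing

/-- The product `f g` is the Fourier transform of a convolution. Parseval's identity then leaves a
double integral whose integrand is the product in the hypothesis, so the integral vanishes if no
frequencies `η` and `ξ - η` of the two factors can combine into one seen by `ψ`. -/
theorem SchwartzMap.integral_mul_mul_eq_zero {ψ f g : 𝓢(Plane, ℂ)}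
    (h : ∀ ξ η, (𝓕⁻ ψ : 𝓢(Plane, ℂ)) (-ξ) * ((𝓕⁻ f : 𝓢(Plane, ℂ)) η
      * (𝓕⁻ g : 𝓢(Plane, ℂ)) (ξ - η)) = 0) :
    ∫ y, ψ y * (f y * g y) = 0 := by
  set H := SchwartzMap.conv (𝓕⁻ f : 𝓢(Plane, ℂ)) (𝓕⁻ g : 𝓢(Plane, ℂ)) with hH
  have h1 : ∀ y, f y * g y = (𝓕 H : 𝓢(Plane, ℂ)) y := fun y => by
    rw [hH, SchwartzMap.fourier_conv_apply,
      FourierTransform.fourier_fourierInv_eq (F := 𝓢(Plane, ℂ)),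
      FourierTransform.fourier_fourierInv_eq (F := 𝓢(Plane, ℂ))]
  simp only [h1]
  rw [← SchwartzMap.integral_fourier_mul_eq]
  refine integral_eq_zero_of_ae (Eventually.of_forall fun ξ => ?_)
  have h2 : (𝓕 ψ : 𝓢(Plane, ℂ)) ξ = (𝓕⁻ ψ : 𝓢(Plane, ℂ)) (-ξ) := by
    rw [SchwartzMap.fourierInv_apply_eq_fourier_neg, neg_neg]
  change (𝓕 ψ : 𝓢(Plane, ℂ)) ξ * H ξ = 0
  rw [h2, hH, SchwartzMap.conv_apply, ← integral_const_mul]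
  refine integral_eq_zero_of_ae (Eventually.of_forall fun η => ?_)
  exact h ξ η

namespace LittlewoodPaley

variable (L : LittlewoodPaley)

theorem fourierInv_gFat_ne_zero {k : ℤ} {ξ : Plane}
    (h : (𝓕⁻ (L.gFat k) : 𝓢(Plane, ℂ)) ξ ≠ 0) :
    3 / 8 * (2 : ℝ) ^ k ≤ ‖ξ‖ ∧ ‖ξ‖ ≤ 16 / 3 * (2 : ℝ) ^ k := by
  rw [fourierInv_gFat] at h
  obtain ⟨i, hi, h1⟩ := Finset.exists_ne_zero_of_sum_ne_zero h
  rw [Finset.mem_Icc] at hi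
  obtain ⟨h2, h3⟩ := L.φ_dilate_ne_zero (by exact_mod_cast h1)
  have h4 : (2 : ℝ) ^ (k - 1) ≤ (2 : ℝ) ^ i := zpow_le_zpow_right₀ one_le_two hi.1
  have h5 : (2 : ℝ) ^ i ≤ (2 : ℝ) ^ (k + 1) := zpow_le_zpow_right₀ one_le_two hi.2
  rw [zpow_sub_one₀ two_ne_zero] at h4
  rw [zpow_add_one₀ two_ne_zero] at h5
  constructor <;> linarith

theorem fourierInv_translate_ne_zero {f : 𝓢(Plane, ℂ)} {a ξ : Plane}
    (h : (𝓕⁻ (SchwartzMap.compSubConstCLM ℂ a f) : 𝓢(Plane, ℂ)) ξ ≠ 0) :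
    (𝓕⁻ f : 𝓢(Plane, ℂ)) ξ ≠ 0 := by
  rw [SchwartzMap.fourierInv_translate] at h
  intro h0
  rw [h0, smul_zero] at h
  exact h rfl

theorem conv_g_gFat (j : ℤ) : SchwartzMap.conv (L.g j) (L.gFat j) = L.g j := by
  conv_rhs => rw [← L.conv_gFat_g j]
  refine SchwartzMap.ext_fourierInv fun ξ => ?_
  rw [SchwartzMap.fourierInv_conv_apply, SchwartzMap.fourierInv_conv_apply, mul_comm]

/-- Differentiation does not enlarge the spectrum: in `g = g * gFat` the derivative may be placed on
`gFat`, and the factor `𝓕⁻ g` keeps the support of the block. -/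
theorem fourierInv_lineDeriv_g_ne_zero {j : ℤ} {e ξ : Plane}
    (h : (𝓕⁻ (∂_{e} (L.g j) : 𝓢(Plane, ℂ)) : 𝓢(Plane, ℂ)) ξ ≠ 0) :
    3 / 4 * (2 : ℝ) ^ j ≤ ‖ξ‖ ∧ ‖ξ‖ ≤ 8 / 3 * (2 : ℝ) ^ j := by
  rw [← L.conv_g_gFat, SchwartzMap.lineDerivOp_conv, SchwartzMap.fourierInv_conv_apply,
    fourierInv_g] at h
  exact L.φ_dilate_ne_zero (by exact_mod_cast left_ne_zero_of_mul h)

/-- No frequencies of sizes `2 ^ j`, `2 ^ k`, `2 ^ l` add up to zero. -/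
def Separated (j k l : ℤ) : Prop := ∀ ξ η ζ : Plane, ζ = ξ - η →
  3 / 4 * (2 : ℝ) ^ j ≤ ‖ξ‖ → ‖ξ‖ ≤ 8 / 3 * (2 : ℝ) ^ j →
  3 / 8 * (2 : ℝ) ^ k ≤ ‖η‖ → ‖η‖ ≤ 16 / 3 * (2 : ℝ) ^ k →
  3 / 8 * (2 : ℝ) ^ l ≤ ‖ζ‖ → ‖ζ‖ ≤ 16 / 3 * (2 : ℝ) ^ l → False

theorem two_zpow_le {a b : ℤ} (h : a + 5 ≤ b) : 32 * (2 : ℝ) ^ a ≤ (2 : ℝ) ^ b := by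
  have := zpow_le_zpow_right₀ (one_le_two (α := ℝ)) h
  rw [zpow_add₀ two_ne_zero] at this
  norm_num at this
  linarith

/-- A gap of five indices is a factor `32`, enough to absorb the widths of the ordinary and of the
fattened annuli. One of the three norms then exceeds the sum of the other two, against the triangle
inequality. -/
theorem separated_of {j k l : ℤ}
    (h : (l + 5 ≤ j ∧ (j + 5 ≤ k ∨ k + 5 ≤ j)) ∨ (j + 5 ≤ l ∧ (l + 5 ≤ k ∨ k + 5 ≤ l))) :
    Separated j k l := by
  rintro ξ η ζ rfl h1 h2 h3 h4 h5 h6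
  have hj : (0 : ℝ) < 2 ^ j := by positivity
  have hk : (0 : ℝ) < 2 ^ k := by positivity
  have hl : (0 : ℝ) < 2 ^ l := by positivity
  have t1 : ‖ξ‖ ≤ ‖η‖ + ‖ξ - η‖ := by
    have := norm_add_le η (ξ - η)
    rwa [add_sub_cancel] at this
  have t2 : ‖η‖ ≤ ‖ξ‖ + ‖ξ - η‖ := by
    have := norm_sub_le ξ (ξ - η)
    rwa [sub_sub_cancel] at this
  have t3 : ‖ξ - η‖ ≤ ‖ξ‖ + ‖η‖ := norm_sub_le _ _
  rcases h with ⟨a, b | b⟩ | ⟨a, b | b⟩ <;>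
  · have := two_zpow_le a
    have := two_zpow_le b
    linarith

theorem fderiv_κS_neg (j : ℤ) (x e : Plane) :
    fderiv ℝ (L.κS j) (-x) e = -fderiv ℝ (L.κS j) x e := by
  have h1 : (L.κS j : Plane → ℝ) = fun x => L.κS j (-x) := funext fun x => (L.κ_neg j x).symm
  have h2 : HasFDerivAt (fun x => L.κS j (-x))
      ((fderiv ℝ (L.κS j) (-x)).comp (-ContinuousLinearMap.id ℝ Plane)) x :=
    ((L.κS j).hasFDerivAt (-x)).comp x (hasFDerivAt_id x).neg
  have h3 := h2.fderiv
  rw [← h1] at h3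
  rw [h3]
  simp

theorem lineDeriv_g_apply (j : ℤ) (e x : Plane) :
    (∂_{e} (L.g j) : 𝓢(Plane, ℂ)) x = (fderiv ℝ (L.κS j) x e : ℂ) := by
  have h1 : (L.g j : Plane → ℂ) = fun x => (L.κS j x : ℂ) := funext (L.g_eq_κ j)
  have h2 : HasFDerivAt (fun x => (L.κS j x : ℂ))
      (Complex.ofRealCLM.comp (fderiv ℝ (L.κS j) x)) x :=
    Complex.ofRealCLM.hasFDerivAt.comp x ((L.κS j).hasFDerivAt x)
  rw [SchwartzMap.lineDerivOp_apply_eq_fderiv, h1, h2.fderiv]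
  rfl

theorem integral_triple_eq_zero {j k l : ℤ} (h : Separated j k l) (x z w e : Plane) :
    ∫ y, fderiv ℝ (L.κS j) (x - y) e * L.κFatS k (y - z) * L.κFatS l (y - w) = 0 := by
  have h1 := SchwartzMap.integral_mul_mul_eq_zero
    (ψ := SchwartzMap.compSubConstCLM ℂ x (∂_{e} (L.g j)))
    (f := SchwartzMap.compSubConstCLM ℂ z (L.gFat k))
    (g := SchwartzMap.compSubConstCLM ℂ w (L.gFat l)) (by
      intro ξ η
      by_contra h0
      have a := L.fourierInv_lineDeriv_g_ne_zero
        (fourierInv_translate_ne_zero (left_ne_zero_of_mul h0))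
      have b := L.fourierInv_gFat_ne_zero (fourierInv_translate_ne_zero
        (left_ne_zero_of_mul (right_ne_zero_of_mul h0)))
      have c := L.fourierInv_gFat_ne_zero (fourierInv_translate_ne_zero
        (right_ne_zero_of_mul (right_ne_zero_of_mul h0)))
      rw [norm_neg] at a
      exact h ξ η (ξ - η) rfl a.1 a.2 b.1 b.2 c.1 c.2)
  simp only [SchwartzMap.compSubConstCLM_apply, lineDeriv_g_apply, gFat_eq_κFat] at h1
  rw [← Complex.ofReal_eq_zero, ← neg_eq_zero, ← h1, ← integral_complex_ofReal, ← integral_neg]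
  refine integral_congr_ae (Eventually.of_forall fun y => ?_)
  have : fderiv ℝ (L.κS j) (x - y) e = -fderiv ℝ (L.κS j) (y - x) e := by
    rw [← fderiv_κS_neg, neg_sub]
  simp only [this, κFatS_apply]
  push_cast
  ring

theorem integral_double_eq_zero {j l : ℤ} (h : l + 5 ≤ j ∨ j + 5 ≤ l) (x w : Plane) :
    ∫ y, L.κS j (x - y) * L.κFatS l (y - w) = 0 := by
  have h1 : SchwartzMap.conv (L.gFat l) (L.g j) = 0 := by
    refine SchwartzMap.ext_fourierInv fun ξ => ?_
    have h0 : (𝓕⁻ (0 : 𝓢(Plane, ℂ)) : 𝓢(Plane, ℂ)) = 0 :=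
      map_zero (FourierTransform.fourierInvCLM ℂ 𝓢(Plane, ℂ))
    rw [SchwartzMap.fourierInv_conv_apply, h0]
    by_contra h2
    have a := L.fourierInv_gFat_ne_zero (left_ne_zero_of_mul h2)
    have b := right_ne_zero_of_mul h2
    rw [fourierInv_g] at b
    have b := L.φ_dilate_ne_zero (by exact_mod_cast b)
    have hj : (0 : ℝ) < 2 ^ j := by positivity
    have hl : (0 : ℝ) < 2 ^ l := by positivity
    rcases h with h | h <;>
    · have := two_zpow_le h
      linarith
  have h2 : SchwartzMap.conv (L.gFat l) (L.g j) (x - w) = 0 := by rw [h1]; rfl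
  rw [SchwartzMap.conv_apply] at h2
  rw [← Complex.ofReal_eq_zero, ← h2, ← integral_complex_ofReal,
    ← integral_sub_right_eq_self (fun y => L.gFat l y * L.g j (x - w - y)) w]
  refine integral_congr_ae (Eventually.of_forall fun y => ?_)
  simp only [sub_sub, add_sub_cancel, gFat_eq_κFat, g_eq_κ, κS_apply, κFatS_apply]
  push_cast
  ring

end LittlewoodPaley

theorem SchwartzMap.integrable_real (K : 𝓢(Plane, ℝ)) : Integrable fun x => K x := K.integrable

theorem SchwartzMap.integrable_fderiv (K : 𝓢(Plane, ℝ)) : Integrable (fderiv ℝ K) := by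
  obtain ⟨C, hC, h⟩ := K.exists_decay_fderiv
  exact (integrable_japanese.const_mul C).mono' K.continuous_fderiv.aestronglyMeasurable
    (Eventually.of_forall h)

theorem SchwartzMap.integrable_fderiv_sub (K : 𝓢(Plane, ℝ)) (x e : Plane) :
    Integrable fun y => fderiv ℝ K (x - y) e :=
  (K.integrable_fderiv.comp_sub_left x).apply_continuousLinearMap e

namespace Spectral

variable {L : LittlewoodPaley} {k : ℤ}

theorem clm_comp {E G : Type*} [NormedAddCommGroup E] [NormedSpace ℝ E] [CompleteSpace E]
    [NormedAddCommGroup G] [NormedSpace ℝ G] [CompleteSpace G] {f : Plane → E}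
    (h : Spectral L k f) (A : E →L[ℝ] G) : Spectral L k fun x => A (f x) := by
  obtain ⟨M, hM⟩ := h.bounded
  refine ⟨A.continuous.comp h.continuous, ⟨‖A‖ * M, fun x => ?_⟩, fun x => ?_⟩
  · exact (A.le_opNorm _).trans (by gcongr; exact hM x)
  · conv_lhs => rw [h.reproducing x]
    rw [← A.integral_comp_comm
      ((L.κFatS k).integrable_smul_sub h.continuous.aestronglyMeasurable hM x)]
    simp only [map_smul]

/-- The reproducing formula moved onto an integrable weight. -/
theorem integral_mul {f : Plane → ℝ} (h : Spectral L k f) {G : Plane → ℝ} (hG : Integrable G) :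
    ∫ y, G y * f y = ∫ z, f z * ∫ y, G y * L.κFatS k (y - z) := by
  obtain ⟨M, hM⟩ := h.bounded
  have h1 : Integrable (fun p : Plane × Plane => G p.2 * L.κFatS k (p.1 - p.2) * f p.1)
      (volume.prod volume) := by
    refine Integrable.mul_bdd (c := M) ?_ (h.continuous.comp continuous_fst).aestronglyMeasurable
      (Eventually.of_forall fun p => hM p.1)
    exact hG.convolution_integrand (ContinuousLinearMap.mul ℝ ℝ) (L.κFatS k).integrable_real
  have h2 := integral_integral_swap
    (f := fun z y => G y * L.κFatS k (z - y) * f z) h1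
  calc ∫ y, G y * f y = ∫ y, ∫ z, G y * L.κFatS k (z - y) * f z := by
        refine integral_congr_ae (Eventually.of_forall fun y => ?_)
        simp only
        conv_lhs => rw [h.reproducing y, ← integral_const_mul]
        refine integral_congr_ae (Eventually.of_forall fun z => ?_)
        have : L.κFatS k (y - z) = L.κFatS k (z - y) := by
          rw [L.κFatS_apply, L.κFatS_apply, ← L.κFat_neg, neg_sub]
        simp only [smul_eq_mul, this]
        ring
    _ = ∫ z, ∫ y, G y * L.κFatS k (z - y) * f z := h2.symm
    _ = _ := by
        refine integral_congr_ae (Eventually.of_forall fun z => ?_)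
        simp only
        rw [integral_mul_const, mul_comm]
        congr 1
        refine integral_congr_ae (Eventually.of_forall fun y => ?_)
        have : L.κFatS k (y - z) = L.κFatS k (z - y) := by
          rw [L.κFatS_apply, L.κFatS_apply, ← L.κFat_neg, neg_sub]
        simp only [this]

theorem integral_κS_mul_eq_zero {j : ℤ} (hjk : k + 5 ≤ j ∨ j + 5 ≤ k) {f : Plane → ℝ}
    (h : Spectral L k f) (x : Plane) : ∫ y, L.κS j (x - y) * f y = 0 := by
  rw [h.integral_mul ((L.κS j).integrable_real.comp_sub_left x)]
  simp [L.integral_double_eq_zero hjk]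

/-- The convolution of `κⱼ` with `f` is identically zero, hence so is its derivative, which may be
computed under the integral. -/
theorem integral_fderiv_mul_eq_zero {j : ℤ} (hjk : k + 5 ≤ j ∨ j + 5 ≤ k) {f : Plane → ℝ}
    (h : Spectral L k f) (x e : Plane) : ∫ y, fderiv ℝ (L.κS j) (x - y) e * f y = 0 := by
  obtain ⟨M, hM⟩ := h.bounded
  have h1 := (L.κS j).hasFDerivAt_integral_smul h.continuous.aestronglyMeasurable hM x
  have h2 : (fun x => ∫ y, L.κS j (x - y) • f y) = fun _ => 0 :=
    funext fun x => h.integral_κS_mul_eq_zero hjk x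
  rw [h2] at h1
  have h3 := h1.unique (hasFDerivAt_const 0 x)
  have h4 := congrArg (fun A : Plane →L[ℝ] ℝ => A e) h3
  simp only [_root_.zero_apply] at h4
  rw [← h4, ContinuousLinearMap.integral_apply
    ((L.κS j).integrable_fderiv_smulRight_sub h.continuous.aestronglyMeasurable hM x)]
  simp [ContinuousLinearMap.smulRight_apply]

/-- The factors are only bounded functions, without classical Fourier transforms. The reproducing
formula is used for `f` and for `a` in turn, until only a product of three Schwartz kernels is left,
to which the frequency argument applies. -/
theorem integral_fderiv_mul_mul_eq_zero {j l : ℤ} (hs : LittlewoodPaley.Separated j k l)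
    {f a : Plane → ℝ} (hf : Spectral L k f) (ha : Spectral L l a) (x e : Plane) :
    ∫ y, fderiv ℝ (L.κS j) (x - y) e * f y * a y = 0 := by
  obtain ⟨M, hM⟩ := ha.bounded
  obtain ⟨M', hM'⟩ := (L.κFatS k).exists_decay_zero
  have h1 : Integrable fun y => fderiv ℝ (L.κS j) (x - y) e * a y :=
    ((L.κS j).integrable_fderiv_sub x e).mul_bdd ha.continuous.aestronglyMeasurable
      (Eventually.of_forall hM)
  have h2 : ∀ z, ∫ y, (fderiv ℝ (L.κS j) (x - y) e * a y) * L.κFatS k (y - z) = 0 := fun z => by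
    have h3 : Integrable fun y => fderiv ℝ (L.κS j) (x - y) e * L.κFatS k (y - z) := by
      refine ((L.κS j).integrable_fderiv_sub x e).mul_bdd (c := M')
        ((L.κFatS k).continuous.comp (by fun_prop)).aestronglyMeasurable
        (Eventually.of_forall fun y => (hM'.2 _).trans (mul_le_of_le_one_right hM'.1 ?_))
      exact Real.rpow_le_one_of_one_le_of_nonpos (by linarith [norm_nonneg (y - z)])
        (by norm_num)
    have h4 := ha.integral_mul h3
    simp only [L.integral_triple_eq_zero hs, mul_zero, integral_zero] at h4
    rw [← h4]
    refine integral_congr_ae (Eventually.of_forall fun y => ?_)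
    simp only
    ring
  have h5 := hf.integral_mul h1
  simp only [h2, mul_zero, integral_zero] at h5
  rw [← h5]
  refine integral_congr_ae (Eventually.of_forall fun y => ?_)
  simp only
  ring

end Spectral

end Vanishing

/-! ### The commutator of a dyadic block with the transport -/

section Commutator

/-- The commutator of the convolution with `K` and the transport by `u`, in divergence form. -/
def transportComm (K : 𝓢(Plane, ℝ)) (u : Plane → Plane) (a : Plane → ℝ) (x : Plane) : ℝ :=
  ∫ y, fderiv ℝ K (x - y) (u x - u y) * a y

theorem enorm_fderiv_apply_mul_le (K : 𝓢(Plane, ℝ)) (z v : Plane) (r : ℝ) :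
    ‖fderiv ℝ K z v * r‖ₑ ≤ ‖v‖ₑ * ‖fderiv ℝ K z‖ₑ * ‖r‖ₑ := by
  rw [enorm_mul, mul_comm ‖v‖ₑ]
  gcongr
  exact (fderiv ℝ K z).le_opENorm v

theorem lintegral_comm_le {K : 𝓢(Plane, ℝ)} {u : Plane → Plane} {a : Plane → ℝ} {M : ℝ≥0∞}
    (hu : ∀ x y, ‖u x - u y‖ₑ ≤ M * ‖x - y‖ₑ) (x : Plane) :
    ∫⁻ y, ‖fderiv ℝ K (x - y) (u x - u y) * a y‖ₑ
      ≤ lconv (fun z => M * (‖z‖ₑ * ‖fderiv ℝ K z‖ₑ)) (fun y => ‖a y‖ₑ) x := by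
  refine lintegral_mono fun y => (enorm_fderiv_apply_mul_le K _ _ _).trans ?_
  simp only [← mul_assoc]
  gcongr
  exact hu x y

theorem eLpNorm_le_of_le_lconv {F : Plane → ℝ} {N a : Plane → ℝ≥0∞}
    (h : ∀ x, ‖F x‖ₑ ≤ lconv N a x) (hN : Measurable N) (ha : Measurable a) {q : ℝ≥0∞}
    (hq : 1 ≤ q) : eLpNorm F q volume ≤ (∫⁻ y, N y) * eLpNorm a q volume :=
  (eLpNorm_mono_enorm (g := lconv N a) fun x => by rw [enorm_eq_self]; exact h x).trans
    (eLpNorm_lconv_le hN ha hq)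

theorem measurable_enorm_fderiv (K : 𝓢(Plane, ℝ)) : Measurable fun z => ‖fderiv ℝ K z‖ₑ :=
  K.continuous_fderiv.enorm.measurable

/-- The Lipschitz bound turns `u x - u y` into `x - y`, and `‖z‖ ‖∇K(z)‖` has integral at most `B`
at every scale. No power of `2^j` is lost. -/
theorem eLpNorm_comm_le {K : 𝓢(Plane, ℝ)} {B : ℝ≥0∞} {j : ℤ} (hK : KernelBound B j K)
    {u : Plane → Plane} {a : Plane → ℝ} (ha : Continuous a) {M : ℝ≥0∞}
    (hu : ∀ x y, ‖u x - u y‖ₑ ≤ M * ‖x - y‖ₑ) {q : ℝ≥0∞} (hq : 1 ≤ q) :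
    eLpNorm (transportComm K u a) q volume ≤ M * B * eLpNorm a q volume := by
  have hm : Measurable fun z : Plane => ‖z‖ₑ * ‖fderiv ℝ K z‖ₑ :=
    continuous_enorm.measurable.mul (measurable_enorm_fderiv K)
  have := eLpNorm_le_of_le_lconv (F := transportComm K u a) (fun x =>
    (enorm_integral_le_lintegral_enorm _).trans (lintegral_comm_le hu x))
    (hm.const_mul M) ha.enorm.measurable hq
  rw [lintegral_const_mul _ hm, eLpNorm_enorm] at this
  refine this.trans ?_
  gcongr
  exact hK.lintegral_moment_le

theorem eLpNorm_integral_fderiv_le {K : 𝓢(Plane, ℝ)} {B : ℝ≥0∞} {j : ℤ} (hK : KernelBound B j K)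
    {u : Plane → Plane} {a : Plane → ℝ} (ha : Continuous a) {M : ℝ≥0∞}
    (hu : ∀ x, ‖u x‖ₑ ≤ M) {q : ℝ≥0∞} (hq : 1 ≤ q) :
    eLpNorm (fun x => ∫ y, fderiv ℝ K (x - y) (u y) * a y) q volume
      ≤ M * (B * dyadicWeight 1 j) * eLpNorm a q volume := by
  have := eLpNorm_le_of_le_lconv (F := fun x => ∫ y, fderiv ℝ K (x - y) (u y) * a y)
    (N := fun z => M * ‖fderiv ℝ K z‖ₑ) (a := fun y => ‖a y‖ₑ) (fun x => by
      refine (enorm_integral_le_lintegral_enorm _).trans (lintegral_mono fun y => ?_)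
      refine (enorm_fderiv_apply_mul_le K _ _ _).trans ?_
      simp only
      gcongr
      exact hu y) ((measurable_enorm_fderiv K).const_mul M) ha.enorm.measurable hq
  rw [lintegral_const_mul _ (measurable_enorm_fderiv K), eLpNorm_enorm] at this
  refine this.trans ?_
  gcongr
  exact hK.lintegral_fderiv_le

theorem clm_plane_eq_sum (A : Plane →L[ℝ] ℝ) (v : Plane) :
    A v = ∑ i : Fin 2, v i * A (EuclideanSpace.single i 1) := by
  conv_lhs => rw [← (EuclideanSpace.basisFun (Fin 2) ℝ).sum_repr v]
  simp

/-- The pointwise divergence of a differentiable vector field on the plane. -/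
def divergence (u : Plane → Plane) (x : Plane) : ℝ :=
  ∑ i : Fin 2, fderiv ℝ u x (EuclideanSpace.single i 1) i

namespace Spectral

variable {L : LittlewoodPaley} {k l j : ℤ}

theorem coord {u : Plane → Plane} (h : Spectral L k u) (i : Fin 2) :
    Spectral L k fun x => u x i :=
  h.clm_comp (EuclideanSpace.proj i : Plane →L[ℝ] ℝ)

theorem fderiv_coord {u : Plane → Plane} (h : Spectral L k u) (i : Fin 2) (x e : Plane) :
    fderiv ℝ (fun x => u x i) x e = fderiv ℝ u x e i := by
  have h1 : HasFDerivAt (fun x => u x i)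
      ((EuclideanSpace.proj i : Plane →L[ℝ] ℝ).comp (fderiv ℝ u x)) x :=
    (EuclideanSpace.proj i : Plane →L[ℝ] ℝ).hasFDerivAt.comp x
      (h.differentiable x).hasFDerivAt
  rw [h1.fderiv]
  rfl

theorem bounded_fderiv {E : Type*} [NormedAddCommGroup E] [NormedSpace ℝ E] [CompleteSpace E]
    {f : Plane → E} (h : Spectral L k f) : ∃ M : ℝ, ∀ x, ‖fderiv ℝ f x‖ ≤ M := by
  obtain ⟨B, hBt, -, -, hB⟩ := L.exists_kernelBound
  obtain ⟨M, hM⟩ := h.bounded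
  have h1 : eLpNorm f ⊤ volume ≤ ENNReal.ofReal M := by
    rw [eLpNorm_exponent_top]
    refine eLpNormEssSup_le_of_ae_enorm_bound (Eventually.of_forall fun x => ?_)
    rw [← ofReal_norm]
    exact ENNReal.ofReal_le_ofReal (hM x)
  have h2 : B * dyadicWeight (1 + twoOver ⊤) k * ENNReal.ofReal M ≠ ⊤ := by
    finiteness [dyadicWeight_ne_top (1 + twoOver ⊤) k]
  refine ⟨(B * dyadicWeight (1 + twoOver ⊤) k * ENNReal.ofReal M).toReal, fun x => ?_⟩
  have h3 : ‖fderiv ℝ f x‖ₑ ≤ B * dyadicWeight (1 + twoOver ⊤) k * ENNReal.ofReal M :=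
    (h.enorm_fderiv_le (hB k) le_top x).trans (by gcongr)
  rw [← ofReal_norm] at h3
  exact (ENNReal.ofReal_le_iff_le_toReal h2).mp h3

theorem integrable_fderiv_mul_mul {u : Plane → Plane} (hu : Spectral L k u) {a : Plane → ℝ}
    (ha : Spectral L l a) (i : Fin 2) (x e : Plane) :
    Integrable fun y => fderiv ℝ (L.κS j) (x - y) e * u y i * a y := by
  obtain ⟨M, hM⟩ := (hu.coord i).bounded
  obtain ⟨M', hM'⟩ := ha.bounded
  exact (((L.κS j).integrable_fderiv_sub x e).mul_bdd
    (hu.coord i).continuous.aestronglyMeasurable (Eventually.of_forall hM)).mul_bdd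
    ha.continuous.aestronglyMeasurable (Eventually.of_forall hM')

theorem fderiv_apply_mul_eq_sum (K : 𝓢(Plane, ℝ)) (u : Plane → Plane) (a : Plane → ℝ)
    (x y : Plane) : fderiv ℝ K (x - y) (u y) * a y
      = ∑ i : Fin 2, fderiv ℝ K (x - y) (EuclideanSpace.single i 1) * u y i * a y := by
  rw [clm_plane_eq_sum, Finset.sum_mul]
  exact Finset.sum_congr rfl fun i _ => by ring

theorem integrable_fderiv_apply_mul {u : Plane → Plane} (hu : Spectral L k u) {a : Plane → ℝ}
    (ha : Spectral L l a) (x : Plane) :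
    Integrable fun y => fderiv ℝ (L.κS j) (x - y) (u y) * a y := by
  simp only [fderiv_apply_mul_eq_sum]
  exact integrable_finsetSum _ fun i _ => hu.integrable_fderiv_mul_mul ha i x _

theorem integral_fderiv_apply_mul {u : Plane → Plane} (hu : Spectral L k u) {a : Plane → ℝ}
    (ha : Spectral L l a) (x : Plane) : ∫ y, fderiv ℝ (L.κS j) (x - y) (u y) * a y
      = ∑ i : Fin 2, ∫ y, fderiv ℝ (L.κS j) (x - y) (EuclideanSpace.single i 1) * u y i * a y := by
  simp only [fderiv_apply_mul_eq_sum]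
  exact integral_finsetSum _ fun i _ => hu.integrable_fderiv_mul_mul ha i x _

/-- The vector `u x` is constant in the integration variable, so its contribution is a derivative of
`κⱼ * a`, which vanishes because the frequencies are far apart. -/
theorem comm_eq_of_far (hjl : l + 5 ≤ j ∨ j + 5 ≤ l) {u : Plane → Plane} (hu : Spectral L k u)
    {a : Plane → ℝ} (ha : Spectral L l a) (x : Plane) :
    transportComm (L.κS j) u a x = -∫ y, fderiv ℝ (L.κS j) (x - y) (u y) * a y := by
  obtain ⟨M, hM⟩ := ha.bounded
  have h1 : Integrable fun y => fderiv ℝ (L.κS j) (x - y) (u x) * a y :=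
    ((L.κS j).integrable_fderiv_sub x (u x)).mul_bdd ha.continuous.aestronglyMeasurable
      (Eventually.of_forall hM)
  simp only [transportComm, map_sub, sub_mul]
  rw [integral_sub h1 (hu.integrable_fderiv_apply_mul ha x),
    ha.integral_fderiv_mul_eq_zero hjl, zero_sub]

theorem comm_eq_zero (hjl : l + 5 ≤ j ∨ j + 5 ≤ l) (hs : LittlewoodPaley.Separated j k l)
    {u : Plane → Plane} (hu : Spectral L k u) {a : Plane → ℝ} (ha : Spectral L l a) (x : Plane) :
    transportComm (L.κS j) u a x = 0 := by
  rw [hu.comm_eq_of_far hjl ha, hu.integral_fderiv_apply_mul ha]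
  simp [(hu.coord _).integral_fderiv_mul_mul_eq_zero hs ha]

/-- Integration by parts moves the derivative from the kernel to the product `u a`; since `u` is
divergence free it falls on `a` alone. This is profitable when `a` has the lowest frequency. -/
theorem integral_fderiv_eq_integral_κS {u : Plane → Plane} (hu : Spectral L k u)
    (hdiv : ∀ x, divergence u x = 0) {a : Plane → ℝ} (ha : Spectral L l a) (x : Plane) :
    ∫ y, fderiv ℝ (L.κS j) (x - y) (u y) * a y
      = ∫ y, L.κS j (x - y) * fderiv ℝ a y (u y) := by
  obtain ⟨M, hM⟩ := ha.bounded
  obtain ⟨M', hM'⟩ := ha.bounded_fderiv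
  obtain ⟨N', hN'⟩ := hu.bounded_fderiv
  have iK : Integrable fun y => L.κS j (x - y) := (L.κS j).integrable_real.comp_sub_left x
  have hd : ∀ y, HasFDerivAt (fun y => L.κS j (x - y)) (-fderiv ℝ (L.κS j) (x - y)) y := fun y => by
    have := ((L.κS j).hasFDerivAt (x - y)).comp y ((hasFDerivAt_id y).const_sub x)
    rwa [ContinuousLinearMap.comp_neg, ContinuousLinearMap.comp_id] at this
  have hf : ∀ i y, HasFDerivAt (fun y => u y i * a y)
      (u y i • fderiv ℝ a y + a y • fderiv ℝ (fun y => u y i) y) y := fun i y =>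
    ((hu.coord i).differentiable y).hasFDerivAt.mul (ha.differentiable y).hasFDerivAt
  have I1 : ∀ i, Integrable fun y =>
      L.κS j (x - y) * (u y i * fderiv ℝ a y (EuclideanSpace.single i 1)) := fun i => by
    obtain ⟨N, hN⟩ := (hu.coord i).bounded
    simp only [← mul_assoc]
    refine (iK.mul_bdd (hu.coord i).continuous.aestronglyMeasurable
      (Eventually.of_forall hN)).mul_bdd (c := M')
      (ha.continuous_fderiv.clm_apply continuous_const).aestronglyMeasurable
      (Eventually.of_forall fun y => ?_)
    refine ((fderiv ℝ a y).le_opNorm _).trans ?_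
    simpa using hM' y
  have I2 : ∀ i, Integrable fun y =>
      L.κS j (x - y) * (a y * fderiv ℝ (fun y => u y i) y (EuclideanSpace.single i 1)) := fun i => by
    obtain ⟨N, hN⟩ := (hu.coord i).bounded_fderiv
    simp only [← mul_assoc]
    refine (iK.mul_bdd ha.continuous.aestronglyMeasurable
      (Eventually.of_forall hM)).mul_bdd (c := N)
      ((hu.coord i).continuous_fderiv.clm_apply continuous_const).aestronglyMeasurable
      (Eventually.of_forall fun y => ?_)
    refine ((fderiv ℝ (fun y => u y i) y).le_opNorm _).trans ?_
    simpa using hN y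
  have key : ∀ i : Fin 2, ∫ y, fderiv ℝ (L.κS j) (x - y) (EuclideanSpace.single i 1) * u y i * a y
      = (∫ y, L.κS j (x - y) * (u y i * fderiv ℝ a y (EuclideanSpace.single i 1)))
        + ∫ y, L.κS j (x - y)
          * (a y * fderiv ℝ (fun y => u y i) y (EuclideanSpace.single i 1)) := fun i => by
    have i3 : Integrable fun y => u y i * a y * L.κS j (x - y) := by
      obtain ⟨N, hN⟩ := (hu.coord i).bounded
      refine ((iK.mul_bdd (hu.coord i).continuous.aestronglyMeasurable
        (Eventually.of_forall hN)).mul_bdd ha.continuous.aestronglyMeasurable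
        (Eventually.of_forall hM)).congr (Eventually.of_forall fun y => ?_)
      simp only
      ring
    have h1 := integral_bilinear_hasFDerivAt_right_eq_neg_left_of_integrable
      (μ := (volume : Measure Plane)) (B := ContinuousLinearMap.mul ℝ ℝ)
      (f := fun y => u y i * a y) (g := fun y => L.κS j (x - y))
      (v := EuclideanSpace.single i (1 : ℝ)) (f' := fun y => u y i • fderiv ℝ a y
        + a y • fderiv ℝ (fun y => u y i) y) (g' := fun y => -fderiv ℝ (L.κS j) (x - y))
      (by
        refine ((I1 i).add (I2 i)).congr (Eventually.of_forall fun y => ?_)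
        simp only [Pi.add_apply, ContinuousLinearMap.mul_apply', _root_.add_apply,
          _root_.smul_apply, smul_eq_mul]
        ring)
      (by
        refine (hu.integrable_fderiv_mul_mul ha (j := j) i x
          (EuclideanSpace.single i 1)).neg.congr (Eventually.of_forall fun y => ?_)
        simp only [Pi.neg_apply, ContinuousLinearMap.mul_apply', _root_.neg_apply]
        ring)
      i3 (fun y _ => hf i y) (fun y _ => hd y)
    rw [← integral_add (I1 i) (I2 i)]
    simp only [ContinuousLinearMap.mul_apply', _root_.neg_apply, mul_neg, integral_neg,
      neg_inj] at h1
    rw [show (fun y => fderiv ℝ (L.κS j) (x - y) (EuclideanSpace.single i 1) * u y i * a y)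
      = fun y => u y i * a y * fderiv ℝ (L.κS j) (x - y) (EuclideanSpace.single i 1) by
        ext y; ring, h1]
    refine integral_congr_ae (Eventually.of_forall fun y => ?_)
    simp only [_root_.add_apply, _root_.smul_apply, smul_eq_mul]
    ring
  rw [hu.integral_fderiv_apply_mul ha, Finset.sum_congr rfl fun i _ => key i,
    Finset.sum_add_distrib, ← integral_finsetSum _ fun i _ => I1 i,
    ← integral_finsetSum _ fun i _ => I2 i]
  -- The terms in which the derivative falls on a component of `u` add up to the divergence.
  have z : ∀ y, ∑ i : Fin 2, L.κS j (x - y)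
      * (a y * fderiv ℝ (fun y => u y i) y (EuclideanSpace.single i 1)) = 0 := fun y => by
    simp only [← Finset.mul_sum, hu.fderiv_coord]
    rw [show ∑ i : Fin 2, (fderiv ℝ u y (EuclideanSpace.single i 1)) i = 0 from hdiv y]
    simp
  simp only [z, integral_zero, add_zero]
  refine integral_congr_ae (Eventually.of_forall fun y => ?_)
  simp only
  rw [clm_plane_eq_sum (fderiv ℝ a y), Finset.mul_sum]

end Spectral

end Commutator

/-! ### Powers of two and the summable decay -/

section Dyad

/-- The number `2 ^ x`. -/
def dyad (x : ℝ) : ℝ≥0∞ := ENNReal.ofReal ((2 : ℝ) ^ x)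

theorem dyadicWeight_eq_dyad (s : ℝ) (j : ℤ) : dyadicWeight s j = dyad (j * s) := rfl

theorem dyad_add (x y : ℝ) : dyad (x + y) = dyad x * dyad y := by
  rw [dyad, dyad, dyad, ← ENNReal.ofReal_mul (by positivity), Real.rpow_add two_pos]

theorem dyad_mono {x y : ℝ} (h : x ≤ y) : dyad x ≤ dyad y :=
  ENNReal.ofReal_le_ofReal (Real.rpow_le_rpow_of_exponent_le one_le_two h)

theorem dyad_natCast (n : ℕ) : dyad n = 2 ^ n := by
  rw [dyad, Real.rpow_natCast, ENNReal.ofReal_pow two_pos.le, ENNReal.ofReal_ofNat]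

/-- The exponentially decaying weight `2 ^ (-|n|)`. -/
def decay (n : ℤ) : ℝ≥0∞ := dyad (-|(n : ℝ)|)

theorem tsum_decay_ne_top : ∑' n, decay n ≠ ⊤ := by
  refine Summable.tsum_ofReal_ne_top ?_
  have h : Summable fun n : ℕ => (2 : ℝ) ^ (-(n : ℝ)) := by
    refine (summable_geometric_of_lt_one (r := (1 / 2 : ℝ)) (by norm_num) (by norm_num)).congr
      fun n => ?_
    rw [Real.rpow_neg two_pos.le, Real.rpow_natCast, one_div, inv_pow]
  rw [summable_int_iff_summable_nat_and_neg]
  constructor <;> · refine h.congr fun n => ?_; simp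

theorem tsum_decay_sub_right (l : ℤ) : ∑' j, decay (j - l) = ∑' n, decay n :=
  (Equiv.subRight l).tsum_eq decay

end Dyad

/-! ### Minkowski's inequality for series -/

section TsumNorm

/-- For `q = ∞` the exceptional null sets of the countably many finite partial sums are discarded
together. For finite `q` the bound passes to the supremum over the directed family of finite sums by
monotone convergence. -/
theorem eLpNorm_tsum_le {X ι : Type*} [MeasurableSpace X] {μ : Measure X} [Countable ι]
    {f : ι → X → ℝ≥0∞} (hf : ∀ i, Measurable (f i)) {q : ℝ≥0∞} (hq : 1 ≤ q) :
    eLpNorm (fun x => ∑' i, f i x) q μ ≤ ∑' i, eLpNorm (f i) q μ := by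
  have hfin : ∀ s : Finset ι, eLpNorm (fun x => ∑ i ∈ s, f i x) q μ ≤ ∑' i, eLpNorm (f i) q μ :=
    fun s => by
      have := eLpNorm_sum_le (f := f) (s := s) (μ := μ) (fun i _ => (hf i).aestronglyMeasurable) hq
      rw [show (∑ i ∈ s, f i) = fun x => ∑ i ∈ s, f i x by ext x; simp] at this
      exact this.trans (ENNReal.sum_le_tsum s)
  rcases eq_or_ne q (⊤ : ℝ≥0∞) with rfl | hqt
  · rw [eLpNorm_exponent_top]
    refine eLpNormEssSup_le_of_ae_enorm_bound ?_
    have h : ∀ s : Finset ι, ∀ᵐ x ∂μ, ∑ i ∈ s, f i x ≤ ∑' i, eLpNorm (f i) ⊤ μ := fun s => by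
      have h1 := enorm_ae_le_eLpNormEssSup (fun x => ∑ i ∈ s, f i x) μ
      filter_upwards [h1] with x hx
      rw [enorm_eq_self, ← eLpNorm_exponent_top] at hx
      exact hx.trans (hfin s)
    filter_upwards [ae_all_iff.mpr h] with x hx
    rw [enorm_eq_self, ENNReal.tsum_eq_iSup_sum]
    exact iSup_le hx
  · have hq0 : q ≠ 0 := (zero_lt_one.trans_le hq).ne'
    have hpos : 0 < q.toReal := ENNReal.toReal_pos hq0 hqt
    rw [eLpNorm_eq_lintegral_rpow_enorm_toReal hq0 hqt]
    simp only [enorm_eq_self, one_div]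
    rw [ENNReal.rpow_inv_le_iff hpos]
    have e : ∀ x, (∑' i, f i x) ^ q.toReal = ⨆ s : Finset ι, (∑ i ∈ s, f i x) ^ q.toReal :=
      fun x => by
        rw [ENNReal.tsum_eq_iSup_sum]
        exact (ENNReal.orderIsoRpow q.toReal hpos).map_iSup _
    simp only [e]
    rw [lintegral_iSup_directed
      (fun s => ((Finset.measurable_sum s fun i _ => hf i).pow_const _).aemeasurable)]
    · refine iSup_le fun s => ?_
      have := hfin s
      rw [eLpNorm_eq_lintegral_rpow_enorm_toReal hq0 hqt] at this
      simp only [enorm_eq_self, one_div] at this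
      rwa [ENNReal.rpow_inv_le_iff hpos] at this
    · refine Monotone.directed_le fun s t hst x => ?_
      exact ENNReal.rpow_le_rpow (Finset.sum_le_sum_of_subset hst) hpos.le

theorem summable_of_tsum_enorm_ne_top {ι E : Type*} [NormedAddCommGroup E] {f : ι → E}
    (h : ∑' i, ‖f i‖ₑ ≠ ⊤) : Summable fun i => ‖f i‖ := by
  have := ENNReal.tsum_coe_ne_top_iff_summable.mp h
  exact NNReal.summable_coe.mpr this

end TsumNorm

/-! ### The commutator estimate -/

section CommutatorEstimate

theorem twoOver_mem {q : ℝ≥0∞} (hq : 1 ≤ q) : 0 ≤ twoOver q ∧ twoOver q ≤ 2 := by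
  obtain ⟨h0, h1⟩ := toReal_inv_mem hq
  rw [twoOver]
  constructor <;> linarith

/-- Hölder's inequality for the derivative of a function along a vector field. -/
theorem eLpNorm_fderiv_apply_le {L : LittlewoodPaley} {k l : ℤ} {B : ℝ≥0∞}
    (hB : KernelBound B l (L.κFatS l)) (hB1 : 1 ≤ B) (hBt : B ≠ ⊤) {p q : ℝ≥0∞} (hq : 1 ≤ q)
    (hqp : q ≤ p) {u : Plane → Plane} (hu : Spectral L k u) {a : Plane → ℝ}
    (ha : Spectral L l a) :
    eLpNorm (fun y => fderiv ℝ a y (u y)) q volume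
      ≤ eLpNorm u p volume * (B * dyadicWeight (1 + twoOver p) l * eLpNorm a q volume) := by
  have hq0 : q ≠ 0 := (zero_lt_one.trans_le hq).ne'
  have hle : p⁻¹ ≤ q⁻¹ := ENNReal.inv_le_inv.mpr hqp
  -- The Hölder exponent `1/r = 1/q - 1/p`. Bernstein's inequality from `L^q` to `L^r` for the
  -- gradient costs `2^(l (1 + 2/q - 2/r)) = 2^(l (1 + 2/p))`.
  set r : ℝ≥0∞ := (q⁻¹ - p⁻¹)⁻¹ with hr
  have hri : r⁻¹ = q⁻¹ - p⁻¹ := inv_inv _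
  have hqr : q ≤ r := by
    rw [← ENNReal.inv_le_inv, hri]
    exact tsub_le_self
  have : ENNReal.HolderTriple p r q := ⟨by rw [hri]; exact add_tsub_cancel_of_le hle⟩
  have htw : 1 + twoOver q - twoOver r = 1 + twoOver p := by
    simp only [twoOver]
    rw [hri, ENNReal.toReal_sub_of_le hle (ENNReal.inv_ne_top.mpr hq0)]
    ring
  have h1 := eLpNorm_le_eLpNorm_mul_eLpNorm_of_nnnorm (p := p) (q := r) (r := q)
    (μ := (volume : Measure Plane)) hu.continuous.aestronglyMeasurable
    ha.continuous_fderiv.aestronglyMeasurable (fun v A => A v) 1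
    (Eventually.of_forall fun y => by
      rw [one_mul, mul_comm]
      exact (fderiv ℝ a y).le_opNNNorm (u y))
  rw [ENNReal.coe_one, one_mul] at h1
  refine h1.trans ?_
  gcongr
  rw [← htw]
  exact ha.eLpNorm_fderiv_le_of_le hB hB1 hBt hq hqr

/-- The size `2 ^ (k s) ‖f_k‖_p` of a member of a dyadic family. -/
def blockSize {E : Type*} [NormedAddCommGroup E] (s : ℝ) (p : ℝ≥0∞) (f : ℤ → Plane → E)
    (k : ℤ) : ℝ≥0∞ := dyadicWeight s k * eLpNorm (f k) p volume

/-- Three regimes survive: `l` close to `j`; `l` much smaller than `j`, forcing `k` close to `j`;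
and `l` much larger than `j`, forcing `k` close to `l`. Each of them is summable in `j` because of
one of the two decay factors. -/
theorem dyadicWeight_mul_eLpNorm_transportComm_le {L : LittlewoodPaley} {B : ℝ≥0∞}
    (hκ : ∀ j, KernelBound B j (L.κS j)) (hB : ∀ j, KernelBound B j (L.κFatS j)) (hB1 : 1 ≤ B)
    (hBt : B ≠ ⊤) {p q : ℝ≥0∞} (hq : 1 ≤ q) (hqp : q ≤ p) (hpq : twoOver q - twoOver p ≤ 1)
    (j : ℤ) {k l : ℤ} {u : Plane → Plane} (hu : Spectral L k u) (hdiv : ∀ x, divergence u x = 0)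
    {a : Plane → ℝ} (ha : Spectral L l a) :
    dyadicWeight (twoOver q) j * eLpNorm (transportComm (L.κS j) u a) q volume
      ≤ 2 ^ 20 * B ^ 2 * (decay (j - l) + decay (j - k))
        * (dyadicWeight (twoOver p + 1) k * eLpNorm u p volume)
        * (dyadicWeight (twoOver q) l * eLpNorm a q volume) := by
  obtain ⟨s0, s2⟩ := twoOver_mem hq
  obtain ⟨t0, t2⟩ := twoOver_mem (hq.trans hqp)
  set s := twoOver q
  set t := twoOver p
  set U := eLpNorm u p volume
  set A := eLpNorm a q volume
  -- Each regime supplies a weight `w` in its `L^q` bound, a comparison of exponents, and a decay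
  -- factor `c`. The constant `2^20` covers all losses from index differences up to `5` with
  -- exponents `2/q ≤ 2` and `2/p + 1 ≤ 3`.
  have fin : ∀ {c : ℝ≥0∞} {w : ℝ≥0∞},
      eLpNorm (transportComm (L.κS j) u a) q volume ≤ B ^ 2 * w * U * A →
      dyadicWeight s j * w ≤ 2 ^ 20 * c * (dyadicWeight (t + 1) k * dyadicWeight s l) →
      c ≤ decay (j - l) + decay (j - k) →
      dyadicWeight s j * eLpNorm (transportComm (L.κS j) u a) q volume
        ≤ 2 ^ 20 * B ^ 2 * (decay (j - l) + decay (j - k))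
          * (dyadicWeight (t + 1) k * U) * (dyadicWeight s l * A) := fun {c w} h1 h2 h3 => by
    calc dyadicWeight s j * eLpNorm (transportComm (L.κS j) u a) q volume
        ≤ dyadicWeight s j * (B ^ 2 * w * U * A) := by gcongr
      _ = B ^ 2 * (dyadicWeight s j * w) * U * A := by ring
      _ ≤ B ^ 2 * (2 ^ 20 * (decay (j - l) + decay (j - k))
          * (dyadicWeight (t + 1) k * dyadicWeight s l)) * U * A := by
          refine mul_le_mul_left (mul_le_mul_left (mul_le_mul_right (h2.trans ?_) _) _) _
          gcongr
      _ = _ := by ring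
  have e20 : (2 : ℝ≥0∞) ^ 20 = dyad 20 := by exact_mod_cast (dyad_natCast 20).symm
  have pq' : p ≥ 1 := hq.trans hqp
  -- Comparable frequencies of `a` and of the block: there is no condition on `k`, and the
  -- commutator structure with the Lipschitz norm of `u` is essential.
  by_cases near : j - 5 < l ∧ l < j + 5
  · have n1 : (j : ℝ) - l ≤ 5 := by exact_mod_cast (by omega : j - l ≤ 5)
    have n2 : -5 ≤ (j : ℝ) - l := by exact_mod_cast (by omega : -5 ≤ j - l)
    refine fin (c := decay (j - l)) (w := dyadicWeight (1 + t) k) ?_ ?_ le_self_add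
    · refine (eLpNorm_comm_le (hκ j) ha.continuous
        (hu.enorm_sub_le fun x => hu.enorm_fderiv_le (hB k) pq' x) hq).trans (le_of_eq ?_)
      ring
    · simp only [dyadicWeight_eq_dyad, decay, e20, ← dyad_add]
      refine dyad_mono ?_
      have : |((j - l : ℤ) : ℝ)| ≤ 5 := by
        push_cast
        exact abs_le.mpr ⟨n2, n1⟩
      nlinarith
  · have far : l + 5 ≤ j ∨ j + 5 ≤ l := by omega
    by_cases hs : (l + 5 ≤ j ∧ (j + 5 ≤ k ∨ k + 5 ≤ j)) ∨ (j + 5 ≤ l ∧ (l + 5 ≤ k ∨ k + 5 ≤ l))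
    · have : transportComm (L.κS j) u a = fun _ => 0 := funext fun x =>
        hu.comm_eq_zero far (LittlewoodPaley.separated_of hs) ha x
      rw [this]
      simp
    · have hneg : transportComm (L.κS j) u a
          = -fun x => ∫ y, fderiv ℝ (L.κS j) (x - y) (u y) * a y :=
        funext fun x => hu.comm_eq_of_far far ha x
      rcases far with far | far
      -- Low frequencies of `a`. Up to the shift `j - k`, the exponent is `(j - l) (2/q - 2/p - 1)`,
      -- which is nonpositive by `hpq`. The only decay is in `j - k`; the sum over `l` is controlled
      -- by the norm of `a`.
      · have n1 : (5 : ℝ) ≤ (j : ℝ) - l := by exact_mod_cast (by omega : 5 ≤ j - l)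
        have n2 : (j : ℝ) - k ≤ 5 := by exact_mod_cast (by omega : j - k ≤ 5)
        have n3 : -5 ≤ (j : ℝ) - k := by exact_mod_cast (by omega : -5 ≤ j - k)
        refine fin (c := decay (j - k)) (w := dyadicWeight (1 + t) l) ?_ ?_ le_add_self
        · rw [hneg, eLpNorm_neg]
          have h1 : (fun x => ∫ y, fderiv ℝ (L.κS j) (x - y) (u y) * a y)
              = fun x => ∫ y, L.κS j (x - y) * fderiv ℝ a y (u y) :=
            funext fun x => hu.integral_fderiv_eq_integral_κS hdiv ha x
          have hc : Continuous fun y => fderiv ℝ a y (u y) :=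
            ha.continuous_fderiv.clm_apply hu.continuous
          have h2 := eLpNorm_le_of_le_lconv
            (F := fun x => ∫ y, L.κS j (x - y) * fderiv ℝ a y (u y))
            (N := fun z => ‖L.κS j z‖ₑ) (a := fun y => ‖fderiv ℝ a y (u y)‖ₑ) (fun x => by
              refine (enorm_integral_le_lintegral_enorm _).trans (le_of_eq ?_)
              simp only [enorm_mul, lconv]) (L.κS j).continuous.enorm.measurable
              hc.enorm.measurable hq
          rw [eLpNorm_enorm] at h2
          rw [h1]
          calc _ ≤ _ := h2
            _ ≤ B * (U * (B * dyadicWeight (1 + t) l * A)) := by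
              gcongr
              · exact (hκ j).lintegral_le
              · exact eLpNorm_fderiv_apply_le (hB l) hB1 hBt hq hqp hu ha
            _ = _ := by ring
        · simp only [dyadicWeight_eq_dyad, decay, e20, ← dyad_add]
          refine dyad_mono ?_
          have : |((j - k : ℤ) : ℝ)| ≤ 5 := by
            push_cast
            exact abs_le.mpr ⟨n3, n2⟩
          nlinarith
      -- High frequencies of `u` and `a` producing a low one. The derivative stays on `κⱼ` and costs
      -- `2^j` where the norm of `u` pays `2^k` with `k` close to `l`; this gives the decay `2^(j -
      -- l)`, and `2/q ≥ 0` does not spoil it.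
      · have n1 : (5 : ℝ) ≤ (l : ℝ) - j := by exact_mod_cast (by omega : 5 ≤ l - j)
        have n2 : (l : ℝ) - k ≤ 5 := by exact_mod_cast (by omega : l - k ≤ 5)
        have n3 : -5 ≤ (l : ℝ) - k := by exact_mod_cast (by omega : -5 ≤ l - k)
        refine fin (c := decay (j - l)) (w := dyadicWeight 1 j * dyadicWeight t k) ?_ ?_ le_self_add
        · rw [hneg, eLpNorm_neg]
          refine (eLpNorm_integral_fderiv_le (hκ j) ha.continuous
            (fun x => hu.enorm_le (hB k) pq' x) hq).trans (le_of_eq ?_)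
          ring
        · simp only [dyadicWeight_eq_dyad, decay, e20, ← dyad_add]
          refine dyad_mono ?_
          have : |((j - l : ℤ) : ℝ)| = l - j := by
            push_cast
            rw [abs_of_nonpos (by linarith)]
            ring
          nlinarith

/-- The dyadic blocks of a divergence free vector field of regularity `2 / p + 1` and of a scalar
of regularity `2 / q`. -/
structure BlockPair (L : LittlewoodPaley) (p q : ℝ≥0∞) (u : ℤ → Plane → Plane)
    (a : ℤ → Plane → ℝ) : Prop where
  spectral_u : ∀ k, Spectral L k (u k)
  spectral_a : ∀ l, Spectral L l (a l)
  divergence_u : ∀ k x, divergence (u k) x = 0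
  sum_u : ∑' k, blockSize (twoOver p + 1) p u k ≠ ⊤
  sum_a : ∑' l, blockSize (twoOver q) q a l ≠ ⊤

namespace BlockPair

variable {L : LittlewoodPaley} {p q : ℝ≥0∞} {u : ℤ → Plane → Plane} {a : ℤ → Plane → ℝ}

theorem enorm_fderiv_u_le (h : BlockPair L p q u a) (hp : 1 ≤ p) {B : ℝ≥0∞}
    (hB : ∀ j, KernelBound B j (L.κFatS j)) (k : ℤ) (x : Plane) :
    ‖fderiv ℝ (u k) x‖ₑ ≤ B * blockSize (twoOver p + 1) p u k := by
  rw [blockSize, ← mul_assoc, add_comm (twoOver p)]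
  exact (h.spectral_u k).enorm_fderiv_le (hB k) hp x

theorem enorm_sub_le (h : BlockPair L p q u a) (hp : 1 ≤ p) {B : ℝ≥0∞}
    (hB : ∀ j, KernelBound B j (L.κFatS j)) (k : ℤ) (x y : Plane) :
    ‖u k x - u k y‖ₑ ≤ B * blockSize (twoOver p + 1) p u k * ‖x - y‖ₑ :=
  (h.spectral_u k).enorm_sub_le (h.enorm_fderiv_u_le hp hB k) x y

theorem enorm_a_le (h : BlockPair L p q u a) (hq : 1 ≤ q) {B : ℝ≥0∞}
    (hB : ∀ j, KernelBound B j (L.κFatS j)) (l : ℤ) (x : Plane) :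
    ‖a l x‖ₑ ≤ B * blockSize (twoOver q) q a l := by
  rw [blockSize, ← mul_assoc]
  exact (h.spectral_a l).enorm_le (hB l) hq x

theorem tsum_enorm_sub_le (h : BlockPair L p q u a) (hp : 1 ≤ p) {B : ℝ≥0∞}
    (hB : ∀ j, KernelBound B j (L.κFatS j)) (x y : Plane) :
    ∑' k, ‖u k x - u k y‖ₑ ≤ B * (∑' k, blockSize (twoOver p + 1) p u k) * ‖x - y‖ₑ := by
  rw [← ENNReal.tsum_mul_left, ← ENNReal.tsum_mul_right]
  exact ENNReal.tsum_le_tsum fun k => h.enorm_sub_le hp hB k x y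

theorem tsum_enorm_a_le (h : BlockPair L p q u a) (hq : 1 ≤ q) {B : ℝ≥0∞}
    (hB : ∀ j, KernelBound B j (L.κFatS j)) (x : Plane) :
    ∑' l, ‖a l x‖ₑ ≤ B * ∑' l, blockSize (twoOver q) q a l := by
  rw [← ENNReal.tsum_mul_left]
  exact ENNReal.tsum_le_tsum fun l => h.enorm_a_le hq hB l x

theorem summable_norm_sub (h : BlockPair L p q u a) (hp : 1 ≤ p) (x y : Plane) :
    Summable fun k => ‖u k x - u k y‖ := by
  obtain ⟨B, hBt, -, -, hB⟩ := L.exists_kernelBound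
  refine summable_of_tsum_enorm_ne_top (ne_top_of_le_ne_top ?_ (h.tsum_enorm_sub_le hp hB x y))
  finiteness [h.sum_u]

theorem summable_norm_a (h : BlockPair L p q u a) (hq : 1 ≤ q) (x : Plane) :
    Summable fun l => ‖a l x‖ := by
  obtain ⟨B, hBt, -, -, hB⟩ := L.exists_kernelBound
  refine summable_of_tsum_enorm_ne_top (ne_top_of_le_ne_top ?_ (h.tsum_enorm_a_le hq hB x))
  finiteness [h.sum_a]

/-- Only differences of the velocity enter the commutator. Their series converges absolutely,
whereas the series of the blocks `u k x` themselves need not converge. -/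
theorem enorm_transportComm_le (h : BlockPair L p q u a) (hp : 1 ≤ p) (hq : 1 ≤ q)
    {υ : Plane → Plane} {α : Plane → ℝ} (hυ : ∀ x y, υ x - υ y = ∑' k, (u k x - u k y))
    (hα : ∀ y, α y = ∑' l, a l y) (j : ℤ) (x : Plane) :
    ‖transportComm (L.κS j) υ α x‖ₑ
      ≤ ∑' i : ℤ × ℤ, ‖transportComm (L.κS j) (u i.1) (a i.2) x‖ₑ := by
  obtain ⟨B, hBt, -, hκ, hB⟩ := L.exists_kernelBound
  have e1 : ∀ y, fderiv ℝ (L.κS j) (x - y) (υ x - υ y) * α y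
      = ∑' i : ℤ × ℤ, fderiv ℝ (L.κS j) (x - y) (u i.1 x - u i.1 y) * a i.2 y := fun y => by
    have s1 := h.summable_norm_sub hp x y
    have s2 : Summable fun k => ‖fderiv ℝ (L.κS j) (x - y) (u k x - u k y)‖ :=
      Summable.of_nonneg_of_le (fun k => norm_nonneg _)
        (fun k => (fderiv ℝ (L.κS j) (x - y)).le_opNorm _) (s1.mul_left _)
    rw [hυ, hα, ContinuousLinearMap.map_tsum _ s1.of_norm,
      tsum_mul_tsum_of_summable_norm s2 (h.summable_norm_a hq y)]
  have e2 : ∫ y, ∑' i : ℤ × ℤ, fderiv ℝ (L.κS j) (x - y) (u i.1 x - u i.1 y) * a i.2 y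
      = ∑' i : ℤ × ℤ, transportComm (L.κS j) (u i.1) (a i.2) x := by
    refine integral_tsum (fun i => ?_) (ne_top_of_le_ne_top ?_
      (b := ∑' i : ℤ × ℤ, (B * blockSize (twoOver p + 1) p u i.1) * B
        * (B * blockSize (twoOver q) q a i.2)) (ENNReal.tsum_le_tsum fun i => ?_))
    · exact ((((L.κS j).continuous_fderiv.comp (by fun_prop)).clm_apply
        (continuous_const.sub (h.spectral_u i.1).continuous)).mul
        (h.spectral_a i.2).continuous).aestronglyMeasurable
    · rw [ENNReal.tsum_prod (f := fun k l => (B * blockSize (twoOver p + 1) p u k) * B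
        * (B * blockSize (twoOver q) q a l))]
      simp only [ENNReal.tsum_mul_left, ENNReal.tsum_mul_right]
      finiteness [h.sum_a, h.sum_u]
    · refine (lintegral_comm_le (h.enorm_sub_le hp hB i.1) x).trans ?_
      have hm : Measurable fun z : Plane => ‖z‖ₑ * ‖fderiv ℝ (L.κS j) z‖ₑ :=
        continuous_enorm.measurable.mul (measurable_enorm_fderiv _)
      refine (lconv_le_top (hm.const_mul _) x).trans ?_
      rw [lintegral_const_mul _ hm]
      gcongr
      · exact (hκ j).lintegral_moment_le
      · rw [eLpNorm_exponent_top]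
        refine eLpNormEssSup_le_of_ae_enorm_bound (Eventually.of_forall fun y => ?_)
        rw [enorm_enorm]
        exact h.enorm_a_le hq hB _ y
  rw [transportComm]
  simp only [e1]
  rw [e2]
  exact enorm_tsum_le_tsum_enorm

theorem measurable_transportComm (h : BlockPair L p q u a) (j k l : ℤ) :
    Measurable (transportComm (L.κS j) (u k) (a l)) := by
  refine (StronglyMeasurable.integral_prod_right' (ν := (volume : Measure Plane))
    (f := fun z : Plane × Plane =>
    fderiv ℝ (L.κS j) (z.1 - z.2) (u k z.1 - u k z.2) * a l z.2) ?_).measurable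
  exact ((((L.κS j).continuous_fderiv.comp (by fun_prop)).clm_apply
    (((h.spectral_u k).continuous.comp continuous_fst).sub
      ((h.spectral_u k).continuous.comp continuous_snd))).mul
    ((h.spectral_a l).continuous.comp continuous_snd)).stronglyMeasurable

/-- The commutator estimate. -/
theorem dyadicWeight_mul_eLpNorm_le (h : BlockPair L p q u a) {B : ℝ≥0∞}
    (hκ : ∀ j, KernelBound B j (L.κS j)) (hB : ∀ j, KernelBound B j (L.κFatS j)) (hB1 : 1 ≤ B)
    (hBt : B ≠ ⊤) (hq : 1 ≤ q) (hqp : q ≤ p) (hpq : twoOver q - twoOver p ≤ 1)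
    {υ : Plane → Plane} {α : Plane → ℝ} (hυ : ∀ x y, υ x - υ y = ∑' k, (u k x - u k y))
    (hα : ∀ y, α y = ∑' l, a l y) (j : ℤ) :
    dyadicWeight (twoOver q) j * eLpNorm (transportComm (L.κS j) υ α) q volume
      ≤ 2 ^ 20 * B ^ 2 * ((∑' k, blockSize (twoOver p + 1) p u k)
          * (∑' l, decay (j - l) * blockSize (twoOver q) q a l)
        + (∑' k, decay (j - k) * blockSize (twoOver p + 1) p u k)
          * ∑' l, blockSize (twoOver q) q a l) := by
  have h1 : eLpNorm (transportComm (L.κS j) υ α) q volume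
      ≤ ∑' i : ℤ × ℤ, eLpNorm (transportComm (L.κS j) (u i.1) (a i.2)) q volume := by
    have m1 := fun i : ℤ × ℤ => (h.measurable_transportComm j i.1 i.2).enorm
    have m2 := eLpNorm_tsum_le (μ := (volume : Measure Plane)) m1 hq
    simp only [eLpNorm_enorm] at m2
    refine le_trans (eLpNorm_mono_enorm fun x => ?_) m2
    rw [enorm_eq_self]
    exact h.enorm_transportComm_le (hq.trans hqp) hq hυ hα j x
  set D := blockSize (twoOver p + 1) p u with hD
  set A := blockSize (twoOver q) q a with hA
  have h2 : ∀ k l, dyadicWeight (twoOver q) j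
      * eLpNorm (transportComm (L.κS j) (u k) (a l)) q volume
      ≤ 2 ^ 20 * B ^ 2 * (D k * (decay (j - l) * A l) + decay (j - k) * D k * A l) := fun k l => by
    refine (dyadicWeight_mul_eLpNorm_transportComm_le hκ hB hB1 hBt hq
      hqp hpq j (h.spectral_u k) (h.divergence_u k) (h.spectral_a l)).trans (le_of_eq ?_)
    simp only [hD, hA, blockSize]
    ring
  calc _ ≤ dyadicWeight (twoOver q) j
        * ∑' i : ℤ × ℤ, eLpNorm (transportComm (L.κS j) (u i.1) (a i.2)) q volume :=
        mul_le_mul_right h1 _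
    _ = ∑' k, ∑' l, dyadicWeight (twoOver q) j
        * eLpNorm (transportComm (L.κS j) (u k) (a l)) q volume := by
        rw [ENNReal.tsum_prod
          (f := fun k l => eLpNorm (transportComm (L.κS j) (u k) (a l)) q volume)]
        simp only [ENNReal.tsum_mul_left]
    _ ≤ ∑' k, ∑' l, 2 ^ 20 * B ^ 2 * (D k * (decay (j - l) * A l) + decay (j - k) * D k * A l) :=
        ENNReal.tsum_le_tsum fun k => ENNReal.tsum_le_tsum fun l => h2 k l
    _ = _ := by
        simp only [ENNReal.tsum_mul_left, ENNReal.tsum_mul_right, ENNReal.tsum_add]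

end BlockPair

end CommutatorEstimate

/-! ### Functions of critical regularity as sums of their blocks -/

section Representation

theorem exists_schwartz_eq_one (R : ℝ) :
    ∃ ψ : 𝓢(Plane, ℂ), ∀ x ∈ Metric.closedBall (0 : Plane) R, ψ x = 1 := by
  let b : ContDiffBump (0 : Plane) := ⟨|R| + 1, |R| + 2, by positivity, by linarith⟩
  have h1 : HasCompactSupport fun x => (b x : ℂ) :=
    b.hasCompactSupport.comp_left (g := fun x : ℝ => (x : ℂ)) Complex.ofReal_zero
  refine ⟨HasCompactSupport.toSchwartzMap h1 (Complex.ofRealCLM.contDiff.comp b.contDiff),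
    fun x hx => ?_⟩
  change ((b x : ℝ) : ℂ) = 1
  rw [b.one_of_mem_closedBall, Complex.ofReal_one]
  exact Metric.closedBall_subset_closedBall (by linarith [le_abs_self R]) hx

variable {F : Type*} [NormedAddCommGroup F] [NormedSpace ℂ F]

theorem IsRepresentedBy.locallyIntegrable {T : 𝓢'(Plane, F)} {f : Plane → F}
    (h : IsRepresentedBy T f) : LocallyIntegrable f := by
  intro x
  obtain ⟨ψ, hψ⟩ := exists_schwartz_eq_one (‖x‖ + 1)
  refine ⟨Metric.ball x 1, Metric.ball_mem_nhds x one_pos, ?_⟩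
  refine (h ψ).1.integrableOn.congr_fun (fun y hy => ?_) measurableSet_ball
  simp only
  rw [hψ y, one_smul]
  rw [mem_closedBall_zero_iff]
  rw [mem_ball_iff_norm] at hy
  have := norm_add_le x (y - x)
  rw [add_sub_cancel] at this
  linarith

variable [CompleteSpace F]

/-- A contDiff function with compact support as a complex Schwartz function. -/
theorem exists_schwartz_of_contDiff {g : Plane → ℝ} (hg : ContDiff ℝ ∞ g)
    (hc : HasCompactSupport g) : ∃ ψ : 𝓢(Plane, ℂ), ∀ x, ψ x = (g x : ℂ) :=
  ⟨HasCompactSupport.toSchwartzMap (f := fun x => (g x : ℂ))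
    (hc.comp_left (g := fun x : ℝ => (x : ℂ)) Complex.ofReal_zero)
    (Complex.ofRealCLM.contDiff.comp hg), fun _ => rfl⟩

namespace LittlewoodPaley

variable (L : LittlewoodPaley)

theorem block_eq_integral (k : ℤ) (T : 𝓢'(Plane, F)) (x : Plane) :
    L.block k T x = ∫ z, L.κFatS k (x - z) • L.block k T z := by
  simp only [κFatS_apply, ← Complex.coe_smul]
  exact L.block_reproducing k T x

/-- A block in `L^p` is automatically bounded, by the reproducing formula and the pointwise
convolution bound. -/
theorem spectral_block {k : ℤ} {T : 𝓢'(Plane, F)} {p : ℝ≥0∞} (hp : 1 ≤ p)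
    (h : eLpNorm (L.block k T) p volume ≠ ⊤) : Spectral L k (L.block k T) := by
  obtain ⟨B, hBt, -, -, hB⟩ := L.exists_kernelBound
  obtain ⟨p0, p1⟩ := toReal_inv_mem hp
  have hc := L.continuous_block k T
  have h1 := lconv_le_eLpNorm (Spectral.measurable_kernel L k) hc.enorm.measurable hp
    (hB k).enorm_le
  set M := (∫⁻ y, ‖L.κFatS k y‖ₑ) ^ (1 - (p⁻¹).toReal) * (B * dyadicWeight 2 k) ^ (p⁻¹).toReal
    * eLpNorm (fun x => ‖L.block k T x‖ₑ) p volume with hM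
  have hMt : M ≠ ⊤ := by
    rw [hM, eLpNorm_enorm]
    have : ∫⁻ y, ‖L.κFatS k y‖ₑ ≠ ⊤ := ne_top_of_le_ne_top hBt (hB k).lintegral_le
    refine ENNReal.mul_ne_top (ENNReal.mul_ne_top ?_ ?_) h
    · exact ENNReal.rpow_ne_top_of_nonneg (sub_nonneg.mpr p1) this
    · exact ENNReal.rpow_ne_top_of_nonneg p0 (ENNReal.mul_ne_top hBt (dyadicWeight_ne_top _ _))
  refine ⟨hc, ⟨M.toReal, fun x => ?_⟩, L.block_eq_integral k T⟩
  have h2 : ‖L.block k T x‖ₑ ≤ M := by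
    refine le_trans ?_ (h1 x)
    conv_lhs => rw [L.block_eq_integral]
    refine (enorm_integral_le_lintegral_enorm _).trans (le_of_eq ?_)
    simp only [enorm_smul, lconv]
  rw [← ofReal_norm] at h2
  exact (ENNReal.ofReal_le_iff_le_toReal hMt).mp h2

theorem besovNorm_one (s : ℝ) (p : ℝ≥0∞) (T : 𝓢'(Plane, F)) :
    besovNorm L s p 1 T = ∑' k, blockSize s p (fun k => L.block k T) k := by
  rw [besovNorm, eLpNorm_one_eq_lintegral_enorm, lintegral_count]
  simp only [enorm_eq_self, blockSize]

theorem eLpNorm_block_ne_top {s : ℝ} {p : ℝ≥0∞} {T : 𝓢'(Plane, F)}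
    (h : besovNorm L s p 1 T ≠ ⊤) (k : ℤ) : eLpNorm (L.block k T) p volume ≠ ⊤ := by
  intro h0
  rw [besovNorm_one] at h
  refine h (top_unique ?_)
  refine le_trans ?_ (ENNReal.le_tsum k)
  rw [blockSize, h0, ENNReal.mul_top (dyadicWeight_ne_zero _ _)]

/-- The functions `h k` need agree with the blocks only as seen by `ψ`. This leaves room for
subtracting constants when `ψ` has mean zero. -/
theorem apply_eq_integral_tsum {T : 𝓢'(Plane, F)} (hT : MemSh L T) (ψ : 𝓢(Plane, ℂ))
    {h : ℤ → Plane → F} (hm : ∀ k, Continuous (h k))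
    (h1 : ∀ k, ∫ x, ψ x • L.block k T x = ∫ x, ψ x • h k x)
    (h2 : ∑' k, ∫⁻ x, ‖ψ x • h k x‖ₑ ≠ ⊤) : T ψ = ∫ x, ψ x • ∑' k, h k x := by
  have e1 : ∫ x, ψ x • ∑' k, h k x = ∑' k, ∫ x, ψ x • h k x := by
    rw [← integral_tsum (f := fun k x => ψ x • h k x)
      (fun k => (ψ.continuous.smul (hm k)).aestronglyMeasurable) h2]
    refine integral_congr_ae (Eventually.of_forall fun x => ?_)
    simp only
    rw [tsum_const_smul'']
  have s : Summable fun k => ∫ x, ψ x • h k x := by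
    refine (summable_of_tsum_enorm_ne_top (ne_top_of_le_ne_top h2
      (ENNReal.tsum_le_tsum fun k => enorm_integral_le_lintegral_enorm _))).of_norm
  rw [e1]
  refine tendsto_nhds_unique (L.tendsto_sum_integral_smul_block hT ψ) ?_
  simp only [h1]
  exact s.hasSum.comp (Finset.tendsto_Ico_neg (R := ℤ))

end LittlewoodPaley

theorem ae_eq_of_integral_schwartz_eq {f g : Plane → F} (hf : LocallyIntegrable f)
    (hg : LocallyIntegrable g) (h : ∀ ψ : 𝓢(Plane, ℂ), HasCompactSupport ψ →
      ∫ x, ψ x • f x = ∫ x, ψ x • g x) : f =ᵐ[volume] g := by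
  refine ae_eq_of_integral_contDiff_smul_eq hf hg fun w hw hwc => ?_
  obtain ⟨ψ, hψ⟩ := exists_schwartz_of_contDiff hw hwc
  have := h ψ (by
    rw [show (ψ : Plane → ℂ) = fun x => (w x : ℂ) from funext hψ]
    exact hwc.comp_left (g := fun x : ℝ => (x : ℂ)) Complex.ofReal_zero)
  simpa only [hψ, Complex.coe_smul] using this

theorem SchwartzMap.lintegral_enorm_ne_top (ψ : 𝓢(Plane, ℂ)) : ∫⁻ x, ‖ψ x‖ₑ ≠ ⊤ :=
  ψ.integrable.2.ne

theorem SchwartzMap.lintegral_enorm_moment_ne_top (ψ : 𝓢(Plane, ℂ)) :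
    ∫⁻ x, ‖ψ x‖ₑ * ‖x‖ₑ ≠ ⊤ := by
  have := (ψ.integrable_pow_mul volume 1).2.ne
  simp only [pow_one, enorm_mul, enorm_norm] at this
  simpa only [mul_comm] using this

section Scalar

variable {L : LittlewoodPaley} {q : ℝ≥0∞} {T : 𝓢'(Plane, F)}

theorem enorm_block_le (hq : 1 ≤ q) (hT : besovNorm L (twoOver q) q 1 T ≠ ⊤) {B : ℝ≥0∞}
    (hB : ∀ j, KernelBound B j (L.κFatS j)) (k : ℤ) (x : Plane) :
    ‖L.block k T x‖ₑ ≤ B * blockSize (twoOver q) q (fun k => L.block k T) k := by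
  rw [blockSize, ← mul_assoc]
  exact (L.spectral_block hq (L.eLpNorm_block_ne_top hT k)).enorm_le (hB k) hq x

theorem continuous_tsum_block (hq : 1 ≤ q) (hT : besovNorm L (twoOver q) q 1 T ≠ ⊤) :
    Continuous fun x => ∑' k, L.block k T x := by
  obtain ⟨B, hBt, -, -, hB⟩ := L.exists_kernelBound
  have hs : ∑' k, B * blockSize (twoOver q) q (fun k => L.block k T) k ≠ ⊤ := by
    rw [ENNReal.tsum_mul_left, ← L.besovNorm_one]
    finiteness
  refine continuous_tsum (fun k => L.continuous_block k T) (ENNReal.summable_toReal hs)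
    fun k x => ?_
  have := enorm_block_le hq hT hB k x
  rw [← ofReal_norm] at this
  exact (ENNReal.ofReal_le_iff_le_toReal (ENNReal.ne_top_of_tsum_ne_top hs k)).mp this

/-- A function of critical regularity is the sum of its dyadic blocks. -/
theorem ae_eq_tsum_block (hq : 1 ≤ q) (hT : MemBesov L (twoOver q) q 1 T) {f : Plane → F}
    (hf : IsRepresentedBy T f) : f =ᵐ[volume] fun x => ∑' k, L.block k T x := by
  obtain ⟨B, hBt, -, -, hB⟩ := L.exists_kernelBound
  refine ae_eq_of_integral_schwartz_eq hf.locallyIntegrable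
    (continuous_tsum_block hq hT.2.ne).locallyIntegrable fun ψ _ => ?_
  rw [← (hf ψ).2]
  refine L.apply_eq_integral_tsum hT.1 ψ (fun k => L.continuous_block k T) (fun k => rfl) ?_
  refine ne_top_of_le_ne_top (b := ∑' k, (∫⁻ x, ‖ψ x‖ₑ)
    * (B * blockSize (twoOver q) q (fun k => L.block k T) k)) ?_ (ENNReal.tsum_le_tsum fun k => ?_)
  · rw [ENNReal.tsum_mul_left, ENNReal.tsum_mul_left, ← L.besovNorm_one]
    finiteness [hT.2.ne, ψ.lintegral_enorm_ne_top]
  · rw [← lintegral_mul_const _ ψ.continuous.enorm.measurable]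
    refine lintegral_mono fun x => ?_
    rw [enorm_smul]
    gcongr
    exact enorm_block_le hq hT.2.ne hB k x

end Scalar

section Velocity

variable {L : LittlewoodPaley} {p : ℝ≥0∞} {T : 𝓢'(Plane, F)}

theorem enorm_block_sub_le (hp : 1 ≤ p) (hT : besovNorm L (twoOver p + 1) p 1 T ≠ ⊤) {B : ℝ≥0∞}
    (hB : ∀ j, KernelBound B j (L.κFatS j)) (k : ℤ) (x y : Plane) :
    ‖L.block k T x - L.block k T y‖ₑ
      ≤ B * blockSize (twoOver p + 1) p (fun k => L.block k T) k * ‖x - y‖ₑ := by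
  have h := L.spectral_block hp (L.eLpNorm_block_ne_top hT k)
  rw [blockSize, ← mul_assoc, add_comm (twoOver p)]
  exact h.enorm_sub_le (h.enorm_fderiv_le (hB k) hp) x y

theorem tsum_enorm_block_sub_le (hp : 1 ≤ p) (hT : besovNorm L (twoOver p + 1) p 1 T ≠ ⊤)
    {B : ℝ≥0∞} (hB : ∀ j, KernelBound B j (L.κFatS j)) (x y : Plane) :
    ∑' k, ‖L.block k T x - L.block k T y‖ₑ
      ≤ B * besovNorm L (twoOver p + 1) p 1 T * ‖x - y‖ₑ := by
  rw [L.besovNorm_one, ← ENNReal.tsum_mul_left, ← ENNReal.tsum_mul_right]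
  exact ENNReal.tsum_le_tsum fun k => enorm_block_sub_le hp hT hB k x y

theorem summable_block_sub (hp : 1 ≤ p) (hT : besovNorm L (twoOver p + 1) p 1 T ≠ ⊤)
    (x y : Plane) : Summable fun k => ‖L.block k T x - L.block k T y‖ := by
  obtain ⟨B, hBt, -, -, hB⟩ := L.exists_kernelBound
  refine summable_of_tsum_enorm_ne_top (ne_top_of_le_ne_top ?_
    (tsum_enorm_block_sub_le hp hT hB x y))
  finiteness

/-- The sum of the dyadic blocks of a velocity field, normalized to vanish at the origin. -/
def normalizedSum (L : LittlewoodPaley) (T : 𝓢'(Plane, F)) (x : Plane) : F :=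
  ∑' k, (L.block k T x - L.block k T 0)

theorem normalizedSum_sub (hp : 1 ≤ p) (hT : besovNorm L (twoOver p + 1) p 1 T ≠ ⊤)
    (x y : Plane) : normalizedSum L T x - normalizedSum L T y
      = ∑' k, (L.block k T x - L.block k T y) := by
  rw [normalizedSum, normalizedSum, ← (summable_block_sub hp hT x 0).of_norm.tsum_sub
    (summable_block_sub hp hT y 0).of_norm]
  simp only [sub_sub_sub_cancel_right]

theorem enorm_normalizedSum_sub_le (hp : 1 ≤ p) (hT : besovNorm L (twoOver p + 1) p 1 T ≠ ⊤)
    {B : ℝ≥0∞} (hB : ∀ j, KernelBound B j (L.κFatS j)) (x y : Plane) :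
    ‖normalizedSum L T x - normalizedSum L T y‖ₑ
      ≤ B * besovNorm L (twoOver p + 1) p 1 T * ‖x - y‖ₑ := by
  rw [normalizedSum_sub hp hT]
  exact enorm_tsum_le_tsum_enorm.trans (tsum_enorm_block_sub_le hp hT hB x y)

theorem continuous_normalizedSum (hp : 1 ≤ p) (hT : besovNorm L (twoOver p + 1) p 1 T ≠ ⊤) :
    Continuous (normalizedSum L T) := by
  obtain ⟨B, hBt, -, -, hB⟩ := L.exists_kernelBound
  have h1 : LipschitzWith (B * besovNorm L (twoOver p + 1) p 1 T).toNNReal (normalizedSum L T) :=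
    fun x y => by
      rw [edist_eq_enorm_sub, edist_eq_enorm_sub, ENNReal.coe_toNNReal (by finiteness)]
      exact enorm_normalizedSum_sub_le hp hT hB x y
  exact h1.continuous

theorem normalizedSum_zero : normalizedSum L T 0 = 0 := by simp [normalizedSum]

theorem integrable_smul_normalizedSum (hp : 1 ≤ p) (hT : besovNorm L (twoOver p + 1) p 1 T ≠ ⊤)
    (ψ : 𝓢(Plane, ℂ)) : Integrable fun x => ψ x • normalizedSum L T x := by
  obtain ⟨B, hBt, -, -, hB⟩ := L.exists_kernelBound
  refine ⟨(ψ.continuous.smul (continuous_normalizedSum hp hT)).aestronglyMeasurable, ?_⟩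
  refine lt_of_le_of_lt (b := ∫⁻ x, B * besovNorm L (twoOver p + 1) p 1 T * (‖ψ x‖ₑ * ‖x‖ₑ))
    (lintegral_mono fun x => ?_) ?_
  · have := enorm_normalizedSum_sub_le hp hT hB x 0
    rw [normalizedSum_zero, sub_zero, sub_zero] at this
    rw [enorm_smul]
    calc ‖ψ x‖ₑ * ‖normalizedSum L T x‖ₑ
        ≤ ‖ψ x‖ₑ * (B * besovNorm L (twoOver p + 1) p 1 T * ‖x‖ₑ) := by gcongr
      _ = _ := by ring
  · rw [lintegral_const_mul' _ _ (by finiteness)]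
    have := ψ.lintegral_enorm_moment_ne_top
    finiteness

/-- Regularity `2/p + 1` makes the increments of the blocks summable, not their values. Subtracting
the values at the origin repairs convergence and is invisible to test functions of mean zero. -/
theorem apply_eq_integral_normalizedSum (hp : 1 ≤ p) (hT : MemBesov L (twoOver p + 1) p 1 T)
    {ψ : 𝓢(Plane, ℂ)} (hψ : ∫ x, ψ x = 0) : T ψ = ∫ x, ψ x • normalizedSum L T x := by
  obtain ⟨B, hBt, -, -, hB⟩ := L.exists_kernelBound
  refine L.apply_eq_integral_tsum hT.1 ψ
    (fun k => (L.continuous_block k T).sub continuous_const) (fun k => ?_) ?_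
  · simp only [smul_sub]
    rw [integral_sub (L.integral_smul_block k T ψ).1 (ψ.integrable.smul_const _),
      integral_smul_const, hψ, zero_smul, sub_zero]
  · refine ne_top_of_le_ne_top (b := ∑' k, (B * blockSize (twoOver p + 1) p
      (fun k => L.block k T) k) * ∫⁻ x, ‖ψ x‖ₑ * ‖x‖ₑ) ?_ (ENNReal.tsum_le_tsum fun k => ?_)
    · rw [ENNReal.tsum_mul_right, ENNReal.tsum_mul_left, ← L.besovNorm_one]
      finiteness [hT.2.ne, ψ.lintegral_enorm_moment_ne_top]
    · rw [← lintegral_const_mul (f := fun x => ‖ψ x‖ₑ * ‖x‖ₑ) _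
        (ψ.continuous.enorm.measurable.mul continuous_enorm.measurable)]
      refine lintegral_mono fun x => ?_
      have := enorm_block_sub_le hp hT.2.ne hB k x 0
      rw [sub_zero] at this
      rw [enorm_smul]
      calc _ ≤ ‖ψ x‖ₑ * (B * blockSize (twoOver p + 1) p (fun k => L.block k T) k * ‖x‖ₑ) := by
            gcongr
        _ = _ := by ring

/-- A velocity field is the normalized sum of its blocks up to a constant. -/
theorem ae_eq_normalizedSum_add (hp : 1 ≤ p) (hT : MemBesov L (twoOver p + 1) p 1 T)
    {f : Plane → F} (hf : IsRepresentedBy T f) {ψ₀ : 𝓢(Plane, ℂ)} (h0 : ∫ x, ψ₀ x = 1) :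
    f =ᵐ[volume] fun x => normalizedSum L T x + (T ψ₀ - ∫ x, ψ₀ x • normalizedSum L T x) := by
  have hc := continuous_normalizedSum hp hT.2.ne
  set c := T ψ₀ - ∫ x, ψ₀ x • normalizedSum L T x with hcdef
  refine ae_eq_of_integral_schwartz_eq hf.locallyIntegrable
    (hc.add continuous_const).locallyIntegrable fun ψ _ => ?_
  rw [← (hf ψ).2]
  have i1 := integrable_smul_normalizedSum hp hT.2.ne ψ
  have i0 := integrable_smul_normalizedSum hp hT.2.ne ψ₀
  -- A multiple of `ψ₀` is subtracted from `ψ` to reach mean zero, and the pairing with `ψ₀` fixes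
  -- the missing additive constant.
  have h1 := apply_eq_integral_normalizedSum hp hT (ψ := ψ - (∫ x, ψ x) • ψ₀) (by
    simp only [_root_.sub_apply, _root_.smul_apply]
    rw [integral_sub ψ.integrable (ψ₀.integrable.fun_smul _), integral_smul, h0, smul_eq_mul, mul_one,
      sub_self])
  have e : ∀ x, (ψ - (∫ x, ψ x) • ψ₀) x • normalizedSum L T x
      = ψ x • normalizedSum L T x - (∫ x, ψ x) • (ψ₀ x • normalizedSum L T x) := fun x => by
    rw [_root_.sub_apply, _root_.smul_apply, sub_smul, smul_eq_mul, mul_smul]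
  simp only [e] at h1
  rw [integral_sub i1 (i0.fun_smul (∫ x, ψ x)), integral_smul, map_sub, map_smul] at h1
  simp only [smul_add]
  rw [integral_add i1 (ψ.integrable.smul_const c), integral_smul_const, hcdef, smul_sub]
  rw [sub_eq_iff_eq_add] at h1
  rw [h1]
  abel

end Velocity

end Representation

/-! ### Real dyadic blocks and their divergence -/

section RealBlocks

section Embedding

variable {F : Type*} [NormedAddCommGroup F] [NormedSpace ℂ F] [CompleteSpace F]
  {E : Type*} [NormedAddCommGroup E] [NormedSpace ℝ E] [CompleteSpace E]
  {ι : E →ₗᵢ[ℝ] F} {ρ : F →L[ℝ] E}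

theorem kernel_apply_eq_κS (L : LittlewoodPaley) (k : ℤ) (x y : Plane) :
    L.kernel k x y = (L.κS k (x - y) : ℂ) := by
  rw [L.kernel_eq_translate, SchwartzMap.compSubConstCLM_apply, L.g_eq_κ, L.κS_apply,
    ← L.κ_neg, neg_sub]

/-- The kernel is real, so the block of an embedded real function is the embedding of a real
convolution. -/
theorem IsRepresentedBy.block_eq {T : 𝓢'(Plane, F)} {f : Plane → E}
    (h : IsRepresentedBy T fun x => ι (f x)) (L : LittlewoodPaley) (k : ℤ) (x : Plane) :
    L.block k T x = ι (∫ y, L.κS k (x - y) • f y) := by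
  rw [LittlewoodPaley.block, (h _).2, ← ι.integral_comp_comm]
  refine integral_congr_ae (Eventually.of_forall fun y => ?_)
  simp only [kernel_apply_eq_κS, Complex.coe_smul, map_smul]

theorem IsRepresentedBy.norm_block {T : 𝓢'(Plane, F)} {f : Plane → E}
    (hρ : ∀ v, ρ (ι v) = v) (h : IsRepresentedBy T fun x => ι (f x)) (L : LittlewoodPaley) (k : ℤ)
    (x : Plane) : ‖ρ (L.block k T x)‖ = ‖L.block k T x‖ := by
  rw [h.block_eq L, hρ, ι.norm_map]

end Embedding

/-- The embedding of real vectors into complex ones. -/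
def complexifyLI : Plane →ₗᵢ[ℝ] CPlane where
  toFun := complexify
  map_add' v w := by ext i; simp [complexify]
  map_smul' c v := by ext i; simp [complexify]
  norm_map' v := by simp [complexify, EuclideanSpace.norm_eq]

/-- The real part of a complex vector. -/
def rePlane : CPlane →L[ℝ] Plane :=
  LinearMap.toContinuousLinearMap
    { toFun := fun v => WithLp.toLp 2 fun i => (v i).re
      map_add' := fun v w => by ext i; simp
      map_smul' := fun c v => by ext i; simp }

theorem rePlane_complexify (v : Plane) : rePlane (complexifyLI v) = v := by
  ext i
  change ((v i : ℝ) : ℂ).re = v i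
  simp

/-- The dyadic blocks of a real scalar distribution. -/
def scalBlock (L : LittlewoodPaley) (A : 𝓢'(Plane, ℂ)) (k : ℤ) (x : Plane) : ℝ :=
  (L.block k A x).re

/-- The dyadic blocks of a real vector field. -/
def velBlock (L : LittlewoodPaley) (V : 𝓢'(Plane, CPlane)) (k : ℤ) (x : Plane) : Plane :=
  rePlane (L.block k V x)

/-- The sum of the dyadic blocks of a real scalar distribution. -/
def scalSum (L : LittlewoodPaley) (A : 𝓢'(Plane, ℂ)) (x : Plane) : ℝ := ∑' k, scalBlock L A k x

/-- The continuous representative of a real vector field of critical regularity. -/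
def velSum (L : LittlewoodPaley) (ψ₀ : 𝓢(Plane, ℂ)) (V : 𝓢'(Plane, CPlane)) (x : Plane) : Plane :=
  rePlane (normalizedSum L V x + (V ψ₀ - ∫ x, ψ₀ x • normalizedSum L V x))

variable {L : LittlewoodPaley} {p q : ℝ≥0∞} {A : 𝓢'(Plane, ℂ)} {V : 𝓢'(Plane, CPlane)}
  {α : Plane → ℝ} {υ : Plane → Plane} {ψ₀ : 𝓢(Plane, ℂ)}

theorem spectral_scalBlock (hq : 1 ≤ q) (hA : besovNorm L (twoOver q) q 1 A ≠ ⊤) (k : ℤ) :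
    Spectral L k (scalBlock L A k) :=
  (L.spectral_block hq (L.eLpNorm_block_ne_top hA k)).clm_comp Complex.reCLM

theorem spectral_velBlock (hp : 1 ≤ p) {s : ℝ} (hV : besovNorm L s p 1 V ≠ ⊤) (k : ℤ) :
    Spectral L k (velBlock L V k) :=
  (L.spectral_block hp (L.eLpNorm_block_ne_top hV k)).clm_comp rePlane

theorem ofReal_scalBlock (hα : IsRepresentedBy A fun x => (α x : ℂ)) (k : ℤ) (x : Plane) :
    (scalBlock L A k x : ℂ) = L.block k A x := by
  have := IsRepresentedBy.block_eq (ι := Complex.ofRealLI) hα L k x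
  rw [scalBlock, this]
  rfl

theorem eLpNorm_scalBlock (hα : IsRepresentedBy A fun x => (α x : ℂ)) (k : ℤ) (r : ℝ≥0∞) :
    eLpNorm (scalBlock L A k) r volume = eLpNorm (L.block k A) r volume := by
  refine eLpNorm_congr_norm_ae (Eventually.of_forall fun x => ?_)
  rw [← ofReal_scalBlock hα, Complex.norm_real]

theorem norm_velBlock (hυ : IsRepresentedBy V fun x => complexify (υ x)) (k : ℤ) (x : Plane) :
    ‖velBlock L V k x‖ = ‖L.block k V x‖ :=
  IsRepresentedBy.norm_block (ι := complexifyLI) (ρ := rePlane) rePlane_complexify hυ L k x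

theorem eLpNorm_velBlock (hυ : IsRepresentedBy V fun x => complexify (υ x)) (k : ℤ) (r : ℝ≥0∞) :
    eLpNorm (velBlock L V k) r volume = eLpNorm (L.block k V) r volume :=
  eLpNorm_congr_norm_ae (Eventually.of_forall fun x => norm_velBlock hυ k x)

theorem tsum_blockSize_scalBlock (hα : IsRepresentedBy A fun x => (α x : ℂ)) (s : ℝ) (r : ℝ≥0∞) :
    ∑' k, blockSize s r (scalBlock L A) k = besovNorm L s r 1 A := by
  simp only [L.besovNorm_one, blockSize, eLpNorm_scalBlock hα]

theorem tsum_blockSize_velBlock (hυ : IsRepresentedBy V fun x => complexify (υ x)) (s : ℝ)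
    (r : ℝ≥0∞) : ∑' k, blockSize s r (velBlock L V) k = besovNorm L s r 1 V := by
  simp only [L.besovNorm_one, blockSize, eLpNorm_velBlock hυ]

theorem scalSum_eq (hq : 1 ≤ q) (hA : besovNorm L (twoOver q) q 1 A ≠ ⊤) (x : Plane) :
    scalSum L A x = (∑' k, L.block k A x).re := by
  obtain ⟨B, hBt, -, -, hB⟩ := L.exists_kernelBound
  have : Summable fun k => ‖L.block k A x‖ := by
    refine summable_of_tsum_enorm_ne_top (ne_top_of_le_ne_top ?_
      (ENNReal.tsum_le_tsum fun k => enorm_block_le hq hA hB k x))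
    rw [ENNReal.tsum_mul_left, ← L.besovNorm_one]
    finiteness
  rw [Complex.re_tsum this.of_norm]
  rfl

theorem continuous_scalSum (hq : 1 ≤ q) (hA : besovNorm L (twoOver q) q 1 A ≠ ⊤) :
    Continuous (scalSum L A) := by
  rw [show scalSum L A = fun x => (∑' k, L.block k A x).re from funext (scalSum_eq hq hA)]
  exact Complex.continuous_re.comp (continuous_tsum_block hq hA)

theorem ae_eq_scalSum (hq : 1 ≤ q) (hA : MemBesov L (twoOver q) q 1 A)
    (hα : IsRepresentedBy A fun x => (α x : ℂ)) : α =ᵐ[volume] scalSum L A := by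
  filter_upwards [ae_eq_tsum_block hq hA hα] with x hx
  rw [scalSum_eq hq hA.2.ne, ← hx, Complex.ofReal_re]

theorem enorm_scalSum_le (hq : 1 ≤ q) (hA : besovNorm L (twoOver q) q 1 A ≠ ⊤) {B : ℝ≥0∞}
    (hB : ∀ j, KernelBound B j (L.κFatS j)) (x : Plane) :
    ‖scalSum L A x‖ₑ ≤ B * besovNorm L (twoOver q) q 1 A := by
  have h1 : ‖∑' k, L.block k A x‖ₑ ≤ B * besovNorm L (twoOver q) q 1 A := by
    refine enorm_tsum_le_tsum_enorm.trans ?_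
    rw [L.besovNorm_one, ← ENNReal.tsum_mul_left]
    exact ENNReal.tsum_le_tsum fun k => enorm_block_le hq hA hB k x
  refine le_trans ?_ h1
  rw [scalSum_eq hq hA, ← ofReal_norm, ← ofReal_norm]
  exact ENNReal.ofReal_le_ofReal (Complex.abs_re_le_norm _)

theorem scalBlock_eq_integral (hq : 1 ≤ q) (hA : MemBesov L (twoOver q) q 1 A)
    (hα : IsRepresentedBy A fun x => (α x : ℂ)) (k : ℤ) (x : Plane) :
    scalBlock L A k x = ∫ y, L.κS k (x - y) * scalSum L A y := by
  have h1 := IsRepresentedBy.block_eq (ι := Complex.ofRealLI) hα L k x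
  rw [scalBlock, h1]
  refine Eq.trans (Complex.ofReal_re _) (integral_congr_ae ?_)
  filter_upwards [ae_eq_scalSum hq hA hα] with y hy
  rw [hy, smul_eq_mul]

theorem velSum_sub (hp : 1 ≤ p) (hV : besovNorm L (twoOver p + 1) p 1 V ≠ ⊤) (x y : Plane) :
    velSum L ψ₀ V x - velSum L ψ₀ V y = ∑' k, (velBlock L V k x - velBlock L V k y) := by
  rw [velSum, velSum, ← map_sub, add_sub_add_right_eq_sub, normalizedSum_sub hp hV,
    rePlane.map_tsum (summable_block_sub hp hV x y).of_norm]
  simp only [map_sub, velBlock]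

theorem ae_eq_velSum (hp : 1 ≤ p) (hV : MemBesov L (twoOver p + 1) p 1 V)
    (hυ : IsRepresentedBy V fun x => complexify (υ x)) (h0 : ∫ x, ψ₀ x = 1) :
    υ =ᵐ[volume] velSum L ψ₀ V := by
  filter_upwards [ae_eq_normalizedSum_add hp hV hυ h0] with x hx
  rw [velSum, ← hx]
  exact (rePlane_complexify _).symm

section Divergence

theorem lineDeriv_apply_of_ofReal {f : 𝓢(Plane, ℂ)} {K : 𝓢(Plane, ℝ)}
    (h : ∀ x, f x = (K x : ℂ)) (e x : Plane) :
    (∂_{e} f : 𝓢(Plane, ℂ)) x = (fderiv ℝ K x e : ℂ) := by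
  have h2 : HasFDerivAt (fun x => (K x : ℂ)) (Complex.ofRealCLM.comp (fderiv ℝ K x)) x :=
    Complex.ofRealCLM.hasFDerivAt.comp x (K.hasFDerivAt x)
  rw [SchwartzMap.lineDerivOp_apply_eq_fderiv, show (f : Plane → ℂ) = fun x => (K x : ℂ) from
    funext h, h2.fderiv]
  rfl

theorem fderiv_κFatS_neg (L : LittlewoodPaley) (j : ℤ) (x e : Plane) :
    fderiv ℝ (L.κFatS j) (-x) e = -fderiv ℝ (L.κFatS j) x e := by
  have h1 : (L.κFatS j : Plane → ℝ) = fun x => L.κFatS j (-x) :=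
    funext fun x => (L.κFat_neg j x).symm
  have h2 : HasFDerivAt (fun x => L.κFatS j (-x))
      ((fderiv ℝ (L.κFatS j) (-x)).comp (-ContinuousLinearMap.id ℝ Plane)) x :=
    ((L.κFatS j).hasFDerivAt (-x)).comp x (hasFDerivAt_id x).neg
  have h3 := h2.fderiv
  rw [← h1] at h3
  rw [h3]
  simp

theorem SchwartzMap.conv_comm (f g : 𝓢(Plane, ℂ)) :
    SchwartzMap.conv f g = SchwartzMap.conv g f := by
  refine SchwartzMap.ext_fourierInv fun ξ => ?_
  rw [SchwartzMap.fourierInv_conv_apply, SchwartzMap.fourierInv_conv_apply, mul_comm]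

theorem SchwartzMap.lineDeriv_translate (f : 𝓢(Plane, ℂ)) (a e : Plane) :
    (∂_{e} (SchwartzMap.compSubConstCLM ℂ a f) : 𝓢(Plane, ℂ))
      = SchwartzMap.compSubConstCLM ℂ a (∂_{e} f : 𝓢(Plane, ℂ)) := by
  ext x
  rw [SchwartzMap.compSubConstCLM_apply, SchwartzMap.lineDerivOp_apply_eq_fderiv,
    SchwartzMap.lineDerivOp_apply_eq_fderiv, ← fderiv_comp_sub]
  rfl

variable {F : Type*} [NormedAddCommGroup F] [NormedSpace ℂ F] [CompleteSpace F]

/-- The derivative first falls on the reproducing kernel `gFat`; commutativity of the convolution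
transfers it to `g`, where it becomes a distributional derivative of `T`. -/
theorem fderiv_block_apply (hp : 1 ≤ p) {T : 𝓢'(Plane, F)} {k : ℤ}
    (hT : eLpNorm (L.block k T) p volume ≠ ⊤) (x e : Plane) :
    fderiv ℝ (L.block k T) x e
      = -T (∂_{e} (SchwartzMap.compSubConstCLM ℂ x (L.g k)) : 𝓢(Plane, ℂ)) := by
  have hs := L.spectral_block hp hT
  obtain ⟨M, hM⟩ := hs.bounded
  have h1 := (L.integral_smul_block k T
    (SchwartzMap.compSubConstCLM ℂ x (∂_{e} (L.gFat k) : 𝓢(Plane, ℂ)))).2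
  rw [SchwartzMap.conv_translate, SchwartzMap.conv_comm, ← SchwartzMap.lineDerivOp_conv,
    SchwartzMap.conv_comm, L.conv_gFat_g] at h1
  rw [SchwartzMap.lineDeriv_translate, ← h1, hs.fderiv_eq, ContinuousLinearMap.integral_apply
    ((L.κFatS k).integrable_fderiv_smulRight_sub hs.continuous.aestronglyMeasurable hM x),
    ← integral_neg]
  refine integral_congr_ae (Eventually.of_forall fun y => ?_)
  simp only [ContinuousLinearMap.smulRight_apply, SchwartzMap.compSubConstCLM_apply]
  rw [lineDeriv_apply_of_ofReal (K := L.κFatS k) (L.gFat_eq_κFat k), ← neg_sub,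
    fderiv_κFatS_neg, Complex.coe_smul, neg_smul]

theorem divergence_velBlock (hp : 1 ≤ p) {s : ℝ} (hV : besovNorm L s p 1 V ≠ ⊤)
    (hdiv : IsDivFree V) (k : ℤ) (x : Plane) : divergence (velBlock L V k) x = 0 := by
  have hs := L.spectral_block hp (L.eLpNorm_block_ne_top hV k)
  have h1 : HasFDerivAt (velBlock L V k) (rePlane.comp (fderiv ℝ (L.block k V) x)) x :=
    rePlane.hasFDerivAt.comp x (hs.differentiable x).hasFDerivAt
  have h2 := hdiv (SchwartzMap.compSubConstCLM ℂ x (L.g k))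
  simp only [TemperedDistribution.lineDerivOp_apply_apply, map_neg] at h2
  simp only [← fderiv_block_apply hp (L.eLpNorm_block_ne_top hV k)] at h2
  have h3 := congrArg Complex.re h2
  rw [Complex.re_sum, Complex.zero_re] at h3
  rw [divergence, h1.fderiv, ← h3]
  rfl

theorem blockPair_of_memBesov (hp : 1 ≤ p) (hq : 1 ≤ q)
    (hV : besovNorm L (twoOver p + 1) p 1 V ≠ ⊤) (hdiv : IsDivFree V)
    (hυ : IsRepresentedBy V fun x => complexify (υ x))
    (hA : besovNorm L (twoOver q) q 1 A ≠ ⊤) (hα : IsRepresentedBy A fun x => (α x : ℂ)) :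
    BlockPair L p q (velBlock L V) (scalBlock L A) where
  spectral_u := spectral_velBlock hp hV
  spectral_a := spectral_scalBlock hq hA
  divergence_u := divergence_velBlock hp hV hdiv
  sum_u := by rwa [tsum_blockSize_velBlock hυ]
  sum_a := by rwa [tsum_blockSize_scalBlock hα]

end Divergence

end RealBlocks

/-! ### Chain rule and Gronwall's inequality for primitives of integrable functions -/

section AbsolutelyContinuous

theorem LipschitzOnWith.comp_absolutelyContinuousOnInterval {β z : ℝ → ℝ} {K : NNReal} {S : Set ℝ}
    {s t : ℝ} (hβ : LipschitzOnWith K β S) (hz : AbsolutelyContinuousOnInterval z s t)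
    (hS : ∀ τ ∈ uIcc s t, z τ ∈ S) : AbsolutelyContinuousOnInterval (fun τ => β (z τ)) s t := by
  have h := Tendsto.const_mul (K : ℝ) hz
  rw [mul_zero] at h
  refine squeeze_zero' (Eventually.of_forall fun E => by positivity) ?_ h
  filter_upwards [Filter.eventually_inf_principal.mpr (Eventually.of_forall fun E hE => hE)]
    with E hE
  rw [Finset.mul_sum]
  refine Finset.sum_le_sum fun i hi => ?_
  have := hE.1 i hi
  exact hβ.dist_le_mul _ (hS _ this.1) _ (hS _ this.2)

theorem ContDiff.comp_absolutelyContinuousOnInterval {β z : ℝ → ℝ} {s t : ℝ}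
    (hβ : ContDiff ℝ 1 β) (hz : AbsolutelyContinuousOnInterval z s t) :
    AbsolutelyContinuousOnInterval (fun τ => β (z τ)) s t := by
  obtain ⟨C, hC⟩ := hz.exists_bound
  obtain ⟨K, hK⟩ := hβ.contDiffOn.exists_lipschitzOnWith one_ne_zero
    (convex_Icc (-C) C) isCompact_Icc
  exact hK.comp_absolutelyContinuousOnInterval hz fun τ hτ => abs_le.mp (hC τ hτ)

/-- The chain rule along a primitive of an integrable function. -/
theorem integral_deriv_comp_mul {β z G : ℝ → ℝ} (hβ : ContDiff ℝ 1 β) {s t : ℝ} (hst : s ≤ t)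
    (hG : IntervalIntegrable G volume s t) (hz : ∀ τ ∈ Icc s t, z τ = z s + ∫ r in s..τ, G r) :
    ∫ τ in s..t, deriv β (z τ) * G τ = β (z t) - β (z s) := by
  set y : ℝ → ℝ := fun τ => z s + ∫ r in s..τ, G r with hy
  have hac : AbsolutelyContinuousOnInterval y s t := by
    have h1 := hG.absolutelyContinuousOnInterval_intervalIntegral (c := s) left_mem_uIcc
    have h2 : AbsolutelyContinuousOnInterval (fun _ : ℝ => z s) s t :=
      (LipschitzWith.const (z s)).lipschitzOnWith.absolutelyContinuousOnInterval
    exact h2.fun_add h1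
  have h3 := (hβ.comp_absolutelyContinuousOnInterval hac).integral_deriv_eq_sub
  rw [hz t (right_mem_Icc.mpr hst)]
  have e : z s = y s := by simp [hy]
  rw [show β (z s) = β (y s) by rw [← e]]
  refine Eq.trans (intervalIntegral.integral_congr_ae ?_) h3
  filter_upwards [hG.ae_hasDerivAt_integral] with τ hτ hmem
  rw [uIoc_of_le hst] at hmem
  have hm : τ ∈ uIcc s t := by rw [uIcc_of_le hst]; exact Ioc_subset_Icc_self hmem
  have h4 : HasDerivAt y (G τ) τ := (hτ hm s left_mem_uIcc).const_add (z s)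
  have h5 : HasDerivAt (fun τ => β (y τ)) (deriv β (y τ) * G τ) τ :=
    ((hβ.differentiable one_ne_zero (y τ)).hasDerivAt).comp τ h4
  rw [h5.deriv, hz τ (Ioc_subset_Icc_self hmem)]

/-- Gronwall's inequality with an integrable coefficient, for the integral. -/
theorem add_integral_le_mul_exp {f γ : ℝ → ℝ} {A s t : ℝ} (hst : s ≤ t)
    (hγ : IntervalIntegrable γ volume s t)
    (hγf : IntervalIntegrable (fun τ => γ τ * f τ) volume s t) (hγ0 : ∀ τ, 0 ≤ γ τ)
    (h : ∀ τ ∈ Icc s t, f τ ≤ A + ∫ r in s..τ, γ r * f r) :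
    A + ∫ r in s..t, γ r * f r ≤ A * Real.exp (∫ r in s..t, γ r) := by
  set H : ℝ → ℝ := fun τ => A + ∫ r in s..τ, γ r * f r with hH
  set Γ : ℝ → ℝ := fun τ => ∫ r in s..τ, γ r with hΓ
  have h2 : AbsolutelyContinuousOnInterval (fun _ : ℝ => A) s t :=
    (LipschitzWith.const A).lipschitzOnWith.absolutelyContinuousOnInterval
  have acH : AbsolutelyContinuousOnInterval H s t :=
    h2.fun_add (hγf.absolutelyContinuousOnInterval_intervalIntegral (c := s) left_mem_uIcc)
  have acΓ : AbsolutelyContinuousOnInterval Γ s t :=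
    hγ.absolutelyContinuousOnInterval_intervalIntegral (c := s) left_mem_uIcc
  have hexp : ContDiff ℝ 1 fun x : ℝ => Real.exp (-x) := by fun_prop
  have acE := hexp.comp_absolutelyContinuousOnInterval acΓ
  have h3 := acH.integral_deriv_mul_eq_sub acE
  -- With the integrating factor `exp (-Γ)`, the derivative of `H exp (-Γ)` is `γ (f - H) exp (-Γ)`,
  -- which is nonpositive because `f ≤ H`.
  have h4 : ∫ τ in s..t, (deriv H τ * Real.exp (-Γ τ)
      + H τ * deriv (fun τ => Real.exp (-Γ τ)) τ) ≤ 0 := by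
    rw [intervalIntegral.integral_of_le hst]
    refine integral_nonpos_of_ae ?_
    refine (ae_restrict_iff' measurableSet_Ioc).mpr ?_
    filter_upwards [hγ.ae_hasDerivAt_integral, hγf.ae_hasDerivAt_integral] with τ h5 h6 hmem
    have hm : τ ∈ uIcc s t := by rw [uIcc_of_le hst]; exact Ioc_subset_Icc_self hmem
    have h7 : HasDerivAt Γ (γ τ) τ := h5 hm s left_mem_uIcc
    have h8 : HasDerivAt H (γ τ * f τ) τ := (h6 hm s left_mem_uIcc).const_add A
    have h9 : HasDerivAt (fun τ => Real.exp (-Γ τ)) (Real.exp (-Γ τ) * -γ τ) τ := h7.fun_neg.exp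
    rw [h8.deriv, show deriv (fun τ => Real.exp (-Γ τ)) τ = _ from h9.deriv]
    have h10 := h τ (Ioc_subset_Icc_self hmem)
    have h11 : 0 ≤ Real.exp (-Γ τ) * γ τ := mul_nonneg (Real.exp_pos _).le (hγ0 τ)
    simp only [Pi.zero_apply]
    have h12 : f τ ≤ H τ := h10
    nlinarith
  rw [h3] at h4
  have e1 : H s = A := by simp [hH]
  have e2 : Γ s = 0 := by simp [hΓ]
  rw [e1, e2, neg_zero, Real.exp_zero, mul_one] at h4
  have h6 := mul_le_mul_of_nonneg_right (sub_nonpos.mp h4) (Real.exp_pos (Γ t)).le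
  rwa [mul_assoc, ← Real.exp_add, neg_add_cancel, Real.exp_zero, mul_one] at h6

/-- Gronwall's inequality with an integrable coefficient. -/
theorem le_mul_exp_of_le_integral {f γ : ℝ → ℝ} {A s t : ℝ} (hst : s ≤ t)
    (hγ : IntervalIntegrable γ volume s t)
    (hγf : IntervalIntegrable (fun τ => γ τ * f τ) volume s t) (hγ0 : ∀ τ, 0 ≤ γ τ)
    (h : ∀ τ ∈ Icc s t, f τ ≤ A + ∫ r in s..τ, γ r * f r) :
    f t ≤ A * Real.exp (∫ r in s..t, γ r) :=
  (h t (right_mem_Icc.mpr hst)).trans (add_integral_le_mul_exp hst hγ hγf hγ0 h)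

theorem ofReal_integral_le_lintegral {X : Type*} [MeasurableSpace X] {μ : Measure X} (f : X → ℝ) :
    ENNReal.ofReal (∫ x, f x ∂μ) ≤ ∫⁻ x, ENNReal.ofReal (f x) ∂μ := by
  by_cases hf : Integrable f μ
  · rw [integral_eq_lintegral_pos_part_sub_lintegral_neg_part hf]
    refine (ENNReal.ofReal_le_ofReal (sub_le_self _ ENNReal.toReal_nonneg)).trans ?_
    exact ENNReal.ofReal_toReal_le
  · rw [integral_undef hf, ENNReal.ofReal_zero]
    exact zero_le

end AbsolutelyContinuous

/-! ### Spatial cut-offs and weights adapted to velocities of linear growth -/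

section CutOffs

/-- A smooth cut-off function at scale `n + 1`. -/
def cutOff (n : ℕ) (x : Plane) : ℝ :=
  (⟨1, 2, one_pos, one_lt_two⟩ : ContDiffBump (0 : Plane)) ((n + 1 : ℝ)⁻¹ • x)

theorem cutOff_contDiff (n : ℕ) : ContDiff ℝ ∞ (cutOff n) :=
  (ContDiffBump.contDiff _).comp (contDiff_const_smul _)

theorem cutOff_nonneg (n : ℕ) (x : Plane) : 0 ≤ cutOff n x := ContDiffBump.nonneg _

theorem cutOff_le_one (n : ℕ) (x : Plane) : cutOff n x ≤ 1 := ContDiffBump.le_one _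

theorem norm_inv_smul (n : ℕ) (x : Plane) : ‖(n + 1 : ℝ)⁻¹ • x‖ = ‖x‖ / (n + 1) := by
  rw [norm_smul, norm_inv, Real.norm_of_nonneg (by positivity), inv_mul_eq_div]

theorem cutOff_eq_one {n : ℕ} {x : Plane} (h : ‖x‖ ≤ n + 1) : cutOff n x = 1 := by
  refine ContDiffBump.one_of_mem_closedBall _ ?_
  rw [mem_closedBall_zero_iff, norm_inv_smul]
  exact div_le_one_of_le₀ h (by positivity)

theorem cutOff_eq_zero {n : ℕ} {x : Plane} (h : 2 * (n + 1) ≤ ‖x‖) : cutOff n x = 0 := by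
  refine ContDiffBump.zero_of_le_dist _ ?_
  rw [dist_zero_right, norm_inv_smul, le_div_iff₀ (by positivity)]
  exact h

theorem cutOff_hasCompactSupport (n : ℕ) : HasCompactSupport (cutOff n) := by
  refine HasCompactSupport.of_support_subset_isCompact
    (isCompact_closedBall (0 : Plane) (2 * (n + 1))) fun x hx => ?_
  rw [mem_closedBall_zero_iff]
  by_contra! h
  exact hx (cutOff_eq_zero h.le)

theorem tendsto_cutOff (x : Plane) : Tendsto (fun n => cutOff n x) atTop (𝓝 1) := by
  refine tendsto_const_nhds.congr' ?_
  filter_upwards [eventually_ge_atTop ⌈‖x‖⌉₊] with n hn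
  refine (cutOff_eq_one ?_).symm
  have := (Nat.le_ceil ‖x‖).trans (Nat.cast_le.mpr hn)
  linarith

theorem fderiv_cutOff_eq_zero {n : ℕ} {x : Plane} (h : ‖x‖ < n + 1) : fderiv ℝ (cutOff n) x = 0 := by
  have : cutOff n =ᶠ[𝓝 x] fun _ => 1 := by
    filter_upwards [(isOpen_lt continuous_norm continuous_const).mem_nhds h] with y hy
    exact cutOff_eq_one (le_of_lt hy)
  rw [this.fderiv_eq]
  simp

/-- The gradient has size `1 / (n + 1)` and lives where `‖x‖ ≤ 2 (n + 1)`. Multiplied by a velocity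
of linear growth it stays bounded uniformly in `n`. -/
theorem exists_fderiv_cutOff_le :
    ∃ C : ℝ, 0 ≤ C ∧ ∀ (n : ℕ) (x : Plane), ‖fderiv ℝ (cutOff n) x‖ * (1 + ‖x‖) ≤ C := by
  set b : ContDiffBump (0 : Plane) := ⟨1, 2, one_pos, one_lt_two⟩ with hb
  have hbd : ContDiff ℝ 1 b := b.contDiff
  obtain ⟨C, hC⟩ := (hbd.continuous_fderiv one_ne_zero).bounded_above_of_compact_support
    (b.hasCompactSupport.fderiv (𝕜 := ℝ))
  have hC0 : 0 ≤ C := (norm_nonneg _).trans (hC 0)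
  refine ⟨3 * C, by positivity, fun n x => ?_⟩
  have hn : (0 : ℝ) < n + 1 := by positivity
  have h1 : HasFDerivAt (cutOff n)
      ((fderiv ℝ b ((n + 1 : ℝ)⁻¹ • x)).comp ((n + 1 : ℝ)⁻¹ • ContinuousLinearMap.id ℝ Plane)) x :=
    (hbd.differentiable one_ne_zero _).hasFDerivAt.comp x
      ((n + 1 : ℝ)⁻¹ • ContinuousLinearMap.id ℝ Plane).hasFDerivAt
  rw [ContinuousLinearMap.comp_smul, ContinuousLinearMap.comp_id] at h1
  by_cases h : 2 * (n + 1) < ‖x‖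
  · have : cutOff n =ᶠ[𝓝 x] fun _ => 0 := by
      filter_upwards [(isOpen_lt continuous_const continuous_norm).mem_nhds h] with y hy
      exact cutOff_eq_zero (le_of_lt hy)
    rw [this.fderiv_eq]
    simpa using hC0
  · push Not at h
    rw [h1.fderiv, norm_smul, norm_inv, Real.norm_of_nonneg hn.le]
    calc (n + 1 : ℝ)⁻¹ * ‖fderiv ℝ b ((n + 1 : ℝ)⁻¹ • x)‖ * (1 + ‖x‖)
        ≤ (n + 1 : ℝ)⁻¹ * C * (3 * (n + 1)) := by
          gcongr
          · exact hC _
          · have : (0 : ℝ) ≤ n := n.cast_nonneg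
            linarith
      _ = 3 * C := by field_simp

/-- An integrable weight with slowly varying logarithm. -/
def slowWeight (x : Plane) : ℝ := ((1 + ‖x‖ ^ 2) ^ 2)⁻¹

theorem slowWeight_pos (x : Plane) : 0 < slowWeight x := by unfold slowWeight; positivity

theorem slowWeight_contDiff : ContDiff ℝ ∞ slowWeight := by
  refine ContDiff.inv ((contDiff_const.add (contDiff_norm_sq ℝ)).pow 2) fun x => ?_
  positivity

/-- Transport by a velocity of linear growth changes the weight by at most a multiple of itself, so
weighted integrals satisfy a Gronwall inequality. -/
theorem norm_fderiv_slowWeight_le (x : Plane) :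
    ‖fderiv ℝ slowWeight x‖ * (1 + ‖x‖) ≤ 8 * slowWeight x := by
  set r := ‖x‖ with hr
  have r0 : 0 ≤ r := norm_nonneg x
  have hp : (0 : ℝ) < 1 + r ^ 2 := by positivity
  have h1 : HasFDerivAt (fun x : Plane => ‖x‖ ^ 2) (2 • innerSL ℝ x) x :=
    (hasStrictFDerivAt_norm_sq x).hasFDerivAt
  have h2 : HasFDerivAt (fun x : Plane => (1 + ‖x‖ ^ 2) ^ 2)
      ((2 * (1 + r ^ 2)) • (2 • innerSL ℝ x)) x := by
    have := (h1.const_add 1).pow 2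
    refine this.congr_fderiv ?_
    rw [pow_one, nsmul_eq_mul, Nat.cast_ofNat]
  have h3 : HasFDerivAt slowWeight
      ((-((1 + r ^ 2) ^ 2 : ℝ) ^ 2)⁻¹ • ((2 * (1 + r ^ 2)) • (2 • innerSL ℝ x))) x := by
    have h4 : HasDerivAt (fun y : ℝ => y⁻¹) (-((1 + r ^ 2) ^ 2 : ℝ) ^ 2)⁻¹ ((1 + ‖x‖ ^ 2) ^ 2) := by
      have := hasDerivAt_inv (x := (1 + ‖x‖ ^ 2) ^ 2) (by positivity)
      rw [inv_neg]
      simpa using this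
    exact h4.comp_hasFDerivAt x h2
  rw [h3.fderiv, norm_smul, norm_smul, ← Nat.cast_smul_eq_nsmul ℝ, norm_smul, innerSL_apply_norm,
    norm_inv, norm_neg, Real.norm_of_nonneg (by positivity), Real.norm_of_nonneg (by positivity),
    ← hr]
  have e : slowWeight x = ((1 + r ^ 2) ^ 2)⁻¹ := rfl
  rw [e]
  have h5 : r * (1 + r) ≤ 2 * (1 + r ^ 2) := by nlinarith
  rw [← sub_nonneg]
  have : 8 * ((1 + r ^ 2) ^ 2)⁻¹ - (((1 + r ^ 2) ^ 2) ^ 2)⁻¹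
      * (2 * (1 + r ^ 2) * (‖((2 : ℕ) : ℝ)‖ * r)) * (1 + r)
      = 4 * (((1 + r ^ 2) ^ 2) ^ 2)⁻¹ * (1 + r ^ 2) * (2 * (1 + r ^ 2) - r * (1 + r)) := by
    have : ‖((2 : ℕ) : ℝ)‖ = 2 := by norm_num
    rw [this]
    field_simp
    ring
  rw [this]
  have := sub_nonneg.mpr h5
  positivity

theorem lintegral_slowWeight_ne_top : ∫⁻ x, ENNReal.ofReal (slowWeight x) ≠ ⊤ := by
  have h : Integrable slowWeight := by
    refine (integrable_japanese.const_mul 8).mono'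
      slowWeight_contDiff.continuous.aestronglyMeasurable (Eventually.of_forall fun x => ?_)
    rw [Real.norm_of_nonneg (slowWeight_pos x).le]
    have h0 : (0 : ℝ) < 1 + ‖x‖ := by positivity
    rw [Real.rpow_neg h0.le, show (3 : ℝ) = ((3 : ℕ) : ℝ) by norm_num, Real.rpow_natCast,
      ← div_eq_mul_inv, slowWeight, inv_eq_one_div, div_le_div_iff₀ (by positivity) (by positivity)]
    have r0 := norm_nonneg x
    have h1 : (1 + ‖x‖) ^ 2 ≤ 2 * (1 + ‖x‖ ^ 2) := by nlinarith [sq_nonneg (1 - ‖x‖)]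
    have h2 : (1 + ‖x‖) ^ 4 ≤ 4 * (1 + ‖x‖ ^ 2) ^ 2 := by nlinarith [sq_nonneg (1 + ‖x‖)]
    have h3 : (1 + ‖x‖) ^ 3 ≤ (1 + ‖x‖) ^ 4 := pow_le_pow_right₀ (by linarith) (by norm_num)
    nlinarith [sq_nonneg (1 + ‖x‖ ^ 2)]
  exact h.lintegral_lt_top.ne

/-- The product of a cut-off function and the slow weight. -/
def cutWeight (n : ℕ) (x : Plane) : ℝ := cutOff n x * slowWeight x

theorem cutWeight_contDiff (n : ℕ) : ContDiff ℝ 1 (cutWeight n) :=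
  ((cutOff_contDiff n).mul slowWeight_contDiff).of_le (by exact_mod_cast le_top)

theorem exists_fderiv_cutWeight_le :
    ∃ C : ℝ, 0 ≤ C ∧ ∀ (n : ℕ) (x : Plane),
      ‖fderiv ℝ (cutWeight n) x‖ * (1 + ‖x‖) ≤ C * slowWeight x := by
  obtain ⟨C, hC, h⟩ := exists_fderiv_cutOff_le
  refine ⟨C + 8, by positivity, fun n x => ?_⟩
  have h1 : HasFDerivAt (cutWeight n)
      (cutOff n x • fderiv ℝ slowWeight x + slowWeight x • fderiv ℝ (cutOff n) x) x :=
    ((cutOff_contDiff n).differentiable (by simp) x).hasFDerivAt.mul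
      (slowWeight_contDiff.differentiable (by simp) x).hasFDerivAt
  rw [h1.fderiv]
  have hw := slowWeight_pos x
  have hx : (0 : ℝ) < 1 + ‖x‖ := by positivity
  calc _ ≤ (cutOff n x * ‖fderiv ℝ slowWeight x‖ + slowWeight x * ‖fderiv ℝ (cutOff n) x‖)
        * (1 + ‖x‖) := by
        gcongr
        refine (norm_add_le _ _).trans ?_
        rw [norm_smul, norm_smul, Real.norm_of_nonneg (cutOff_nonneg n x),
          Real.norm_of_nonneg hw.le]
    _ = cutOff n x * (‖fderiv ℝ slowWeight x‖ * (1 + ‖x‖))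
        + slowWeight x * (‖fderiv ℝ (cutOff n) x‖ * (1 + ‖x‖)) := by ring
    _ ≤ 1 * (8 * slowWeight x) + slowWeight x * C := by
        exact add_le_add (mul_le_mul (cutOff_le_one n x) (norm_fderiv_slowWeight_le x)
          (by positivity) zero_le_one) (mul_le_mul_of_nonneg_left (h n x) hw.le)
    _ = _ := by ring

end CutOffs

/-! ### Transport of smooth functions and the energy inequality -/

section SmoothTransport

/-- A function `b` of class `C¹` in space which is the primitive in time of `F`, where
`F = R - υ · ∇b` for a divergence free field `υ` of at most linear growth. -/
structure SmoothTransport (s t : ℝ) (b F R : ℝ → Plane → ℝ) (υ : ℝ → Plane → Plane)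
    (g : ℝ → ℝ) : Prop where
  le : s ≤ t
  contDiff : ∀ τ ∈ Icc s t, ContDiff ℝ 1 (b τ)
  bounded : ∃ M, ∀ τ ∈ Icc s t, ∀ x, |b τ x| ≤ M
  continuousOn : ContinuousOn (fun z : ℝ × Plane => b z.1 z.2) (Icc s t ×ˢ univ)
  aestronglyMeasurable :
    AEStronglyMeasurable (fun z : ℝ × Plane => F z.1 z.2) ((volume.restrict (Ioc s t)).prod volume)
  integrableOn : IntegrableOn g (Ioc s t)
  abs_le : ∀ᵐ τ ∂(volume.restrict (Ioc s t)), ∀ x, |F τ x| ≤ g τ * (1 + ‖x‖)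
  norm_le : ∀ᵐ τ ∂(volume.restrict (Ioc s t)), ∀ x, ‖υ τ x‖ ≤ g τ * (1 + ‖x‖)
  continuous : ∀ᵐ τ ∂(volume.restrict (Ioc s t)), Continuous (υ τ)
  integral_fderiv : ∀ᵐ τ ∂(volume.restrict (Ioc s t)), ∀ η : Plane → ℝ, ContDiff ℝ 1 η →
    HasCompactSupport η → ∫ x, fderiv ℝ η x (υ τ x) = 0
  eq_add : ∀ᵐ τ ∂(volume.restrict (Ioc s t)), ∀ x, R τ x = F τ x + fderiv ℝ (b τ) x (υ τ x)
  primitive : ∀ᵐ x : Plane, ∀ τ ∈ Icc s t, b τ x = b s x + ∫ r in s..τ, F r x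

namespace SmoothTransport

variable {s t : ℝ} {b F R : ℝ → Plane → ℝ} {υ : ℝ → Plane → Plane} {g : ℝ → ℝ}

theorem restrict (h : SmoothTransport s t b F R υ g) {t' : ℝ} (ht : t' ∈ Icc s t) :
    SmoothTransport s t' b F R υ g := by
  have h1 : Icc s t' ⊆ Icc s t := Icc_subset_Icc_right ht.2
  have h2 : Ioc s t' ⊆ Ioc s t := Ioc_subset_Ioc_right ht.2
  have h3 : volume.restrict (Ioc s t') ≤ volume.restrict (Ioc s t) :=
    Measure.restrict_mono h2 le_rfl
  have h4 := ae_mono h3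
  refine ⟨ht.1, fun τ hτ => h.contDiff τ (h1 hτ), ?_, ?_, ?_, h.integrableOn.mono_set h2,
    h4 h.abs_le, h4 h.norm_le, h4 h.continuous, h4 h.integral_fderiv, h4 h.eq_add,
    h.primitive.mono fun x hx τ hτ => hx τ (h1 hτ)⟩
  · obtain ⟨M, hM⟩ := h.bounded
    exact ⟨M, fun τ hτ => hM τ (h1 hτ)⟩
  · exact h.continuousOn.mono (prod_mono h1 subset_rfl)
  · exact h.aestronglyMeasurable.mono_measure (Measure.prod_mono h3 le_rfl)

theorem neg (h : SmoothTransport s t b F R υ g) :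
    SmoothTransport s t (fun τ x => -b τ x) (fun τ x => -F τ x) (fun τ x => -R τ x) υ g := by
  refine ⟨h.le, fun τ hτ => (h.contDiff τ hτ).neg, ?_, h.continuousOn.neg,
    h.aestronglyMeasurable.neg, h.integrableOn, ?_, h.norm_le, h.continuous, h.integral_fderiv,
    ?_, h.primitive.mono fun x hx τ hτ => ?_⟩
  · obtain ⟨M, hM⟩ := h.bounded
    exact ⟨M, fun τ hτ x => by rw [abs_neg]; exact hM τ hτ x⟩
  · filter_upwards [h.abs_le] with τ hτ x
    rw [abs_neg]
    exact hτ x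
  · filter_upwards [h.eq_add] with τ hτ x
    rw [hτ x, fderiv_fun_neg, _root_.neg_apply]
    ring
  · rw [hx τ hτ, intervalIntegral.integral_neg]
    ring

theorem integrable_time (h : SmoothTransport s t b F R υ g) :
    ∀ᵐ x : Plane, IntegrableOn (fun τ => F τ x) (Ioc s t) := by
  have h1 := h.aestronglyMeasurable.prod_swap.prodMk_left
  filter_upwards [h1] with x hx
  refine (h.integrableOn.mul_const (1 + ‖x‖)).mono' hx ?_
  filter_upwards [h.abs_le] with τ hτ
  exact hτ x

/-- A function of time alone is not affected by the transport, so subtracting a primitive of `k`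
subtracts `k` from the source. Upper bounds are thereby reduced to a statement about signs. -/
theorem sub_primitive (h : SmoothTransport s t b F R υ g) {k : ℝ → ℝ}
    (hk : IntegrableOn k (Ioc s t)) (N : ℝ) :
    SmoothTransport s t (fun τ x => b τ x - (N + ∫ r in s..τ, k r)) (fun τ x => F τ x - k τ)
      (fun τ x => R τ x - k τ) υ (fun τ => g τ + |k τ|) := by
  have hki : IntervalIntegrable k volume s t := (intervalIntegrable_iff_integrableOn_Ioc_of_le h.le).mpr hk
  have hc : ContinuousOn (fun τ => N + ∫ r in s..τ, k r) (Icc s t) := by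
    have h0 := intervalIntegral.continuousOn_primitive_interval
      ((intervalIntegrable_iff').mp hki)
    rw [uIcc_of_le h.le] at h0
    exact continuousOn_const.add h0
  have hcs : ContinuousOn (fun z : ℝ × Plane => N + ∫ r in s..z.1, k r) (Icc s t ×ˢ univ) :=
    hc.comp continuous_fst.continuousOn fun z hz => hz.1
  have hg0 : ∀ᵐ τ ∂(volume.restrict (Ioc s t)), 0 ≤ g τ := by
    filter_upwards [h.abs_le] with τ hτ
    simpa using (abs_nonneg _).trans (hτ 0)
  refine ⟨h.le, fun τ hτ => (h.contDiff τ hτ).sub contDiff_const, ?_, h.continuousOn.sub hcs,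
    h.aestronglyMeasurable.sub hk.aestronglyMeasurable.comp_fst, h.integrableOn.add hk.abs, ?_, ?_,
    h.continuous, h.integral_fderiv, ?_, (h.primitive.and h.integrable_time).mono fun x hx τ hτ => ?_⟩
  · obtain ⟨M, hM⟩ := h.bounded
    obtain ⟨M', hM'⟩ := isCompact_Icc.exists_bound_of_continuousOn hc
    exact ⟨M + M', fun τ hτ x => (abs_sub _ _).trans (add_le_add (hM τ hτ x) (hM' τ hτ))⟩
  · filter_upwards [h.abs_le] with τ hτ x
    have h1 := hτ x
    have h2 := abs_sub (F τ x) (k τ)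
    have h3 := mul_nonneg (abs_nonneg (k τ)) (norm_nonneg x)
    nlinarith
  · filter_upwards [h.norm_le] with τ hτ x
    refine (hτ x).trans (mul_le_mul_of_nonneg_right ?_ (by positivity))
    linarith [abs_nonneg (k τ)]
  · filter_upwards [h.eq_add] with τ hτ x
    rw [hτ x, fderiv_sub_const]
    ring
  · have hsub : Ioc s τ ⊆ Ioc s t := Ioc_subset_Ioc_right hτ.2
    rw [intervalIntegral.integral_sub, hx.1 τ hτ, intervalIntegral.integral_same]
    · ring
    · exact (intervalIntegrable_iff_integrableOn_Ioc_of_le hτ.1).mpr (hx.2.mono_set hsub)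
    · exact (intervalIntegrable_iff_integrableOn_Ioc_of_le hτ.1).mpr (hk.mono_set hsub)

theorem aemeasurable_comp (h : SmoothTransport s t b F R υ g) {β : ℝ → ℝ} (hβ : Continuous β) :
    AEStronglyMeasurable (fun z : ℝ × Plane => β (b z.1 z.2))
      ((volume.restrict (Ioc s t)).prod volume) := by
  rw [← Measure.restrict_univ (μ := (volume : Measure Plane)), Measure.prod_restrict]
  refine ContinuousOn.aestronglyMeasurable ?_ (measurableSet_Ioc.prod MeasurableSet.univ)
  exact hβ.comp_continuousOn (h.continuousOn.mono (prod_mono Ioc_subset_Icc_self subset_rfl))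

/-- The energy inequality for a nonlinear function `β` and a spatial weight `Z`. -/
theorem lintegral_le (h : SmoothTransport s t b F R υ g) {β : ℝ → ℝ} (hβ : ContDiff ℝ 1 β)
    (hβ0 : ∀ z, 0 ≤ β z) {Z : Plane → ℝ} (hZ : ContDiff ℝ 1 Z) (hZc : HasCompactSupport Z)
    (hZ0 : ∀ x, 0 ≤ Z x) {ρ : ℝ → ℝ≥0∞}
    (hρ : ∀ᵐ τ ∂(volume.restrict (Ioc s t)),
      (∫⁻ x, ENNReal.ofReal (Z x * (deriv β (b τ x) * R τ x)))
        + ∫⁻ x, ‖β (b τ x)‖ₑ * ‖fderiv ℝ Z x (υ τ x)‖ₑ ≤ ρ τ) :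
    ∫⁻ x, ENNReal.ofReal (Z x * β (b t x))
      ≤ (∫⁻ x, ENNReal.ofReal (Z x * β (b s x))) + ∫⁻ τ in Ioc s t, ρ τ := by
  obtain ⟨M, hM⟩ := h.bounded
  have hdβ : Continuous (deriv β) := hβ.continuous_deriv le_rfl
  obtain ⟨B, hB⟩ := (isCompact_Icc (a := -M) (b := M)).exists_bound_of_continuousOn
    hdβ.continuousOn
  have hBb : ∀ τ ∈ Icc s t, ∀ x, ‖deriv β (b τ x)‖ ≤ B := fun τ hτ x =>
    hB _ (_root_.abs_le.mp (hM τ hτ x))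
  have hB0 : 0 ≤ B := (norm_nonneg _).trans (hBb s (left_mem_Icc.mpr h.le) 0)
  have hmem : ∀ᵐ τ ∂(volume.restrict (Ioc s t)), τ ∈ Ioc s t := ae_restrict_mem measurableSet_Ioc
  set Φ : ℝ × Plane → ℝ := fun z => Z z.2 * (deriv β (b z.1 z.2) * F z.1 z.2) with hΦ
  have hZint : Integrable fun x => Z x * (1 + ‖x‖) := by
    refine Continuous.integrable_of_hasCompactSupport ?_ hZc.mul_right
    exact hZ.continuous.mul (continuous_const.add continuous_norm)
  have hΦi : Integrable Φ ((volume.restrict (Ioc s t)).prod volume) := by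
    refine ((h.integrableOn.const_mul B).mul_prod hZint).mono' ?_ ?_
    · exact (hZ.continuous.comp continuous_snd).aestronglyMeasurable.mul
        ((h.aemeasurable_comp hdβ).mul h.aestronglyMeasurable)
    · have h1 : ∀ᵐ z ∂((volume.restrict (Ioc s t)).prod (volume : Measure Plane)),
          z.1 ∈ Ioc s t ∧ ∀ x, |F z.1 x| ≤ g z.1 * (1 + ‖x‖) :=
        Measure.quasiMeasurePreserving_fst.ae (hmem.and h.abs_le)
      filter_upwards [h1] with z hz
      rw [hΦ, norm_mul, norm_mul, Real.norm_of_nonneg (hZ0 _)]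
      have h2 := hBb z.1 (Ioc_subset_Icc_self hz.1) z.2
      calc Z z.2 * (‖deriv β (b z.1 z.2)‖ * ‖F z.1 z.2‖)
          ≤ Z z.2 * (B * (g z.1 * (1 + ‖z.2‖))) :=
            mul_le_mul_of_nonneg_left (mul_le_mul h2 (hz.2 z.2) (norm_nonneg _) hB0) (hZ0 _)
        _ = _ := by ring
  have hint : ∀ τ ∈ Icc s t, Integrable fun x => Z x * β (b τ x) := fun τ hτ =>
    (hZ.continuous.mul (hβ.continuous.comp (h.contDiff τ hτ).continuous)).integrable_of_hasCompactSupport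
      hZc.mul_right
  have hs : s ∈ Icc s t := left_mem_Icc.mpr h.le
  have ht : t ∈ Icc s t := right_mem_Icc.mpr h.le
  -- For almost every fixed `x` the chain rule holds along the primitive in time; Fubini's theorem,
  -- justified by the integrability of `Φ`, then exchanges the integrals.
  have key : ∫ x, Z x * β (b t x)
      = (∫ x, Z x * β (b s x)) + ∫ τ in Ioc s t, ∫ x, Φ (τ, x) := by
    rw [integral_integral_swap (f := fun τ x => Φ (τ, x)) hΦi, ← integral_add (hint s hs)
      hΦi.integral_prod_right]
    refine integral_congr_ae ?_
    filter_upwards [h.integrable_time, h.primitive] with x hx hx'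
    have h1 := integral_deriv_comp_mul hβ h.le
      ((intervalIntegrable_iff_integrableOn_Ioc_of_le h.le).mpr hx) (z := fun τ => b τ x)
      hx'
    rw [intervalIntegral.integral_of_le h.le] at h1
    simp only [hΦ]
    rw [integral_const_mul, h1]
    ring
  have hslice : ∀ᵐ τ ∂(volume.restrict (Ioc s t)), Integrable fun x => Φ (τ, x) :=
    hΦi.prod_right_ae
  have hτ : ∀ᵐ τ ∂(volume.restrict (Ioc s t)), ENNReal.ofReal (∫ x, Φ (τ, x)) ≤ ρ τ := by
    filter_upwards [hρ, hslice, hmem, h.continuous, h.integral_fderiv, h.eq_add]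
      with τ h1 h2 h3 h4 h5 h6
    have hb := h.contDiff τ (Ioc_subset_Icc_self h3)
    have hη : ContDiff ℝ 1 fun x => Z x * β (b τ x) := hZ.mul (hβ.comp hb)
    have hd : ∀ x, fderiv ℝ (fun x => Z x * β (b τ x)) x (υ τ x)
        = Z x * (deriv β (b τ x) * fderiv ℝ (b τ) x (υ τ x))
          + β (b τ x) * fderiv ℝ Z x (υ τ x) := by
      intro x
      have e1 : HasFDerivAt (fun x => β (b τ x)) (deriv β (b τ x) • fderiv ℝ (b τ) x) x :=
        ((hβ.differentiable one_ne_zero (b τ x)).hasDerivAt).comp_hasFDerivAt x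
          (hb.differentiable one_ne_zero x).hasFDerivAt
      rw [((hZ.differentiable one_ne_zero x).hasFDerivAt.fun_mul e1).fderiv]
      rfl
    have i1 : Integrable fun x => fderiv ℝ (fun x => Z x * β (b τ x)) x (υ τ x) := by
      refine Continuous.integrable_of_hasCompactSupport
        ((hη.continuous_fderiv one_ne_zero).clm_apply h4) ?_
      have h0 : HasCompactSupport fun x => Z x * β (b τ x) := hZc.mul_right
      refine (h0.fderiv (𝕜 := ℝ)).mono fun x hx hx' => hx ?_
      simp only
      rw [hx', _root_.zero_apply]
    have i2 : Integrable fun x => β (b τ x) * fderiv ℝ Z x (υ τ x) := by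
      refine Continuous.integrable_of_hasCompactSupport ((hβ.continuous.comp hb.continuous).mul
        ((hZ.continuous_fderiv one_ne_zero).clm_apply h4)) ?_
      refine (hZc.fderiv (𝕜 := ℝ)).mono fun x hx hx' => hx ?_
      simp only
      rw [hx', _root_.zero_apply, mul_zero]
    have e2 : ∀ x, Z x * (deriv β (b τ x) * R τ x) = Φ (τ, x)
        + fderiv ℝ (fun x => Z x * β (b τ x)) x (υ τ x)
        - β (b τ x) * fderiv ℝ Z x (υ τ x) := by
      intro x
      rw [hd, h6 x, hΦ]
      ring
    have i3 : Integrable fun x => Z x * (deriv β (b τ x) * R τ x) := by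
      simp only [e2]
      exact (h2.add i1).sub i2
    -- `Z β(b)` is an admissible test function for the weak divergence condition, so the whole
    -- transport term disappears and only the derivative of the weight remains.
    have e3 : ∫ x, Φ (τ, x) = (∫ x, Z x * (deriv β (b τ x) * R τ x))
        + ∫ x, β (b τ x) * fderiv ℝ Z x (υ τ x) := by
      have e4 : ∫ x, Z x * (deriv β (b τ x) * R τ x) = (∫ x, Φ (τ, x))
        + (∫ x, fderiv ℝ (fun x => Z x * β (b τ x)) x (υ τ x))
        - ∫ x, β (b τ x) * fderiv ℝ Z x (υ τ x) := by
        rw [← integral_add h2 i1, ← integral_sub (by exact h2.add i1) i2]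
        exact integral_congr_ae (Eventually.of_forall e2)
      rw [e4, h5 _ hη hZc.mul_right]
      ring
    rw [e3]
    refine ENNReal.ofReal_add_le.trans (le_trans (add_le_add (ofReal_integral_le_lintegral _) ?_) h1)
    refine (ofReal_integral_le_lintegral _).trans (lintegral_mono fun x => ?_)
    rw [← enorm_mul]
    exact Real.ofReal_le_enorm _
  have hpos : ∀ τ, 0 ≤ᵐ[volume] fun x => Z x * β (b τ x) := fun τ =>
    Eventually.of_forall fun x => mul_nonneg (hZ0 x) (hβ0 _)
  rw [← ofReal_integral_eq_lintegral_ofReal (hint t ht) (hpos t),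
    ← ofReal_integral_eq_lintegral_ofReal (hint s hs) (hpos s), key]
  refine ENNReal.ofReal_add_le.trans (add_le_add le_rfl ?_)
  exact (ofReal_integral_le_lintegral _).trans (lintegral_mono_ae hτ)

end SmoothTransport

end SmoothTransport

/-! ### The `L^q` estimate for finite `q` -/

section EnergyEstimate

theorem lintegral_le_of_tendsto {X : Type*} [MeasurableSpace X] {μ : Measure X}
    {f : ℕ → X → ℝ≥0∞} {f' : X → ℝ≥0∞} {c : ℕ → ℝ≥0∞} {c' : ℝ≥0∞} (hf : ∀ n, AEMeasurable (f n) μ)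
    (hlim : ∀ x, Tendsto (fun n => f n x) atTop (𝓝 (f' x))) (hc : ∀ n, ∫⁻ x, f n x ∂μ ≤ c n)
    (hclim : Tendsto c atTop (𝓝 c')) : ∫⁻ x, f' x ∂μ ≤ c' := by
  calc ∫⁻ x, f' x ∂μ = ∫⁻ x, liminf (fun n => f n x) atTop ∂μ :=
        lintegral_congr fun x => (hlim x).liminf_eq.symm
    _ ≤ liminf (fun n => ∫⁻ x, f n x ∂μ) atTop := lintegral_liminf_le' hf
    _ ≤ liminf c atTop := liminf_le_liminf (Eventually.of_forall hc)
    _ = c' := hclim.liminf_eq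

/-- Functions of class `C¹` which approximate `|z| ^ r`. -/
theorem exists_contDiff_tendsto_rpow {r : ℝ} (hr : 1 ≤ r) :
    ∃ β : ℕ → ℝ → ℝ, (∀ n, ContDiff ℝ 1 (β n)) ∧ (∀ n z, 0 ≤ β n z) ∧
      (∀ n z, β n z ≤ |z| ^ r) ∧ (∀ n z, |deriv (β n) z| ≤ r * |z| ^ (r - 1)) ∧
      ∀ z, Tendsto (fun n => β n z) atTop (𝓝 (|z| ^ r)) := by
  rcases hr.eq_or_lt with rfl | hr
  · have hε : ∀ n : ℕ, (0 : ℝ) < 1 / (n + 1) := fun n => by positivity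
    have hp : ∀ (n : ℕ) (z : ℝ), (1 / (n + 1 : ℝ)) ^ 2 + z ^ 2 ≠ 0 := fun n z => by
      have := hε n
      positivity
    -- Only `|z|` itself fails to be `C¹`. It is replaced by `√(ε² + z²) - ε`, where subtracting `ε`
    -- keeps the function below `|z|` and zero at the origin.
    refine ⟨fun n z => √((1 / (n + 1 : ℝ)) ^ 2 + z ^ 2) - 1 / (n + 1), fun n => ?_, fun n z => ?_,
      fun n z => ?_, fun n z => ?_, fun z => ?_⟩
    · exact (ContDiff.sqrt (contDiff_const.add (contDiff_id.pow 2)) (hp n)).sub contDiff_const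
    · rw [sub_nonneg]
      exact Real.le_sqrt_of_sq_le (by nlinarith [sq_nonneg z])
    · rw [Real.rpow_one, sub_le_iff_le_add]
      refine Real.sqrt_le_iff.mpr ⟨by have := (hε n).le; positivity, ?_⟩
      have := mul_nonneg (abs_nonneg z) (hε n).le
      nlinarith [sq_abs z]
    · have h1 : HasDerivAt (fun z : ℝ => (1 / (n + 1 : ℝ)) ^ 2 + z ^ 2) (2 * z) z := by
        simpa using ((hasDerivAt_id z).pow 2).const_add ((1 / (n + 1 : ℝ)) ^ 2)
      rw [((h1.sqrt (hp n z)).sub_const _).deriv, sub_self, Real.rpow_zero, mul_one, abs_div,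
        abs_mul, abs_mul, abs_two, abs_of_nonneg (Real.sqrt_nonneg _)]
      refine div_le_one_of_le₀ ?_ (by positivity)
      refine mul_le_mul_of_nonneg_left ?_ zero_le_two
      refine Real.le_sqrt_of_sq_le ?_
      rw [sq_abs]
      linarith [sq_nonneg (1 / (n + 1 : ℝ))]
    · have h1 : Tendsto (fun n : ℕ => (1 / (n + 1 : ℝ))) atTop (𝓝 0) :=
        tendsto_one_div_add_atTop_nhds_zero_nat
      have h2 := (((h1.pow 2).add_const (z ^ 2)).sqrt).sub h1
      simpa [Real.sqrt_sq_eq_abs] using h2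
  · refine ⟨fun _ z => |z| ^ r, fun _ => ?_, fun _ z => by positivity, fun _ z => le_rfl,
      fun _ z => ?_, fun z => tendsto_const_nhds⟩
    · exact contDiff_norm_rpow (E := ℝ) hr
    · rw [(hasDerivAt_abs_rpow z hr).deriv, abs_mul, abs_mul, abs_of_pos (by linarith : 0 < r),
        abs_of_nonneg (by positivity : 0 ≤ |z| ^ (r - 2)), mul_assoc]
      rcases eq_or_ne z 0 with rfl | hz
      · simp
        positivity
      · rw [show r - 1 = r - 2 + 1 by ring, Real.rpow_add_one (abs_ne_zero.mpr hz)]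

theorem lintegral_rpow_sub_one_mul_le {X : Type*} [MeasurableSpace X] {μ : Measure X} {r : ℝ}
    (hr : 1 ≤ r) {f h : X → ℝ} (hf : AEStronglyMeasurable f μ) (hh : AEStronglyMeasurable h μ) :
    ∫⁻ x, ‖f x‖ₑ ^ (r - 1) * ‖h x‖ₑ ∂μ
      ≤ eLpNorm f (ENNReal.ofReal r) μ ^ (r - 1) * eLpNorm h (ENNReal.ofReal r) μ := by
  rcases hr.eq_or_lt with rfl | hr
  · simp [eLpNorm_one_eq_lintegral_enorm]
  · have h0 : 0 < r := by linarith
    have hn : ∀ k : X → ℝ, eLpNorm k (ENNReal.ofReal r) μ = (∫⁻ x, ‖k x‖ₑ ^ r ∂μ) ^ (1 / r) := by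
      intro k
      rw [eLpNorm_eq_lintegral_rpow_enorm_toReal (by simpa using h0) ENNReal.ofReal_ne_top,
        ENNReal.toReal_ofReal h0.le]
    have hc := Real.HolderConjugate.conjExponent hr
    have h1 := ENNReal.lintegral_mul_rpow_le_lintegral_rpow_mul_lintegral_rpow hc hh.enorm hf.enorm
    rw [hn, hn, ← ENNReal.rpow_mul]
    calc _ = ∫⁻ x, ‖h x‖ₑ * ‖f x‖ₑ ^ (r - 1) ∂μ := lintegral_congr fun x => mul_comm _ _
      _ ≤ _ := h1
      _ = _ := by
        rw [mul_comm]
        congr 2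
        rw [Real.conjExponent]
        field_simp

namespace SmoothTransport

variable {s t : ℝ} {b F R : ℝ → Plane → ℝ} {υ : ℝ → Plane → Plane} {g : ℝ → ℝ}

/-- The error made by the cut-off is supported in `‖x‖ ≥ n + 1` and bounded there by `C g(τ) |b|^r`.
It tends to zero by dominated convergence, in space and then in time. -/
theorem lintegral_comp_le (h : SmoothTransport s t b F R υ g) {r : ℝ} (hr : 1 ≤ r) {M : ℝ≥0∞}
    (hM : M ≠ ⊤) (hbM : ∀ τ ∈ Icc s t, ∫⁻ x, ‖b τ x‖ₑ ^ r ≤ M) {β : ℝ → ℝ} (hβ : ContDiff ℝ 1 β)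
    (hβ0 : ∀ z, 0 ≤ β z) (hβr : ∀ z, β z ≤ |z| ^ r)
    (hβ' : ∀ z, |deriv β z| ≤ r * |z| ^ (r - 1)) :
    ∫⁻ x, ENNReal.ofReal (β (b t x)) ≤ (∫⁻ x, ‖b s x‖ₑ ^ r)
      + ∫⁻ τ in Ioc s t, ENNReal.ofReal r * ∫⁻ x, ‖b τ x‖ₑ ^ (r - 1) * ‖R τ x‖ₑ := by
  have hr0 : 0 ≤ r := by linarith
  have hpow : ∀ z ρ : ℝ, 0 ≤ ρ → ENNReal.ofReal (|z| ^ ρ) = ‖z‖ₑ ^ ρ := fun z ρ hρ => by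
    rw [← ENNReal.ofReal_rpow_of_nonneg (abs_nonneg z) hρ, ← Real.norm_eq_abs, ofReal_norm]
  obtain ⟨C, hC, hcut⟩ := exists_fderiv_cutOff_le
  set S : ℕ → Set Plane := fun n => {x | (n + 1 : ℝ) ≤ ‖x‖} with hS
  have hSm : ∀ n, MeasurableSet (S n) := fun n =>
    (isClosed_le continuous_const continuous_norm).measurableSet
  set W : ℕ → ℝ → ℝ≥0∞ := fun n τ =>
    ENNReal.ofReal (C * g τ) * ∫⁻ x, ‖b τ x‖ₑ ^ r * (S n).indicator 1 x with hW
  have hmem : ∀ᵐ τ ∂(volume.restrict (Ioc s t)), τ ∈ Ioc s t := ae_restrict_mem measurableSet_Ioc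
  have hgm : AEMeasurable (fun τ => ENNReal.ofReal (C * g τ)) (volume.restrict (Ioc s t)) :=
    (h.integrableOn.aemeasurable.const_mul C).ennreal_ofReal
  have hWm : ∀ n, AEMeasurable (W n) (volume.restrict (Ioc s t)) := by
    intro n
    refine hgm.mul ?_
    have h1 : AEMeasurable (fun z : ℝ × Plane => ‖b z.1 z.2‖ₑ ^ r * (S n).indicator 1 z.2)
        ((volume.restrict (Ioc s t)).prod volume) :=
      ((h.aemeasurable_comp continuous_id).enorm.pow_const r).mul
        ((measurable_const.indicator (hSm n)).comp measurable_snd).aemeasurable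
    exact h1.lintegral_prod_right'
  have hWle : ∀ n, W n ≤ᵐ[volume.restrict (Ioc s t)] fun τ => ENNReal.ofReal (C * g τ) * M := by
    intro n
    filter_upwards [hmem] with τ hτ
    refine mul_le_mul_right (le_trans (lintegral_mono fun x => ?_)
      (hbM τ (Ioc_subset_Icc_self hτ))) _
    refine mul_le_of_le_one_right' ?_
    exact indicator_le_self' (fun _ _ => zero_le) x
  have hWfin : ∫⁻ τ in Ioc s t, ENNReal.ofReal (C * g τ) * M ≠ ⊤ := by
    rw [lintegral_mul_const' _ _ hM]
    exact ENNReal.mul_ne_top (h.integrableOn.const_mul C).lintegral_lt_top.ne hM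
  have hW0 : Tendsto (fun n => ∫⁻ τ in Ioc s t, W n τ) atTop (𝓝 0) := by
    rw [← lintegral_zero (μ := volume.restrict (Ioc s t))]
    refine tendsto_lintegral_of_dominated_convergence' _ hWm hWle hWfin ?_
    filter_upwards [hmem] with τ hτ
    have hτ' := Ioc_subset_Icc_self hτ
    have hbc := (h.contDiff τ hτ').continuous
    have h1 : Tendsto (fun n => ∫⁻ x, ‖b τ x‖ₑ ^ r * (S n).indicator 1 x) atTop
        (𝓝 (∫⁻ _ : Plane, 0)) := by
      refine tendsto_lintegral_of_dominated_convergence (fun x => ‖b τ x‖ₑ ^ r) (fun n => ?_)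
        (fun n => ?_) (ne_top_of_le_ne_top hM (hbM τ hτ')) ?_
      · exact (hbc.enorm.measurable.pow_const r).mul (measurable_const.indicator (hSm n))
      · refine Eventually.of_forall fun x => mul_le_of_le_one_right' ?_
        exact indicator_le_self' (fun _ _ => zero_le) x
      · refine Eventually.of_forall fun x => tendsto_const_nhds.congr' ?_
        filter_upwards [eventually_ge_atTop ⌈‖x‖⌉₊] with n hn
        rw [indicator_of_notMem, mul_zero]
        have := (Nat.le_ceil ‖x‖).trans (Nat.cast_le.mpr hn)
        simp only [hS, mem_ofPred_eq, not_le]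
        linarith
    rw [lintegral_zero] at h1
    simpa using ENNReal.Tendsto.const_mul h1 (Or.inr (ENNReal.ofReal_ne_top (r := C * g τ)))
  have ht : t ∈ Icc s t := right_mem_Icc.mpr h.le
  have hs : s ∈ Icc s t := left_mem_Icc.mpr h.le
  have hbt := (h.contDiff t ht).continuous
  refine lintegral_le_of_tendsto (f := fun n x => ENNReal.ofReal (cutOff n x * β (b t x)))
    (c := fun n => ((∫⁻ x, ‖b s x‖ₑ ^ r)
      + ∫⁻ τ in Ioc s t, ENNReal.ofReal r * ∫⁻ x, ‖b τ x‖ₑ ^ (r - 1) * ‖R τ x‖ₑ)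
      + ∫⁻ τ in Ioc s t, W n τ) (fun n => ?_) (fun x => ?_) (fun n => ?_) ?_
  · exact (((cutOff_contDiff n).continuous.mul
      (hβ.continuous.comp hbt)).measurable.ennreal_ofReal).aemeasurable
  · refine ENNReal.tendsto_ofReal ?_
    simpa using (tendsto_cutOff x).mul_const (β (b t x))
  · have hcutd : ContDiff ℝ 1 (cutOff n) := (cutOff_contDiff n).of_le (by exact_mod_cast le_top)
    refine (h.lintegral_le hβ hβ0 hcutd (cutOff_hasCompactSupport n) (cutOff_nonneg n)
      (ρ := fun τ => (ENNReal.ofReal r * ∫⁻ x, ‖b τ x‖ₑ ^ (r - 1) * ‖R τ x‖ₑ) + W n τ) ?_).trans ?_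
    · filter_upwards [h.norm_le] with τ hτ
      refine add_le_add ?_ ?_
      · rw [← lintegral_const_mul' _ _ ENNReal.ofReal_ne_top]
        refine lintegral_mono fun x => ?_
        refine (Real.ofReal_le_enorm _).trans ?_
        rw [enorm_mul, enorm_mul, ← mul_assoc (ENNReal.ofReal r)]
        have e1 : ‖cutOff n x‖ₑ ≤ 1 := by
          rw [← ofReal_norm, Real.norm_of_nonneg (cutOff_nonneg n x)]
          exact ENNReal.ofReal_le_one.mpr (cutOff_le_one n x)
        have e2 : ‖deriv β (b τ x)‖ₑ ≤ ENNReal.ofReal r * ‖b τ x‖ₑ ^ (r - 1) := by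
          rw [← ofReal_norm, ← hpow _ _ (by linarith), ← ENNReal.ofReal_mul hr0]
          exact ENNReal.ofReal_le_ofReal (hβ' _)
        calc _ ≤ 1 * (ENNReal.ofReal r * ‖b τ x‖ₑ ^ (r - 1) * ‖R τ x‖ₑ) :=
              mul_le_mul' e1 (mul_le_mul' e2 le_rfl)
          _ = _ := one_mul _
      · simp only [hW]
        rw [← lintegral_const_mul' _ _ ENNReal.ofReal_ne_top]
        refine lintegral_mono fun x => ?_
        have e1 : ‖β (b τ x)‖ₑ ≤ ‖b τ x‖ₑ ^ r := by
          rw [← hpow _ _ hr0, ← ofReal_norm, Real.norm_of_nonneg (hβ0 _)]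
          exact ENNReal.ofReal_le_ofReal (hβr _)
        have e2 : ‖fderiv ℝ (cutOff n) x (υ τ x)‖ₑ
            ≤ ENNReal.ofReal (C * g τ) * (S n).indicator 1 x := by
          by_cases hx : x ∈ S n
          · rw [indicator_of_mem hx, Pi.one_apply, mul_one, ← ofReal_norm]
            refine ENNReal.ofReal_le_ofReal ?_
            have hg0 : 0 ≤ g τ := by simpa using (norm_nonneg _).trans (hτ 0)
            calc ‖fderiv ℝ (cutOff n) x (υ τ x)‖
                ≤ ‖fderiv ℝ (cutOff n) x‖ * (g τ * (1 + ‖x‖)) :=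
                  (ContinuousLinearMap.le_opNorm _ _).trans
                    (mul_le_mul_of_nonneg_left (hτ x) (norm_nonneg _))
              _ = ‖fderiv ℝ (cutOff n) x‖ * (1 + ‖x‖) * g τ := by ring
              _ ≤ C * g τ := mul_le_mul_of_nonneg_right (hcut n x) hg0
          · have : ‖x‖ < n + 1 := not_le.mp hx
            rw [fderiv_cutOff_eq_zero this]
            simp
        calc _ ≤ ‖b τ x‖ₑ ^ r * (ENNReal.ofReal (C * g τ) * (S n).indicator 1 x) :=
              mul_le_mul' e1 e2
          _ = _ := by ring
    · rw [lintegral_add_right' _ (hWm n), ← add_assoc]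
      refine add_le_add (add_le_add (lintegral_mono fun x => ?_) le_rfl) le_rfl
      rw [← hpow _ _ hr0]
      refine ENNReal.ofReal_le_ofReal (le_trans ?_ (hβr _))
      exact mul_le_of_le_one_left (hβ0 _) (cutOff_le_one n x)
  · simpa using tendsto_const_nhds.add hW0

theorem lintegral_rpow_le (h : SmoothTransport s t b F R υ g) {r : ℝ} (hr : 1 ≤ r) {M : ℝ≥0∞}
    (hM : M ≠ ⊤) (hbM : ∀ τ ∈ Icc s t, ∫⁻ x, ‖b τ x‖ₑ ^ r ≤ M) :
    ∫⁻ x, ‖b t x‖ₑ ^ r ≤ (∫⁻ x, ‖b s x‖ₑ ^ r)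
      + ∫⁻ τ in Ioc s t, ENNReal.ofReal r * ∫⁻ x, ‖b τ x‖ₑ ^ (r - 1) * ‖R τ x‖ₑ := by
  obtain ⟨β, h1, h2, h3, h4, h5⟩ := exists_contDiff_tendsto_rpow hr
  have hbt := (h.contDiff t (right_mem_Icc.mpr h.le)).continuous
  refine lintegral_le_of_tendsto (f := fun n x => ENNReal.ofReal (β n (b t x)))
    (fun n => ?_) (fun x => ?_) (fun n => h.lintegral_comp_le hr hM hbM (h1 n) (h2 n) (h3 n) (h4 n))
    tendsto_const_nhds
  · exact ((h1 n).continuous.comp hbt).measurable.ennreal_ofReal.aemeasurable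
  · have := ENNReal.tendsto_ofReal (h5 (b t x))
    rwa [← ENNReal.ofReal_rpow_of_nonneg (abs_nonneg _) (by linarith), ← Real.norm_eq_abs,
      ofReal_norm] at this

theorem aestronglyMeasurable_source (h : SmoothTransport s t b F R υ g) :
    ∀ᵐ τ ∂(volume.restrict (Ioc s t)), AEStronglyMeasurable (R τ) volume := by
  have h1 := h.aestronglyMeasurable.prodMk_left
  filter_upwards [h1, h.continuous, h.eq_add, ae_restrict_mem measurableSet_Ioc]
    with τ h2 h3 h4 h5
  have h6 := (h.contDiff τ (Ioc_subset_Icc_self h5)).continuous_fderiv one_ne_zero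
  rw [show R τ = fun x => F τ x + fderiv ℝ (b τ) x (υ τ x) from funext h4]
  exact h2.add (h6.clm_apply h3).aestronglyMeasurable

/-- The `L^q` estimate for finite `q`. -/
theorem eLpNorm_le_of_ne_top (h : SmoothTransport s t b F R υ g) {q : ℝ≥0∞} (hq : 1 ≤ q)
    (hq' : q ≠ ⊤) {M : ℝ≥0∞} (hM : M ≠ ⊤) (hbM : ∀ τ ∈ Icc s t, eLpNorm (b τ) q volume ≤ M)
    {ρ : ℝ → ℝ≥0∞} (hρ : ∀ᵐ τ ∂(volume.restrict (Ioc s t)), eLpNorm (R τ) q volume ≤ ρ τ) :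
    eLpNorm (b t) q volume ≤ eLpNorm (b s) q volume + q * ∫⁻ τ in Ioc s t, ρ τ := by
  set r := q.toReal with hr
  have hr1 : 1 ≤ r := by
    rw [hr, ← ENNReal.toReal_one]
    exact ENNReal.toReal_mono hq' hq
  have hr0 : 0 < r := by linarith
  have hqr : q = ENNReal.ofReal r := (ENNReal.ofReal_toReal hq').symm
  have hq0 : q ≠ 0 := (zero_lt_one.trans_le hq).ne'
  have hn : ∀ k : Plane → ℝ, ∫⁻ x, ‖k x‖ₑ ^ r = eLpNorm k q volume ^ r := by
    intro k
    rw [eLpNorm_eq_lintegral_rpow_enorm_toReal hq0 hq', ← hr, ← ENNReal.rpow_mul,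
      one_div_mul_cancel hr0.ne', ENNReal.rpow_one]
  -- Working with the supremum in time avoids differentiating the `L^q` norm: the factor
  -- `‖b‖_q^(r-1)` under the time integral is bounded by `S^(r-1)`.
  set S : ℝ≥0∞ := ⨆ τ ∈ Icc s t, eLpNorm (b τ) q volume with hS
  have hSM : S ≤ M := iSup₂_le hbM
  have hStop : S ≠ ⊤ := ne_top_of_le_ne_top hM hSM
  have hbS : ∀ τ ∈ Icc s t, eLpNorm (b τ) q volume ≤ S := fun τ hτ =>
    le_iSup₂ (f := fun τ (_ : τ ∈ Icc s t) => eLpNorm (b τ) q volume) τ hτ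
  set N := eLpNorm (b s) q volume with hN
  set I := ∫⁻ τ in Ioc s t, ρ τ with hI
  have hSr : S ^ (r - 1) ≠ ⊤ := ENNReal.rpow_ne_top_of_nonneg (by linarith) hStop
  have key : ∀ t' ∈ Icc s t, eLpNorm (b t') q volume ^ r ≤ N ^ r + q * (S ^ (r - 1) * I) := by
    intro t' ht'
    have h1 := h.restrict ht'
    have h2 := h1.lintegral_rpow_le hr1 (M := M ^ r) (ENNReal.rpow_ne_top_of_nonneg hr0.le hM)
      fun τ hτ => by
        rw [hn]
        exact ENNReal.rpow_le_rpow (hbM τ ⟨hτ.1, hτ.2.trans ht'.2⟩) hr0.le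
    rw [hn, hn, lintegral_const_mul' _ _ ENNReal.ofReal_ne_top, ← hqr] at h2
    refine h2.trans (add_le_add le_rfl (mul_le_mul_right ?_ _))
    rw [hI, ← lintegral_const_mul' _ _ hSr]
    refine (lintegral_mono_set (Ioc_subset_Ioc_right ht'.2)).trans (lintegral_mono_ae ?_)
    filter_upwards [hρ, h.aestronglyMeasurable_source, ae_restrict_mem measurableSet_Ioc]
      with τ h3 h4 h5
    have h6 := Ioc_subset_Icc_self h5
    refine (lintegral_rpow_sub_one_mul_le hr1
      (h.contDiff τ h6).continuous.aestronglyMeasurable h4).trans ?_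
    rw [← hqr]
    exact mul_le_mul' (ENNReal.rpow_le_rpow (hbS τ h6) (by linarith)) h3
  have hSle : S ^ r ≤ N ^ r + q * (S ^ (r - 1) * I) := by
    have h1 : S ≤ (N ^ r + q * (S ^ (r - 1) * I)) ^ (1 / r) := iSup₂_le fun τ hτ => by
      rw [one_div, ENNReal.le_rpow_inv_iff hr0]
      exact key τ hτ
    rwa [one_div, ENNReal.le_rpow_inv_iff hr0] at h1
  refine (hbS t (right_mem_Icc.mpr h.le)).trans ?_
  rcases eq_or_ne S 0 with h0 | h0
  · rw [h0]
    exact zero_le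
  have hNS : N ≤ S := hbS s (left_mem_Icc.mpr h.le)
  have hpow : ∀ x : ℝ≥0∞, x ^ r = x * x ^ (r - 1) := fun x => by
    conv_lhs => rw [show r = 1 + (r - 1) by ring]
    rw [ENNReal.rpow_add_of_nonneg _ _ zero_le_one (by linarith), ENNReal.rpow_one]
  have hS0 : S ^ (r - 1) ≠ 0 := by
    rw [Ne, ENNReal.rpow_eq_zero_iff]
    rintro (⟨h1, -⟩ | ⟨h1, -⟩)
    exacts [h0 h1, hStop h1]
  -- Division by `S^(r-1)`, with `N^r ≤ N S^(r-1)`. The initial norm keeps the coefficient one, and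
  -- the factor `q` is left on the source only.
  rw [← ENNReal.mul_le_mul_iff_left hS0 hSr, ← hpow]
  refine hSle.trans ?_
  rw [add_mul, hpow N]
  refine add_le_add (mul_le_mul_right (ENNReal.rpow_le_rpow hNS (by linarith)) _) (le_of_eq ?_)
  ring

end SmoothTransport

end EnergyEstimate

/-! ### The maximum principle and the `L^∞` estimate -/

section SupEstimate

namespace SmoothTransport

variable {s t : ℝ} {b F R : ℝ → Plane → ℝ} {υ : ℝ → Plane → Plane} {g : ℝ → ℝ}

/-- The energy inequality for the weight `slowWeight`, when the source has a sign. -/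
theorem lintegral_smoothTransition_le (h : SmoothTransport s t b F R υ g)
    (hR : ∀ᵐ τ ∂(volume.restrict (Ioc s t)), ∀ᵐ x, R τ x ≤ 0) (hb : ∀ᵐ x, b s x ≤ 0) {C : ℝ}
    (hcut : ∀ n x, ‖fderiv ℝ (cutWeight n) x‖ * (1 + ‖x‖) ≤ C * slowWeight x) :
    ∫⁻ x, ENNReal.ofReal (slowWeight x * Real.smoothTransition (b t x))
      ≤ ∫⁻ τ in Ioc s t, ENNReal.ofReal (C * g τ)
        * ∫⁻ x, ENNReal.ofReal (slowWeight x * Real.smoothTransition (b τ x)) := by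
  have hbt := (h.contDiff t (right_mem_Icc.mpr h.le)).continuous
  have hβ : ContDiff ℝ 1 Real.smoothTransition := Real.smoothTransition.contDiff (n := 1)
  have hβ0 := Real.smoothTransition.nonneg
  refine lintegral_le_of_tendsto
    (f := fun n x => ENNReal.ofReal (cutWeight n x * Real.smoothTransition (b t x)))
    (fun n => ?_) (fun x => ?_) (fun n => ?_) tendsto_const_nhds
  · exact ((cutWeight_contDiff n).continuous.mul
      (hβ.continuous.comp hbt)).measurable.ennreal_ofReal.aemeasurable
  · refine ENNReal.tendsto_ofReal (Tendsto.mul_const _ ?_)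
    simpa [cutWeight] using (tendsto_cutOff x).mul_const (slowWeight x)
  · have hZc : HasCompactSupport (cutWeight n) := (cutOff_hasCompactSupport n).mul_right
    have hZ0 : ∀ x, 0 ≤ cutWeight n x := fun x =>
      mul_nonneg (cutOff_nonneg n x) (slowWeight_pos x).le
    refine (h.lintegral_le hβ hβ0 (cutWeight_contDiff n) hZc hZ0
      (ρ := fun τ => ENNReal.ofReal (C * g τ)
        * ∫⁻ x, ENNReal.ofReal (slowWeight x * Real.smoothTransition (b τ x))) ?_).trans ?_
    · filter_upwards [h.norm_le, hR] with τ h1 h2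
      have hg0 : 0 ≤ g τ := by simpa using (norm_nonneg _).trans (h1 0)
      -- The function `smoothTransition` is nondecreasing and vanishes on nonpositive numbers, so a
      -- nonpositive source adds nothing.
      have e1 : ∫⁻ x, ENNReal.ofReal
          (cutWeight n x * (deriv Real.smoothTransition (b τ x) * R τ x)) = 0 := by
        rw [← lintegral_zero (μ := (volume : Measure Plane))]
        refine lintegral_congr_ae ?_
        filter_upwards [h2] with x h3
        refine ENNReal.ofReal_of_nonpos (mul_nonpos_of_nonneg_of_nonpos (hZ0 x) ?_)
        exact mul_nonpos_of_nonneg_of_nonpos Real.smoothTransition.monotone.deriv_nonneg h3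
      rw [e1, zero_add, ← lintegral_const_mul' _ _ ENNReal.ofReal_ne_top]
      refine lintegral_mono fun x => ?_
      rw [← enorm_mul, ← ofReal_norm, norm_mul, Real.norm_of_nonneg (hβ0 _),
        ← ENNReal.ofReal_mul' (mul_nonneg (slowWeight_pos x).le (hβ0 _))]
      refine ENNReal.ofReal_le_ofReal ?_
      have h4 : ‖fderiv ℝ (cutWeight n) x (υ τ x)‖ ≤ C * g τ * slowWeight x := by
        calc _ ≤ ‖fderiv ℝ (cutWeight n) x‖ * (g τ * (1 + ‖x‖)) :=
              (ContinuousLinearMap.le_opNorm _ _).trans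
                (mul_le_mul_of_nonneg_left (h1 x) (norm_nonneg _))
          _ = ‖fderiv ℝ (cutWeight n) x‖ * (1 + ‖x‖) * g τ := by ring
          _ ≤ C * slowWeight x * g τ := mul_le_mul_of_nonneg_right (hcut n x) hg0
          _ = _ := by ring
      calc _ ≤ Real.smoothTransition (b τ x) * (C * g τ * slowWeight x) :=
            mul_le_mul_of_nonneg_left h4 (hβ0 _)
        _ = _ := by ring
    · refine le_of_eq ?_
      rw [show ∫⁻ x, ENNReal.ofReal (cutWeight n x * Real.smoothTransition (b s x)) = 0 from ?_,
        zero_add]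
      rw [← lintegral_zero (μ := (volume : Measure Plane))]
      refine lintegral_congr_ae ?_
      filter_upwards [hb] with x hx
      rw [Real.smoothTransition.zero_of_nonpos hx, mul_zero, ENNReal.ofReal_zero]

/-- The maximum principle. -/
theorem ae_nonpos (h : SmoothTransport s t b F R υ g)
    (hR : ∀ᵐ τ ∂(volume.restrict (Ioc s t)), ∀ᵐ x, R τ x ≤ 0) (hb : ∀ᵐ x, b s x ≤ 0) :
    ∀ᵐ x, b t x ≤ 0 := by
  obtain ⟨C, hC, hcut⟩ := exists_fderiv_cutWeight_le
  set E : ℝ → ℝ≥0∞ := fun τ =>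
    ∫⁻ x, ENNReal.ofReal (slowWeight x * Real.smoothTransition (b τ x)) with hE
  set W := ∫⁻ x, ENNReal.ofReal (slowWeight x) with hW
  have hWtop : W ≠ ⊤ := lintegral_slowWeight_ne_top
  have hEW : ∀ τ, E τ ≤ W := fun τ => lintegral_mono fun x => ENNReal.ofReal_le_ofReal
    (mul_le_of_le_one_right (slowWeight_pos x).le (Real.smoothTransition.le_one _))
  have hEtop : ∀ τ, E τ ≠ ⊤ := fun τ => ne_top_of_le_ne_top hWtop (hEW τ)
  have hEm : AEMeasurable E (volume.restrict (Ioc s t)) := by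
    have h1 : AEMeasurable (fun z : ℝ × Plane =>
        ENNReal.ofReal (slowWeight z.2 * Real.smoothTransition (b z.1 z.2)))
        ((volume.restrict (Ioc s t)).prod volume) :=
      (((slowWeight_contDiff.continuous.comp continuous_snd).aestronglyMeasurable.mul
        (h.aemeasurable_comp Real.smoothTransition.continuous)).aemeasurable).ennreal_ofReal
    exact h1.lintegral_prod_right'
  set γ : ℝ → ℝ := fun τ => max (C * g τ) 0 with hγ
  have hγi : IntegrableOn γ (Ioc s t) := (h.integrableOn.const_mul C).pos_part
  have hγ0 : ∀ τ, 0 ≤ γ τ := fun τ => le_max_right _ _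
  have hγfi : IntegrableOn (fun τ => γ τ * (E τ).toReal) (Ioc s t) := by
    refine Integrable.mono' (hγi.mul_const W.toReal)
      (hγi.aestronglyMeasurable.mul hEm.ennreal_toReal.aestronglyMeasurable)
      (Eventually.of_forall fun τ => ?_)
    rw [norm_mul, Real.norm_of_nonneg (hγ0 τ), Real.norm_of_nonneg ENNReal.toReal_nonneg]
    exact mul_le_mul_of_nonneg_left (ENNReal.toReal_mono hWtop (hEW τ)) (hγ0 τ)
  -- Gronwall with zero initial value: the weighted integral of `smoothTransition (b t)` vanishes.
  -- As this function is positive on positive numbers, `b t` is almost nowhere positive.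
  have hgr := le_mul_exp_of_le_integral (f := fun τ => (E τ).toReal) (γ := γ) (A := 0) h.le
    ((intervalIntegrable_iff_integrableOn_Ioc_of_le h.le).mpr hγi)
    ((intervalIntegrable_iff_integrableOn_Ioc_of_le h.le).mpr hγfi) hγ0 (fun t' ht' => ?_)
  · rw [zero_mul] at hgr
    have h1 : E t = 0 := by
      have := le_antisymm hgr ENNReal.toReal_nonneg
      rcases (ENNReal.toReal_eq_zero_iff _).mp this with h | h
      · exact h
      · exact absurd h (hEtop t)
    have hbt := (h.contDiff t (right_mem_Icc.mpr h.le)).continuous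
    have hm : Measurable fun x => ENNReal.ofReal (slowWeight x * Real.smoothTransition (b t x)) :=
      (slowWeight_contDiff.continuous.mul
        (Real.smoothTransition.continuous.comp hbt)).measurable.ennreal_ofReal
    filter_upwards [(lintegral_eq_zero_iff hm).mp h1] with x hx
    rw [Pi.zero_apply, ENNReal.ofReal_eq_zero] at hx
    by_contra! h2
    exact hx.not_gt (mul_pos (slowWeight_pos x) (Real.smoothTransition.pos_of_pos h2))
  · have hsub : Ioc s t' ⊆ Ioc s t := Ioc_subset_Ioc_right ht'.2
    have h1 := (h.restrict ht').lintegral_smoothTransition_le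
      (ae_restrict_of_ae_restrict_of_subset hsub hR) hb hcut
    rw [zero_add, intervalIntegral.integral_of_le ht'.1]
    rw [integral_eq_lintegral_of_nonneg_ae
      (Eventually.of_forall fun τ => mul_nonneg (hγ0 τ) ENNReal.toReal_nonneg)
      (hγfi.mono_set hsub).aestronglyMeasurable]
    refine ENNReal.toReal_mono ?_ (h1.trans (lintegral_mono fun τ => ?_))
    · exact (hγfi.mono_set hsub).lintegral_lt_top.ne
    · rw [ENNReal.ofReal_mul (hγ0 τ), ENNReal.ofReal_toReal (hEtop τ)]
      exact mul_le_mul' (ENNReal.ofReal_le_ofReal (le_max_left _ _)) le_rfl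

theorem ae_le (h : SmoothTransport s t b F R υ g) {k : ℝ → ℝ} (hk : IntegrableOn k (Ioc s t))
    (hR : ∀ᵐ τ ∂(volume.restrict (Ioc s t)), ∀ᵐ x, R τ x ≤ k τ) {N : ℝ} (hb : ∀ᵐ x, b s x ≤ N) :
    ∀ᵐ x, b t x ≤ N + ∫ τ in s..t, k τ := by
  have h1 := (h.sub_primitive hk N).ae_nonpos ?_ ?_
  · filter_upwards [h1] with x hx
    linarith
  · filter_upwards [hR] with τ hτ
    filter_upwards [hτ] with x hx
    linarith
  · filter_upwards [hb] with x hx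
    rw [intervalIntegral.integral_same]
    linarith

/-- The `L^∞` estimate. -/
theorem eLpNorm_top_le (h : SmoothTransport s t b F R υ g) {ρ : ℝ → ℝ≥0∞}
    (hρm : AEMeasurable ρ (volume.restrict (Ioc s t)))
    (hρ : ∀ᵐ τ ∂(volume.restrict (Ioc s t)), eLpNorm (R τ) ⊤ volume ≤ ρ τ) :
    eLpNorm (b t) ⊤ volume ≤ eLpNorm (b s) ⊤ volume + ∫⁻ τ in Ioc s t, ρ τ := by
  rcases eq_or_ne (∫⁻ τ in Ioc s t, ρ τ) ⊤ with hI | hI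
  · rw [hI, add_top]
    exact le_top
  obtain ⟨M, hM⟩ := h.bounded
  have hN : eLpNorm (b s) ⊤ volume ≠ ⊤ := by
    refine ne_top_of_le_ne_top (ENNReal.ofReal_ne_top (r := M)) ?_
    rw [eLpNorm_exponent_top]
    refine eLpNormEssSup_le_of_ae_bound (Eventually.of_forall fun x => ?_)
    exact hM s (left_mem_Icc.mpr h.le) x
  set N := (eLpNorm (b s) ⊤ volume).toReal with hNdef
  set k : ℝ → ℝ := fun τ => (ρ τ).toReal with hk
  have hki : IntegrableOn k (Ioc s t) := integrable_toReal_of_lintegral_ne_top hρm hI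
  have hfin : ∀ᵐ τ ∂(volume.restrict (Ioc s t)), ρ τ < ⊤ := ae_lt_top' hρm hI
  have hbs : ∀ᵐ x, ‖b s x‖ ≤ N := by
    have h1 := ae_le_eLpNormEssSup (f := b s) (μ := volume)
    filter_upwards [h1] with x hx
    rw [← eLpNorm_exponent_top] at hx
    have := ENNReal.toReal_mono hN hx
    rwa [toReal_enorm] at this
  have hRk : ∀ᵐ τ ∂(volume.restrict (Ioc s t)), ∀ᵐ x, ‖R τ x‖ ≤ k τ := by
    filter_upwards [hρ, hfin] with τ h1 h2
    have h3 := ae_le_eLpNormEssSup (f := R τ) (μ := volume)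
    filter_upwards [h3] with x hx
    rw [← eLpNorm_exponent_top] at hx
    have := ENNReal.toReal_mono h2.ne (hx.trans h1)
    rwa [toReal_enorm] at this
  have up := h.ae_le hki (hRk.mono fun τ hτ => hτ.mono fun x hx => (le_abs_self _).trans hx)
    (hbs.mono fun x hx => (le_abs_self _).trans hx)
  have lo := h.neg.ae_le hki (hRk.mono fun τ hτ => hτ.mono fun x hx => (neg_le_abs _).trans hx)
    (hbs.mono fun x hx => (neg_le_abs _).trans hx)
  have hint : ∫ τ in s..t, k τ = (∫⁻ τ in Ioc s t, ρ τ).toReal := by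
    rw [intervalIntegral.integral_of_le h.le, integral_toReal hρm hfin]
  rw [hint] at up lo
  rw [eLpNorm_exponent_top (f := b t)]
  refine (eLpNormEssSup_le_of_ae_bound (C := N + (∫⁻ τ in Ioc s t, ρ τ).toReal) ?_).trans ?_
  · filter_upwards [up, lo] with x h1 h2
    exact abs_le'.mpr ⟨h1, h2⟩
  · rw [ENNReal.ofReal_add ENNReal.toReal_nonneg ENNReal.toReal_nonneg, ENNReal.ofReal_toReal hN,
      ENNReal.ofReal_toReal hI]

/-- The `L^q` estimate. -/
theorem exists_eLpNorm_le {q : ℝ≥0∞} (hq : 1 ≤ q) : ∃ C : ℝ≥0∞, C ≠ ⊤ ∧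
    ∀ {s t : ℝ} {b F R : ℝ → Plane → ℝ} {υ : ℝ → Plane → Plane} {g : ℝ → ℝ},
      SmoothTransport s t b F R υ g → ∀ {M : ℝ≥0∞}, M ≠ ⊤ →
      (∀ τ ∈ Icc s t, eLpNorm (b τ) q volume ≤ M) → ∀ {ρ : ℝ → ℝ≥0∞},
      AEMeasurable ρ (volume.restrict (Ioc s t)) →
      (∀ᵐ τ ∂(volume.restrict (Ioc s t)), eLpNorm (R τ) q volume ≤ ρ τ) →
      eLpNorm (b t) q volume ≤ eLpNorm (b s) q volume + C * ∫⁻ τ in Ioc s t, ρ τ := by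
  rcases eq_or_ne q ⊤ with rfl | hq'
  · refine ⟨1, ENNReal.one_ne_top, fun h _ _ _ _ hm hρ => ?_⟩
    rw [one_mul]
    exact h.eLpNorm_top_le hm hρ
  · exact ⟨q, hq', fun h _ hM hbM _ _ hρ => h.eLpNorm_le_of_ne_top hq hq' hM hbM hρ⟩

end SmoothTransport

end SupEstimate

/-! ### Weakly divergence free velocities -/

section WeakDivergence

theorem HasCompactSupport.fderiv_clm_apply {η : Plane → ℝ} (h : HasCompactSupport η)
    (u : Plane → Plane) : HasCompactSupport fun x => fderiv ℝ η x (u x) := by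
  refine (h.fderiv (𝕜 := ℝ)).mono fun x hx hx' => hx ?_
  simp only
  rw [hx', _root_.zero_apply]

theorem integral_fderiv_apply_eq_zero {u : Plane → Plane} (hu : ContDiff ℝ 1 u)
    (hdiv : ∀ x, divergence u x = 0) {η : Plane → ℝ} (hη : ContDiff ℝ 1 η)
    (hηc : HasCompactSupport η) : ∫ x, fderiv ℝ η x (u x) = 0 := by
  have hc : ∀ i : Fin 2, ContDiff ℝ 1 fun x => u x i := fun i =>
    (EuclideanSpace.proj i : Plane →L[ℝ] ℝ).contDiff.comp hu
  have hd : ∀ (i : Fin 2) (x e : Plane), fderiv ℝ (fun x => u x i) x e = fderiv ℝ u x e i := by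
    intro i x e
    have h1 : HasFDerivAt (fun x => u x i)
        ((EuclideanSpace.proj i : Plane →L[ℝ] ℝ).comp (fderiv ℝ u x)) x :=
      (EuclideanSpace.proj i : Plane →L[ℝ] ℝ).hasFDerivAt.comp x
        (hu.differentiable one_ne_zero x).hasFDerivAt
    rw [h1.fderiv]
    rfl
  have hd' := hη.continuous_fderiv one_ne_zero
  have i1 : ∀ i : Fin 2, Integrable fun x => u x i * fderiv ℝ η x (EuclideanSpace.single i 1) :=
    fun i => ((hc i).continuous.mul
      (hd'.clm_apply continuous_const)).integrable_of_hasCompactSupport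
      (hηc.fderiv_clm_apply _).mul_left
  have i2 : ∀ i : Fin 2, Integrable fun x =>
      fderiv ℝ (fun x => u x i) x (EuclideanSpace.single i 1) * η x :=
    fun i => ((((hc i).continuous_fderiv one_ne_zero).clm_apply continuous_const).mul
      hη.continuous).integrable_of_hasCompactSupport hηc.mul_left
  have key : ∀ i : Fin 2, ∫ x, u x i * fderiv ℝ η x (EuclideanSpace.single i 1)
      = -∫ x, fderiv ℝ (fun x => u x i) x (EuclideanSpace.single i 1) * η x := fun i => by
    have h1 := integral_bilinear_hasFDerivAt_right_eq_neg_left_of_integrable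
      (μ := (volume : Measure Plane)) (B := ContinuousLinearMap.mul ℝ ℝ)
      (f := fun y => u y i) (g := η)
      (v := EuclideanSpace.single i (1 : ℝ)) (f' := fun y => fderiv ℝ (fun y => u y i) y)
      (g' := fun y => fderiv ℝ η y) (i2 i) (i1 i)
      (((hc i).continuous.mul hη.continuous).integrable_of_hasCompactSupport hηc.mul_left)
      (fun y _ => ((hc i).differentiable one_ne_zero y).hasFDerivAt)
      (fun y _ => (hη.differentiable one_ne_zero y).hasFDerivAt)
    exact h1
  rw [integral_congr_ae (Eventually.of_forall fun x => clm_plane_eq_sum (fderiv ℝ η x) (u x)),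
    integral_finsetSum _ fun i _ => i1 i, Finset.sum_congr rfl fun i _ => key i,
    Finset.sum_neg_distrib, ← integral_finsetSum _ fun i _ => i2 i, neg_eq_zero]
  refine integral_eq_zero_of_ae (Eventually.of_forall fun x => ?_)
  simp only [← Finset.sum_mul, hd]
  rw [show ∑ i : Fin 2, (fderiv ℝ u x (EuclideanSpace.single i 1)) i = 0 from hdiv x]
  simp

theorem divergence_add_const (u : Plane → Plane) (c x : Plane) :
    divergence (fun x => u x + c) x = divergence u x := by
  simp only [divergence, fderiv_add_const]

namespace BlockPair

variable {L : LittlewoodPaley} {p q : ℝ≥0∞} {u : ℤ → Plane → Plane} {a : ℤ → Plane → ℝ}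

/-- A field of critical regularity with divergence free blocks is weakly divergence free. -/
theorem integral_fderiv_eq_zero (h : BlockPair L p q u a) (hp : 1 ≤ p) {υ : Plane → Plane}
    (hυ : ∀ x y, υ x - υ y = ∑' k, (u k x - u k y)) {η : Plane → ℝ} (hη : ContDiff ℝ 1 η)
    (hηc : HasCompactSupport η) : ∫ x, fderiv ℝ η x (υ x) = 0 := by
  obtain ⟨B, hBt, -, -, hB⟩ := L.exists_kernelBound
  have hd' := hη.continuous_fderiv one_ne_zero
  have hk : ∀ k, ∫ x, fderiv ℝ η x (u k x - u k 0) = 0 := fun k => by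
    refine integral_fderiv_apply_eq_zero (u := fun x => u k x - u k 0)
      ((h.spectral_u k).contDiff.sub contDiff_const) (fun x => ?_) hη hηc
    simp only [sub_eq_add_neg]
    rw [divergence_add_const, h.divergence_u]
  have hc : ∫ x, fderiv ℝ η x (υ 0) = 0 :=
    integral_fderiv_apply_eq_zero contDiff_const (fun x => by simp [divergence]) hη hηc
  have h0 : ∫⁻ x, ‖fderiv ℝ η x‖ₑ * ‖x‖ₑ ≠ ⊤ := by
    have : Integrable fun x : Plane => ‖fderiv ℝ η x‖ * ‖x‖ :=
      (hd'.norm.mul continuous_norm).integrable_of_hasCompactSupport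
        ((hηc.fderiv (𝕜 := ℝ)).norm.mul_right)
    have h1 := this.2
    rw [HasFiniteIntegral] at h1
    simpa [enorm_mul] using h1.ne
  have hfin : ∑' k, ∫⁻ x, ‖fderiv ℝ η x (u k x - u k 0)‖ₑ ≠ ⊤ := by
    refine ne_top_of_le_ne_top (b := ∑' k, B * blockSize (twoOver p + 1) p u k
      * ∫⁻ x, ‖fderiv ℝ η x‖ₑ * ‖x‖ₑ) ?_ (ENNReal.tsum_le_tsum fun k => ?_)
    · rw [ENNReal.tsum_mul_right, ENNReal.tsum_mul_left]
      finiteness [h.sum_u]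
    · have hb : B * blockSize (twoOver p + 1) p u k ≠ ⊤ := by
        finiteness [ENNReal.ne_top_of_tsum_ne_top h.sum_u k]
      rw [← lintegral_const_mul' _ _ hb]
      refine lintegral_mono fun x => ((fderiv ℝ η x).le_opENorm _).trans ?_
      have := h.enorm_sub_le hp hB k x 0
      rw [sub_zero] at this
      calc _ ≤ ‖fderiv ℝ η x‖ₑ * (B * blockSize (twoOver p + 1) p u k * ‖x‖ₑ) :=
            mul_le_mul_right this _
        _ = _ := by ring
  -- The velocity is a constant plus the series of block increments. Each piece is a `C¹` divergence
  -- free field, and the series is integrated term by term thanks to the linear bound on the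
  -- increments and the compact support of `η`.
  have e : ∀ x, fderiv ℝ η x (υ x)
      = fderiv ℝ η x (υ 0) + ∑' k, fderiv ℝ η x (u k x - u k 0) := fun x => by
    rw [← ContinuousLinearMap.map_tsum _ (h.summable_norm_sub hp x 0).of_norm, ← hυ, ← map_add,
      add_sub_cancel]
  have m : ∀ k, Continuous fun x => fderiv ℝ η x (u k x - u k 0) := fun k =>
    hd'.clm_apply ((h.spectral_u k).continuous.sub continuous_const)
  have i2 : Integrable fun x => ∑' k, fderiv ℝ η x (u k x - u k 0) := by
    refine ⟨?_, ?_⟩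
    · have e' : (fun x => ∑' k, fderiv ℝ η x (u k x - u k 0))
          = fun x => fderiv ℝ η x (υ x - υ 0) := by
        ext x
        rw [hυ, ContinuousLinearMap.map_tsum _ (h.summable_norm_sub hp x 0).of_norm]
      rw [e']
      have hυc : Continuous υ := by
        have hl : LipschitzWith (B * ∑' k, blockSize (twoOver p + 1) p u k).toNNReal υ :=
          fun x y => by
            rw [edist_eq_enorm_sub, edist_eq_enorm_sub, hυ,
              ENNReal.coe_toNNReal (by finiteness [h.sum_u])]
            exact enorm_tsum_le_tsum_enorm.trans (h.tsum_enorm_sub_le hp hB x y)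
        exact hl.continuous
      exact (hd'.clm_apply (hυc.sub continuous_const)).aestronglyMeasurable
    · refine lt_of_le_of_lt (lintegral_mono fun x => enorm_tsum_le_tsum_enorm) ?_
      rw [lintegral_tsum fun k => (m k).enorm.measurable.aemeasurable]
      exact hfin.lt_top
  simp only [e]
  rw [integral_add ((hd'.clm_apply continuous_const).integrable_of_hasCompactSupport
      (hηc.fderiv_clm_apply _)) i2, hc,
    integral_tsum (f := fun k x => fderiv ℝ η x (u k x - u k 0))
      (fun k => (m k).aestronglyMeasurable) hfin]
  simp only [hk, tsum_zero, add_zero]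

end BlockPair

end WeakDivergence

/-! ### Uniform nonvanishing and approximation in time -/

section TimeCutOffs

/-- By compactness of the time interval, a single ball and a single positive amount of mass detect
that `f` vanishes at no time. -/
theorem exists_le_integral_cutOff_mul {f : ℝ → Plane → ℝ} {s t : ℝ} (hst : s ≤ t)
    (hf : ContinuousOn (fun z : ℝ × Plane => f z.1 z.2) (Icc s t ×ˢ univ))
    (h0 : ∀ τ ∈ Icc s t, ∃ x, f τ x ≠ 0) :
    ∃ (n : ℕ) (ε : ℝ), 0 < ε ∧ ∀ τ ∈ Icc s t, ε ≤ ∫ x, cutOff n x * |f τ x| := by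
  have hx : ∀ τ ∈ Icc s t, Continuous (f τ) := fun τ hτ =>
    continuousOn_univ.mp (hf.comp (by fun_prop : Continuous fun x : Plane => (τ, x)).continuousOn
      fun x _ => ⟨hτ, mem_univ _⟩)
  -- Otherwise `f (τ n)` vanishes on the ball of radius `n + 1` for some times `τ n`, and at a limit
  -- time `f` would vanish everywhere.
  obtain ⟨n, hn⟩ : ∃ n : ℕ, ∀ τ ∈ Icc s t, ∃ x, ‖x‖ ≤ n + 1 ∧ f τ x ≠ 0 := by
    by_contra! hcon
    choose τ hτ hz using hcon
    obtain ⟨τ', hτ', φ, hφ, hlim⟩ := isCompact_Icc.tendsto_subseq hτ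
    obtain ⟨x, hx'⟩ := h0 τ' hτ'
    refine hx' (tendsto_nhds_unique (f := fun n => f (τ (φ n)) x) (l := atTop) ?_ ?_)
    · have h1 : Tendsto (fun n => (τ (φ n), x)) atTop (𝓝[Icc s t ×ˢ univ] (τ', x)) :=
        tendsto_nhdsWithin_iff.mpr ⟨hlim.prodMk_nhds tendsto_const_nhds,
          Eventually.of_forall fun n => ⟨hτ _, mem_univ _⟩⟩
      exact (hf (τ', x) ⟨hτ', mem_univ _⟩).tendsto.comp h1
    · refine tendsto_const_nhds.congr' ?_
      filter_upwards [hφ.tendsto_atTop.eventually_ge_atTop ⌈‖x‖⌉₊] with n hn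
      refine (hz _ x ?_).symm
      have := (Nat.le_ceil ‖x‖).trans (Nat.cast_le.mpr hn)
      linarith
  have hc : ContinuousOn (fun τ => ∫ x, cutOff n x * |f τ x|) (Icc s t) := by
    refine continuousOn_integral_of_compact_support (cutOff_hasCompactSupport n)
      (((cutOff_contDiff n).continuous.comp continuous_snd).continuousOn.mul hf.abs)
      fun τ x _ hx => ?_
    rw [image_eq_zero_of_notMem_tsupport hx, zero_mul]
  obtain ⟨τ₀, hτ₀, hmin⟩ := isCompact_Icc.exists_isMinOn (nonempty_Icc.mpr hst) hc
  refine ⟨n, ∫ x, cutOff n x * |f τ₀ x|, ?_, fun τ hτ => hmin hτ⟩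
  obtain ⟨x, hxn, hx0⟩ := hn τ₀ hτ₀
  have hcont : Continuous fun x => cutOff n x * |f τ₀ x| :=
    (cutOff_contDiff n).continuous.mul (hx τ₀ hτ₀).abs
  refine hcont.integral_pos_of_hasCompactSupport_nonneg_nonzero (x := x)
    (cutOff_hasCompactSupport n).mul_right
    (fun x => mul_nonneg (cutOff_nonneg n x) (abs_nonneg _)) ?_
  rw [cutOff_eq_one hxn, one_mul]
  exact abs_ne_zero.mpr hx0

theorem deriv_smoothTransition_eq_zero {x : ℝ} (hx : x ∉ Icc (0 : ℝ) 1) :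
    deriv Real.smoothTransition x = 0 := by
  rw [mem_Icc, not_and_or, not_le, not_le] at hx
  rcases hx with hx | hx
  · have : Real.smoothTransition =ᶠ[𝓝 x] fun _ => 0 := by
      filter_upwards [Iio_mem_nhds hx] with y hy
      exact Real.smoothTransition.zero_of_nonpos (le_of_lt hy)
    rw [this.deriv_eq, deriv_const]
  · have : Real.smoothTransition =ᶠ[𝓝 x] fun _ => 1 := by
      filter_upwards [Ioi_mem_nhds hx] with y hy
      exact Real.smoothTransition.one_of_one_le (le_of_lt hy)
    rw [this.deriv_eq, deriv_const]

theorem continuous_deriv_smoothTransition : Continuous (deriv Real.smoothTransition) :=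
  (Real.smoothTransition.contDiff (n := 1)).continuous_deriv le_rfl

theorem integral_deriv_smoothTransition : ∫ σ, deriv Real.smoothTransition σ = 1 := by
  have h1 : ∫ σ in (0 : ℝ)..1, deriv Real.smoothTransition σ = 1 := by
    rw [intervalIntegral.integral_deriv_eq_sub
      (fun x _ => (Real.smoothTransition.contDiff (n := 1)).differentiable one_ne_zero x)
      (continuous_deriv_smoothTransition.intervalIntegrable _ _)]
    simp
  rw [intervalIntegral.integral_of_le zero_le_one, ← integral_Icc_eq_integral_Ioc] at h1
  rw [← h1, setIntegral_eq_integral_of_forall_compl_eq_zero]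
  exact fun x hx => deriv_smoothTransition_eq_zero hx

/-- The derivatives of the ramps are probability densities concentrating at `s` from the right, so
only values of `P` on the right of `s` are used. -/
theorem tendsto_integral_deriv_smoothTransition_mul {P : ℝ → ℝ} {s δ : ℝ} (hδ : 0 < δ)
    (hP : ContinuousOn P (Icc s (s + δ))) :
    Tendsto (fun n : ℕ => ∫ τ, (n + 1) * deriv Real.smoothTransition ((n + 1) * (τ - s)) * P τ)
      atTop (𝓝 (P s)) := by
  have e : ∀ n : ℕ, ∫ τ, (n + 1) * deriv Real.smoothTransition ((n + 1) * (τ - s)) * P τ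
      = ∫ σ, deriv Real.smoothTransition σ * P (s + σ / (n + 1)) := fun n => by
    have hn : (0 : ℝ) < n + 1 := by positivity
    have h1 := Measure.integral_comp_mul_left
      (fun σ => deriv Real.smoothTransition σ * P (s + σ / (n + 1))) (n + 1 : ℝ)
    have h2 := integral_sub_right_eq_self (μ := (volume : Measure ℝ))
      (fun τ => deriv Real.smoothTransition ((n + 1) * τ) * P (s + (n + 1) * τ / (n + 1))) s
    rw [h1, abs_of_pos (inv_pos.mpr hn), smul_eq_mul] at h2
    rw [← mul_right_inj' (inv_pos.mpr hn).ne', ← h2, ← integral_const_mul]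
    refine integral_congr_ae (Eventually.of_forall fun τ => ?_)
    simp only
    rw [mul_div_cancel_left₀ _ hn.ne', add_sub_cancel]
    field_simp
  simp only [e]
  obtain ⟨M, hM⟩ := isCompact_Icc.exists_bound_of_continuousOn hP
  have hlim : Tendsto (fun n : ℕ => ∫ σ, deriv Real.smoothTransition σ * P (s + σ / (n + 1))) atTop
      (𝓝 (∫ σ, deriv Real.smoothTransition σ * P s)) := by
    have hmem : ∀ (n : ℕ), 1 / δ ≤ n → ∀ σ ∈ Icc (0 : ℝ) 1,
        s + σ / (n + 1) ∈ Icc s (s + δ) := fun n hn σ hσ => by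
      have hn0 : (0 : ℝ) < n + 1 := by positivity
      refine ⟨by have := div_nonneg hσ.1 hn0.le; linarith, ?_⟩
      have : σ / (n + 1) ≤ δ := by
        rw [div_le_iff₀ hn0]
        rw [div_le_iff₀ hδ] at hn
        nlinarith [hσ.2]
      linarith
    refine tendsto_integral_filter_of_dominated_convergence
      (fun σ => |deriv Real.smoothTransition σ| * M) ?_ ?_ ?_ ?_
    · filter_upwards [eventually_ge_atTop ⌈1 / δ⌉₊] with n hn
      have hn' : 1 / δ ≤ n := (Nat.le_ceil _).trans (Nat.cast_le.mpr hn)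
      have hc : ContinuousOn (fun σ => deriv Real.smoothTransition σ * P (s + σ / (n + 1)))
          (Icc 0 1) :=
        continuous_deriv_smoothTransition.continuousOn.mul
          (hP.comp (by fun_prop) fun σ hσ => hmem n hn' σ hσ)
      have h1 := hc.aestronglyMeasurable (μ := volume) measurableSet_Icc
      rw [aestronglyMeasurable_indicator_iff measurableSet_Icc |>.symm] at h1
      refine h1.congr (Eventually.of_forall fun σ => ?_)
      by_cases hσ : σ ∈ Icc (0 : ℝ) 1
      · rw [indicator_of_mem hσ]
      · simp only [indicator_of_notMem hσ, deriv_smoothTransition_eq_zero hσ, zero_mul]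
    · filter_upwards [eventually_ge_atTop ⌈1 / δ⌉₊] with n hn
      have hn' : 1 / δ ≤ n := (Nat.le_ceil _).trans (Nat.cast_le.mpr hn)
      refine Eventually.of_forall fun σ => ?_
      rw [norm_mul]
      by_cases hσ : σ ∈ Icc (0 : ℝ) 1
      · exact mul_le_mul_of_nonneg_left (hM _ (hmem n hn' σ hσ)) (norm_nonneg _)
      · rw [deriv_smoothTransition_eq_zero hσ]
        simp
    · refine (continuous_deriv_smoothTransition.abs.integrable_of_hasCompactSupport ?_).mul_const M
      refine HasCompactSupport.of_support_subset_isCompact (isCompact_Icc (a := (0 : ℝ)) (b := 1))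
        fun σ hσ => ?_
      by_contra h
      exact hσ (by simp only; rw [deriv_smoothTransition_eq_zero h, abs_zero])
    · refine Eventually.of_forall fun σ => ?_
      by_cases hσ : σ ∈ Icc (0 : ℝ) 1
      · refine Tendsto.const_mul _ ?_
        have h1 : Tendsto (fun n : ℕ => s + σ / (n + 1)) atTop (𝓝[Icc s (s + δ)] s) := by
          refine tendsto_nhdsWithin_iff.mpr ⟨?_, ?_⟩
          · have h2 : Tendsto (fun n : ℕ => (1 / (n + 1 : ℝ))) atTop (𝓝 0) :=
              tendsto_one_div_add_atTop_nhds_zero_nat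
            have h3 := (h2.const_mul σ).const_add s
            simpa [div_eq_mul_inv] using h3
          · filter_upwards [eventually_ge_atTop ⌈1 / δ⌉₊] with n hn
            exact hmem n ((Nat.le_ceil _).trans (Nat.cast_le.mpr hn)) σ hσ
        exact (hP s (left_mem_Icc.mpr (by linarith))).tendsto.comp h1
      · simp only [deriv_smoothTransition_eq_zero hσ, zero_mul]
        exact tendsto_const_nhds
  rwa [integral_mul_const, integral_deriv_smoothTransition, one_mul] at hlim

end TimeCutOffs

/-! ### From the weak equation to an integrated equation in time -/

section WeakFormulation

variable {X E G : Type*} [NormedAddCommGroup E] [NormedSpace ℝ E] [NormedAddCommGroup G]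
  [NormedSpace ℝ G]

theorem MeasureTheory.LocallyIntegrableOn.integrable_clm_apply [TopologicalSpace X] [MeasurableSpace X]
    [OpensMeasurableSpace X] [T2Space X] [SecondCountableTopologyEither X (E →L[ℝ] G)]
    {μ : Measure X} {U : Set X} {H : X → E}
    (hH : LocallyIntegrableOn H U μ) {c : X → E →L[ℝ] G} (hc : Continuous c)
    (hcs : HasCompactSupport c) (hcU : tsupport c ⊆ U) : Integrable (fun z => c z (H z)) μ := by
  have hK : IntegrableOn H (tsupport c) μ := hH.integrableOn_compact_subset hcU hcs
  obtain ⟨M, hM⟩ := hc.bounded_above_of_compact_support hcs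
  have h1 : IntegrableOn (fun z => c z (H z)) (tsupport c) μ := by
    refine (hK.norm.const_mul M).mono' ?_ (Eventually.of_forall fun z => ?_)
    · exact isBoundedBilinearMap_apply.continuous.comp_aestronglyMeasurable
        (hc.aestronglyMeasurable.prodMk hK.aestronglyMeasurable)
    · exact ((c z).le_opNorm _).trans (mul_le_mul_of_nonneg_right (hM z) (norm_nonneg _))
  refine h1.integrable_of_forall_notMem_eq_zero fun z hz => ?_
  rw [image_eq_zero_of_notMem_tsupport hz, _root_.zero_apply]

/-- The weak transport equation tested against products. -/
theorem integral_deriv_mul_add_integral_mul_eq_zero {T : ℝ} {α : ℝ × Plane → ℝ}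
    {υ : ℝ × Plane → Plane} (hα : LocallyIntegrableOn α (Ioo 0 T ×ˢ univ))
    (hw : LocallyIntegrableOn (fun z => α z • υ z) (Ioo 0 T ×ˢ univ))
    (heq : ∀ ψ : ℝ × Plane → ℝ, ContDiff ℝ ∞ ψ → HasCompactSupport ψ →
      tsupport ψ ⊆ Ioo 0 T ×ˢ univ → ∫ z, α z * fderiv ℝ ψ z (1, υ z) = 0)
    {θ : ℝ → ℝ} (hθ : ContDiff ℝ ∞ θ) (hθc : HasCompactSupport θ) (hθT : tsupport θ ⊆ Ioo 0 T)
    {η : Plane → ℝ} (hη : ContDiff ℝ ∞ η) (hηc : HasCompactSupport η) :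
    (∫ τ, deriv θ τ * ∫ y, η y * α (τ, y))
      + ∫ τ, θ τ * ∫ y, fderiv ℝ η y (α (τ, y) • υ (τ, y)) = 0 := by
  have hsub : tsupport θ ×ˢ tsupport η ⊆ Ioo 0 T ×ˢ univ := prod_mono hθT (subset_univ _)
  have hcl : IsClosed (tsupport θ ×ˢ tsupport η) :=
    (isClosed_tsupport θ).prod (isClosed_tsupport η)
  have hcp : IsCompact (tsupport θ ×ˢ tsupport η) := hθc.isCompact.prod hηc.isCompact
  have supp : ∀ {V : Type} [NormedAddCommGroup V] (c : ℝ × Plane → V),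
      (∀ z, z ∉ tsupport θ ×ˢ tsupport η → c z = 0) →
      HasCompactSupport c ∧ tsupport c ⊆ tsupport θ ×ˢ tsupport η := fun c hc => by
    have h1 : tsupport c ⊆ tsupport θ ×ˢ tsupport η :=
      closure_minimal (fun z hz => by_contra fun h => hz (hc z h)) hcl
    exact ⟨hcp.of_isClosed_subset (isClosed_tsupport c) h1, h1⟩
  have hz : ∀ z : ℝ × Plane, z ∉ tsupport θ ×ˢ tsupport η → z.1 ∉ tsupport θ ∨ z.2 ∉ tsupport η :=
    fun z hz => by rwa [mem_prod, not_and_or] at hz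
  have dθ0 : ∀ τ, τ ∉ tsupport θ → deriv θ τ = 0 := fun τ hτ => by
    have : θ =ᶠ[𝓝 τ] fun _ => 0 := notMem_tsupport_iff_eventuallyEq.mp hτ
    rw [this.deriv_eq, deriv_const]
  have dη0 : ∀ y, y ∉ tsupport η → fderiv ℝ η y = 0 := fun y hy => by
    have : η =ᶠ[𝓝 y] fun _ => 0 := notMem_tsupport_iff_eventuallyEq.mp hy
    rw [this.fderiv_eq]
    simp
  have hdθ : Continuous (deriv θ) := hθ.continuous_deriv (by simp)
  have hdη : Continuous (fderiv ℝ η) := hη.continuous_fderiv (by simp)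
  have s0 := supp (fun z => θ z.1 * η z.2) fun z h => by
    rcases hz z h with h | h
    · rw [image_eq_zero_of_notMem_tsupport h, zero_mul]
    · rw [image_eq_zero_of_notMem_tsupport h, mul_zero]
  have h0 := heq (fun z => θ z.1 * η z.2)
    ((hθ.comp contDiff_fst).mul (hη.comp contDiff_snd)) s0.1 (s0.2.trans hsub)
  have i1 : Integrable fun z : ℝ × Plane => deriv θ z.1 * (η z.2 * α z) := by
    have s1 := supp (fun z => (deriv θ z.1 * η z.2) • ContinuousLinearMap.id ℝ ℝ) fun z h => by
      rcases hz z h with h | h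
      · rw [dθ0 _ h, zero_mul, zero_smul]
      · rw [image_eq_zero_of_notMem_tsupport h, mul_zero, zero_smul]
    refine (hα.integrable_clm_apply
      (c := fun z => (deriv θ z.1 * η z.2) • ContinuousLinearMap.id ℝ ℝ)
      (((hdθ.comp continuous_fst).mul (hη.continuous.comp continuous_snd)).smul
      continuous_const) s1.1 (s1.2.trans hsub)).congr (Eventually.of_forall fun z => ?_)
    simp only [_root_.smul_apply, ContinuousLinearMap.id_apply, smul_eq_mul]
    ring
  have i2 : Integrable fun z : ℝ × Plane => θ z.1 * fderiv ℝ η z.2 (α z • υ z) := by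
    have s1 := supp (fun z => θ z.1 • fderiv ℝ η z.2) fun z h => by
      rcases hz z h with h | h
      · rw [image_eq_zero_of_notMem_tsupport h, zero_smul]
      · rw [dη0 _ h, smul_zero]
    exact hw.integrable_clm_apply (c := fun z => θ z.1 • fderiv ℝ η z.2)
      ((hθ.continuous.comp continuous_fst).smul (hdη.comp continuous_snd)) s1.1 (s1.2.trans hsub)
  have e : ∀ z : ℝ × Plane, α z * fderiv ℝ (fun z : ℝ × Plane => θ z.1 * η z.2) z (1, υ z)
      = deriv θ z.1 * (η z.2 * α z) + θ z.1 * fderiv ℝ η z.2 (α z • υ z) := fun z => by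
    have d1 : HasFDerivAt (fun z : ℝ × Plane => θ z.1)
        ((fderiv ℝ θ z.1).comp (ContinuousLinearMap.fst ℝ ℝ Plane)) z :=
      (hθ.differentiable (by simp) z.1).hasFDerivAt.comp z hasFDerivAt_fst
    have d2 : HasFDerivAt (fun z : ℝ × Plane => η z.2)
        ((fderiv ℝ η z.2).comp (ContinuousLinearMap.snd ℝ ℝ Plane)) z :=
      (hη.differentiable (by simp) z.2).hasFDerivAt.comp z hasFDerivAt_snd
    rw [(d1.fun_mul d2).fderiv]
    simp only [_root_.add_apply, _root_.smul_apply, ContinuousLinearMap.comp_apply,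
      ContinuousLinearMap.coe_fst', ContinuousLinearMap.coe_snd', smul_eq_mul, map_smul,
      fderiv_apply_one_eq_deriv]
    ring
  rw [integral_congr_ae (Eventually.of_forall e), integral_add i1 i2] at h0
  rw [Measure.volume_eq_prod] at h0 i1 i2
  rw [integral_prod _ i1, integral_prod _ i2] at h0
  simpa only [integral_const_mul] using h0

theorem integrable_mul_of_continuousOn {c P : ℝ → ℝ} {s t : ℝ} (hc : Continuous c)
    (h0 : ∀ τ, τ ∉ Icc s t → c τ = 0) (hP : ContinuousOn P (Icc s t)) :
    Integrable fun τ => c τ * P τ :=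
  (hc.continuousOn.mul hP).integrableOn_Icc.integrable_of_forall_notMem_eq_zero
    fun τ hτ => by simp only [Pi.mul_apply, h0 τ hτ, zero_mul]

/-- A continuous function with integrable weak derivative is a primitive of it. -/
theorem sub_eq_integral_of_weak {P Q : ℝ → ℝ} {s t t₁ : ℝ} (hst : s ≤ t) (ht : t < t₁)
    (hP : ContinuousOn P (Icc s t₁)) (hQ : IntegrableOn Q (Icc s t₁))
    (h : ∀ θ : ℝ → ℝ, ContDiff ℝ ∞ θ → tsupport θ ⊆ Icc s t₁ →
      (∫ τ, deriv θ τ * P τ) + ∫ τ, θ τ * Q τ = 0) :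
    P t - P s = ∫ τ in Ioc s t, Q τ := by
  set δ := t₁ - t with hδ
  have hδ0 : 0 < δ := sub_pos.mpr ht
  -- The difference of a ramp at `s` and a ramp at `t` is a smooth approximation of the indicator of
  -- `(s, t]`. Each ramp rises to the right of its base point, so the room up to `t₁` lets the
  -- second one finish.
  set ramp : ℝ → ℕ → ℝ → ℝ := fun r n τ => Real.smoothTransition ((n + 1) * (τ - r)) with hramp
  set θ : ℕ → ℝ → ℝ := fun n τ => ramp s n τ - ramp t n τ with hθ
  have hrc : ∀ r n, ContDiff ℝ ∞ (ramp r n) := fun r n => by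
    have h1 : ContDiff ℝ ∞ Real.smoothTransition := Real.smoothTransition.contDiff
    exact h1.comp (contDiff_const.mul (contDiff_id.sub contDiff_const))
  have hn0 : ∀ n : ℕ, (0 : ℝ) < n + 1 := fun n => by positivity
  have hr0 : ∀ {r τ : ℝ} (n : ℕ), τ ≤ r → ramp r n τ = 0 := fun n hτ =>
    Real.smoothTransition.zero_of_nonpos
      (mul_nonpos_of_nonneg_of_nonpos (hn0 n).le (sub_nonpos.mpr hτ))
  have hr1 : ∀ {r τ : ℝ} (n : ℕ), r + 1 / (n + 1) ≤ τ → ramp r n τ = 1 := fun {r τ} n hτ => by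
    refine Real.smoothTransition.one_of_one_le ?_
    have : 1 / (n + 1 : ℝ) ≤ τ - r := by linarith
    rw [div_le_iff₀ (hn0 n)] at this
    linarith
  have hrd : ∀ r n τ, deriv (ramp r n) τ
      = (n + 1) * deriv Real.smoothTransition ((n + 1) * (τ - r)) := fun r n τ => by
    have h1 : HasDerivAt (fun τ : ℝ => (n + 1 : ℝ) * (τ - r)) ((n + 1 : ℝ) * 1) τ :=
      ((hasDerivAt_id τ).sub_const r).const_mul _
    have h2 : HasDerivAt Real.smoothTransition
        (deriv Real.smoothTransition ((n + 1) * (τ - r))) ((n + 1) * (τ - r)) :=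
      ((Real.smoothTransition.contDiff (n := 1)).differentiable one_ne_zero _).hasDerivAt
    have h3 := h2.comp τ h1
    rw [show ramp r n = Real.smoothTransition ∘ fun τ : ℝ => (n + 1 : ℝ) * (τ - r) from rfl, h3.deriv]
    ring
  have hev : ∀ᶠ n : ℕ in atTop, 1 / (n + 1 : ℝ) ≤ δ := by
    have h2 : Tendsto (fun n : ℕ => (1 / (n + 1 : ℝ))) atTop (𝓝 0) :=
      tendsto_one_div_add_atTop_nhds_zero_nat
    exact (h2.eventually_lt_const hδ0).mono fun n hn => hn.le
  have hrd0 : ∀ {r τ : ℝ} (n : ℕ), τ ∉ Icc r (r + 1 / (n + 1)) → deriv (ramp r n) τ = 0 := by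
    intro r τ n hτ
    rw [hrd, deriv_smoothTransition_eq_zero, mul_zero]
    refine fun hm => hτ ⟨?_, ?_⟩
    · have := hm.1
      by_contra! hlt
      exact this.not_gt (mul_neg_of_pos_of_neg (hn0 n) (sub_neg.mpr hlt))
    · have := hm.2
      rw [← sub_le_iff_le_add', le_div_iff₀ (hn0 n)]
      linarith
  have hPs : ContinuousOn P (Icc s (s + δ)) := hP.mono (Icc_subset_Icc_right (by linarith))
  have hPt : ContinuousOn P (Icc t (t + δ)) := hP.mono (Icc_subset_Icc hst (by linarith))
  have L1 : Tendsto (fun n => ∫ τ, deriv (θ n) τ * P τ) atTop (𝓝 (P s - P t)) := by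
    refine ((tendsto_integral_deriv_smoothTransition_mul hδ0 hPs).sub
      (tendsto_integral_deriv_smoothTransition_mul hδ0 hPt)).congr' ?_
    filter_upwards [hev] with n hn
    simp only [← hrd]
    have hi : ∀ r, ContinuousOn P (Icc r (r + δ)) →
        Integrable fun τ => deriv (ramp r n) τ * P τ := fun r hr =>
      integrable_mul_of_continuousOn ((hrc r n).continuous_deriv (by simp))
        (fun τ hτ => hrd0 n hτ) (hr.mono (Icc_subset_Icc_right (by linarith)))
    rw [← integral_sub (hi s hPs) (hi t hPt)]
    refine integral_congr_ae (Eventually.of_forall fun τ => ?_)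
    simp only
    rw [← sub_mul, hθ, deriv_fun_sub ((hrc s n).differentiable (by simp) τ)
      ((hrc t n).differentiable (by simp) τ)]
  have hsupp : ∀ n : ℕ, 1 / (n + 1 : ℝ) ≤ δ → ∀ τ, τ ∉ Icc s t₁ → θ n τ = 0 := fun n hn τ hτ => by
    rw [mem_Icc, not_and_or, not_le, not_le] at hτ
    simp only [hθ]
    rcases hτ with hτ | hτ
    · rw [hr0 n hτ.le, hr0 n (hτ.le.trans hst), sub_zero]
    · rw [hr1 n (by linarith), hr1 n (by linarith), sub_self]
  have hθ1 : ∀ n τ, ‖θ n τ‖ ≤ 1 := fun n τ => by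
    have h1 := Real.smoothTransition.nonneg ((n + 1) * (τ - s))
    have h2 := Real.smoothTransition.le_one ((n + 1) * (τ - s))
    have h3 := Real.smoothTransition.nonneg ((n + 1) * (τ - t))
    have h4 := Real.smoothTransition.le_one ((n + 1) * (τ - t))
    simp only [hθ, hramp, Real.norm_eq_abs]
    exact abs_le.mpr ⟨by linarith, by linarith⟩
  have L2 : Tendsto (fun n => ∫ τ, θ n τ * Q τ) atTop (𝓝 (∫ τ in Ioc s t, Q τ)) := by
    have e : ∀ᶠ n in atTop, ∫ τ in Icc s t₁, θ n τ * Q τ = ∫ τ, θ n τ * Q τ := by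
      filter_upwards [hev] with n hn
      exact setIntegral_eq_integral_of_forall_compl_eq_zero fun τ hτ => by
        rw [hsupp n hn τ hτ, zero_mul]
    have hsub : Ioc s t ⊆ Icc s t₁ := Ioc_subset_Icc_self.trans (Icc_subset_Icc_right ht.le)
    have e' : ∫ τ in Icc s t₁, (Ioc s t).indicator Q τ = ∫ τ in Ioc s t, Q τ := by
      rw [setIntegral_indicator measurableSet_Ioc, inter_eq_self_of_subset_right hsub]
    rw [← e']
    refine Tendsto.congr' e (tendsto_integral_of_dominated_convergence (fun τ => ‖Q τ‖)
      (fun n => ?_) hQ.norm (fun n => Eventually.of_forall fun τ => ?_)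
      (Eventually.of_forall fun τ => ?_))
    · exact (((hrc s n).continuous.sub (hrc t n).continuous).aestronglyMeasurable).mul
        hQ.aestronglyMeasurable
    · rw [norm_mul]
      exact mul_le_of_le_one_left (norm_nonneg _) (hθ1 n τ)
    · have hlim : ∀ r, r < τ → ∀ᶠ n : ℕ in atTop, ramp r n τ = 1 := fun r hr => by
        have h2 : Tendsto (fun n : ℕ => (1 / (n + 1 : ℝ))) atTop (𝓝 0) :=
          tendsto_one_div_add_atTop_nhds_zero_nat
        filter_upwards [h2.eventually_lt_const (sub_pos.mpr hr)] with n hn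
        exact hr1 n (by linarith)
      refine tendsto_const_nhds.congr' ?_
      rcases le_or_gt τ s with h1 | h1
      · refine Eventually.of_forall fun n => ?_
        rw [indicator_of_notMem fun hm => h1.not_gt hm.1]
        simp only [hθ]
        rw [hr0 n h1, hr0 n (h1.trans hst), sub_zero, zero_mul]
      · rcases le_or_gt τ t with h2 | h2
        · filter_upwards [hlim s h1] with n hn
          rw [indicator_of_mem (show τ ∈ Ioc s t from ⟨h1, h2⟩)]
          simp only [hθ]
          rw [hn, hr0 n h2, sub_zero, one_mul]
        · filter_upwards [hlim s h1, hlim t h2] with n hn hn'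
          rw [indicator_of_notMem fun hm => h2.not_ge hm.2]
          simp only [hθ]
          rw [hn, hn', sub_self, zero_mul]
  have L3 : Tendsto (fun n => (∫ τ, deriv (θ n) τ * P τ) + ∫ τ, θ n τ * Q τ) atTop (𝓝 0) := by
    refine tendsto_const_nhds.congr' ?_
    filter_upwards [hev] with n hn
    refine (h (θ n) ((hrc s n).sub (hrc t n)) ?_).symm
    exact closure_minimal (fun τ hτ => by_contra fun hm => hτ (hsupp n hn τ hm)) isClosed_Icc
  have := tendsto_nhds_unique (L1.add L2) L3
  linarith

end WeakFormulation

/-! ### Linear growth of the velocity and regularization of the solution -/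

section Characteristics

theorem SchwartzMap.integrable_fderiv_mul_one_add (K : 𝓢(Plane, ℝ)) :
    Integrable fun z => ‖fderiv ℝ K z‖ * (1 + ‖z‖) := by
  have h1 := K.integrable_pow_mul_iteratedFDeriv volume 1 1
  refine (K.integrable_fderiv.norm.add h1).congr (Eventually.of_forall fun z => ?_)
  simp only [Pi.add_apply]
  rw [norm_iteratedFDeriv_one, pow_one]
  ring

theorem one_add_norm_le (x y : Plane) : 1 + ‖y‖ ≤ (1 + ‖x‖) * (1 + ‖x - y‖) := by
  have h1 : ‖y‖ ≤ ‖x‖ + ‖x - y‖ := by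
    have := norm_sub_le x (x - y)
    rwa [sub_sub_cancel] at this
  have h2 := mul_nonneg (norm_nonneg x) (norm_nonneg (x - y))
  nlinarith

/-- A bounded continuous solution `f` of a transport equation, in weak form, on a time interval on
which it does not vanish; `w` is a measurable version of `f υ`. -/
structure WeakTransport (s t M : ℝ) (f : ℝ → Plane → ℝ) (υ : ℝ → Plane → Plane)
    (w : ℝ × Plane → Plane) (D : ℝ → ℝ) : Prop where
  le : s ≤ t
  continuousOn : ContinuousOn (fun z : ℝ × Plane => f z.1 z.2) (Icc s t ×ˢ univ)
  bounded : ∀ τ ∈ Icc s t, ∀ x, |f τ x| ≤ M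
  exists_ne_zero : ∀ τ ∈ Icc s t, ∃ x, f τ x ≠ 0
  stronglyMeasurable : StronglyMeasurable w
  integrableOn : ∀ r, IntegrableOn w (Icc s t ×ˢ Metric.closedBall 0 r)
  ae_eq : ∀ᵐ τ ∂(volume.restrict (Icc s t)), ∀ᵐ y, w (τ, y) = f τ y • υ τ y
  integrable_lip : IntegrableOn D (Icc s t)
  lip : ∀ᵐ τ ∂(volume.restrict (Icc s t)), ∀ x y, ‖υ τ x - υ τ y‖ ≤ D τ * ‖x - y‖
  integral_fderiv : ∀ᵐ τ ∂(volume.restrict (Icc s t)), ∀ η : Plane → ℝ, ContDiff ℝ 1 η →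
    HasCompactSupport η → ∫ x, fderiv ℝ η x (υ τ x) = 0
  weak : ∀ θ : ℝ → ℝ, ContDiff ℝ ∞ θ → tsupport θ ⊆ Icc s t → ∀ η : Plane → ℝ, ContDiff ℝ ∞ η →
    HasCompactSupport η →
    (∫ τ, deriv θ τ * ∫ y, η y * f τ y) + ∫ τ, θ τ * ∫ y, fderiv ℝ η y (w (τ, y)) = 0

namespace WeakTransport

variable {s t M : ℝ} {f : ℝ → Plane → ℝ} {υ : ℝ → Plane → Plane} {w : ℝ × Plane → Plane} {D : ℝ → ℝ}

theorem continuous (h : WeakTransport s t M f υ w D) {τ : ℝ} (hτ : τ ∈ Icc s t) :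
    Continuous (f τ) :=
  continuousOn_univ.mp (h.continuousOn.comp
    (by fun_prop : Continuous fun x : Plane => (τ, x)).continuousOn fun _ _ => ⟨hτ, mem_univ _⟩)

theorem nonneg (h : WeakTransport s t M f υ w D) : 0 ≤ M :=
  (abs_nonneg _).trans (h.bounded s (left_mem_Icc.mpr h.le) 0)

theorem continuous_velocity (h : WeakTransport s t M f υ w D) :
    ∀ᵐ τ ∂(volume.restrict (Icc s t)), Continuous (υ τ) := by
  filter_upwards [h.lip] with τ hτ
  refine (LipschitzWith.of_dist_le' (K := D τ) fun x y => ?_).continuous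
  rw [dist_eq_norm, dist_eq_norm]
  exact hτ x y

/-- The velocity grows at most linearly, with an integrable constant. -/
theorem exists_norm_le (h : WeakTransport s t M f υ w D) :
    ∃ g : ℝ → ℝ, IntegrableOn g (Icc s t) ∧
      ∀ᵐ τ ∂(volume.restrict (Icc s t)), 0 ≤ g τ ∧ ∀ x, ‖υ τ x‖ ≤ g τ * (1 + ‖x‖) := by
  obtain ⟨n, ε, hε, hn⟩ := exists_le_integral_cutOff_mul h.le h.continuousOn h.exists_ne_zero
  set r : ℝ := 2 * (n + 1) with hr
  have hr0 : 0 ≤ r := by positivity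
  have hw : Integrable w ((volume.restrict (Icc s t)).prod
      (volume.restrict (Metric.closedBall 0 r))) := by
    rw [Measure.prod_restrict]
    exact h.integrableOn r
  set W : ℝ → ℝ := fun τ => ∫ y in Metric.closedBall 0 r, ‖w (τ, y)‖ with hW
  have hWi : IntegrableOn W (Icc s t) := hw.norm.integral_prod_left
  have hD0 : ∀ᵐ τ ∂(volume.restrict (Icc s t)), 0 ≤ D τ := by
    filter_upwards [h.lip] with τ hτ
    have h1 := (norm_nonneg _).trans (hτ (EuclideanSpace.single 0 1) 0)
    simpa using h1
  -- The velocity at the origin is bounded by `ε⁻¹ W + r D`, as shown next; the Lipschitz bound adds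
  -- `D ‖x‖`.
  refine ⟨fun τ => ε⁻¹ * W τ + (r + 1) * D τ, (hWi.const_mul _).add
    (h.integrable_lip.const_mul _), ?_⟩
  filter_upwards [h.ae_eq, h.lip, hD0, hw.prod_right_ae, h.continuous_velocity,
    ae_restrict_mem measurableSet_Icc] with τ h1 h2 h3 h4 h5 h6
  have hfc := h.continuous h6
  have hW0 : 0 ≤ W τ := integral_nonneg fun y => norm_nonneg _
  -- If the velocity at the origin were larger, then `‖υ‖ ≥ c` on the whole ball, and the mass `ε`
  -- of `f` there would make the integral of `‖f υ‖` at least `c ε > W`.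
  have key : ‖υ τ 0‖ ≤ ε⁻¹ * W τ + r * D τ := by
    by_contra! hlt
    set c := ‖υ τ 0‖ - r * D τ with hc
    have hc0 : ε⁻¹ * W τ < c := by linarith
    have hcpos : 0 < c := (mul_nonneg (inv_pos.mpr hε).le hW0).trans_lt hc0
    have i1 : Integrable fun x => cutOff n x * |f τ x| :=
      ((cutOff_contDiff n).continuous.mul hfc.abs).integrable_of_hasCompactSupport
        (cutOff_hasCompactSupport n).mul_right
    have i2 : IntegrableOn (fun y => ‖w (τ, y)‖) (Metric.closedBall 0 r) := h4.norm
    have hz : ∀ y, y ∉ Metric.closedBall (0 : Plane) r → cutOff n y * |f τ y| = 0 := fun y hy => by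
      rw [mem_closedBall_zero_iff, not_le] at hy
      rw [cutOff_eq_zero hy.le, zero_mul]
    have h7 : c * ε ≤ W τ := by
      calc c * ε ≤ c * ∫ x, cutOff n x * |f τ x| := mul_le_mul_of_nonneg_left (hn τ h6) hcpos.le
        _ = ∫ x in Metric.closedBall 0 r, c * (cutOff n x * |f τ x|) := by
          rw [integral_const_mul, setIntegral_eq_integral_of_forall_compl_eq_zero hz]
        _ ≤ W τ := by
          refine setIntegral_mono_ae_restrict (i1.const_mul c).integrableOn i2 ?_
          filter_upwards [ae_restrict_of_ae h1,
            ae_restrict_mem Metric.isClosed_closedBall.measurableSet] with y hy hyr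
          rw [mem_closedBall_zero_iff] at hyr
          rw [hy, norm_smul, Real.norm_eq_abs]
          have h8 : c ≤ ‖υ τ y‖ := by
            have h9 := h2 0 y
            rw [zero_sub, norm_neg] at h9
            have h10 := norm_sub_norm_le (υ τ 0) (υ τ y)
            have h11 := mul_le_mul_of_nonneg_left hyr h3
            rw [hc]
            linarith
          calc c * (cutOff n y * |f τ y|) ≤ c * (1 * |f τ y|) := by
                have := mul_le_mul_of_nonneg_right (cutOff_le_one n y) (abs_nonneg (f τ y))
                exact mul_le_mul_of_nonneg_left this hcpos.le
            _ = |f τ y| * c := by ring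
            _ ≤ |f τ y| * ‖υ τ y‖ := mul_le_mul_of_nonneg_left h8 (abs_nonneg _)
    rw [inv_mul_lt_iff₀ hε] at hc0
    linarith
  have hg0 : 0 ≤ ε⁻¹ * W τ := mul_nonneg (inv_pos.mpr hε).le hW0
  refine ⟨by positivity, fun x => ?_⟩
  have h7 := h2 x 0
  rw [sub_zero] at h7
  have h8 := norm_sub_norm_le (υ τ x) (υ τ 0)
  have h9 := norm_nonneg x
  have h10 := mul_nonneg (add_nonneg hg0 (mul_nonneg hr0 h3)) h9
  nlinarith

/-- The equation for the integral against a fixed smooth function. -/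
theorem sub_eq_integral (h : WeakTransport s t M f υ w D) {η : Plane → ℝ} (hη : ContDiff ℝ ∞ η)
    (hi : Integrable η) (hdi : Integrable fun y => ‖fderiv ℝ η y‖ * (1 + ‖y‖)) {τ : ℝ}
    (hτ : s ≤ τ) (hτt : τ < t) :
    (∫ y, η y * f τ y) - ∫ y, η y * f s y = ∫ r in Ioc s τ, ∫ y, fderiv ℝ η y (w (r, y)) := by
  obtain ⟨g, hg, hgυ⟩ := h.exists_norm_le
  obtain ⟨C, hC, hcut⟩ := exists_fderiv_cutOff_le
  -- The weak form admits compactly supported functions only. The cut-off versions of `η` have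
  -- derivatives with a common weighted majorant `J`, because the cut-off gradient compensates the
  -- linear growth.
  set ηn : ℕ → Plane → ℝ := fun n y => cutOff n y * η y with hηn
  have hηnc : ∀ n, ContDiff ℝ ∞ (ηn n) := fun n => (cutOff_contDiff n).mul hη
  have hηns : ∀ n, HasCompactSupport (ηn n) := fun n => (cutOff_hasCompactSupport n).mul_right
  have hdη : ∀ n y v, fderiv ℝ (ηn n) y v
      = cutOff n y * fderiv ℝ η y v + η y * fderiv ℝ (cutOff n) y v := fun n y v => by
    rw [(((cutOff_contDiff n).differentiable (by simp) y).hasFDerivAt.fun_mul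
      (hη.differentiable (by simp) y).hasFDerivAt).fderiv]
    rfl
  set J : Plane → ℝ := fun y => ‖fderiv ℝ η y‖ * (1 + ‖y‖) + C * |η y| with hJ
  have hJi : Integrable J := hdi.add (hi.abs.const_mul C)
  have hdηle : ∀ n y, ‖fderiv ℝ (ηn n) y‖ * (1 + ‖y‖) ≤ J y := fun n y => by
    have hy : 0 < 1 + ‖y‖ := by positivity
    have h1 : ‖fderiv ℝ (ηn n) y‖ ≤ ‖fderiv ℝ η y‖ + |η y| * ‖fderiv ℝ (cutOff n) y‖ := by
      refine ContinuousLinearMap.opNorm_le_bound _ (by positivity) fun v => ?_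
      rw [hdη, add_mul]
      refine (norm_add_le _ _).trans (add_le_add ?_ ?_)
      · rw [norm_mul, Real.norm_of_nonneg (cutOff_nonneg n y)]
        exact (mul_le_of_le_one_left (norm_nonneg _) (cutOff_le_one n y)).trans
          (ContinuousLinearMap.le_opNorm _ _)
      · rw [norm_mul, mul_assoc]
        exact mul_le_mul_of_nonneg_left (ContinuousLinearMap.le_opNorm _ _) (abs_nonneg _)
    calc _ ≤ (‖fderiv ℝ η y‖ + |η y| * ‖fderiv ℝ (cutOff n) y‖) * (1 + ‖y‖) :=
          mul_le_mul_of_nonneg_right h1 hy.le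
      _ = ‖fderiv ℝ η y‖ * (1 + ‖y‖) + |η y| * (‖fderiv ℝ (cutOff n) y‖ * (1 + ‖y‖)) := by ring
      _ ≤ ‖fderiv ℝ η y‖ * (1 + ‖y‖) + |η y| * C :=
          add_le_add le_rfl (mul_le_mul_of_nonneg_left (hcut n y) (abs_nonneg _))
      _ = J y := by rw [hJ]; ring
  have hwle : ∀ᵐ r ∂(volume.restrict (Icc s t)), 0 ≤ g r ∧
      ∀ᵐ y, ‖w (r, y)‖ ≤ M * g r * (1 + ‖y‖) := by
    filter_upwards [h.ae_eq, hgυ, ae_restrict_mem measurableSet_Icc] with r h1 h2 h3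
    refine ⟨h2.1, ?_⟩
    filter_upwards [h1] with y hy
    rw [hy, norm_smul, mul_assoc]
    exact mul_le_mul (h.bounded r h3 y) (h2.2 y) (norm_nonneg _) h.nonneg
  have hwm : ∀ r, StronglyMeasurable fun y => w (r, y) := fun r =>
    h.stronglyMeasurable.comp_measurable measurable_prodMk_left
  have meas : ∀ {ζ : Plane → ℝ}, Continuous (fderiv ℝ ζ) →
      StronglyMeasurable fun z : ℝ × Plane => fderiv ℝ ζ z.2 (w z) := fun {ζ} hζ =>
    isBoundedBilinearMap_apply.continuous.comp_stronglyMeasurable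
      ((hζ.comp continuous_snd).stronglyMeasurable.prodMk h.stronglyMeasurable)
  have hbd : ∀ᵐ r ∂(volume.restrict (Icc s t)), ∀ n, ∀ᵐ y,
      ‖fderiv ℝ (ηn n) y (w (r, y))‖ ≤ M * g r * J y := by
    filter_upwards [hwle] with r hr n
    filter_upwards [hr.2] with y hy
    calc _ ≤ ‖fderiv ℝ (ηn n) y‖ * (M * g r * (1 + ‖y‖)) :=
          (ContinuousLinearMap.le_opNorm _ _).trans (mul_le_mul_of_nonneg_left hy (norm_nonneg _))
      _ = M * g r * (‖fderiv ℝ (ηn n) y‖ * (1 + ‖y‖)) := by ring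
      _ ≤ M * g r * J y :=
          mul_le_mul_of_nonneg_left (hdηle n y) (mul_nonneg h.nonneg hr.1)
  set Q : ℕ → ℝ → ℝ := fun n r => ∫ y, fderiv ℝ (ηn n) y (w (r, y)) with hQ
  have hQm : ∀ n, StronglyMeasurable (Q n) := fun n =>
    (meas ((hηnc n).continuous_fderiv (by simp))).integral_prod_right'
  have hQle : ∀ n, ∀ᵐ r ∂(volume.restrict (Icc s t)), ‖Q n r‖ ≤ M * g r * ∫ y, J y := fun n => by
    filter_upwards [hbd] with r hr
    rw [← integral_const_mul]
    exact norm_integral_le_of_norm_le (hJi.const_mul _) (hr n)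
  have hQb : IntegrableOn (fun r => M * g r * ∫ y, J y) (Icc s t) :=
    (hg.const_mul M).mul_const _
  have hsub : Ioc s τ ⊆ Icc s t := Ioc_subset_Icc_self.trans (Icc_subset_Icc_right hτt.le)
  have step : ∀ n, (∫ y, ηn n y * f τ y) - ∫ y, ηn n y * f s y = ∫ r in Ioc s τ, Q n r := fun n => by
    refine sub_eq_integral_of_weak (P := fun r => ∫ y, ηn n y * f r y) hτ hτt ?_
      (hQb.mono' (hQm n).aestronglyMeasurable (hQle n))
      fun θ hθ hθs => h.weak θ hθ hθs (ηn n) (hηnc n) (hηns n)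
    refine continuousOn_integral_of_compact_support (hηns n)
      (((hηnc n).continuous.comp continuous_snd).continuousOn.mul h.continuousOn) fun r y _ hy => ?_
    rw [image_eq_zero_of_notMem_tsupport hy, zero_mul]
  have limP : ∀ r ∈ Icc s t, Tendsto (fun n => ∫ y, ηn n y * f r y) atTop
      (𝓝 (∫ y, η y * f r y)) := fun r hr => by
    refine tendsto_integral_of_dominated_convergence (fun y => |η y| * M) (fun n => ?_)
      (hi.abs.mul_const M) (fun n => Eventually.of_forall fun y => ?_)
      (Eventually.of_forall fun y => ?_)
    · exact ((hηnc n).continuous.mul (h.continuous hr)).aestronglyMeasurable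
    · rw [norm_mul, norm_mul, Real.norm_of_nonneg (cutOff_nonneg n y)]
      exact mul_le_mul (mul_le_of_le_one_left (norm_nonneg _) (cutOff_le_one n y))
        (h.bounded r hr y) (norm_nonneg _) (abs_nonneg _)
    · simpa using ((tendsto_cutOff y).mul_const (η y)).mul_const (f r y)
  have limQ : Tendsto (fun n => ∫ r in Ioc s τ, Q n r) atTop
      (𝓝 (∫ r in Ioc s τ, ∫ y, fderiv ℝ η y (w (r, y)))) := by
    refine tendsto_integral_of_dominated_convergence (fun r => M * g r * ∫ y, J y)
      (fun n => (hQm n).aestronglyMeasurable) (hQb.mono_set hsub)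
      (fun n => ae_restrict_of_ae_restrict_of_subset hsub (hQle n)) ?_
    filter_upwards [ae_restrict_of_ae_restrict_of_subset hsub hbd] with r hr
    refine tendsto_integral_of_dominated_convergence (fun y => M * g r * J y) (fun n => ?_)
      (hJi.const_mul _) hr (Eventually.of_forall fun y => ?_)
    · exact ((meas ((hηnc n).continuous_fderiv (by simp))).comp_measurable
        (measurable_prodMk_left (x := r))).aestronglyMeasurable
    · refine tendsto_const_nhds.congr' ?_
      filter_upwards [eventually_ge_atTop ⌈‖y‖⌉₊] with n hn
      have h1 := (Nat.le_ceil ‖y‖).trans (Nat.cast_le.mpr hn)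
      rw [hdη, cutOff_eq_one (by linarith), fderiv_cutOff_eq_zero (by linarith)]
      simp
  have hs : s ∈ Icc s t := left_mem_Icc.mpr h.le
  have := ((limP τ ⟨hτ, hτt.le⟩).sub (limP s hs)).congr step
  exact tendsto_nhds_unique this limQ

theorem integrable_fderiv_sub_mul (K : 𝓢(Plane, ℝ)) (x : Plane) :
    Integrable fun y => ‖fderiv ℝ K (x - y)‖ * (1 + ‖y‖) := by
  refine ((K.integrable_fderiv_mul_one_add.comp_sub_left x).const_mul (1 + ‖x‖)).mono'
    ((K.continuous_fderiv.comp (by fun_prop)).norm.mul (by fun_prop)).aestronglyMeasurable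
    (Eventually.of_forall fun y => ?_)
  rw [Real.norm_of_nonneg (by positivity)]
  calc _ ≤ ‖fderiv ℝ K (x - y)‖ * ((1 + ‖x‖) * (1 + ‖x - y‖)) :=
        mul_le_mul_of_nonneg_left (one_add_norm_le x y) (norm_nonneg _)
    _ = _ := by ring

theorem integral_fderiv_sub_mul_le (K : 𝓢(Plane, ℝ)) (x : Plane) :
    ∫ y, ‖fderiv ℝ K (x - y)‖ * (1 + ‖y‖)
      ≤ (∫ z, ‖fderiv ℝ K z‖ * (1 + ‖z‖)) * (1 + ‖x‖) := by
  rw [← integral_sub_left_eq_self (fun z => ‖fderiv ℝ K z‖ * (1 + ‖z‖)) volume x,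
    ← integral_mul_const]
  refine integral_mono (integrable_fderiv_sub_mul K x)
    ((K.integrable_fderiv_mul_one_add.comp_sub_left x).mul_const _) fun y => ?_
  calc _ ≤ ‖fderiv ℝ K (x - y)‖ * ((1 + ‖x‖) * (1 + ‖x - y‖)) :=
        mul_le_mul_of_nonneg_left (one_add_norm_le x y) (norm_nonneg _)
    _ = _ := by ring

theorem fderiv_comp_const_sub (K : 𝓢(Plane, ℝ)) (x y : Plane) :
    fderiv ℝ (fun y => K (x - y)) y = -fderiv ℝ K (x - y) := by
  have h1 : HasFDerivAt (fun y : Plane => x - y) (-ContinuousLinearMap.id ℝ Plane) y :=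
    (hasFDerivAt_id y).const_sub x
  have h2 := ((K.hasFDerivAt (x - y)).comp y h1).fderiv
  rw [ContinuousLinearMap.comp_neg, ContinuousLinearMap.comp_id] at h2
  exact h2

/-- The regularization of a solution of the transport equation solves a transport equation whose
source is a commutator. -/
theorem exists_smoothTransport (h : WeakTransport s t M f υ w D) (K : 𝓢(Plane, ℝ)) {τ : ℝ}
    (hτ : s ≤ τ) (hτt : τ < t) : ∃ (F : ℝ → Plane → ℝ) (g : ℝ → ℝ),
      SmoothTransport s τ (fun r x => ∫ y, K (x - y) * f r y) F
        (fun r => transportComm K (υ r) (f r)) υ g := by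
  obtain ⟨g, hg, hgυ⟩ := h.exists_norm_le
  set J := ∫ z, ‖fderiv ℝ K z‖ * (1 + ‖z‖) with hJ
  have hJ0 : 0 ≤ J := integral_nonneg fun z => by positivity
  have hMJ : 0 ≤ M * J := mul_nonneg h.nonneg hJ0
  have hIcc : Icc s τ ⊆ Icc s t := Icc_subset_Icc_right hτt.le
  have hsub : Ioc s τ ⊆ Icc s t := Ioc_subset_Icc_self.trans hIcc
  have hKi := K.integrable_real
  -- The time derivative is minus the divergence of `K * (f υ)`, written with the measurable version
  -- `w`. In the factor `1 + M J`, the term `1` covers the growth of `υ` and the term `M J` that of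
  -- this derivative.
  refine ⟨fun r x => ∫ y, fderiv ℝ (fun y => K (x - y)) y (w (r, y)), fun r => (1 + M * J) * g r,
    hτ, fun r hr => ?_, ⟨∫ y, |K y| * M, fun r hr x => ?_⟩, ?_, ?_,
    (hg.mono_set hsub).const_mul _, ?_, ?_,
    ae_restrict_of_ae_restrict_of_subset hsub h.continuous_velocity,
    ae_restrict_of_ae_restrict_of_subset hsub h.integral_fderiv, ?_,
    Eventually.of_forall fun x r hr => ?_⟩
  · exact K.contDiff_integral_smul (h.continuous (hIcc hr)) (h.bounded r (hIcc hr))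
  · rw [← integral_sub_left_eq_self (fun y => |K y| * M) volume x, ← Real.norm_eq_abs]
    refine norm_integral_le_of_norm_le ((hKi.abs.mul_const M).comp_sub_left x)
      (Eventually.of_forall fun y => ?_)
    rw [norm_mul]
    exact mul_le_mul_of_nonneg_left (h.bounded r (hIcc hr) y) (norm_nonneg _)
  · have e : ∀ z : ℝ × Plane, ∫ y, K (z.2 - y) * f z.1 y = ∫ y, K y * f z.1 (z.2 - y) := fun z => by
      rw [← integral_sub_left_eq_self (fun y => K y * f z.1 (z.2 - y)) volume z.2]
      simp only [sub_sub_cancel]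
    simp only [e]
    refine continuousOn_of_dominated (bound := fun y => |K y| * M) (fun z hz => ?_) (fun z hz => ?_)
      (hKi.abs.mul_const M) (Eventually.of_forall fun y => ?_)
    · exact (K.continuous.mul ((h.continuous (hIcc hz.1)).comp
        (by fun_prop))).aestronglyMeasurable
    · refine Eventually.of_forall fun y => ?_
      rw [norm_mul]
      exact mul_le_mul_of_nonneg_left (h.bounded z.1 (hIcc hz.1) _) (norm_nonneg _)
    · refine continuousOn_const.mul (h.continuousOn.comp
        (f := fun z : ℝ × Plane => (z.1, z.2 - y)) (by fun_prop) fun z hz => ?_)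
      exact ⟨hIcc hz.1, mem_univ _⟩
  · simp only [fderiv_comp_const_sub]
    refine StronglyMeasurable.aestronglyMeasurable ?_
    refine StronglyMeasurable.integral_prod_right' (ν := (volume : Measure Plane))
      (f := fun z : (ℝ × Plane) × Plane => (-fderiv ℝ K (z.1.2 - z.2)) (w (z.1.1, z.2))) ?_
    exact isBoundedBilinearMap_apply.continuous.comp_stronglyMeasurable
      ((K.continuous_fderiv.comp (by fun_prop)).neg.stronglyMeasurable.prodMk
        (h.stronglyMeasurable.comp_measurable (by fun_prop)))
  · filter_upwards [ae_restrict_of_ae_restrict_of_subset hsub hgυ,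
      ae_restrict_of_ae_restrict_of_subset hsub h.ae_eq, ae_restrict_mem measurableSet_Ioc]
      with r h1 h2 h3 x
    have h4 : |∫ y, fderiv ℝ (fun y => K (x - y)) y (w (r, y))|
        ≤ ∫ y, M * g r * (‖fderiv ℝ K (x - y)‖ * (1 + ‖y‖)) := by
      rw [← Real.norm_eq_abs]
      refine norm_integral_le_of_norm_le ((integrable_fderiv_sub_mul K x).const_mul _) ?_
      filter_upwards [h2] with y hy
      rw [fderiv_comp_const_sub, _root_.neg_apply, norm_neg, hy]
      have h5 : ‖f r y • υ r y‖ ≤ M * (g r * (1 + ‖y‖)) := by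
        rw [norm_smul]
        exact mul_le_mul (h.bounded r (hsub h3) y) (h1.2 y) (norm_nonneg _) h.nonneg
      calc _ ≤ ‖fderiv ℝ K (x - y)‖ * (M * (g r * (1 + ‖y‖))) :=
            (ContinuousLinearMap.le_opNorm _ _).trans
              (mul_le_mul_of_nonneg_left h5 (norm_nonneg _))
        _ = _ := by ring
    rw [integral_const_mul] at h4
    have h6 := mul_le_mul_of_nonneg_left (integral_fderiv_sub_mul_le K x)
      (mul_nonneg h.nonneg h1.1)
    have h7 := mul_nonneg h1.1 (by positivity : 0 ≤ 1 + ‖x‖)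
    calc _ ≤ M * g r * (J * (1 + ‖x‖)) := h4.trans h6
      _ ≤ M * g r * (J * (1 + ‖x‖)) + g r * (1 + ‖x‖) := le_add_of_nonneg_right h7
      _ = _ := by ring
  · filter_upwards [ae_restrict_of_ae_restrict_of_subset hsub hgυ] with r h1 x
    refine (h1.2 x).trans (mul_le_mul_of_nonneg_right ?_ (by positivity))
    have := mul_nonneg hMJ h1.1
    linarith
  · filter_upwards [ae_restrict_of_ae_restrict_of_subset hsub hgυ,
      ae_restrict_of_ae_restrict_of_subset hsub h.ae_eq, ae_restrict_mem measurableSet_Ioc,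
      ae_restrict_of_ae_restrict_of_subset hsub h.continuous_velocity] with r h1 h2 h3 h4 x
    have hf := h.continuous (hsub h3)
    have hb := h.bounded r (hsub h3)
    have hi := K.integrable_fderiv_smulRight_sub hf.aestronglyMeasurable hb x
    have e1 : fderiv ℝ (fun x => ∫ y, K (x - y) * f r y) x (υ r x)
        = ∫ y, fderiv ℝ K (x - y) (υ r x) * f r y := by
      have := K.fderiv_integral_smul hf.aestronglyMeasurable hb x
      simp only [smul_eq_mul] at this
      rw [this, ContinuousLinearMap.integral_apply hi]
      rfl
    have i1 : Integrable fun y => fderiv ℝ K (x - y) (υ r x) * f r y :=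
      ContinuousLinearMap.integrable_comp (ContinuousLinearMap.apply ℝ ℝ (υ r x)) hi
    have i2 : Integrable fun y => fderiv ℝ K (x - y) (υ r y) * f r y := by
      refine ((integrable_fderiv_sub_mul K x).const_mul (g r * M)).mono'
        (((K.continuous_fderiv.comp (by fun_prop)).clm_apply h4).mul hf).aestronglyMeasurable
        (Eventually.of_forall fun y => ?_)
      rw [norm_mul]
      calc _ ≤ (‖fderiv ℝ K (x - y)‖ * (g r * (1 + ‖y‖))) * M :=
            mul_le_mul ((ContinuousLinearMap.le_opNorm _ _).trans
              (mul_le_mul_of_nonneg_left (h1.2 y) (norm_nonneg _))) (hb y) (abs_nonneg _)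
              (mul_nonneg (norm_nonneg _) (mul_nonneg h1.1 (by positivity)))
        _ = _ := by ring
    have e2 : ∫ y, fderiv ℝ (fun y => K (x - y)) y (w (r, y))
        = -∫ y, fderiv ℝ K (x - y) (υ r y) * f r y := by
      rw [← integral_neg]
      refine integral_congr_ae ?_
      filter_upwards [h2] with y hy
      rw [hy, fderiv_comp_const_sub, _root_.neg_apply, map_smul, smul_eq_mul, mul_comm]
    -- The gradient of the convolution contributes `υ r x` and the time derivative contributes `-υ r
    -- y`; together they form the commutator.
    rw [e1, e2, transportComm]
    simp only [map_sub, sub_mul]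
    rw [integral_sub i1 i2]
    ring
  · have hηc : ContDiff ℝ ∞ fun y => K (x - y) := (K.smooth ⊤).comp (contDiff_const.sub contDiff_id)
    have hdi : Integrable fun y => ‖fderiv ℝ (fun y => K (x - y)) y‖ * (1 + ‖y‖) := by
      simp only [fderiv_comp_const_sub, norm_neg]
      exact integrable_fderiv_sub_mul K x
    have := h.sub_eq_integral hηc (hKi.comp_sub_left x) hdi hr.1 (hr.2.trans_lt hτt)
    rw [intervalIntegral.integral_of_le hr.1, ← this]
    ring

end WeakTransport

end Characteristics

/-! ### Measurability in time of spatial norms -/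

section TimeMeasurability

variable {E : Type*} [NormedAddCommGroup E]

theorem Continuous.eLpNorm_top_eq_iSup {f : Plane → E} (hf : Continuous f) {d : ℕ → Plane}
    (hd : DenseRange d) : eLpNorm f ⊤ volume = ⨆ n, ‖f (d n)‖ₑ := by
  rw [eLpNorm_exponent_top]
  refine le_antisymm ?_ (iSup_le fun n => ?_)
  · refine eLpNormEssSup_le_of_ae_enorm_bound (Eventually.of_forall fun x => ?_)
    have hcl : IsClosed {x | ‖f x‖ₑ ≤ ⨆ n, ‖f (d n)‖ₑ} :=
      isClosed_le hf.enorm continuous_const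
    have : range d ⊆ {x | ‖f x‖ₑ ≤ ⨆ n, ‖f (d n)‖ₑ} := by
      rintro _ ⟨n, rfl⟩
      exact le_iSup (fun n => ‖f (d n)‖ₑ) n
    exact hcl.closure_subset_iff.mpr this (hd x)
  · have hcl : IsClosed {x | ‖f x‖ₑ ≤ eLpNormEssSup f volume} :=
      isClosed_le hf.enorm continuous_const
    have hde := Measure.dense_of_ae (ae_le_eLpNormEssSup (f := f) (μ := (volume : Measure Plane)))
    exact hcl.closure_subset_iff.mpr subset_rfl (hde (d n))

/-- Measurability in time is known only at each fixed point. The exceptional times for a countable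
dense set of points form one null set; off it, continuity in `x` carries measurability to all
points, and a function continuous in one variable and measurable in the other is jointly measurable.
-/
theorem aemeasurable_eLpNorm_of_continuous {μ : Measure ℝ} {f : ℝ → Plane → E}
    (hc : ∀ τ, Continuous (f τ)) (hm : ∀ x, AEStronglyMeasurable (fun τ => f τ x) μ) {p : ℝ≥0∞}
    (hp : p ≠ 0) : AEMeasurable (fun τ => eLpNorm (f τ) p volume) μ := by
  set d := TopologicalSpace.denseSeq Plane with hd
  have hdr : DenseRange d := TopologicalSpace.denseRange_denseSeq Plane
  have h1 : ∀ᵐ τ ∂μ, ∀ n, f τ (d n) = (hm (d n)).mk _ τ := ae_all_iff.mpr fun n => (hm (d n)).ae_eq_mk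
  obtain ⟨S, hS, hSm, hS0⟩ := h1.exists_measurable_mem
  set h : Plane → ℝ → E := fun x τ => S.indicator (fun τ => f τ x) τ with hh
  have hhd : ∀ n, StronglyMeasurable (h (d n)) := fun n => by
    have e : h (d n) = S.indicator ((hm (d n)).mk _) := by
      ext τ
      simp only [hh]
      by_cases hτ : τ ∈ S
      · rw [indicator_of_mem hτ, indicator_of_mem hτ]
        exact hS0 τ hτ n
      · rw [indicator_of_notMem hτ, indicator_of_notMem hτ]
    rw [e]
    exact ((hm (d n)).stronglyMeasurable_mk).indicator hSm
  have hhc : ∀ τ, Continuous fun x => h x τ := fun τ => by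
    simp only [hh]
    by_cases hτ : τ ∈ S
    · simpa only [indicator_of_mem hτ] using hc τ
    · simpa only [indicator_of_notMem hτ] using continuous_const
  have hhm : ∀ x, StronglyMeasurable (h x) := fun x => by
    obtain ⟨y, hy, hlim⟩ := mem_closure_iff_seq_limit.mp (hdr x)
    choose n hn using hy
    refine stronglyMeasurable_of_tendsto atTop (f := fun i => h (d (n i))) (fun i => hhd _)
      (tendsto_pi_nhds.mpr fun τ => ?_)
    simp only [hn]
    exact ((hhc τ).tendsto x).comp hlim
  have hu := stronglyMeasurable_uncurry_of_continuous_of_stronglyMeasurable hhc hhm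
  have hmeas : Measurable fun τ => eLpNorm (fun x => h x τ) p volume := by
    rcases eq_or_ne p ⊤ with rfl | hp'
    · simp only [(hhc _).eLpNorm_top_eq_iSup hdr]
      exact Measurable.iSup fun n => (hhd n).enorm
    · simp only [eLpNorm_eq_lintegral_rpow_enorm_toReal hp hp']
      exact ((hu.enorm.pow_const _).lintegral_prod_left').pow_const _
  refine hmeas.aemeasurable.congr ?_
  filter_upwards [hS] with τ hτ
  simp only [hh, indicator_of_mem hτ]

theorem tendsto_of_le_add {X : Type*} {l : Filter X} {N d : X → ℝ≥0∞} {c : ℝ≥0∞} (hc : c ≠ ⊤)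
    (h1 : ∀ᶠ x in l, N x ≤ c + d x) (h2 : ∀ᶠ x in l, c ≤ N x + d x) (hd : Tendsto d l (𝓝 0)) :
    Tendsto N l (𝓝 c) := by
  have l1 : Tendsto (fun x => c + d x) l (𝓝 c) := by simpa using tendsto_const_nhds.add hd
  have l2 : Tendsto (fun x => c - d x) l (𝓝 c) := by
    simpa using ENNReal.Tendsto.sub tendsto_const_nhds hd (Or.inl hc)
  refine tendsto_of_tendsto_of_tendsto_of_le_of_le' l2 l1 (h2.mono fun x hx => ?_) h1
  exact tsub_le_iff_right.mpr hx

theorem continuousOn_uncurry_of_enorm_sub_le {f : ℝ → Plane → E} {S : Set ℝ}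
    (hc : ∀ t ∈ S, Continuous (f t)) {e : ℝ → ℝ → ℝ≥0∞}
    (he : ∀ t ∈ S, Tendsto (fun τ => e τ t) (𝓝[S] t) (𝓝 0))
    (h : ∀ t ∈ S, ∀ τ ∈ S, ∀ x, ‖f τ x - f t x‖ₑ ≤ e τ t) :
    ContinuousOn (fun z : ℝ × Plane => f z.1 z.2) (S ×ˢ univ) := by
  rintro ⟨t, y⟩ ⟨ht, -⟩
  have hfst : Tendsto (Prod.fst : ℝ × Plane → ℝ) (𝓝[S ×ˢ univ] (t, y)) (𝓝[S] t) :=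
    tendsto_nhdsWithin_iff.mpr ⟨continuous_fst.continuousAt.tendsto.mono_left nhdsWithin_le_nhds,
      eventually_nhdsWithin_of_forall fun z hz => hz.1⟩
  have h1 : Tendsto (fun z : ℝ × Plane => ‖f z.1 z.2 - f t z.2‖ₑ) (𝓝[S ×ˢ univ] (t, y)) (𝓝 0) := by
    refine tendsto_of_tendsto_of_tendsto_of_le_of_le' tendsto_const_nhds ((he t ht).comp hfst)
      (Eventually.of_forall fun z => zero_le) ?_
    exact eventually_nhdsWithin_of_forall fun z hz => h t ht z.1 hz.1 z.2
  have h2 : Tendsto (fun z : ℝ × Plane => f z.1 z.2 - f t z.2) (𝓝[S ×ˢ univ] (t, y)) (𝓝 0) :=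
    tendsto_zero_iff_enorm_tendsto_zero.mpr h1
  have h3 : Tendsto (fun z : ℝ × Plane => f t z.2) (𝓝[S ×ˢ univ] (t, y)) (𝓝 (f t y)) :=
    (((hc t ht).comp continuous_snd).tendsto (t, y)).mono_left nhdsWithin_le_nhds
  have h4 := h2.add h3
  rw [zero_add] at h4
  exact h4.congr fun z => sub_add_cancel _ _

end TimeMeasurability

/-! ### Continuity in time of blocks and norms -/

section BlockContinuity

variable {F : Type*} [NormedAddCommGroup F] [NormedSpace ℂ F] {L : LittlewoodPaley} {q : ℝ≥0∞}
  {s : ℝ}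

theorem LittlewoodPaley.block_sub (L : LittlewoodPaley) (j : ℤ) (S T : 𝓢'(Plane, F)) (x : Plane) :
    L.block j (S - T) x = L.block j S x - L.block j T x := rfl

theorem eLpNorm_block_sub_comm [CompleteSpace F] (j : ℤ) (S T : 𝓢'(Plane, F)) :
    eLpNorm (L.block j (S - T)) q volume = eLpNorm (L.block j (T - S)) q volume :=
  eLpNorm_congr_norm_ae (Eventually.of_forall fun x => by
    rw [L.block_sub, L.block_sub, norm_sub_rev])

theorem besovNorm_sub_comm [CompleteSpace F] (S T : 𝓢'(Plane, F)) :
    besovNorm L s q 1 (S - T) = besovNorm L s q 1 (T - S) := by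
  simp only [L.besovNorm_one, blockSize, eLpNorm_block_sub_comm]

theorem eLpNorm_block_le_add [CompleteSpace F] (hq : 1 ≤ q) (j : ℤ) (S T : 𝓢'(Plane, F)) :
    eLpNorm (L.block j S) q volume
      ≤ eLpNorm (L.block j T) q volume + eLpNorm (L.block j (S - T)) q volume := by
  have h1 := eLpNorm_add_le (L.continuous_block j T).aestronglyMeasurable
    (L.continuous_block j (S - T)).aestronglyMeasurable hq (μ := (volume : Measure Plane))
  refine le_trans (le_of_eq ?_) h1
  congr 1
  ext x
  rw [Pi.add_apply, L.block_sub, add_sub_cancel]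

theorem besovNorm_le_add [CompleteSpace F] (hq : 1 ≤ q) (S T : 𝓢'(Plane, F)) :
    besovNorm L s q 1 S ≤ besovNorm L s q 1 T + besovNorm L s q 1 (S - T) := by
  simp only [L.besovNorm_one, blockSize]
  rw [← ENNReal.tsum_add]
  refine ENNReal.tsum_le_tsum fun k => ?_
  rw [← mul_add]
  exact mul_le_mul_right (eLpNorm_block_le_add hq k S T) _

theorem dyadicWeight_mul_eLpNorm_block_le [CompleteSpace F] (j : ℤ) (S : 𝓢'(Plane, F)) :
    dyadicWeight s j * eLpNorm (L.block j S) q volume ≤ besovNorm L s q 1 S := by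
  rw [L.besovNorm_one]
  exact ENNReal.le_tsum (f := fun k => blockSize s q (fun k => L.block k S) k) j

theorem besovNorm_sub_ne_top [CompleteSpace F] (hq : 1 ≤ q) {S T : 𝓢'(Plane, F)}
    (hS : besovNorm L s q 1 S ≠ ⊤) (hT : besovNorm L s q 1 T ≠ ⊤) :
    besovNorm L s q 1 (S - T) ≠ ⊤ := by
  refine ne_top_of_le_ne_top (ENNReal.add_ne_top.mpr ⟨hS, hT⟩) ?_
  simp only [L.besovNorm_one, blockSize]
  rw [← ENNReal.tsum_add]
  refine ENNReal.tsum_le_tsum fun k => ?_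
  rw [← mul_add]
  exact mul_le_mul_right (eLpNorm_sub_le (L.continuous_block k S).aestronglyMeasurable
    (L.continuous_block k T).aestronglyMeasurable hq) _

end BlockContinuity

namespace MemCBesov

variable {F : Type*} [NormedAddCommGroup F] [NormedSpace ℂ F] [CompleteSpace F]
  {L : LittlewoodPaley} {q : ℝ≥0∞} {s T : ℝ} {a : ℝ → 𝓢'(Plane, F)}

theorem continuousOn_besovNorm (h : MemCBesov L s q 1 T a) (hq : 1 ≤ q) :
    ContinuousOn (fun t => besovNorm L s q 1 (a t)) (Icc 0 T) := fun t ht =>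
  tendsto_of_le_add (h.1 t ht).2.ne (Eventually.of_forall fun τ => besovNorm_le_add hq _ _)
    (Eventually.of_forall fun τ => by
      rw [besovNorm_sub_comm]
      exact besovNorm_le_add hq _ _) (h.2 t ht)

theorem continuousOn_eLpNorm_block (h : MemCBesov L s q 1 T a) (hq : 1 ≤ q) (j : ℤ) :
    ContinuousOn (fun t => dyadicWeight s j * eLpNorm (L.block j (a t)) q volume) (Icc 0 T) :=
  fun t ht => by
  refine tendsto_of_le_add (d := fun τ => besovNorm L s q 1 (a τ - a t))
    (ne_top_of_le_ne_top (h.1 t ht).2.ne (dyadicWeight_mul_eLpNorm_block_le j _))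
    (Eventually.of_forall fun τ => ?_) (Eventually.of_forall fun τ => ?_) (h.2 t ht)
  · refine (mul_le_mul_right (eLpNorm_block_le_add hq j _ (a t)) _).trans ?_
    rw [mul_add]
    exact add_le_add le_rfl (dyadicWeight_mul_eLpNorm_block_le j _)
  · refine (mul_le_mul_right (eLpNorm_block_le_add hq j _ (a τ)) _).trans ?_
    rw [mul_add, besovNorm_sub_comm]
    exact add_le_add le_rfl (dyadicWeight_mul_eLpNorm_block_le j _)

theorem exists_bound (h : MemCBesov L s q 1 T a) (hq : 1 ≤ q) :
    ∃ M : ℝ≥0∞, M ≠ ⊤ ∧ ∀ t ∈ Icc 0 T, besovNorm L s q 1 (a t) ≤ M := by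
  rcases lt_or_ge T 0 with hT | hT
  · exact ⟨0, ENNReal.zero_ne_top, fun t ht => absurd (ht.1.trans ht.2) hT.not_ge⟩
  obtain ⟨t, ht, hmax⟩ := isCompact_Icc.exists_isMaxOn (nonempty_Icc.mpr hT)
    (h.continuousOn_besovNorm hq)
  exact ⟨_, (h.1 t ht).2.ne, fun τ hτ => hmax hτ⟩

end MemCBesov

namespace MemCBesov

variable {L : LittlewoodPaley} {q : ℝ≥0∞} {T : ℝ} {a : ℝ → 𝓢'(Plane, ℂ)}

theorem continuousOn_block (h : MemCBesov L (twoOver q) q 1 T a) (hq : 1 ≤ q) (k : ℤ) (x : Plane) :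
    ContinuousOn (fun t => L.block k (a t) x) (Icc 0 T) := by
  obtain ⟨B, hBt, -, -, hB⟩ := L.exists_kernelBound
  have h1 := continuousOn_uncurry_of_enorm_sub_le (f := fun t => L.block k (a t)) (S := Icc 0 T)
    (fun t _ => L.continuous_block k (a t))
    (e := fun τ t => B * besovNorm L (twoOver q) q 1 (a τ - a t)) (fun t ht => ?_)
    (fun t ht τ hτ x => ?_)
  · exact h1.comp (f := fun t => (t, x)) (by fun_prop) fun t ht => ⟨ht, mem_univ _⟩
  · simpa using ENNReal.Tendsto.const_mul (h.2 t ht) (Or.inr hBt)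
  · rw [← L.block_sub]
    refine (enorm_block_le hq (besovNorm_sub_ne_top hq (h.1 τ hτ).2.ne (h.1 t ht).2.ne) hB k x).trans
      (mul_le_mul_right ?_ _)
    exact dyadicWeight_mul_eLpNorm_block_le k _

/-- Blocks which are real almost always are real. -/
theorem ofReal_re_block (h : MemCBesov L (twoOver q) q 1 T a) (hq : 1 ≤ q) (hT : 0 < T)
    (hr : ∀ᵐ t ∂(volume.restrict (Ioo 0 T)), ∃ α : Plane → ℝ, IsRepresentedBy (a t)
      fun x => (α x : ℂ)) {t : ℝ} (ht : t ∈ Icc 0 T) (k : ℤ) (x : Plane) :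
    (scalBlock L (a t) k x : ℂ) = L.block k (a t) x := by
  have h1 := h.continuousOn_block hq k x
  have h2 : ContinuousOn (fun t => (scalBlock L (a t) k x : ℂ)) (Icc 0 T) :=
    Complex.continuous_ofReal.comp_continuousOn (Complex.continuous_re.comp_continuousOn h1)
  refine Measure.eqOn_Icc_of_ae_eq volume hT.ne ?_ h2 h1 ht
  rw [← restrict_Ioo_eq_restrict_Icc]
  filter_upwards [hr] with τ ⟨α, hα⟩
  exact ofReal_scalBlock hα k x

end MemCBesov

/-! ### Continuous real representatives at every time -/

section RealRepresentation

variable {L : LittlewoodPaley} {q : ℝ≥0∞} {A A' : 𝓢'(Plane, ℂ)}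

theorem summable_norm_block (hq : 1 ≤ q) (hA : besovNorm L (twoOver q) q 1 A ≠ ⊤) (x : Plane) :
    Summable fun k => ‖L.block k A x‖ := by
  obtain ⟨B, hBt, -, -, hB⟩ := L.exists_kernelBound
  refine summable_of_tsum_enorm_ne_top (ne_top_of_le_ne_top ?_
    (ENNReal.tsum_le_tsum fun k => enorm_block_le hq hA hB k x))
  rw [ENNReal.tsum_mul_left, ← L.besovNorm_one]
  finiteness

theorem scalSum_sub (hq : 1 ≤ q) (hA : besovNorm L (twoOver q) q 1 A ≠ ⊤)
    (hA' : besovNorm L (twoOver q) q 1 A' ≠ ⊤) (x : Plane) :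
    scalSum L (A - A') x = scalSum L A x - scalSum L A' x := by
  rw [scalSum_eq hq (besovNorm_sub_ne_top hq hA hA'), scalSum_eq hq hA, scalSum_eq hq hA',
    ← Complex.sub_re, ← (summable_norm_block hq hA x).of_norm.tsum_sub
      (summable_norm_block hq hA' x).of_norm]
  rfl

theorem isRepresentedBy_scalSum (hq : 1 ≤ q) (hA : MemBesov L (twoOver q) q 1 A)
    (hr : ∀ k x, (scalBlock L A k x : ℂ) = L.block k A x) :
    IsRepresentedBy A fun x => (scalSum L A x : ℂ) := by
  obtain ⟨B, hBt, -, -, hB⟩ := L.exists_kernelBound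
  have e : ∀ x, (scalSum L A x : ℂ) = ∑' k, L.block k A x := fun x => by
    rw [scalSum, Complex.ofReal_tsum]
    simp only [hr]
  have hb : B * besovNorm L (twoOver q) q 1 A ≠ ⊤ := by finiteness [hA.2.ne]
  intro ψ
  refine ⟨?_, ?_⟩
  · refine ψ.integrable.mul_bdd (c := (B * besovNorm L (twoOver q) q 1 A).toReal)
      (Complex.continuous_ofReal.comp (continuous_scalSum hq hA.2.ne)).aestronglyMeasurable
      (Eventually.of_forall fun x => ?_)
    rw [Complex.norm_real]
    have := ENNReal.toReal_mono hb (enorm_scalSum_le hq hA.2.ne hB x)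
    rwa [toReal_enorm] at this
  · simp only [e]
    refine L.apply_eq_integral_tsum hA.1 ψ (fun k => L.continuous_block k A) (fun k => rfl) ?_
    refine ne_top_of_le_ne_top (b := ∑' k, (∫⁻ x, ‖ψ x‖ₑ)
      * (B * blockSize (twoOver q) q (fun k => L.block k A) k)) ?_
      (ENNReal.tsum_le_tsum fun k => ?_)
    · rw [ENNReal.tsum_mul_left, ENNReal.tsum_mul_left, ← L.besovNorm_one]
      finiteness [hA.2.ne, ψ.lintegral_enorm_ne_top]
    · rw [← lintegral_mul_const _ ψ.continuous.enorm.measurable]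
      refine lintegral_mono fun x => ?_
      rw [enorm_smul]
      exact mul_le_mul_right (enorm_block_le hq hA.2.ne hB k x) _

/-- The blocks are convolutions with the sum of the blocks, so a vanishing sum would make every
block, and hence the norm, vanish. -/
theorem exists_scalSum_ne_zero (hq : 1 ≤ q) (hA : MemBesov L (twoOver q) q 1 A)
    (hr : ∀ k x, (scalBlock L A k x : ℂ) = L.block k A x)
    (h0 : besovNorm L (twoOver q) q 1 A ≠ 0) : ∃ x, scalSum L A x ≠ 0 := by
  by_contra! hz
  refine h0 ?_
  rw [L.besovNorm_one, ENNReal.tsum_eq_zero]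
  intro k
  have : L.block k A = 0 := by
    ext x
    rw [← hr, scalBlock_eq_integral hq hA (isRepresentedBy_scalSum hq hA hr)]
    simp [hz]
  rw [blockSize, this, eLpNorm_zero, mul_zero]

theorem MemCBesov.continuousOn_scalSum {T : ℝ} {a : ℝ → 𝓢'(Plane, ℂ)}
    (h : MemCBesov L (twoOver q) q 1 T a) (hq : 1 ≤ q) :
    ContinuousOn (fun z : ℝ × Plane => scalSum L (a z.1) z.2) (Icc 0 T ×ˢ univ) := by
  obtain ⟨B, hBt, -, -, hB⟩ := L.exists_kernelBound
  refine continuousOn_uncurry_of_enorm_sub_le (f := fun t => scalSum L (a t)) (S := Icc 0 T)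
    (fun t ht => continuous_scalSum hq (h.1 t ht).2.ne)
    (e := fun τ t => B * besovNorm L (twoOver q) q 1 (a τ - a t)) (fun t ht => ?_)
    (fun t ht τ hτ x => ?_)
  · simpa using ENNReal.Tendsto.const_mul (h.2 t ht) (Or.inr hBt)
  · rw [← scalSum_sub hq (h.1 τ hτ).2.ne (h.1 t ht).2.ne]
    exact enorm_scalSum_le hq (besovNorm_sub_ne_top hq (h.1 τ hτ).2.ne (h.1 t ht).2.ne) hB x

end RealRepresentation

/-! ### Estimate of a block while the solution does not vanish -/

section LocalEstimate

/-- The right hand side of the estimate of the `j`-th dyadic block of a transported quantity. -/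
def transportSource (L : LittlewoodPaley) (p q : ℝ≥0∞) (V : 𝓢'(Plane, CPlane)) (A : 𝓢'(Plane, ℂ))
    (j : ℤ) : ℝ≥0∞ :=
  besovNorm L (twoOver p + 1) p 1 V
      * (∑' l, decay (j - l) * blockSize (twoOver q) q (fun l => L.block l A) l)
    + (∑' k, decay (j - k) * blockSize (twoOver p + 1) p (fun k => L.block k V) k)
      * besovNorm L (twoOver q) q 1 A

/-- Young's inequality for sequences in `ℓ¹`, an equality for nonnegative terms. Each of the two
paraproduct-like terms contributes one factor `∑ decay`. -/
theorem tsum_transportSource (L : LittlewoodPaley) (p q : ℝ≥0∞) (V : 𝓢'(Plane, CPlane))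
    (A : 𝓢'(Plane, ℂ)) : ∑' j, transportSource L p q V A j
      = 2 * (∑' n, decay n) * (besovNorm L (twoOver p + 1) p 1 V * besovNorm L (twoOver q) q 1 A) := by
  simp only [transportSource]
  rw [ENNReal.tsum_add, ENNReal.tsum_mul_left, ENNReal.tsum_mul_right,
    ENNReal.tsum_comm, ENNReal.tsum_comm (f := fun j k => decay (j - k)
      * blockSize (twoOver p + 1) p (fun k => L.block k V) k)]
  simp only [ENNReal.tsum_mul_right, tsum_decay_sub_right]
  rw [ENNReal.tsum_mul_left, ENNReal.tsum_mul_left, ← L.besovNorm_one, ← L.besovNorm_one]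
  ring

variable {L : LittlewoodPaley} {p q : ℝ≥0∞} {T : ℝ} {a : ℝ → 𝓢'(Plane, ℂ)}
  {u : ℝ → 𝓢'(Plane, CPlane)}

theorem MemL1Besov.aemeasurable_blockSize {s : ℝ} (hu : MemL1Besov L s p 1 T u) (hp : 1 ≤ p)
    (k : ℤ) : AEMeasurable (fun τ => blockSize s p (fun k => L.block k (u τ)) k)
      (volume.restrict (Ioo 0 T)) :=
  (aemeasurable_eLpNorm_of_continuous (fun τ => L.continuous_block k (u τ)) (fun _ => hu.1 _)
    (zero_lt_one.trans_le hp).ne').const_mul _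

theorem MemL1Besov.aemeasurable_besovNorm {s : ℝ} (hu : MemL1Besov L s p 1 T u) (hp : 1 ≤ p) :
    AEMeasurable (fun τ => besovNorm L s p 1 (u τ)) (volume.restrict (Ioo 0 T)) := by
  simp only [L.besovNorm_one]
  exact AEMeasurable.tsum fun k => hu.aemeasurable_blockSize hp k

theorem MemCBesov.aemeasurable_besovNorm {s : ℝ} (ha : MemCBesov L s q 1 T a) (hq : 1 ≤ q) :
    AEMeasurable (fun τ => besovNorm L s q 1 (a τ)) (volume.restrict (Ioo 0 T)) :=
  ((ha.continuousOn_besovNorm hq).mono Ioo_subset_Icc_self).aemeasurable measurableSet_Ioo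

theorem aemeasurable_transportSource (hu : MemL1Besov L (twoOver p + 1) p 1 T u) (hp : 1 ≤ p)
    (ha : MemCBesov L (twoOver q) q 1 T a) (hq : 1 ≤ q) (j : ℤ) :
    AEMeasurable (fun τ => transportSource L p q (u τ) (a τ) j) (volume.restrict (Ioo 0 T)) := by
  refine ((hu.aemeasurable_besovNorm hp).mul (AEMeasurable.tsum fun l => ?_)).add
    ((AEMeasurable.tsum fun k => (hu.aemeasurable_blockSize hp k).const_mul _).mul
      (ha.aemeasurable_besovNorm hq))
  exact (((ha.continuousOn_eLpNorm_block hq l).mono Ioo_subset_Icc_self).aemeasurable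
    measurableSet_Ioo).const_mul _

/-- The standing assumptions on the solution of the transport equation. -/
structure BesovTransport (L : LittlewoodPaley) (p q : ℝ≥0∞) (T : ℝ) (u : ℝ → 𝓢'(Plane, CPlane))
    (a : ℝ → 𝓢'(Plane, ℂ)) : Prop where
  pos : 0 < T
  mem_u : MemL1Besov L (twoOver p + 1) p 1 T u
  divFree : ∀ᵐ t ∂(volume.restrict (Ioo 0 T)), IsDivFree (u t)
  mem_a : MemCBesov L (twoOver q) q 1 T a
  transport : IsTransportSolution T u a

namespace BesovTransport

theorem ofReal_scalBlock (h : BesovTransport L p q T u a) (hq : 1 ≤ q) {t : ℝ} (ht : t ∈ Icc 0 T)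
    (k : ℤ) (x : Plane) : (scalBlock L (a t) k x : ℂ) = L.block k (a t) x := by
  obtain ⟨α, υ, hr, -⟩ := h.transport
  exact h.mem_a.ofReal_re_block hq h.pos (hr.mono fun τ hτ => ⟨_, hτ.1⟩) ht k x

theorem isRepresentedBy (h : BesovTransport L p q T u a) (hq : 1 ≤ q) {t : ℝ} (ht : t ∈ Icc 0 T) :
    IsRepresentedBy (a t) fun x => (scalSum L (a t) x : ℂ) :=
  isRepresentedBy_scalSum hq (h.mem_a.1 t ht) (h.ofReal_scalBlock hq ht)

theorem blockPair (h : BesovTransport L p q T u a) (hp : 1 ≤ p) (hq : 1 ≤ q) :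
    ∀ᵐ τ ∂(volume.restrict (Ioo 0 T)), BlockPair L p q (velBlock L (u τ)) (scalBlock L (a τ)) := by
  obtain ⟨α, υ, hr, -⟩ := h.transport
  filter_upwards [hr, h.mem_u.2.1, h.divFree, ae_restrict_mem measurableSet_Ioo]
    with τ h1 h2 h3 h4
  exact blockPair_of_memBesov hp hq h2.2.ne h3 h1.2
    (h.mem_a.1 τ (Ioo_subset_Icc_self h4)).2.ne h1.1

theorem exists_schwartz_integral_eq_one : ∃ ψ : 𝓢(Plane, ℂ), ∫ x, ψ x = 1 := by
  set b : ContDiffBump (0 : Plane) := ⟨1, 2, one_pos, one_lt_two⟩ with hb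
  obtain ⟨ψ, hψ⟩ := exists_schwartz_of_contDiff (g := fun x => b.normed volume x)
    (b.contDiff_normed) (b.hasCompactSupport_normed)
  refine ⟨ψ, ?_⟩
  simp only [hψ]
  rw [integral_complex_ofReal, b.integral_normed, Complex.ofReal_one]

/-- The given functions are replaced by the continuous representatives, which agree with them almost
everywhere at almost every time. The interval lies strictly inside `(0, T)`, so that its products
with balls are compact in the cylinder where `u a` is locally integrable. -/
theorem exists_weakTransport (h : BesovTransport L p q T u a) (hp : 1 ≤ p) (hq : 1 ≤ q)
    {ψ₀ : 𝓢(Plane, ℂ)} (h0 : ∫ x, ψ₀ x = 1) {s t : ℝ} (hs : 0 < s) (hst : s ≤ t) (ht : t < T)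
    (hne : ∀ τ ∈ Icc s t, besovNorm L (twoOver q) q 1 (a τ) ≠ 0) :
    ∃ (M : ℝ) (w : ℝ × Plane → Plane) (D : ℝ → ℝ),
      WeakTransport s t M (fun τ => scalSum L (a τ)) (fun τ => velSum L ψ₀ (u τ)) w D := by
  obtain ⟨B, hBt, -, -, hB⟩ := L.exists_kernelBound
  obtain ⟨M, hMt, hM⟩ := h.mem_a.exists_bound hq
  have hsub : Icc s t ⊆ Ioo 0 T := fun τ hτ => ⟨hs.trans_le hτ.1, hτ.2.trans_lt ht⟩
  have hsub' : Icc s t ⊆ Icc 0 T := hsub.trans Ioo_subset_Icc_self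
  have hae : ∀ {P : ℝ → Prop}, (∀ᵐ τ ∂(volume.restrict (Ioo 0 T)), P τ) →
      ∀ᵐ τ ∂(volume.restrict (Icc s t)), P τ := fun hP =>
    ae_restrict_of_ae_restrict_of_subset hsub hP
  have hpair := h.blockPair hp hq
  obtain ⟨α, υ, hr, hα, hw, heq⟩ := h.transport
  have hreg : ∀ᵐ τ ∂(volume.restrict (Ioo 0 T)),
      (fun x => α (τ, x)) =ᵐ[volume] scalSum L (a τ) ∧
      (fun x => υ (τ, x)) =ᵐ[volume] velSum L ψ₀ (u τ) := by
    filter_upwards [hr, h.mem_u.2.1, ae_restrict_mem measurableSet_Ioo] with τ h1 h2 h3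
    exact ⟨ae_eq_scalSum hq (h.mem_a.1 τ (Ioo_subset_Icc_self h3)) h1.1,
      ae_eq_velSum hp h2 h1.2 h0⟩
  have hwm : AEStronglyMeasurable (fun z => α z • υ z) (volume.restrict (Ioo 0 T ×ˢ univ)) :=
    hw.aestronglyMeasurable
  set w := hwm.mk _ with hwdef
  have hww : ∀ᵐ τ ∂(volume.restrict (Ioo 0 T)), ∀ᵐ y, α (τ, y) • υ (τ, y) = w (τ, y) := by
    have h1 : ∀ᵐ z ∂(volume.restrict (Ioo 0 T ×ˢ univ)), α z • υ z = w z := hwm.ae_eq_mk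
    clear_value w
    rw [Measure.volume_eq_prod, ← Measure.prod_restrict, Measure.restrict_univ] at h1
    exact Measure.ae_ae_of_ae_prod h1
  have hsubp : ∀ r, Icc s t ×ˢ Metric.closedBall (0 : Plane) r ⊆ Ioo 0 T ×ˢ univ := fun r =>
    prod_mono hsub (subset_univ _)
  refine ⟨(B * M).toReal, w, fun τ => (B * besovNorm L (twoOver p + 1) p 1 (u τ)).toReal, hst,
    (h.mem_a.continuousOn_scalSum hq).mono (prod_mono hsub' subset_rfl), fun τ hτ x => ?_,
    fun τ hτ => ?_, hwm.stronglyMeasurable_mk, fun r => ?_, ?_, ?_, ?_, ?_, ?_⟩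
  · have h1 := (enorm_scalSum_le hq (h.mem_a.1 τ (hsub' hτ)).2.ne hB x).trans
      (mul_le_mul_right (hM τ (hsub' hτ)) B)
    have h2 := ENNReal.toReal_mono (ENNReal.mul_ne_top hBt hMt) h1
    rwa [toReal_enorm] at h2
  · exact exists_scalSum_ne_zero hq (h.mem_a.1 τ (hsub' hτ)) (h.ofReal_scalBlock hq (hsub' hτ))
      (hne τ hτ)
  · have h1 : IntegrableOn (fun z => α z • υ z) (Icc s t ×ˢ Metric.closedBall 0 r) :=
      hw.integrableOn_compact_subset (hsubp r) (isCompact_Icc.prod (isCompact_closedBall _ _))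
    exact h1.congr (ae_restrict_of_ae_restrict_of_subset (hsubp r) hwm.ae_eq_mk)
  · filter_upwards [hae hww, hae hreg] with τ h1 h2
    filter_upwards [h1, h2.1, h2.2] with y h3 h4 h5
    rw [← h3, h4, h5]
  · have h1 : ∫⁻ τ in Icc s t, B * besovNorm L (twoOver p + 1) p 1 (u τ) ≠ ⊤ := by
      rw [lintegral_const_mul' _ _ hBt]
      exact ENNReal.mul_ne_top hBt (ne_top_of_le_ne_top h.mem_u.2.2.ne (lintegral_mono_set hsub))
    exact integrable_toReal_of_lintegral_ne_top
      (((h.mem_u.aemeasurable_besovNorm hp).mono_set hsub).const_mul B) h1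
  · filter_upwards [hae hpair, hae h.mem_u.2.1, hae hr] with τ h1 h2 h3 x y
    have hfin : B * besovNorm L (twoOver p + 1) p 1 (u τ) ≠ ⊤ := ENNReal.mul_ne_top hBt h2.2.ne
    have h4 := h1.tsum_enorm_sub_le hp hB x y
    rw [tsum_blockSize_velBlock h3.2] at h4
    have h5 : ‖velSum L ψ₀ (u τ) x - velSum L ψ₀ (u τ) y‖ₑ
        ≤ B * besovNorm L (twoOver p + 1) p 1 (u τ) * ‖x - y‖ₑ := by
      rw [velSum_sub hp h2.2.ne]
      exact enorm_tsum_le_tsum_enorm.trans h4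
    have h6 := ENNReal.toReal_mono (by finiteness) h5
    rwa [ENNReal.toReal_mul, toReal_enorm, toReal_enorm] at h6
  · filter_upwards [hae hpair, hae h.mem_u.2.1] with τ h1 h2 η hη hηc
    exact h1.integral_fderiv_eq_zero hp (fun x y => velSum_sub hp h2.2.ne x y) hη hηc
  · intro θ hθ hθs η hη hηc
    have hθc : HasCompactSupport θ :=
      isCompact_Icc.of_isClosed_subset (isClosed_tsupport θ) hθs
    rw [← integral_deriv_mul_add_integral_mul_eq_zero hα hw heq hθ hθc (hθs.trans hsub) hη hηc]
    have z : ∀ τ, τ ∉ Ioo 0 T → θ τ = 0 ∧ deriv θ τ = 0 := fun τ hτ => by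
      have h1 : τ ∉ tsupport θ := fun hm => hτ (hsub (hθs hm))
      have h2 : θ =ᶠ[𝓝 τ] fun _ => 0 := notMem_tsupport_iff_eventuallyEq.mp h1
      exact ⟨h2.eq_of_nhds, by rw [h2.deriv_eq, deriv_const]⟩
    congr 1
    · refine integral_congr_ae ?_
      filter_upwards [(ae_restrict_iff' measurableSet_Ioo).mp hreg] with τ h1
      by_cases hτ : τ ∈ Ioo 0 T
      · congr 1
        refine integral_congr_ae ?_
        filter_upwards [(h1 hτ).1] with y hy
        rw [hy]
      · rw [(z τ hτ).2, zero_mul, zero_mul]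
    · refine integral_congr_ae ?_
      filter_upwards [(ae_restrict_iff' measurableSet_Ioo).mp hww] with τ h1
      by_cases hτ : τ ∈ Ioo 0 T
      · congr 1
        refine integral_congr_ae ?_
        filter_upwards [h1 hτ] with y hy
        rw [hy]
      · rw [(z τ hτ).1, zero_mul, zero_mul]

/-- The estimate of a dyadic block on a time interval on which the solution does not vanish. -/
theorem exists_block_le (L : LittlewoodPaley) (hp : 1 ≤ p) (hq : 1 ≤ q) (hqp : q ≤ p)
    (hpq : twoOver q - twoOver p ≤ 1) : ∃ C : ℝ≥0∞, C ≠ ⊤ ∧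
    ∀ {T : ℝ} {a : ℝ → 𝓢'(Plane, ℂ)} {u : ℝ → 𝓢'(Plane, CPlane)}, BesovTransport L p q T u a →
      ∀ {s t t₁ : ℝ}, 0 < s → s ≤ t → t < t₁ → t₁ < T →
      (∀ τ ∈ Icc s t₁, besovNorm L (twoOver q) q 1 (a τ) ≠ 0) → ∀ j,
      dyadicWeight (twoOver q) j * eLpNorm (L.block j (a t)) q volume
        ≤ dyadicWeight (twoOver q) j * eLpNorm (L.block j (a s)) q volume
          + C * ∫⁻ τ in Ioc s t, transportSource L p q (u τ) (a τ) j := by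
  obtain ⟨B, hBt, hB1, hκ, hB⟩ := L.exists_kernelBound
  obtain ⟨C, hCt, hC⟩ := SmoothTransport.exists_eLpNorm_le hq
  obtain ⟨ψ₀, h0⟩ := exists_schwartz_integral_eq_one
  refine ⟨C * (2 ^ 20 * B ^ 2), by finiteness, fun {T a u} h {s t t₁} hs hst htt ht hne j => ?_⟩
  obtain ⟨M, w, D, hweak⟩ := h.exists_weakTransport hp hq h0 hs (hst.trans htt.le) ht hne
  obtain ⟨F, g, hsmooth⟩ := hweak.exists_smoothTransport (L.κS j) hst htt
  set W := dyadicWeight (twoOver q) j with hW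
  have hW0 : W ≠ 0 := dyadicWeight_ne_zero _ _
  have hWt : W ≠ ⊤ := dyadicWeight_ne_top _ _
  have hsub : Icc s t ⊆ Icc 0 T := fun τ hτ => ⟨hs.le.trans hτ.1, hτ.2.trans (htt.trans ht).le⟩
  have hsub' : Ioc s t ⊆ Ioo 0 T := fun τ hτ => ⟨hs.trans hτ.1, hτ.2.trans_lt (htt.trans ht)⟩
  -- Regularization by `κⱼ` is the dyadic block itself.
  have hb : ∀ τ ∈ Icc s t, eLpNorm (fun x => ∫ y, L.κS j (x - y) * scalSum L (a τ) y) q volume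
      = eLpNorm (L.block j (a τ)) q volume := fun τ hτ => by
    have hrep := h.isRepresentedBy hq (hsub hτ)
    rw [← eLpNorm_scalBlock hrep]
    congr 1
    ext x
    exact (scalBlock_eq_integral hq (h.mem_a.1 τ (hsub hτ)) hrep j x).symm
  obtain ⟨N, hNt, hN⟩ := h.mem_a.exists_bound hq
  -- The finite a priori bound on the `L^q` norms comes from the boundedness of the Besov norm on
  -- the compact time interval.
  have h1 := hC hsmooth (M := W⁻¹ * N) (ENNReal.mul_ne_top (ENNReal.inv_ne_top.mpr hW0) hNt)
    (fun τ hτ => ?_)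
    (ρ := fun τ => W⁻¹ * (2 ^ 20 * B ^ 2 * transportSource L p q (u τ) (a τ) j)) ?_ ?_
  · rw [hb t (right_mem_Icc.mpr hst), hb s (left_mem_Icc.mpr hst),
      lintegral_const_mul' _ _ (ENNReal.inv_ne_top.mpr hW0),
      lintegral_const_mul' _ _ (by finiteness)] at h1
    refine (mul_le_mul_right h1 W).trans (le_of_eq ?_)
    rw [mul_add]
    congr 1
    calc _ = W * W⁻¹ * (C * (2 ^ 20 * B ^ 2
          * ∫⁻ τ in Ioc s t, transportSource L p q (u τ) (a τ) j)) := by ring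
      _ = _ := by
        rw [ENNReal.mul_inv_cancel hW0 hWt, one_mul]
        ring
  · rw [hb τ hτ, ← ENNReal.mul_le_iff_le_inv hW0 hWt]
    exact (dyadicWeight_mul_eLpNorm_block_le j _).trans (hN τ (hsub hτ))
  · exact (((aemeasurable_transportSource h.mem_u hp h.mem_a hq j).mono_set hsub').const_mul
      _).const_mul _
  · have hpair := h.blockPair hp hq
    obtain ⟨α, υ, hr, -⟩ := h.transport
    filter_upwards [ae_restrict_of_ae_restrict_of_subset hsub' hpair,
      ae_restrict_of_ae_restrict_of_subset hsub' hr,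
      ae_restrict_of_ae_restrict_of_subset hsub' h.mem_u.2.1] with τ h2 h3 h4
    rw [← ENNReal.mul_le_iff_le_inv hW0 hWt]
    have h5 := h2.dyadicWeight_mul_eLpNorm_le hκ hB hB1 hBt hq hqp hpq
      (υ := velSum L ψ₀ (u τ)) (α := scalSum L (a τ)) (fun x y => velSum_sub hp h4.2.ne x y)
      (fun y => rfl) j
    rw [tsum_blockSize_velBlock h3.2, tsum_blockSize_scalBlock h3.1] at h5
    simpa only [transportSource, blockSize, eLpNorm_velBlock h3.2, eLpNorm_scalBlock h3.1] using h5

end BesovTransport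

end LocalEstimate

/-! ### From local intervals to the initial time, and Gronwall's inequality -/

section GlobalEstimate

/-- Gronwall's inequality for extended nonnegative functions. -/
theorem lintegral_mul_le_mul_exp_sub_one {N D : ℝ → ℝ≥0∞} {A M : ℝ≥0∞} {t : ℝ} (ht : 0 ≤ t)
    (hA : A ≠ ⊤) (hM : M ≠ ⊤) (hD : AEMeasurable D (volume.restrict (Ioo 0 t)))
    (hDt : ∫⁻ τ in Ioo 0 t, D τ ≠ ⊤) (hN : AEMeasurable N (volume.restrict (Ioo 0 t)))
    (hNM : ∀ τ ∈ Icc 0 t, N τ ≤ M)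
    (h : ∀ τ ∈ Icc 0 t, N τ ≤ A + ∫⁻ r in Ioo 0 τ, D r * N r) :
    ∫⁻ r in Ioo 0 t, D r * N r
      ≤ A * ENNReal.ofReal (Real.exp (∫⁻ r in Ioo 0 t, D r).toReal - 1) := by
  have hDN : ∫⁻ r in Ioo 0 t, D r * N r ≠ ⊤ := by
    have h1 : ∫⁻ r in Ioo 0 t, D r * N r ≤ ∫⁻ r in Ioo 0 t, D r * M :=
      setLIntegral_mono_ae' measurableSet_Ioo (Eventually.of_forall fun r hr =>
        mul_le_mul_right (hNM r (Ioo_subset_Icc_self hr)) _)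
    rw [lintegral_mul_const' _ _ hM] at h1
    exact ne_top_of_le_ne_top (ENNReal.mul_ne_top hDt hM) h1
  have hi : ∀ {g : ℝ → ℝ≥0∞}, AEMeasurable g (volume.restrict (Ioo 0 t)) →
      ∫⁻ r in Ioo 0 t, g r ≠ ⊤ → ∀ τ ∈ Icc 0 t,
      IntervalIntegrable (fun r => (g r).toReal) volume 0 τ ∧
      ∫ r in (0 : ℝ)..τ, (g r).toReal = (∫⁻ r in Ioo 0 τ, g r).toReal := fun hg hgt τ hτ => by
    have hs : Ioo 0 τ ⊆ Ioo 0 t := Ioo_subset_Ioo_right hτ.2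
    have h1 := hg.mono_set hs
    have h2 := ne_top_of_le_ne_top hgt (lintegral_mono_set hs)
    refine ⟨?_, ?_⟩
    · rw [intervalIntegrable_iff_integrableOn_Ioo_of_le hτ.1]
      exact integrable_toReal_of_lintegral_ne_top h1 h2
    · rw [intervalIntegral.integral_of_le hτ.1, integral_Ioc_eq_integral_Ioo,
        integral_toReal h1 (ae_lt_top' h1 h2)]
  have hγ := hi hD hDt
  have hγN := hi (hD.mul hN) hDN
  simp only [Pi.mul_apply, ENNReal.toReal_mul] at hγN
  have htt : t ∈ Icc 0 t := right_mem_Icc.mpr ht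
  have key := add_integral_le_mul_exp ht (hγ t htt).1 (hγN t htt).1
    (fun τ => ENNReal.toReal_nonneg) (A := A.toReal) fun τ hτ => by
      rw [(hγN τ hτ).2]
      have h2 : ∫⁻ r in Ioo 0 τ, D r * N r ≠ ⊤ :=
        ne_top_of_le_ne_top hDN (lintegral_mono_set (Ioo_subset_Ioo_right hτ.2))
      have h3 := ENNReal.toReal_mono (ENNReal.add_ne_top.mpr ⟨hA, h2⟩) (h τ hτ)
      rwa [ENNReal.toReal_add hA h2] at h3
  rw [(hγN t htt).2, (hγ t htt).2] at key
  rw [← ENNReal.ofReal_toReal hDN, ← ENNReal.ofReal_toReal hA,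
    ← ENNReal.ofReal_mul ENNReal.toReal_nonneg]
  exact ENNReal.ofReal_le_ofReal (by linarith)

variable {L : LittlewoodPaley} {p q : ℝ≥0∞}

namespace BesovTransport

/-- The start of the last time interval before `t` on which the solution does not vanish. -/
theorem exists_start {T : ℝ} {a : ℝ → 𝓢'(Plane, ℂ)} {u : ℝ → 𝓢'(Plane, CPlane)}
    (h : BesovTransport L p q T u a) (hq : 1 ≤ q) {t : ℝ} (ht : t ∈ Ioo 0 T)
    (hne : besovNorm L (twoOver q) q 1 (a t) ≠ 0) : ∃ σ ∈ Ico 0 t,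
      (∀ j, dyadicWeight (twoOver q) j * eLpNorm (L.block j (a σ)) q volume
        ≤ dyadicWeight (twoOver q) j * eLpNorm (L.block j (a 0)) q volume) ∧
      ∀ τ ∈ Ioc σ t, besovNorm L (twoOver q) q 1 (a τ) ≠ 0 := by
  have hc := (h.mem_a.continuousOn_besovNorm hq).mono (Icc_subset_Icc_right ht.2.le)
  -- The zero times form a compact set. Its maximum, if there is one, is the starting time: all
  -- blocks vanish there, hence are bounded by those of the datum. Otherwise the starting time is
  -- `0`.
  set Z : Set ℝ := Icc 0 t ∩ (fun τ => besovNorm L (twoOver q) q 1 (a τ)) ⁻¹' {0} with hZ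
  have hZc : IsCompact Z := isCompact_Icc.of_isClosed_subset
    (hc.preimage_isClosed_of_isClosed isClosed_Icc isClosed_singleton) inter_subset_left
  rcases Z.eq_empty_or_nonempty with h0 | h0
  · refine ⟨0, ⟨le_rfl, ht.1⟩, fun j => le_rfl, fun τ hτ hz => ?_⟩
    exact (h0 ▸ (⟨⟨hτ.1.le, hτ.2⟩, hz⟩ : τ ∈ Z) : τ ∈ (∅ : Set ℝ))
  · obtain ⟨σ, hσ, hmax⟩ := hZc.exists_isGreatest h0
    have hσ0 : besovNorm L (twoOver q) q 1 (a σ) = 0 := hσ.2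
    refine ⟨σ, ⟨hσ.1.1, lt_of_le_of_ne hσ.1.2 ?_⟩, fun j => ?_, fun τ hτ hz => ?_⟩
    · rintro rfl
      exact hne hσ0
    · refine ((dyadicWeight_mul_eLpNorm_block_le j (a σ)).trans hσ0.le).trans zero_le
    · exact (hmax ⟨⟨hσ.1.1.trans hτ.1.le, hτ.2⟩, hz⟩).not_gt hτ.1

/-- The estimate of a dyadic block in terms of the initial datum. -/
theorem exists_block_le_initial (L : LittlewoodPaley) (hp : 1 ≤ p) (hq : 1 ≤ q) (hqp : q ≤ p)
    (hpq : twoOver q - twoOver p ≤ 1) : ∃ C : ℝ≥0∞, C ≠ ⊤ ∧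
    ∀ {T : ℝ} {a : ℝ → 𝓢'(Plane, ℂ)} {u : ℝ → 𝓢'(Plane, CPlane)}, BesovTransport L p q T u a →
      ∀ t ∈ Icc 0 T, ∀ j, dyadicWeight (twoOver q) j * eLpNorm (L.block j (a t)) q volume
        ≤ dyadicWeight (twoOver q) j * eLpNorm (L.block j (a 0)) q volume
          + C * ∫⁻ τ in Ioo 0 t, transportSource L p q (u τ) (a τ) j := by
  obtain ⟨C, hCt, hC⟩ := exists_block_le L hp hq hqp hpq
  refine ⟨C, hCt, fun {T a u} h t ht j => ?_⟩
  have hW := h.mem_a.continuousOn_eLpNorm_block hq j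
  have key : ∀ t ∈ Ioo 0 T, dyadicWeight (twoOver q) j * eLpNorm (L.block j (a t)) q volume
        ≤ dyadicWeight (twoOver q) j * eLpNorm (L.block j (a 0)) q volume
          + C * ∫⁻ τ in Ioo 0 t, transportSource L p q (u τ) (a τ) j := fun t ht => by
    by_cases hne : besovNorm L (twoOver q) q 1 (a t) = 0
    · exact ((dyadicWeight_mul_eLpNorm_block_le j (a t)).trans hne.le).trans zero_le
    obtain ⟨σ, hσ, hσ0, hσ1⟩ := h.exists_start hq ht hne
    -- The local estimate needs nonvanishing slightly beyond `t`; continuity of the norm at the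
    -- interior time `t` supplies it.
    have hev : ∀ᶠ τ in 𝓝 t, besovNorm L (twoOver q) q 1 (a τ) ≠ 0 :=
      ((h.mem_a.continuousOn_besovNorm hq).continuousAt (Icc_mem_nhds ht.1 ht.2)).eventually_ne hne
    obtain ⟨l, r, hlr, hsub⟩ := mem_nhds_iff_exists_Ioo_subset.mp hev
    obtain ⟨t₁, h1, h2⟩ := exists_between (lt_min hlr.2 ht.2)
    have hbound : ∀ s ∈ Ioo σ t, dyadicWeight (twoOver q) j * eLpNorm (L.block j (a t)) q volume
        ≤ dyadicWeight (twoOver q) j * eLpNorm (L.block j (a s)) q volume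
          + C * ∫⁻ τ in Ioo 0 t, transportSource L p q (u τ) (a τ) j := fun s hs => by
      refine (hC h (hσ.1.trans_lt hs.1) hs.2.le h1 (h2.trans_le (min_le_right _ _))
        (fun τ hτ => ?_) j).trans ?_
      · rcases le_or_gt τ t with hle | hlt
        · exact hσ1 τ ⟨hs.1.trans_le hτ.1, hle⟩
        · exact hsub ⟨hlr.1.trans hlt, hτ.2.trans_lt (h2.trans_le (min_le_left _ _))⟩
      · rw [restrict_Ioo_eq_restrict_Ioc]
        gcongr
        exact (hσ.1.trans_lt hs.1).le
    -- The local estimate is not available from `σ` itself, which may be `0` or a zero time. It is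
    -- applied from `s > σ`, and `s` decreases to `σ` by continuity of the block norms.
    have : (𝓝[Ioo σ t] σ).NeBot := left_nhdsWithin_Ioo_neBot hσ.2
    have hlim := ((hW σ ⟨hσ.1, hσ.2.le.trans ht.2.le⟩).mono_left (nhdsWithin_mono σ
      fun τ (hτ : τ ∈ Ioo σ t) => ⟨hσ.1.trans hτ.1.le, hτ.2.le.trans ht.2.le⟩)).add
      (tendsto_const_nhds (x := C * ∫⁻ τ in Ioo 0 t, transportSource L p q (u τ) (a τ) j))
    refine (ge_of_tendsto hlim (eventually_mem_nhdsWithin.mono hbound)).trans ?_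
    exact add_le_add_left (hσ0 j) _
  rcases eq_or_lt_of_le ht.1 with rfl | h0
  · exact le_self_add
  rcases eq_or_lt_of_le ht.2 with rfl | h1
  -- The endpoint `t = T` is reached by continuity from the left.
  · have : (𝓝[Ioo 0 t] t).NeBot := right_nhdsWithin_Ioo_neBot h0
    refine le_of_tendsto ((hW t ht).mono_left (nhdsWithin_mono t Ioo_subset_Icc_self))
      (eventually_mem_nhdsWithin.mono fun τ hτ => (key τ hτ).trans ?_)
    gcongr
    exact hτ.2.le
  · exact key t ⟨h0, h1⟩

/-- The time-uniform estimate of the dyadic blocks of the solution, with summable remainders. -/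
theorem exists_blockTimeNorm_le (L : LittlewoodPaley) (hp : 1 ≤ p) (hq : 1 ≤ q) (hqp : q ≤ p)
    (hpq : twoOver q - twoOver p ≤ 1) : ∃ C : ℝ≥0∞, C ≠ ⊤ ∧
    ∀ {T : ℝ} {a : ℝ → 𝓢'(Plane, ℂ)} {u : ℝ → 𝓢'(Plane, CPlane)}, BesovTransport L p q T u a →
      ∀ t ∈ Icc 0 T, ∃ ρ : ℤ → ℝ≥0∞,
        (∀ j, dyadicWeight (twoOver q) j * blockTimeNorm L (⊤ : ℝ≥0∞) q t j a
          ≤ dyadicWeight (twoOver q) j * eLpNorm (L.block j (a 0)) q volume + ρ j) ∧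
        ∑' j, ρ j ≤ besovNorm L (twoOver q) q 1 (a 0) * ENNReal.ofReal
          (Real.exp (C * l1BesovNorm L (twoOver p + 1) p 1 t u).toReal - 1) := by
  obtain ⟨C, hCt, hC⟩ := exists_block_le_initial L hp hq hqp hpq
  have hK : C * (2 * ∑' n, decay n) ≠ ⊤ := by
    have := tsum_decay_ne_top
    finiteness
  refine ⟨C * (2 * ∑' n, decay n), hK, fun {T a u} h t ht =>
    ⟨fun j => C * ∫⁻ τ in Ioo 0 t, transportSource L p q (u τ) (a τ) j, fun j => ?_, ?_⟩⟩
  · have hW0 := dyadicWeight_ne_zero (twoOver q) j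
    have hWt := dyadicWeight_ne_top (twoOver q) j
    rw [ENNReal.mul_le_iff_le_inv hW0 hWt, blockTimeNorm, eLpNorm_exponent_top]
    refine eLpNormEssSup_le_of_ae_enorm_bound ?_
    filter_upwards [ae_restrict_mem measurableSet_Ioo] with τ hτ
    rw [enorm_eq_self, ← ENNReal.mul_le_iff_le_inv hW0 hWt]
    refine (hC h τ ⟨hτ.1.le, hτ.2.le.trans ht.2⟩ j).trans ?_
    gcongr
    exact hτ.2.le
  · obtain ⟨M, hMt, hM⟩ := h.mem_a.exists_bound hq
    -- Summation over `j` turns the sources into a multiple of the product of the two Besov norms,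
    -- which closes the Gronwall inequality for the norm of `a`.
    have hsum : ∀ τ ∈ Icc 0 t, ∑' j, C * ∫⁻ r in Ioo 0 τ, transportSource L p q (u r) (a r) j
        = ∫⁻ r in Ioo 0 τ, C * (2 * ∑' n, decay n) * besovNorm L (twoOver p + 1) p 1 (u r)
          * besovNorm L (twoOver q) q 1 (a r) := fun τ hτ => by
      have hs : Ioo 0 τ ⊆ Ioo 0 T := Ioo_subset_Ioo_right (hτ.2.trans ht.2)
      rw [ENNReal.tsum_mul_left, ← lintegral_tsum fun j =>
        (aemeasurable_transportSource h.mem_u hp h.mem_a hq j).mono_set hs,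
        ← lintegral_const_mul' _ _ hCt]
      refine lintegral_congr fun r => ?_
      rw [tsum_transportSource]
      ring
    have hst : Ioo 0 t ⊆ Ioo 0 T := Ioo_subset_Ioo_right ht.2
    rw [hsum t (right_mem_Icc.mpr ht.1), l1BesovNorm, ← lintegral_const_mul' _ _ hK]
    refine lintegral_mul_le_mul_exp_sub_one ht.1
      (h.mem_a.1 0 (left_mem_Icc.mpr h.pos.le)).2.ne hMt
      (((h.mem_u.aemeasurable_besovNorm hp).mono_set hst).const_mul _) ?_
      ((h.mem_a.aemeasurable_besovNorm hq).mono_set hst)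
      (fun τ hτ => hM τ ⟨hτ.1, hτ.2.trans ht.2⟩) fun τ hτ => ?_
    · rw [lintegral_const_mul' _ _ hK]
      exact ENNReal.mul_ne_top hK (ne_top_of_le_ne_top h.mem_u.2.2.ne (lintegral_mono_set hst))
    · rw [← hsum τ hτ, L.besovNorm_one, L.besovNorm_one, ← ENNReal.tsum_add]
      exact ENNReal.tsum_le_tsum fun j => hC h τ ⟨hτ.1, hτ.2.trans ht.2⟩ j

end BesovTransport

end GlobalEstimate

/-! ### High-frequency parts and embeddings -/

section HighFrequency

variable {F : Type*} [NormedAddCommGroup F] [NormedSpace ℂ F] [CompleteSpace F]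
  {L : LittlewoodPaley} {q : ℝ≥0∞}

theorem eLpNorm_block_sub_lowFreq_le {B : ℝ≥0∞} (hB : ∀ j, KernelBound B j (L.κS j)) (hq : 1 ≤ q)
    (j m : ℤ) (T : 𝓢'(Plane, F)) : eLpNorm (L.block j (T - L.lowFreq m T)) q volume
      ≤ ∑ k ∈ (Finset.Icc (j - 1) (j + 1)).filter (m ≤ ·), B * eLpNorm (L.block k T) q volume := by
  have hN : Measurable fun x => ‖L.κS j x‖ₑ := (L.κS j).continuous.enorm.measurable
  have hf : ∀ k, Measurable fun x => ‖L.block k T x‖ₑ :=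
    fun k => (L.continuous_block k T).enorm.measurable
  have h1 : eLpNorm (L.block j (T - L.lowFreq m T)) q volume
      ≤ eLpNorm (∑ k ∈ (Finset.Icc (j - 1) (j + 1)).filter (m ≤ ·),
        lconv (fun x => ‖L.κS j x‖ₑ) (fun x => ‖L.block k T x‖ₑ)) q volume := by
    refine eLpNorm_mono_enorm fun x => ?_
    rw [L.block_sub_lowFreq, enorm_eq_self, Finset.sum_apply]
    refine (enorm_sum_le _ _).trans (Finset.sum_le_sum fun k _ => ?_)
    refine (enorm_integral_le_lintegral_enorm _).trans (le_of_eq ?_)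
    simp only [lconv, ← L.κS_apply, Complex.coe_smul, enorm_smul]
  refine h1.trans ((eLpNorm_sum_le (fun k _ =>
    (measurable_lconv hN (hf k)).aestronglyMeasurable) hq).trans (Finset.sum_le_sum fun k _ => ?_))
  refine (eLpNorm_lconv_le hN (hf k) hq).trans ?_
  rw [eLpNorm_enorm]
  exact mul_le_mul_left (hB j).lintegral_le _

theorem blockTimeNorm_sub_lowFreq_le {B : ℝ≥0∞} (hB : ∀ j, KernelBound B j (L.κS j)) (hq : 1 ≤ q)
    (j m : ℤ) (t : ℝ) (v : ℝ → 𝓢'(Plane, F)) :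
    blockTimeNorm L (⊤ : ℝ≥0∞) q t j (fun τ => v τ - L.lowFreq m (v τ))
      ≤ ∑ k ∈ (Finset.Icc (j - 1) (j + 1)).filter (m ≤ ·),
        B * blockTimeNorm L (⊤ : ℝ≥0∞) q t k v := by
  simp only [blockTimeNorm, eLpNorm_exponent_top]
  refine eLpNormEssSup_le_of_ae_enorm_bound ?_
  have h1 : ∀ᵐ τ ∂(volume.restrict (Ioo 0 t)), ∀ k, ‖eLpNorm (L.block k (v τ)) q volume‖ₑ
      ≤ eLpNormEssSup (fun τ => eLpNorm (L.block k (v τ)) q volume) (volume.restrict (Ioo 0 t)) :=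
    ae_all_iff.mpr fun k => enorm_ae_le_eLpNormEssSup _ _
  filter_upwards [h1] with τ hτ
  rw [enorm_eq_self]
  refine (eLpNorm_block_sub_lowFreq_le hB hq j m (v τ)).trans (Finset.sum_le_sum fun k _ => ?_)
  exact mul_le_mul_right ((enorm_eq_self _).symm.trans_le (hτ k)) _

/-- Each `k ≥ m` is counted for the three indices `j` with `|j - k| ≤ 1`. -/
theorem tsum_sum_Icc_filter (m : ℤ) (f : ℤ → ℝ≥0∞) :
    ∑' j, ∑ k ∈ (Finset.Icc (j - 1) (j + 1)).filter (m ≤ ·), f k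
      = 3 * ∑' k : {k : ℤ // m ≤ k}, f k := by
  have h1 : ∀ j : ℤ, ∑ k ∈ (Finset.Icc (j - 1) (j + 1)).filter (m ≤ ·), f k
      = {k | m ≤ k}.indicator f (j - 1) + {k | m ≤ k}.indicator f j
        + {k | m ≤ k}.indicator f (j + 1) := fun j => by
    rw [Finset.sum_filter, show Finset.Icc (j - 1) (j + 1) = {j - 1, j, j + 1} by
      ext k
      simp only [Finset.mem_Icc, Finset.mem_insert, Finset.mem_singleton]
      omega, Finset.sum_insert (by simp; omega), Finset.sum_insert (by simp), Finset.sum_singleton,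
      add_assoc]
    simp only [indicator_apply, mem_ofPred_eq]
  simp only [h1]
  have h2 : ∑' j, {k | m ≤ k}.indicator f (j - 1) = ∑' j, {k | m ≤ k}.indicator f j :=
    (Equiv.subRight (1 : ℤ)).tsum_eq _
  have h3 : ∑' j, {k | m ≤ k}.indicator f (j + 1) = ∑' j, {k | m ≤ k}.indicator f j :=
    (Equiv.addRight (1 : ℤ)).tsum_eq _
  rw [ENNReal.tsum_add, ENNReal.tsum_add, h2, h3, ← tsum_subtype]
  change (∑' k : {k : ℤ // m ≤ k}, f k) + (∑' k : {k : ℤ // m ≤ k}, f k)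
    + (∑' k : {k : ℤ // m ≤ k}, f k) = _
  ring

theorem cheminLernerNorm_one (σ : ℝ≥0∞) (s t : ℝ) (v : ℝ → 𝓢'(Plane, F)) :
    cheminLernerNorm L σ s q 1 t v = ∑' j, dyadicWeight s j * blockTimeNorm L σ q t j v := by
  rw [cheminLernerNorm, eLpNorm_one_eq_lintegral_enorm, lintegral_count]
  simp only [enorm_eq_self]

theorem dyadicWeight_le_four_mul {s : ℝ} (hs : 0 ≤ s) (hs2 : s ≤ 2) {j k : ℤ} (h : j ≤ k + 1) :
    dyadicWeight s j ≤ 4 * dyadicWeight s k := by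
  refine (dyadicWeight_mono_int hs h).trans ?_
  rw [dyadicWeight_int_add, mul_comm]
  gcongr
  rw [dyadicWeight, Int.cast_one, one_mul]
  refine (ENNReal.ofReal_le_ofReal
    (Real.rpow_le_rpow_of_exponent_le one_le_two hs2)).trans (le_of_eq ?_)
  norm_num

/-- The constant is `12 = 3 * 4`: three neighbouring indices, and a factor `2^s ≤ 4` for moving the
weight from `j` to a neighbour. -/
theorem cheminLernerNorm_sub_lowFreq_le {B : ℝ≥0∞} (hB : ∀ j, KernelBound B j (L.κS j))
    (hq : 1 ≤ q) {s : ℝ} (hs : 0 ≤ s) (hs2 : s ≤ 2) (m : ℤ) (t : ℝ) (v : ℝ → 𝓢'(Plane, F)) :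
    cheminLernerNorm L (⊤ : ℝ≥0∞) s q 1 t (fun τ => v τ - L.lowFreq m (v τ))
      ≤ 12 * B * ∑' k : {k : ℤ // m ≤ k},
        dyadicWeight s k * blockTimeNorm L (⊤ : ℝ≥0∞) q t k v := by
  rw [cheminLernerNorm_one]
  calc _ ≤ ∑' j, ∑ k ∈ (Finset.Icc (j - 1) (j + 1)).filter (m ≤ ·),
        4 * B * (dyadicWeight s k * blockTimeNorm L (⊤ : ℝ≥0∞) q t k v) := by
        refine ENNReal.tsum_le_tsum fun j => ?_
        refine (mul_le_mul_right (blockTimeNorm_sub_lowFreq_le hB hq j m t v) _).trans ?_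
        rw [Finset.mul_sum]
        refine Finset.sum_le_sum fun k hk => ?_
        have h1 : j ≤ k + 1 := by
          have := (Finset.mem_Icc.mp (Finset.mem_filter.mp hk).1).1
          omega
        refine (mul_le_mul_left (dyadicWeight_le_four_mul hs hs2 h1) _).trans (le_of_eq ?_)
        ring
    _ = _ := by
        rw [tsum_sum_Icc_filter m
          (fun k => 4 * B * (dyadicWeight s k * blockTimeNorm L (⊤ : ℝ≥0∞) q t k v)),
          ENNReal.tsum_mul_left]
        ring

/-- The embedding of homogeneous Besov spaces of the same differential dimension. -/
theorem besovNorm_le_mul_besovNorm {B : ℝ≥0∞} (hB : ∀ j, KernelBound B j (L.κFatS j)) (hB1 : 1 ≤ B)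
    (hBt : B ≠ ⊤) {p : ℝ≥0∞} (hp : 1 ≤ p) (hpq : p ≤ q) (σ : ℝ) {V : 𝓢'(Plane, F)}
    (hV : besovNorm L (twoOver p + σ) p 1 V ≠ ⊤) :
    besovNorm L (twoOver q + σ) q 1 V ≤ B * besovNorm L (twoOver p + σ) p 1 V := by
  rw [L.besovNorm_one, L.besovNorm_one, ← ENNReal.tsum_mul_left]
  refine ENNReal.tsum_le_tsum fun k => ?_
  have h1 := (L.spectral_block hp (L.eLpNorm_block_ne_top hV k)).eLpNorm_le (hB k) hB1 hBt hp hpq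
  simp only [blockSize]
  refine (mul_le_mul_right h1 _).trans (le_of_eq ?_)
  rw [show twoOver p + σ = (twoOver q + σ) + (twoOver p - twoOver q) by ring,
    dyadicWeight_add (twoOver q + σ)]
  ring

theorem MemL1Besov.of_le {B : ℝ≥0∞} (hB : ∀ j, KernelBound B j (L.κFatS j)) (hB1 : 1 ≤ B)
    (hBt : B ≠ ⊤) {p : ℝ≥0∞} (hp : 1 ≤ p) (hpq : p ≤ q) {σ T : ℝ} {u : ℝ → 𝓢'(Plane, F)}
    (hu : MemL1Besov L (twoOver p + σ) p 1 T u) : MemL1Besov L (twoOver q + σ) q 1 T u ∧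
      ∀ t ≤ T, l1BesovNorm L (twoOver q + σ) q 1 t u
        ≤ B * l1BesovNorm L (twoOver p + σ) p 1 t u := by
  have h1 : ∀ t ≤ T, l1BesovNorm L (twoOver q + σ) q 1 t u
      ≤ B * l1BesovNorm L (twoOver p + σ) p 1 t u := fun t ht => by
    rw [l1BesovNorm, l1BesovNorm, ← lintegral_const_mul' _ _ hBt]
    refine lintegral_mono_ae ?_
    filter_upwards [ae_restrict_of_ae_restrict_of_subset (Ioo_subset_Ioo_right ht) hu.2.1] with τ hτ
    exact besovNorm_le_mul_besovNorm hB hB1 hBt hp hpq σ hτ.2.ne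
  refine ⟨⟨hu.1, hu.2.1.mono fun τ hτ => ⟨hτ.1, ?_⟩,
    (h1 T le_rfl).trans_lt (ENNReal.mul_lt_top hBt.lt_top hu.2.2)⟩, h1⟩
  exact (besovNorm_le_mul_besovNorm hB hB1 hBt hp hpq σ hτ.2.ne).trans_lt
    (ENNReal.mul_lt_top hBt.lt_top hτ.2)

end HighFrequency

/-! ### All exponents and the final constants -/

section Conclusion

/-- Bernoulli's inequality for `e^(cx) = (1 + (e^x - 1))^c`. A multiplicative constant on the
remainder can thus be absorbed into the exponent. -/
theorem mul_exp_sub_one_le {c x y : ℝ} (hc : 1 ≤ c) (h : c * x ≤ y) :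
    c * (Real.exp x - 1) ≤ Real.exp y - 1 := by
  have h1 := one_add_mul_self_le_rpow_one_add (s := Real.exp x - 1)
    (by linarith [Real.exp_pos x]) hc
  rw [add_sub_cancel, ← Real.exp_mul, mul_comm x c] at h1
  linarith [Real.exp_le_exp.mpr h]

namespace BesovTransport

/-- The time-uniform estimate of the dyadic blocks, for the full range of exponents. -/
theorem exists_blockTimeNorm_le_mul (L : LittlewoodPaley) {p q : ℝ≥0∞} (hp : 1 ≤ p) (hq : 1 ≤ q)
    (hpq : (q⁻¹).toReal - (p⁻¹).toReal ≤ 1 / 2) : ∃ C : ℝ≥0∞, C ≠ ⊤ ∧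
    ∀ {T : ℝ} {a : ℝ → 𝓢'(Plane, ℂ)} {u : ℝ → 𝓢'(Plane, CPlane)}, BesovTransport L p q T u a →
      ∀ t ∈ Icc 0 T, ∃ ρ : ℤ → ℝ≥0∞,
        (∀ j, dyadicWeight (twoOver q) j * blockTimeNorm L (⊤ : ℝ≥0∞) q t j a
          ≤ dyadicWeight (twoOver q) j * eLpNorm (L.block j (a 0)) q volume + ρ j) ∧
        ∑' j, ρ j ≤ besovNorm L (twoOver q) q 1 (a 0) * ENNReal.ofReal
          (Real.exp (C * l1BesovNorm L (twoOver p + 1) p 1 t u).toReal - 1) := by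
  rcases le_or_gt q p with hle | hlt
  · exact exists_blockTimeNorm_le L hp hq hle (by rw [twoOver, twoOver]; linarith)
  -- For `q > p` the estimate is used with both exponents equal to `q`; the embedding constant `B`
  -- of the velocity goes into the exponent.
  obtain ⟨C, hCt, hC⟩ := exists_blockTimeNorm_le L hq hq le_rfl (by rw [sub_self]; norm_num)
  obtain ⟨B, hBt, hB1, -, hB⟩ := L.exists_kernelBound
  refine ⟨C * B, ENNReal.mul_ne_top hCt hBt, fun {T a u} h t ht => ?_⟩
  obtain ⟨hu, hle⟩ := h.mem_u.of_le hB hB1 hBt hp hlt.le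
  obtain ⟨ρ, h1, h2⟩ := hC ⟨h.pos, hu, h.divFree, h.mem_a, h.transport⟩ t ht
  refine ⟨ρ, h1, h2.trans ?_⟩
  have h3 : l1BesovNorm L (twoOver p + 1) p 1 t u ≠ ⊤ :=
    ne_top_of_le_ne_top h.mem_u.2.2.ne (lintegral_mono_set (Ioo_subset_Ioo_right ht.2))
  have h4 : C * l1BesovNorm L (twoOver q + 1) q 1 t u
      ≤ C * B * l1BesovNorm L (twoOver p + 1) p 1 t u := by
    rw [mul_assoc]
    exact mul_le_mul_right (hle t ht.2) C
  have h5 := ENNReal.toReal_mono (by finiteness) h4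
  exact mul_le_mul_right (ENNReal.ofReal_le_ofReal (sub_le_sub_right (Real.exp_le_exp.mpr h5) 1)) _

end BesovTransport

end Conclusion

end

theorem proposition2p1 (L : LittlewoodPaley) (p q : ℝ≥0∞) (hp : 1 ≤ p) (hq : 1 ≤ q)
    (hpq : (q⁻¹).toReal - (p⁻¹).toReal ≤ 1 / 2) :
    ∃ C : ℝ, 0 < C ∧
      ∀ (T : ℝ) (a₀ : 𝓢'(Plane, ℂ)) (a : ℝ → 𝓢'(Plane, ℂ)) (u : ℝ → 𝓢'(Plane, CPlane)),
        0 < T →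
        MemBesov L (twoOver q) q 1 a₀ →
        MemL1Besov L (twoOver p + 1) p 1 T u →
        (∀ᵐ t ∂(volume.restrict (Ioo 0 T)), IsDivFree (u t)) →
        MemCBesov L (twoOver q) q 1 T a →
        a 0 = a₀ →
        IsTransportSolution T u a →
        ∀ t ∈ Icc 0 T, ∀ U : ℝ, U = (l1BesovNorm L (twoOver p + 1) p 1 t u).toReal →
          cheminLernerNorm L ∞ (twoOver q) q 1 t a
            ≤ besovNorm L (twoOver q) q 1 a₀ * ENNReal.ofReal (Real.exp (C * U)) ∧
          ∀ m : ℤ,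
            ((∑' j : {j : ℤ // m ≤ j}, dyadicWeight (twoOver q) j * blockTimeNorm L ∞ q t j a)
              ≤ (∑' j : {j : ℤ // m ≤ j},
                  dyadicWeight (twoOver q) j * eLpNorm (L.block j a₀) q volume)
                + besovNorm L (twoOver q) q 1 a₀ * ENNReal.ofReal (Real.exp (C * U) - 1)) ∧
            (cheminLernerNorm L ∞ (twoOver q) q 1 t (fun τ => a τ - L.lowFreq m (a τ))
              ≤ ENNReal.ofReal C * (∑' j : {j : ℤ // m ≤ j},
                  dyadicWeight (twoOver q) j * eLpNorm (L.block j a₀) q volume)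
                + besovNorm L (twoOver q) q 1 a₀ * ENNReal.ofReal (Real.exp (C * U) - 1)) := by
  obtain ⟨K, hKt, hK⟩ := BesovTransport.exists_blockTimeNorm_le_mul L hp hq hpq
  obtain ⟨B, hBt, hB1, hB, -⟩ := L.exists_kernelBound
  -- The loss in passing from the high-frequency blocks to `a - Ṡₘ a`.
  set c : ℝ := (12 * B).toReal with hc
  have hct : 12 * B ≠ (⊤ : ℝ≥0∞) := by finiteness
  have hc1 : 1 ≤ c := by
    rw [hc, ← ENNReal.toReal_one]
    refine ENNReal.toReal_mono hct ?_
    calc (1 : ℝ≥0∞) ≤ 12 * 1 := by norm_num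
      _ ≤ 12 * B := by gcongr
  have hK0 : 0 ≤ K.toReal := ENNReal.toReal_nonneg
  -- One constant serves three purposes: it is positive even when `K = 0`, it is at least `c` as a
  -- factor of the initial blocks, and it is at least `c K` in the exponent, where the factor `c` of
  -- the remainder is absorbed.
  refine ⟨c * (K.toReal + 1), by positivity, ?_⟩
  intro T a₀ a u hT _ hu hdiv ha h0 htr t ht U hU
  subst h0
  obtain ⟨ρ, h1, h2⟩ := hK ⟨hT, hu, hdiv, ha, htr⟩ t ht
  rw [ENNReal.toReal_mul, ← hU] at h2
  have hU0 : 0 ≤ U := hU ▸ ENNReal.toReal_nonneg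
  have hKU : c * (K.toReal * U) ≤ c * (K.toReal + 1) * U := by nlinarith
  have hKU0 : 0 ≤ K.toReal * U := mul_nonneg hK0 hU0
  have hexp : ENNReal.ofReal c * ENNReal.ofReal (Real.exp (K.toReal * U) - 1)
      ≤ ENNReal.ofReal (Real.exp (c * (K.toReal + 1) * U) - 1) := by
    rw [← ENNReal.ofReal_mul (by linarith)]
    exact ENNReal.ofReal_le_ofReal (mul_exp_sub_one_le hc1 hKU)
  have hexp' : ENNReal.ofReal (Real.exp (K.toReal * U) - 1)
      ≤ ENNReal.ofReal (Real.exp (c * (K.toReal + 1) * U) - 1) :=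
    (le_mul_of_one_le_left zero_le (ENNReal.one_le_ofReal.mpr hc1)).trans hexp
  have hhigh : ∀ m : ℤ,
      (∑' j : {j : ℤ // m ≤ j}, dyadicWeight (twoOver q) j * blockTimeNorm L (⊤ : ℝ≥0∞) q t j a)
        ≤ (∑' j : {j : ℤ // m ≤ j},
            dyadicWeight (twoOver q) j * eLpNorm (L.block j (a 0)) q volume)
          + besovNorm L (twoOver q) q 1 (a 0)
            * ENNReal.ofReal (Real.exp (K.toReal * U) - 1) := fun m => by
    refine (ENNReal.tsum_le_tsum fun j : {j : ℤ // m ≤ j} => h1 j).trans ?_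
    rw [ENNReal.tsum_add]
    gcongr
    exact (ENNReal.tsum_comp_le_tsum_of_injective Subtype.val_injective ρ).trans h2
  refine ⟨?_, fun m => ⟨(hhigh m).trans (by gcongr), ?_⟩⟩
  · rw [cheminLernerNorm_one]
    refine (ENNReal.tsum_le_tsum h1).trans ?_
    rw [ENNReal.tsum_add]
    calc _ ≤ besovNorm L (twoOver q) q 1 (a 0) + besovNorm L (twoOver q) q 1 (a 0)
          * ENNReal.ofReal (Real.exp (c * (K.toReal + 1) * U) - 1) := by
          refine add_le_add (L.besovNorm_one _ _ _).ge (h2.trans (by gcongr))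
      _ = _ := by
          have h3 : 0 ≤ Real.exp (c * (K.toReal + 1) * U) - 1 :=
            sub_nonneg.mpr (Real.one_le_exp (by positivity))
          rw [← mul_one_add, ← ENNReal.ofReal_one, ← ENNReal.ofReal_add zero_le_one h3,
            add_sub_cancel]
  · obtain ⟨q0, q1⟩ := toReal_inv_mem hq
    refine (cheminLernerNorm_sub_lowFreq_le hB hq (by rw [twoOver]; linarith)
      (by rw [twoOver]; linarith) m t a).trans ((mul_le_mul_right (hhigh m) _).trans ?_)
    rw [mul_add, ← ENNReal.ofReal_toReal hct, ← hc, mul_left_comm]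
    gcongr
    nlinarith
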